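/- Let $\mathbb K$ be an algebraically closed field of characteristic $2$ and $n\ge 2$. For a shearing vector $\underline N\in(\mathbb Z_{>0}\cup\{\infty\})^m$ let $\mathcal O(m;\underline N)$ be the span of the divided monomials $u^{(r)}=u_1^{(r_1)}\cdots u_m^{(r_m)}$ with $r_i<2^{N_i}$, where $u^{(r)}u^{(s)}=\binom{r+s}{r}u^{(r+s)}$, with the distinguished derivatives $\partial_{u_i}u^{(r)}=u^{(r-e_i)}$. For a Lie algebra $\mathfrak g$ put $\mathfrak g^{(1)}=[\mathfrak g,\mathfrak g]$ and $\mathfrak g^{(2)}=[\mathfrak g^{(1)},\mathfrak g^{(1)}]$; "simple" includes "non-abelian". **The algebras $\mathfrak{po}_{a,b}(2n;\widetilde{\underline N})$.** Let $\underline N\in(\mathbb Z_{>0}\cup\{\infty\})^n$ be a shearing vector for the indeterminates $q_1,\dots,q_n$, and let $\widetilde{\underline N}=(\underline N,1,\dots,1)$ be the shearing vector for $q_1,\dots,q_n,\xi_1,\dots,\xi_n,\tau$. For $f\in\mathcal O(q,\xi,\tau;\widetilde{\underline N})$ set $$M_f=f\partial_\tau+\sum_i\Big(\partial_{q_i}(f)\,(\partial_{\xi_i}+q_i\partial_\tau)+(\partial_{\xi_i}+q_i\partial_\tau)(f)\,\partial_{q_i}\Big),\qquad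 \Delta^{\mathfrak m}(f)=\sum_i(\partial_{\xi_i}+q_i\partial_\tau)\partial_{q_i}(f).$$ For $(a,b)\in\mathbb K^2$, $(a,b)\ne(0,0)$, let $\mathfrak{po}_{a,b}(2n;\widetilde{\underline N})=\mathbf F(\mathfrak b_{a,b}(n;\underline N))$ be the Lie algebra of all vector fields $M_f$ with $f\in\mathcal O(q,\xi,\tau;\widetilde{\underline N})$ and $b\,\partial_\tau(f)+a\,\Delta^{\mathfrak m}(f)=0$; write $\mathfrak b_\lambda(n;\underline N)$ for it if $\lambda=a/b\in\mathbb K\cup\{\infty\}$. Let $\mathfrak{le}(n;\underline N)$ be the Lie algebra of the vector fields $\mathrm{Le}_f=\sum_i(\partial_{q_i}(f)\partial_{\xi_i}+\partial_{\xi_i}(f)\partial_{q_i})$ with $f\in\mathcal O(q,\xi;(\underline N,1,\dots,1))$. 1. *Generic $a/b$.* Let $a/b\ne 0,1,\infty$ and $\mathfrak g=\mathfrak{po}_{a,b}(2n;\widetilde{\underline N})$. Then $\mathfrak g^{(1)}$ is simple. If $n$ is even or some $N_i=\infty$, then $\mathfrak g$ itself is simple. If $n$ is odd and all $N_i<\infty$,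 then $\mathfrak g^{(1)}$ is of codimension $1$ in $\mathfrak g$. 2. *$a/b=0$.* There is an exact sequence of Lie algebras $$0\to\mathbb K M_1\to\mathfrak b_0(n;\underline N)\to\mathfrak{le}(n;\underline N)\to0,$$ the second map sending $M_f$ to $\mathrm{Le}_f$ for $f\in\mathcal O(q,\xi;(\underline N,1,\dots,1))$. If some $N_i=\infty$, then $\mathfrak{le}(n;\underline N)$ is simple; if all $N_i<\infty$, then $\mathfrak{le}(n;\underline N)^{(1)}$ is simple and of codimension $1$ in $\mathfrak{le}(n;\underline N)$. 3. *$a/b=1$ and $a/b=\infty$.* For every $\underline N$, the Lie algebras $\mathfrak b_1(n;\underline N)^{(2)}$ and $\mathfrak b_\infty(n;\underline N)^{(2)}$ are simple. For $\underline N=\underline N_\infty=(\infty,\dots,\infty)$, the Lie algebras $\mathfrak b_1^{(1)}$ and $\mathfrak b_\infty^{(1)}$ are simple, and they are of codimension $1$ with complements spanned by $M_{\xi_1\cdots\xi_n}$ and $M_{\tau\xi_1\cdots\xi_n}$, respectively: $$0\to\mathfrak b_1^{(1)}(n;\underline N_\infty)\to\mathfrak b_1(n;\underline N_\infty)\to\mathbb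 K\cdot M_{\xi_1\cdots\xi_n}\to0,$$ $$0\to\mathfrak b_\infty^{(1)}(n;\underline N_\infty)\to\mathfrak b_\infty(n;\underline N_\infty)\to\mathbb K\cdot M_{\tau\xi_1\cdots\xi_n}\to0.$$ **The algebras $\widetilde{\mathfrak{sb}}_\mu(2^n-1;\underline N)$.** Let $\mu\in\mathbb K$, $\mu\ne0$. Let $\mathfrak g_0$ be the Lie algebra of the vector fields on $\mathcal O(\xi_1,\dots,\xi_n;(1,\dots,1))$ that preserve the volume form $(1+\mu\xi_1\cdots\xi_n)\mathrm{vol}_\xi$, acting by the Lie derivative on the quotient $\mathfrak g_{-1}$ of the space of volume forms $h\,\mathrm{vol}_\xi$ by the line $\mathbb K(1+\mu\xi_1\cdots\xi_n)\mathrm{vol}_\xi$. The classes of $\xi_S\,\mathrm{vol}_\xi$, $\xi_S=\prod_{i\in S}\xi_i$, where $S$ runs over the non-empty subsets of $\{1,\dots,n\}$, form a basis of $\mathfrak g_{-1}$, so $\dim\mathfrak g_{-1}=2^n-1$. Let $\widetilde{\mathfrak{sb}}_\mu(2^n-1;\underline N)$ be the complete Cartan prolong $(\mathfrak g_{-1},\mathfrak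 g_0)_{*,\underline N}$ in the indeterminates $x_S$ dual to this basis, with shearing vector $\underline N=(N_S)_S$, $N_S\ge1$. A coordinate $N_S$ is *critical* if it cannot take arbitrarily large values, i.e., if there is $B\in\mathbb Z_{\ge0}$ such that for all $\underline N$ with $N_S\ge B$ the prolong does not change when $N_S$ is replaced by $B$. 4. The Lie algebra $\widetilde{\mathfrak{sb}}_\mu(2^n-1;\underline N)^{(1)}$ is simple, except that for $n=2$ the case $N_{\{1\}}=N_{\{2\}}=1$ is excluded. If $N_{\{i\}}=\infty$ for all $i$, then $\widetilde{\mathfrak{sb}}_\mu(2^n-1;\underline N)$ itself is simple. 5. The noncritical coordinates of the shearing vector of $\widetilde{\mathfrak{sb}}_\mu(2^n-1;\underline N)$ are precisely $N_{\{1\}},\dots,N_{\{n\}}$ (those corresponding to $\xi_1\mathrm{vol}_\xi,\dots,\xi_n\mathrm{vol}_\xi$). The largest effective value of every critical coordinate is $1$: if $|S|\ge2$, the prolong does not change when $N_S$ is replaced by $1$. -/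

import Mathlib

open scoped BigOperators

noncomputable section

attribute [local instance 100] LieRing.ofAssociativeRing

/-- The divided power algebra `𝒪(ι; N_∞)` over `K` in the indeterminates `u_i`, `i : ι`: finite
linear combinations `∑ c_r u^(r)` of the divided monomials `u^(r) = ∏ u_i^(r_i)`. -/
def DivPow (K ι : Type*) [Field K] : Type _ := (ι →₀ ℕ) →₀ K

namespace DivPow

section Module

variable {K ι : Type*} [Field K]

instance : AddCommGroup (DivPow K ι) := inferInstanceAs (AddCommGroup ((ι →₀ ℕ) →₀ K))
instance : Module K (DivPow K ι) := inferInstanceAs (Module K ((ι →₀ ℕ) →₀ K))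

/-- The divided monomial `u^(r)`. -/
def mon (r : ι →₀ ℕ) : DivPow K ι := Finsupp.single r (1 : K)

/-- The linear map sending each monomial `u^(r)` to `φ r`. -/
def lift {M : Type*} [AddCommGroup M] [Module K M] (φ : (ι →₀ ℕ) → M) : DivPow K ι →ₗ[K] M :=
  Finsupp.lift M K (ι →₀ ℕ) φ

theorem lift_mon {M : Type*} [AddCommGroup M] [Module K M] (φ : (ι →₀ ℕ) → M) (r : ι →₀ ℕ) :
    lift φ (mon r : DivPow K ι) = φ r := by
  have h : lift φ (mon r : DivPow K ι) = (Finsupp.single r (1 : K)).sum fun x c => c • φ x :=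
    Finsupp.lift_apply M K (ι →₀ ℕ) φ _
  rw [h, Finsupp.sum_single_index (by simp), one_smul]

theorem induct {p : DivPow K ι → Prop} (f : DivPow K ι) (hz : p 0)
    (ha : ∀ f g, p f → p g → p (f + g)) (hs : ∀ (c : K) f, p f → p (c • f))
    (hm : ∀ r, p (mon r)) : p f := by
  refine Finsupp.induction_linear f hz ha fun r c => ?_
  have h : c • (Finsupp.single r (1 : K)) = Finsupp.single r c := by
    rw [Finsupp.smul_single, smul_eq_mul, mul_one]
  exact h ▸ hs c _ (hm r)

/-- The exponent of the single indeterminate `u_i`. -/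
def unitExp (i : ι) : ι →₀ ℕ := Finsupp.single i 1

theorem unitExp_same (i : ι) : unitExp i i = 1 := by simp [unitExp]

theorem unitExp_ne {i j : ι} (h : j ≠ i) : unitExp i j = 0 := by
  simp [unitExp, h.symm]

theorem exists_add {i : ι} {r : ι →₀ ℕ} (h : r i ≠ 0) : ∃ s, r = s + unitExp i := by
  refine ⟨r - unitExp i, (tsub_add_cancel_of_le ?_).symm⟩
  intro j
  by_cases hj : j = i
  · subst hj; rw [unitExp_same]; omega
  · rw [unitExp_ne hj]; omega

end Module

variable {K ι : Type*} [Field K] [Fintype ι]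

/-- The multi-index binomial coefficient `∏ i, (r_i + s_i choose r_i)`. -/
def binom (r s : ι →₀ ℕ) : ℕ := ∏ i, (r i + s i).choose (r i)

/-- The product of the divided power algebra: `u^(r) u^(s) = (r + s choose r) u^(r+s)`. -/
def mulHom : DivPow K ι →ₗ[K] DivPow K ι →ₗ[K] DivPow K ι :=
  lift fun r => lift fun s => (binom r s : K) • mon (r + s)

instance : Mul (DivPow K ι) := ⟨fun f g => mulHom f g⟩
instance : One (DivPow K ι) := ⟨mon 0⟩

theorem mul_def (f g : DivPow K ι) : f * g = mulHom f g := rfl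

theorem mon_mul_mon (r s : ι →₀ ℕ) :
    (mon r * mon s : DivPow K ι) = (binom r s : K) • mon (r + s) := by
  rw [mul_def, mulHom, lift_mon, lift_mon]

theorem binom_comm (r s : ι →₀ ℕ) : binom r s = binom s r := by
  unfold binom
  refine Finset.prod_congr rfl fun i _ => ?_
  rw [add_comm, Nat.choose_symm_add]

theorem binom_assoc (r s t : ι →₀ ℕ) :
    binom r s * binom (r + s) t = binom s t * binom r (s + t) := by
  unfold binom
  rw [← Finset.prod_mul_distrib, ← Finset.prod_mul_distrib]
  refine Finset.prod_congr rfl fun i _ => ?_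
  simp only [Finsupp.add_apply]
  have h := Nat.choose_mul (n := r i + s i + t i) (k := r i + s i) (s := r i) (by omega)
  have e1 : r i + s i + t i - r i = s i + t i := by omega
  have e2 : r i + s i - r i = s i := by omega
  rw [e1, e2] at h
  rw [← add_assoc, mul_comm, h, mul_comm]

theorem smul_mul' (c : K) (f g : DivPow K ι) : (c • f) * g = c • (f * g) := by
  simp [mul_def]

theorem mul_smul' (c : K) (f g : DivPow K ι) : f * (c • g) = c • (f * g) := by
  simp [mul_def]

theorem add_mul' (f g h : DivPow K ι) : (f + g) * h = f * h + g * h := by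
  simp [mul_def]

theorem mul_add' (f g h : DivPow K ι) : f * (g + h) = f * g + f * h := by
  simp [mul_def]

theorem zero_mul' (f : DivPow K ι) : 0 * f = 0 := by simp [mul_def]

theorem mul_zero' (f : DivPow K ι) : f * 0 = 0 := by simp [mul_def]

theorem mul_comm' (f g : DivPow K ι) : f * g = g * f := by
  refine induct (p := fun f => f * g = g * f) f ?_ ?_ ?_ fun r => ?_
  · rw [zero_mul', mul_zero']
  · intro a b ha hb; rw [add_mul', mul_add', ha, hb]
  · intro c a ha; rw [smul_mul', mul_smul', ha]
  refine induct (p := fun g => mon r * g = g * mon r) g ?_ ?_ ?_ fun s => ?_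
  · rw [zero_mul', mul_zero']
  · intro a b ha hb; rw [add_mul', mul_add', ha, hb]
  · intro c a ha; rw [smul_mul', mul_smul', ha]
  rw [mon_mul_mon, mon_mul_mon, binom_comm, add_comm]

theorem one_mul' (f : DivPow K ι) : 1 * f = f := by
  refine induct (p := fun f => 1 * f = f) f ?_ ?_ ?_ fun r => ?_
  · rw [mul_zero']
  · intro a b ha hb; rw [mul_add', ha, hb]
  · intro c a ha; rw [mul_smul', ha]
  change mon 0 * mon r = mon r
  rw [mon_mul_mon, zero_add]
  simp [binom]

theorem mul_assoc' (f g h : DivPow K ι) : f * g * h = f * (g * h) := by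
  refine induct (p := fun f => f * g * h = f * (g * h)) f ?_ ?_ ?_ fun r => ?_
  · simp only [zero_mul']
  · intro a b ha hb; simp only [add_mul', ha, hb]
  · intro c a ha; simp only [smul_mul', ha]
  refine induct (p := fun g => mon r * g * h = mon r * (g * h)) g ?_ ?_ ?_ fun s => ?_
  · simp only [zero_mul', mul_zero']
  · intro a b ha hb; simp only [add_mul', mul_add', ha, hb]
  · intro c a ha; simp only [smul_mul', mul_smul', ha]
  refine induct (p := fun h => mon r * mon s * h = mon r * (mon s * h)) h ?_ ?_ ?_ fun t => ?_
  · simp only [mul_zero']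
  · intro a b ha hb; simp only [mul_add', ha, hb]
  · intro c a ha; simp only [mul_smul', ha]
  rw [mon_mul_mon, mon_mul_mon, smul_mul', mul_smul', mon_mul_mon, mon_mul_mon, smul_smul,
    smul_smul, ← Nat.cast_mul, ← Nat.cast_mul, binom_assoc, add_assoc]

instance : CommRing (DivPow K ι) :=
  { (inferInstance : AddCommGroup (DivPow K ι)) with
    mul := (· * ·)
    one := 1
    left_distrib := mul_add'
    right_distrib := add_mul'
    zero_mul := zero_mul'
    mul_zero := mul_zero'
    mul_assoc := mul_assoc'
    one_mul := one_mul'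
    mul_one := fun f => by rw [mul_comm', one_mul']
    mul_comm := mul_comm' }

instance : Algebra K (DivPow K ι) := Algebra.ofModule smul_mul' mul_smul'

/-- The indeterminate `u_i`. -/
def var (i : ι) : DivPow K ι := mon (unitExp i)

/-- The linear map `u^(r) ↦ u^(r - e_i)` (zero if `r_i = 0`). -/
def lower (i : ι) : DivPow K ι →ₗ[K] DivPow K ι :=
  lift fun r => if r i = 0 then 0 else mon (r - unitExp i)

theorem lower_mon_zero {i : ι} {r : ι →₀ ℕ} (h : r i = 0) :
    lower i (mon r : DivPow K ι) = 0 := by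
  rw [lower, lift_mon, if_pos h]

theorem lower_mon_add (i : ι) (r : ι →₀ ℕ) :
    lower i (mon (r + unitExp i) : DivPow K ι) = mon r := by
  rw [lower, lift_mon, if_neg (by simp [unitExp_same]), add_tsub_cancel_right]

theorem binom_split (i : ι) (r s : ι →₀ ℕ) :
    ∃ m : ℕ, binom r s = (r i + s i).choose (r i) * m ∧
      binom (r + unitExp i) s = (r i + 1 + s i).choose (r i + 1) * m ∧
      binom r (s + unitExp i) = (r i + (s i + 1)).choose (r i) * m ∧
      binom (r + unitExp i) (s + unitExp i) = (r i + 1 + (s i + 1)).choose (r i + 1) * m := by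
  classical
  refine ⟨∏ j ∈ Finset.univ.erase i, (r j + s j).choose (r j), ?_, ?_, ?_, ?_⟩
  · exact (Finset.mul_prod_erase Finset.univ _ (Finset.mem_univ i)).symm
  all_goals
    unfold binom
    rw [← Finset.mul_prod_erase Finset.univ _ (Finset.mem_univ i)]
    simp only [Finsupp.add_apply, unitExp_same]
    refine congrArg _ (Finset.prod_congr rfl fun j hj => ?_)
    simp only [unitExp_ne (Finset.ne_of_mem_erase hj), add_zero]

theorem lower_leibniz (i : ι) (f g : DivPow K ι) :
    lower i (f * g) = f * lower i g + g * lower i f := by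
  refine induct (p := fun f => lower i (f * g) = f * lower i g + g * lower i f) f ?_ ?_ ?_ fun r => ?_
  · simp
  · intro a b ha hb; rw [add_mul, map_add, ha, hb, map_add]; ring
  · intro c a ha
    rw [smul_mul', map_smul, ha, map_smul, smul_mul', mul_smul', smul_add]
  refine induct (p := fun g => lower i (mon r * g) = mon r * lower i g + g * lower i (mon r))
    g ?_ ?_ ?_ fun s => ?_
  · simp
  · intro a b ha hb; rw [mul_add, map_add, ha, hb, map_add]; ring
  · intro c a ha
    rw [mul_smul', map_smul, ha, map_smul, smul_mul', mul_smul', smul_add]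
  by_cases hr : r i = 0
  · by_cases hs : s i = 0
    · rw [lower_mon_zero hr, lower_mon_zero hs, mon_mul_mon, map_smul,
        lower_mon_zero (by simp [hr, hs])]
      simp
    · obtain ⟨s, rfl⟩ := exists_add hs
      obtain ⟨m, h1, h2, h3, h4⟩ := binom_split i r s
      rw [lower_mon_zero hr, lower_mon_add, mon_mul_mon, map_smul, ← add_assoc, lower_mon_add,
        mon_mul_mon, mul_zero, add_zero, h3, h1, hr]
      simp
  · obtain ⟨r, rfl⟩ := exists_add hr
    by_cases hs : s i = 0
    · obtain ⟨m, h1, h2, h3, h4⟩ := binom_split i r s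
      rw [lower_mon_zero hs, lower_mon_add, mon_mul_mon, map_smul, add_right_comm, lower_mon_add,
        mon_mul_mon, mul_zero, zero_add, h2, binom_comm, h1, hs, add_comm s r]
      simp
    · obtain ⟨s, rfl⟩ := exists_add hs
      obtain ⟨m, h1, h2, h3, h4⟩ := binom_split i r s
      rw [lower_mon_add, lower_mon_add, mon_mul_mon, mon_mul_mon, mon_mul_mon, map_smul,
        ← add_assoc, lower_mon_add, binom_comm (s + unitExp i) r, h2, h3, h4,
        add_right_comm r (unitExp i) s, show s + unitExp i + r = r + s + unitExp i by
          rw [add_comm s, add_right_comm, add_comm, ← add_assoc, add_right_comm, add_comm s],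
        ← add_smul, ← Nat.cast_add, ← add_mul]
      congr 3
      have := Nat.choose_succ_succ (r i + 1 + s i) (r i)
      rw [show r i + 1 + (s i + 1) = (r i + 1 + s i) + 1 by ring, this, add_comm,
        show r i + (s i + 1) = r i + 1 + s i by ring]

/-- The distinguished partial derivative `∂_i`, `∂_i (u_j^(k)) = δ_ij u_j^(k-1)`. -/
def pd (i : ι) : Derivation K (DivPow K ι) (DivPow K ι) :=
  Derivation.mk' (lower i) fun f g => by
    rw [lower_leibniz]; rfl

theorem pd_apply (i : ι) (f : DivPow K ι) : pd i f = lower i f := rfl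

theorem pd_comm (i j : ι) (f : DivPow K ι) : pd i (pd j f) = pd j (pd i f) := by
  simp only [pd_apply]
  refine induct (p := fun f => lower i (lower j f) = lower j (lower i f)) f ?_ ?_ ?_ fun r => ?_
  · simp
  · intro a b ha hb; simp only [map_add, ha, hb]
  · intro c a ha; simp only [map_smul, ha]
  by_cases hij : i = j
  · rw [hij]
  by_cases hi : r i = 0
  · rw [lower_mon_zero hi, map_zero]
    by_cases hj : r j = 0
    · rw [lower_mon_zero hj, map_zero]
    · obtain ⟨r, rfl⟩ := exists_add hj
      rw [lower_mon_add, lower_mon_zero]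
      simp only [Finsupp.add_apply] at hi
      omega
  · obtain ⟨r, rfl⟩ := exists_add hi
    rw [lower_mon_add]
    by_cases hj : r j = 0
    · rw [lower_mon_zero hj, lower_mon_zero, map_zero]
      rw [Finsupp.add_apply, hj, unitExp_ne (Ne.symm hij)]
    · obtain ⟨r, rfl⟩ := exists_add hj
      rw [lower_mon_add, add_right_comm, lower_mon_add, lower_mon_add]

theorem pd_var_same (i : ι) : pd i (var i : DivPow K ι) = 1 := by
  rw [pd_apply, var, ← zero_add (unitExp i), lower_mon_add]; rfl

theorem pd_var_ne {i j : ι} (h : i ≠ j) : pd i (var j : DivPow K ι) = 0 := by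
  rw [pd_apply, var, lower_mon_zero (unitExp_ne h)]

theorem two_eq_zero [CharP K 2] (f : DivPow K ι) : f + f = 0 := by
  rw [← two_smul K f, CharTwo.two_eq_zero, zero_smul]

theorem var_mul_var [CharP K 2] (i : ι) : (var i * var i : DivPow K ι) = 0 := by
  have h : binom (unitExp i) (unitExp i) = 2 * binom (0 : ι →₀ ℕ) 0 := by
    obtain ⟨m, h1, h2, h3, h4⟩ := binom_split i (0 : ι →₀ ℕ) 0
    rw [zero_add] at h4
    rw [h4, h1]
    simp
  rw [var, mon_mul_mon, h]
  simp [CharTwo.two_eq_zero]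

/-- The multi-index `r` is allowed by the shearing vector `N`: `r_i < 2 ^ N_i` for all `i`
(no condition on `r_i` if `N_i = ∞`). -/
def Admissible (N : ι → ℕ∞) (r : ι →₀ ℕ) : Prop := ∀ i, ∀ k : ℕ, N i = k → r i < 2 ^ k

/-- The space `𝒪(ι; N) = Span(u^(r) | r_i < 2 ^ N_i)` of divided powers with shearing vector `N`
(for fields of characteristic 2). -/
def trunc (N : ι → ℕ∞) : Submodule K (DivPow K ι) :=
  Submodule.span K {f | ∃ r, Admissible N r ∧ f = mon r}

theorem even_choose {k r s : ℕ} (hr : r < 2 ^ k) (hs : s < 2 ^ k) (h : 2 ^ k ≤ r + s) :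
    2 ∣ (r + s).choose r := by
  by_contra hd
  have h1 := (Nat.choose_pos (Nat.le_add_right r s)).ne'
  have hf : ((r + s).choose r).factorization 2 = 0 :=
    Nat.factorization_eq_zero_of_not_dvd hd
  have hk := Nat.factorization_choose' Nat.prime_two (n := s) (k := r) (b := Nat.log 2 (s + r) + 1)
    (Nat.lt_succ_self _)
  rw [add_comm s r, hf] at hk
  have hmem : k ∈ Finset.filter (fun i => 2 ^ i ≤ r % 2 ^ i + s % 2 ^ i)
      (Finset.Ico 1 (Nat.log 2 (r + s) + 1)) := by
    rw [Finset.mem_filter, Finset.mem_Ico, Nat.mod_eq_of_lt hr, Nat.mod_eq_of_lt hs]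
    refine ⟨⟨?_, ?_⟩, h⟩
    · rcases Nat.eq_zero_or_pos k with h0 | h0
      · subst h0; simp at hr hs; omega
      · exact h0
    · exact Nat.lt_succ_of_le ((Nat.le_log_iff_pow_le (by norm_num) (by omega)).2 h)
  exact absurd hk.symm (Finset.card_pos.2 ⟨k, hmem⟩).ne'

theorem mon_mem_trunc {N : ι → ℕ∞} {r : ι →₀ ℕ} (h : Admissible N r) :
    (mon r : DivPow K ι) ∈ trunc N := Submodule.subset_span ⟨r, h, rfl⟩

theorem mul_mem_trunc [CharP K 2] {N : ι → ℕ∞} {f g : DivPow K ι} (hf : f ∈ trunc N)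
    (hg : g ∈ trunc N) : f * g ∈ trunc N := by
  refine Submodule.span_induction₂ (p := fun f g _ _ => f * g ∈ trunc N) ?_ ?_ ?_ ?_ ?_ ?_ ?_ hf hg
  · rintro _ _ ⟨r, hr, rfl⟩ ⟨s, hs, rfl⟩
    rw [mon_mul_mon]
    by_cases h : Admissible N (r + s)
    · exact Submodule.smul_mem _ _ (mon_mem_trunc h)
    · unfold Admissible at h
      push Not at h
      obtain ⟨i, k, hk, hle⟩ := h
      have hd : 2 ∣ binom r s :=
        (even_choose (hr i k hk) (hs i k hk) hle).trans
          (Finset.dvd_prod_of_mem (fun i => (r i + s i).choose (r i)) (Finset.mem_univ i))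
      rw [(CharP.cast_eq_zero_iff K 2 _).2 hd, zero_smul]
      exact Submodule.zero_mem _
  · intro y _; simp
  · intro x _; simp
  · intro x y z _ _ _ h1 h2; rw [add_mul]; exact Submodule.add_mem _ h1 h2
  · intro x y z _ _ _ h1 h2; rw [mul_add]; exact Submodule.add_mem _ h1 h2
  · intro c x y _ _ h; rw [smul_mul']; exact Submodule.smul_mem _ _ h
  · intro c x y _ _ h; rw [mul_smul']; exact Submodule.smul_mem _ _ h

theorem pd_mem_trunc {N : ι → ℕ∞} (i : ι) {f : DivPow K ι} (hf : f ∈ trunc N) :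
    pd i f ∈ trunc N := by
  refine Submodule.span_induction (p := fun f _ => pd i f ∈ trunc N) ?_ ?_ ?_ ?_ hf
  · rintro _ ⟨r, hr, rfl⟩
    rw [pd_apply]
    by_cases h : r i = 0
    · rw [lower_mon_zero h]; exact Submodule.zero_mem _
    · obtain ⟨r, rfl⟩ := exists_add h
      rw [lower_mon_add]
      refine mon_mem_trunc fun j k hk => lt_of_le_of_lt ?_ (hr j k hk)
      simp
  · simp
  · intro x y _ _ hx hy; rw [map_add]; exact Submodule.add_mem _ hx hy
  · intro c x _ hx; rw [Derivation.map_smul]; exact Submodule.smul_mem _ _ hx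

theorem var_mem_trunc {N : ι → ℕ∞} (h : ∀ i, N i ≠ 0) (i : ι) : (var i : DivPow K ι) ∈ trunc N := by
  refine mon_mem_trunc fun j k hk => ?_
  have hk0 : k ≠ 0 := by
    rintro rfl
    exact h j (by simpa using hk)
  have h1 : unitExp i j ≤ 1 := by
    by_cases hj : j = i
    · rw [hj, unitExp_same]
    · rw [unitExp_ne hj]; omega
  exact lt_of_le_of_lt h1 (Nat.one_lt_two_pow hk0)

/-- The vector field `∑ i, f_i ∂_i`. -/
def field (f : ι → DivPow K ι) : Derivation K (DivPow K ι) (DivPow K ι) := ∑ i, f i • pd i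

theorem sum_smul_apply {κ : Type*} (s : Finset κ) (f : κ → DivPow K ι)
    (D : κ → Derivation K (DivPow K ι) (DivPow K ι)) (a : DivPow K ι) :
    (∑ i ∈ s, f i • D i) a = ∑ i ∈ s, f i * D i a := by
  classical
  refine Finset.induction_on s (by simp) fun i s hi h => ?_
  rw [Finset.sum_insert hi, Finset.sum_insert hi, Derivation.add_apply, h, Derivation.smul_apply,
    smul_eq_mul]

theorem field_apply (f : ι → DivPow K ι) (a : DivPow K ι) : field f a = ∑ i, f i * pd i a :=
  sum_smul_apply _ _ _ _

theorem lie_field (f g : ι → DivPow K ι) :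
    ⁅field f, field g⁆ = field fun i => field f (g i) - field g (f i) := by
  ext a
  rw [Derivation.commutator_apply, field_apply g a, field_apply f a, field_apply _ a, map_sum,
    map_sum]
  simp only [Derivation.leibniz, smul_eq_mul, Finset.sum_add_distrib, sub_mul,
    Finset.sum_sub_distrib]
  have h : ∑ i, g i * field f (pd i a) = ∑ i, f i * field g (pd i a) := by
    simp only [field_apply, Finset.mul_sum]
    rw [Finset.sum_comm]
    refine Finset.sum_congr rfl fun i _ => Finset.sum_congr rfl fun j _ => ?_
    rw [pd_comm]; ring
  rw [h]
  simp only [mul_comm (pd _ a)]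
  ring

theorem field_add (f g : ι → DivPow K ι) : field (f + g) = field f + field g := by
  simp [field, add_smul, Finset.sum_add_distrib]

theorem field_zero : field (0 : ι → DivPow K ι) = 0 := by simp [field]

theorem field_smul (c : K) (f : ι → DivPow K ι) : field (c • f) = c • field f := by
  simp [field, Finset.smul_sum, smul_assoc]

theorem field_mem_trunc [CharP K 2] {N : ι → ℕ∞} {f : ι → DivPow K ι} (hf : ∀ i, f i ∈ trunc N)
    {a : DivPow K ι} (ha : a ∈ trunc N) : field f a ∈ trunc N := by
  rw [field_apply]
  exact Submodule.sum_mem _ fun i _ => mul_mem_trunc (hf i) (pd_mem_trunc i ha)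

/-- The `𝒪`-module `𝒪 ⊗ g0` of matrices with entries in `𝒪` spanned by the constant
matrices from `g0`. -/
def matrixSpan [DecidableEq ι] (g0 : LieSubalgebra K (Matrix ι ι K)) :
    Submodule (DivPow K ι) (Matrix ι ι (DivPow K ι)) :=
  Submodule.span (DivPow K ι) {J | ∃ A ∈ g0, J = A.map (algebraMap K (DivPow K ι))}

/-- The Jacobian matrix `(∂_j f_i)_{j,i}` of `∑ i, f_i ∂_i`. -/
def jacobian (f : ι → DivPow K ι) : Matrix ι ι (DivPow K ι) := Matrix.of fun j i => pd j (f i)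

theorem jacobian_lie [DecidableEq ι] (f g : ι → DivPow K ι) :
    jacobian (fun i => field f (g i) - field g (f i)) =
      (jacobian g).map (field f) - (jacobian f).map (field g) +
        ⁅jacobian f, jacobian g⁆ := by
  ext j i
  simp only [jacobian, Ring.lie_def, Matrix.add_apply, Matrix.sub_apply, Matrix.map_apply,
    Matrix.of_apply, Matrix.mul_apply, map_sub, field_apply, map_sum, Derivation.leibniz,
    smul_eq_mul, Finset.sum_add_distrib, pd_comm j]
  have h1 : ∀ u v : ι → DivPow K ι, ∑ x, pd x (u i) * pd j (v x) = ∑ x, pd j (v x) * pd x (u i) :=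
    fun u v => Finset.sum_congr rfl fun x _ => mul_comm _ _
  rw [h1 g f, h1 f g]
  ring

theorem map_mem_matrixSpan [DecidableEq ι] {g0 : LieSubalgebra K (Matrix ι ι K)}
    (D : Derivation K (DivPow K ι) (DivPow K ι)) {J : Matrix ι ι (DivPow K ι)}
    (h : J ∈ matrixSpan g0) : J.map D ∈ matrixSpan g0 := by
  refine Submodule.span_induction (p := fun J _ => J.map D ∈ matrixSpan g0) ?_ ?_ ?_ ?_ h
  · rintro _ ⟨A, -, rfl⟩
    have : (A.map (algebraMap K (DivPow K ι))).map D = 0 := by ext; simp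
    rw [this]; exact Submodule.zero_mem _
  · have : (0 : Matrix ι ι (DivPow K ι)).map D = 0 := by ext; simp
    rw [this]; exact Submodule.zero_mem _
  · intro x y _ _ hx hy
    have : (x + y).map D = x.map D + y.map D := by ext; simp
    rw [this]; exact Submodule.add_mem _ hx hy
  · intro c x hx0 hx
    have : (c • x).map D = c • x.map D + D c • x := by ext; simp; ring
    rw [this]
    exact Submodule.add_mem _ (Submodule.smul_mem _ _ hx) (Submodule.smul_mem _ _ hx0)

theorem lie_mem_matrixSpan [DecidableEq ι] {g0 : LieSubalgebra K (Matrix ι ι K)}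
    {J J' : Matrix ι ι (DivPow K ι)} (h : J ∈ matrixSpan g0) (h' : J' ∈ matrixSpan g0) :
    ⁅J, J'⁆ ∈ matrixSpan g0 := by
  refine Submodule.span_induction₂ (p := fun J J' _ _ => ⁅J, J'⁆ ∈ matrixSpan g0)
    ?_ ?_ ?_ ?_ ?_ ?_ ?_ h h'
  · rintro _ _ ⟨A, hA, rfl⟩ ⟨B, hB, rfl⟩
    refine Submodule.subset_span ⟨⁅A, B⁆, g0.lie_mem hA hB, ?_⟩
    rw [Ring.lie_def, Ring.lie_def, Matrix.map_sub _ (map_sub _), Matrix.map_mul, Matrix.map_mul]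
  · intro y _; simp
  · intro x _; simp
  · intro x y z _ _ _ h1 h2; rw [add_lie]; exact Submodule.add_mem _ h1 h2
  · intro x y z _ _ _ h1 h2; rw [lie_add]; exact Submodule.add_mem _ h1 h2
  · intro c x y _ _ h
    have : ⁅c • x, y⁆ = c • ⁅x, y⁆ := by simp [Ring.lie_def, smul_sub]
    rw [this]; exact Submodule.smul_mem _ _ h
  · intro c x y _ _ h
    have : ⁅x, c • y⁆ = c • ⁅x, y⁆ := by simp [Ring.lie_def, smul_sub]
    rw [this]; exact Submodule.smul_mem _ _ h

/-- The complete Cartan prolong `(g_{-1}, g_0)_{*,N}` of depth 1, where `g_{-1} = K^ι` is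
spanned by the constant vector fields `∂_i`, and the matrix `A ∈ g_0` is identified with the
linear vector field `∑ A_{ji} u_j ∂_i`. It consists of the vector fields `∑ f_i ∂_i` with
`f_i ∈ 𝒪(ι; N)`, all of whose Taylor coefficients, paired once with `g_{-1}`, lie in `g_0`,
i.e., with Jacobian matrix in `𝒪 ⊗ g_0`. -/
def prolong [DecidableEq ι] [CharP K 2] (g0 : LieSubalgebra K (Matrix ι ι K)) (N : ι → ℕ∞) :
    LieSubalgebra K (Derivation K (DivPow K ι) (DivPow K ι)) where
  carrier := {D | ∃ f : ι → DivPow K ι, (∀ i, f i ∈ trunc N) ∧ jacobian f ∈ matrixSpan g0 ∧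
    D = field f}
  add_mem' := by
    rintro _ _ ⟨f, hf, hf', rfl⟩ ⟨g, hg, hg', rfl⟩
    refine ⟨f + g, fun i => Submodule.add_mem _ (hf i) (hg i), ?_, (field_add f g).symm⟩
    have : jacobian (f + g) = jacobian f + jacobian g := by ext; simp [jacobian]
    rw [this]; exact Submodule.add_mem _ hf' hg'
  zero_mem' := by
    refine ⟨0, fun i => Submodule.zero_mem _, ?_, field_zero.symm⟩
    have : jacobian (0 : ι → DivPow K ι) = 0 := by ext; simp [jacobian]
    rw [this]; exact Submodule.zero_mem _
  smul_mem' := by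
    rintro c _ ⟨f, hf, hf', rfl⟩
    refine ⟨c • f, fun i => Submodule.smul_mem _ _ (hf i), ?_, (field_smul c f).symm⟩
    have : jacobian (c • f) = algebraMap K (DivPow K ι) c • jacobian f := by
      ext; simp [jacobian, Algebra.smul_def]
    rw [this]; exact Submodule.smul_mem _ _ hf'
  lie_mem' := by
    rintro _ _ ⟨f, hf, hf', rfl⟩ ⟨g, hg, hg', rfl⟩
    refine ⟨_, fun i => Submodule.sub_mem _ (field_mem_trunc hf (hg i))
      (field_mem_trunc hg (hf i)), ?_, lie_field f g⟩
    rw [jacobian_lie]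
    exact Submodule.add_mem _ (Submodule.sub_mem _ (map_mem_matrixSpan _ hg')
      (map_mem_matrixSpan _ hf')) (lie_mem_matrixSpan hf' hg')

/-- The `i`-th coordinate of the shearing vector is critical for the prolongs of `g_0`: it cannot
take arbitrarily large values, that is, replacing large values of `N_i` by some fixed bound
does not change the prolong. -/
def IsCritical [DecidableEq ι] [CharP K 2] (g0 : LieSubalgebra K (Matrix ι ι K)) (i : ι) : Prop :=
  ∃ B : ℕ, ∀ N : ι → ℕ∞, (B : ℕ∞) ≤ N i →
    prolong g0 N = prolong g0 (Function.update N i B)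

end DivPow

section Contact

/-! Vector fields with generating functions. Here `T`, `Q_i`, `X_i` is a frame of derivations of a
commutative algebra `A` of characteristic 2, whose only nonzero commutators are `[Q_i, X_i] = T`. -/

variable {K A κ : Type*} [Field K] [CommRing A] [Algebra K A] [Fintype κ]

/-- The field `f T + ∑ i, (Q_i(f) X_i + X_i(f) Q_i)` with generating function `f`. -/
def genField (T : Derivation K A A) (Q X : κ → Derivation K A A) (f : A) : Derivation K A A :=
  f • T + ∑ i, (Q i f • X i + X i f • Q i)

/-- The bracket of generating functions. -/
def genBracket (T : Derivation K A A) (Q X : κ → Derivation K A A) (f g : A) : A :=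
  f * T g + g * T f + ∑ i, (Q i f * X i g + X i f * Q i g)

variable {T : Derivation K A A} {Q X : κ → Derivation K A A}

theorem genField_apply (f a : A) :
    genField T Q X f a = f * T a + ∑ i, (Q i f * X i a + X i f * Q i a) := by
  have h : ∀ s : Finset κ, (∑ i ∈ s, (Q i f • X i + X i f • Q i)) a =
      ∑ i ∈ s, (Q i f * X i a + X i f * Q i a) := by
    classical
    intro s
    refine Finset.induction_on s (by simp) fun i s hi h => ?_
    rw [Finset.sum_insert hi, Finset.sum_insert hi, Derivation.add_apply, h]
    simp
  rw [genField, Derivation.add_apply, h]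
  simp

theorem genField_add (f g : A) :
    genField T Q X (f + g) = genField T Q X f + genField T Q X g := by
  ext a
  simp only [genField_apply, Derivation.add_apply, map_add, add_mul, Finset.sum_add_distrib]
  ring

theorem genField_smul (c : K) (f : A) : genField T Q X (c • f) = c • genField T Q X f := by
  ext a
  simp only [genField_apply, Derivation.smul_apply, Derivation.map_smul, smul_mul_assoc, smul_add,
    Finset.smul_sum]

theorem sum_symm_eq_zero (h2 : ∀ a : A, a + a = 0) (R : κ → κ → A)
    (hs : ∀ i j, R i j = R j i) (hd : ∀ i, R i i = 0) : ∑ i, ∑ j, R i j = 0 := by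
  classical
  rw [← Finset.sum_product' Finset.univ Finset.univ R]
  refine Finset.sum_involution (fun p _ => (p.2, p.1)) ?_ ?_ ?_ ?_
  · rintro ⟨i, j⟩ _
    change R i j + R j i = 0
    rw [hs j i, h2]
  · rintro ⟨i, j⟩ _ hne h
    simp only [Prod.mk.injEq] at h
    exact hne (by rw [h.1]; exact hd _)
  · simp
  · simp

/-- The commutation relations of the frame. -/
structure IsFrame [DecidableEq κ] (T : Derivation K A A) (Q X : κ → Derivation K A A) : Prop where
  two : ∀ a : A, a + a = 0
  TQ : ∀ i a, T (Q i a) = Q i (T a)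
  TX : ∀ i a, T (X i a) = X i (T a)
  QQ : ∀ i j a, Q i (Q j a) = Q j (Q i a)
  XX : ∀ i j a, X i (X j a) = X j (X i a)
  QX : ∀ i j a, Q i (X j a) = X j (Q i a) + if i = j then T a else 0

variable [DecidableEq κ]

theorem lie_genField (H : IsFrame T Q X) (f g : A) :
    ⁅genField T Q X f, genField T Q X g⁆ = genField T Q X (genBracket T Q X f g) := by
  have h2 : (2 : A) = 0 := by rw [← one_add_one_eq_two]; exact H.two 1
  ext a
  have e1 : ∀ f g, ∑ i, ∑ j, (Q i f * X i (Q j g * X j a + X j g * Q j a) +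
      X i f * Q i (Q j g * X j a + X j g * Q j a)) =
      ∑ i, ∑ j, (Q i f * Q j g * X i (X j a) + X i f * X j g * Q i (Q j a)) +
      ∑ i, ∑ j, (Q i f * X j g * X i (Q j a) + X i f * Q j g * X j (Q i a)) +
      ∑ i, X i f * Q i g * T a +
      ∑ j, ∑ i, (Q i f * X i (Q j g) * X j a + Q i f * X i (X j g) * Q j a +
        X i f * Q i (Q j g) * X j a + X i f * Q i (X j g) * Q j a) := by
    intro f g
    rw [Finset.sum_comm (f := fun j i => (Q i f * X i (Q j g) * X j a + Q i f * X i (X j g) * Q j a +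
        X i f * Q i (Q j g) * X j a + X i f * Q i (X j g) * Q j a))]
    rw [← Finset.sum_add_distrib, ← Finset.sum_add_distrib, ← Finset.sum_add_distrib]
    refine Finset.sum_congr rfl fun i _ => ?_
    have hδ : X i f * Q i g * T a = ∑ j, if i = j then X i f * Q j g * T a else 0 := by simp
    rw [hδ, ← Finset.sum_add_distrib, ← Finset.sum_add_distrib, ← Finset.sum_add_distrib]
    refine Finset.sum_congr rfl fun j _ => ?_
    have := H.QX i j a
    simp only [map_add, Derivation.leibniz, smul_eq_mul, this]
    split_ifs <;> ring
  have e2 : ∑ i, ∑ j, (Q i f * Q j g * X i (X j a) + X i f * X j g * Q i (Q j a)) =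
      ∑ i, ∑ j, (Q i g * Q j f * X i (X j a) + X i g * X j f * Q i (Q j a)) := by
    rw [Finset.sum_comm]
    refine Finset.sum_congr rfl fun i _ => Finset.sum_congr rfl fun j _ => ?_
    rw [H.XX i j, H.QQ i j]; ring
  have e3 : ∑ i, ∑ j, (Q i f * X j g * X i (Q j a) + X i f * Q j g * X j (Q i a)) =
      ∑ i, ∑ j, (Q i g * X j f * X i (Q j a) + X i g * Q j f * X j (Q i a)) := by
    rw [Finset.sum_comm]
    refine Finset.sum_congr rfl fun i _ => Finset.sum_congr rfl fun j _ => ?_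
    ring
  have e4 : ∑ j, (Q j (∑ i, (Q i f * X i g + X i f * Q i g)) * X j a +
        X j (∑ i, (Q i f * X i g + X i f * Q i g)) * Q j a) =
      ∑ j, ∑ i, (Q i f * X i (Q j g) * X j a + Q i f * X i (X j g) * Q j a +
        X i f * Q i (Q j g) * X j a + X i f * Q i (X j g) * Q j a) +
      ∑ j, ∑ i, (Q i g * X i (Q j f) * X j a + Q i g * X i (X j f) * Q j a +
        X i g * Q i (Q j f) * X j a + X i g * Q i (X j f) * Q j a) +
      ∑ j, ((Q j f * T g + T f * Q j g) * X j a + (T f * X j g + X j f * T g) * Q j a) := by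
    rw [← Finset.sum_add_distrib, ← Finset.sum_add_distrib]
    refine Finset.sum_congr rfl fun j _ => ?_
    have hδ : (Q j f * T g + T f * Q j g) * X j a + (T f * X j g + X j f * T g) * Q j a =
        ∑ i, if j = i then (Q i f * T g + T f * Q i g) * X j a +
          (T f * X i g + X i f * T g) * Q j a else 0 := by simp
    rw [hδ, map_sum, map_sum, Finset.sum_mul, Finset.sum_mul, ← Finset.sum_add_distrib,
      ← Finset.sum_add_distrib, ← Finset.sum_add_distrib]
    refine Finset.sum_congr rfl fun i _ => ?_
    have a1 := H.QX j i f
    have a2 := H.QX j i g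
    have a3 := H.QX i j f
    have a4 := H.QX i j g
    have a5 := H.QQ i j f
    have a6 := H.QQ i j g
    have a7 := H.XX i j f
    have a8 := H.XX i j g
    simp only [map_add, Derivation.leibniz, smul_eq_mul, a1, a2, a3, a4, a5, a6, a7, a8]
    by_cases hij : j = i
    · subst hij
      simp only [if_true]
      linear_combination (-(T f * X j g + X j f * T g) * Q j a) * h2
    · simp only [if_neg hij, if_neg (Ne.symm hij)]
      ring
  have M : ∀ f g, genField T Q X f (genField T Q X g a) =
      genField T Q X f g * T a + f * g * T (T a) + ∑ i, (g * Q i f * X i (T a) + g * X i f * Q i (T a))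
      + ∑ i, (f * Q i g * X i (T a) + f * X i g * Q i (T a))
      + ∑ i, (f * Q i (T g) * X i a + f * X i (T g) * Q i a) +
      ∑ i, ∑ j, (Q i f * X i (Q j g * X j a + X j g * Q j a) +
      X i f * Q i (Q j g * X j a + X j g * Q j a)) := by
    intro f g
    rw [genField_apply g a, map_add, genField_apply f (∑ i, _), Derivation.leibniz,
      genField_apply f (T a)]
    have : f * T (∑ i, (Q i g * X i a + X i g * Q i a)) =
      ∑ i, (f * Q i g * X i (T a) + f * X i g * Q i (T a))
      + ∑ i, (f * Q i (T g) * X i a + f * X i (T g) * Q i a) := by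
      rw [map_sum, Finset.mul_sum, ← Finset.sum_add_distrib]
      refine Finset.sum_congr rfl fun i _ => ?_
      simp only [map_add, Derivation.leibniz, smul_eq_mul, H.TQ, H.TX]; ring
    have hd : ∑ i, (Q i f * X i (∑ j, (Q j g * X j a + X j g * Q j a)) +
        X i f * Q i (∑ j, (Q j g * X j a + X j g * Q j a))) =
        ∑ i, ∑ j, (Q i f * X i (Q j g * X j a + X j g * Q j a) +
          X i f * Q i (Q j g * X j a + X j g * Q j a)) := by
      refine Finset.sum_congr rfl fun i _ => ?_
      rw [map_sum, map_sum, Finset.mul_sum, Finset.mul_sum, Finset.sum_add_distrib]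
    rw [this, hd]
    simp only [smul_eq_mul, mul_add, Finset.mul_sum, Finset.sum_add_distrib]
    simp only [← mul_assoc]
    ring
  have N : genField T Q X (genBracket T Q X f g) a = genBracket T Q X f g * T a +
      ∑ i, (f * Q i (T g) * X i a + f * X i (T g) * Q i a) +
      ∑ i, (g * Q i (T f) * X i a + g * X i (T f) * Q i a) +
      ∑ j, ((Q j f * T g + T f * Q j g) * X j a + (T f * X j g + X j f * T g) * Q j a) +
      ∑ j, (Q j (∑ i, (Q i f * X i g + X i f * Q i g)) * X j a +
        X j (∑ i, (Q i f * X i g + X i f * Q i g)) * Q j a) := by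
    rw [genField_apply, genBracket]
    simp only [← Finset.sum_add_distrib, add_assoc]
    congr 1
    refine Finset.sum_congr rfl fun i _ => ?_
    have a1 : T (Q i f) = Q i (T f) := H.TQ i f
    simp only [map_add, Derivation.leibniz, smul_eq_mul]
    ring
  rw [Derivation.commutator_apply, M f g, M g f, N, e4, e1 f g, e1 g f, e2, e3, genBracket,
    genField_apply f g, genField_apply g f]
  simp only [Finset.sum_add_distrib, Finset.sum_mul, add_mul, mul_comm (X _ g), mul_comm (Q _ g)]
  linear_combination (-(g * T f * T a + ∑ i, Q i f * X i g * T a +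
    ∑ x, g * Q x (T f) * X x a + ∑ x, g * X x (T f) * Q x a +
    ∑ x, ∑ y, X y (Q x f) * Q y g * X x a + ∑ x, ∑ y, X y (X x f) * Q y g * Q x a +
    ∑ x, ∑ y, Q y (Q x f) * X y g * X x a + ∑ x, ∑ y, Q y (X x f) * X y g * Q x a +
    ∑ x, Q x f * T g * X x a + ∑ x, T f * Q x g * X x a +
    ∑ x, T f * X x g * Q x a + ∑ x, X x f * T g * Q x a)) * h2

theorem T_genBracket (H : IsFrame T Q X) (f g : A) :
    T (genBracket T Q X f g) = genField T Q X f (T g) + genField T Q X g (T f) := by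
  rw [genBracket, genField_apply, genField_apply]
  simp only [map_add, map_sum, Derivation.leibniz, smul_eq_mul, H.TQ, H.TX,
    Finset.sum_add_distrib]
  simp only [mul_comm (X _ g), mul_comm (Q _ g)]
  linear_combination H.two (T f * T g)

theorem div_genBracket (H : IsFrame T Q X) {f g : A} (hf : ∀ i, X i (X i f) = 0)
    (hg : ∀ i, X i (X i g) = 0) :
    ∑ j, X j (Q j (genBracket T Q X f g)) =
      genField T Q X f (∑ j, X j (Q j g)) + genField T Q X g (∑ j, X j (Q j f)) := by
  have h2 : (2 : A) = 0 := by rw [← one_add_one_eq_two]; exact H.two 1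
  have cross : ∀ i j, X j (Q j (Q i f * X i g + X i f * Q i g)) =
      (Q i f * X i (X j (Q j g)) + X i f * Q i (X j (Q j g)) +
        (Q i g * X i (X j (Q j f)) + X i g * Q i (X j (Q j f)))) +
      (X j (Q i f) * X i (Q j g) + X i (Q j f) * X j (Q i g)) +
      (Q j (Q i f) * X j (X i g) + X j (X i f) * Q j (Q i g)) +
      (if i = j then Q i f * X i (T g) + X i f * Q i (T g) + (Q i g * X i (T f) + X i g * Q i (T f))
        + (X i (Q i f) * T g + T f * X i (Q i g)) else 0) := by
    intro i j
    have b1 := fun a => H.QX j i a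
    have b2 := fun a => H.QX i j a
    by_cases hij : i = j
    · subst hij
      simp only [if_true] at b1
      simp only [map_add, Derivation.leibniz, smul_eq_mul, b1, if_true, H.TQ]
      linear_combination (-(X i f * Q i (T g) + X i g * Q i (T f))) * h2
    · simp only [if_neg hij, if_neg (Ne.symm hij), add_zero] at b1 b2 ⊢
      simp only [map_add, Derivation.leibniz, smul_eq_mul, b1, b2, H.QQ j i, H.XX j i]
      ring
  have s1 : ∑ j, ∑ i, (X j (Q i f) * X i (Q j g) + X i (Q j f) * X j (Q i g)) = 0 := by
    refine sum_symm_eq_zero H.two _ (fun i j => add_comm _ _) fun i => H.two _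
  have s2 : ∑ j, ∑ i, (Q j (Q i f) * X j (X i g) + X j (X i f) * Q j (Q i g)) = 0 := by
    refine sum_symm_eq_zero H.two _ (fun i j => ?_) fun i => ?_
    · rw [H.QQ i j f, H.QQ i j g, H.XX i j f, H.XX i j g]
    · rw [hf, hg]; ring
  have s3 : ∑ j, ∑ i, (Q i f * X i (X j (Q j g)) + X i f * Q i (X j (Q j g)) +
        (Q i g * X i (X j (Q j f)) + X i g * Q i (X j (Q j f)))) =
      ∑ i, (Q i f * X i (∑ j, X j (Q j g)) + X i f * Q i (∑ j, X j (Q j g))) +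
      ∑ i, (Q i g * X i (∑ j, X j (Q j f)) + X i g * Q i (∑ j, X j (Q j f))) := by
    rw [Finset.sum_comm, ← Finset.sum_add_distrib]
    refine Finset.sum_congr rfl fun i _ => ?_
    simp only [map_sum, Finset.mul_sum, Finset.sum_add_distrib]
  have s4 : ∑ j, X j (Q j (f * T g + g * T f)) = f * T (∑ j, X j (Q j g)) +
      g * T (∑ j, X j (Q j f)) + ∑ i, (Q i f * X i (T g) + X i f * Q i (T g) +
        (Q i g * X i (T f) + X i g * Q i (T f)) + (X i (Q i f) * T g + T f * X i (Q i g))) := by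
    rw [map_sum, map_sum, Finset.mul_sum, Finset.mul_sum, ← Finset.sum_add_distrib,
      ← Finset.sum_add_distrib]
    refine Finset.sum_congr rfl fun j _ => ?_
    simp only [map_add, Derivation.leibniz, smul_eq_mul, H.TX, H.TQ]
    ring
  have s5 : ∑ j, X j (Q j (∑ i, (Q i f * X i g + X i f * Q i g))) =
      ∑ j, ∑ i, X j (Q j (Q i f * X i g + X i f * Q i g)) := by
    simp only [map_sum]
  have s6 : ∑ j, X j (Q j (genBracket T Q X f g)) = ∑ j, X j (Q j (f * T g + g * T f)) +
      ∑ j, X j (Q j (∑ i, (Q i f * X i g + X i f * Q i g))) := by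
    rw [← Finset.sum_add_distrib]
    refine Finset.sum_congr rfl fun j _ => ?_
    rw [genBracket, map_add (Q j), map_add (X j)]
  have s7 : ∑ j, ∑ i, (if i = j then Q i f * X i (T g) + X i f * Q i (T g) +
        (Q i g * X i (T f) + X i g * Q i (T f)) + (X i (Q i f) * T g + T f * X i (Q i g)) else 0) =
      ∑ i, (Q i f * X i (T g) + X i f * Q i (T g) +
        (Q i g * X i (T f) + X i g * Q i (T f)) + (X i (Q i f) * T g + T f * X i (Q i g))) := by
    refine Finset.sum_congr rfl fun j _ => ?_
    simp
  have s8 : ∑ j, ∑ i, X j (Q j (Q i f * X i g + X i f * Q i g)) =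
      ∑ j, ∑ i, (Q i f * X i (X j (Q j g)) + X i f * Q i (X j (Q j g)) +
        (Q i g * X i (X j (Q j f)) + X i g * Q i (X j (Q j f)))) +
      ∑ j, ∑ i, (X j (Q i f) * X i (Q j g) + X i (Q j f) * X j (Q i g)) +
      ∑ j, ∑ i, (Q j (Q i f) * X j (X i g) + X j (X i f) * Q j (Q i g)) +
      ∑ j, ∑ i, (if i = j then Q i f * X i (T g) + X i f * Q i (T g) +
        (Q i g * X i (T f) + X i g * Q i (T f)) + (X i (Q i f) * T g + T f * X i (Q i g))
        else 0) := by
    rw [← Finset.sum_add_distrib, ← Finset.sum_add_distrib, ← Finset.sum_add_distrib]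
    refine Finset.sum_congr rfl fun j _ => ?_
    rw [← Finset.sum_add_distrib, ← Finset.sum_add_distrib, ← Finset.sum_add_distrib]
    exact Finset.sum_congr rfl fun i _ => cross i j
  rw [genField_apply, genField_apply, s6, s4, s5, s8, s1, s2, s3, s7]
  linear_combination (∑ i, (Q i f * X i (T g) + X i f * Q i (T g) +
        (Q i g * X i (T f) + X i g * Q i (T f)) + (X i (Q i f) * T g + T f * X i (Q i g)))) * h2

end Contact

namespace DivPow

section Concrete

variable {K ι : Type*} [Field K] [Fintype ι]

theorem pd_eq_zero {N : ι → ℕ∞} {i : ι} (hi : N i = 0) {f : DivPow K ι} (hf : f ∈ trunc N) :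
    pd i f = 0 := by
  refine Submodule.span_induction (p := fun f _ => pd i f = 0) ?_ ?_ ?_ ?_ hf
  · rintro _ ⟨r, hr, rfl⟩
    have h := hr i 0 (by simpa using hi)
    exact lower_mon_zero (by omega)
  · simp
  · intro x y _ _ hx hy; rw [map_add, hx, hy, add_zero]
  · intro c x _ hx; rw [Derivation.map_smul, hx, smul_zero]

theorem pd_pd_eq_zero {N : ι → ℕ∞} {i : ι} (hi : N i = 1) {f : DivPow K ι} (hf : f ∈ trunc N) :
    pd i (pd i f) = 0 := by
  refine Submodule.span_induction (p := fun f _ => pd i (pd i f) = 0) ?_ ?_ ?_ ?_ hf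
  · rintro _ ⟨r, hr, rfl⟩
    have h := hr i 1 (by simpa using hi)
    rw [pd_apply, pd_apply]
    by_cases h0 : r i = 0
    · rw [lower_mon_zero h0, map_zero]
    · obtain ⟨r, rfl⟩ := exists_add h0
      rw [lower_mon_add]
      rw [Finsupp.add_apply, unitExp_same] at h
      exact lower_mon_zero (by omega)
  · simp
  · intro x y _ _ hx hy; rw [map_add, map_add, hx, hy, add_zero]
  · intro c x _ hx; rw [Derivation.map_smul, Derivation.map_smul, hx, smul_zero]

theorem var_mem_trunc' {N : ι → ℕ∞} {i : ι} (h : N i ≠ 0) : (var i : DivPow K ι) ∈ trunc N := by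
  refine mon_mem_trunc fun j k hk => ?_
  by_cases hj : j = i
  · have hk0 : k ≠ 0 := by
      rintro rfl
      exact h (by rw [← hj]; simpa using hk)
    rw [hj, unitExp_same]
    exact Nat.one_lt_two_pow hk0
  · rw [unitExp_ne hj]; positivity

end Concrete

end DivPow

section Algebras

open DivPow

/-! ### The algebras `po_{a,b}(2n; Ñ)` -/

/-- The indices of the indeterminates `q_1, …, q_n; ξ_1, …, ξ_n; τ`. -/
abbrev CVar (n : ℕ) := (Fin n ⊕ Fin n) ⊕ Unit

section Po

variable {K : Type*} [Field K] {n : ℕ}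

/-- The operator `∂_τ`. -/
def dTau : Derivation K (DivPow K (CVar n)) (DivPow K (CVar n)) := pd (Sum.inr ())

/-- The operators `∂_{q_i}`. -/
def dQ (i : Fin n) : Derivation K (DivPow K (CVar n)) (DivPow K (CVar n)) := pd (Sum.inl (Sum.inl i))

/-- The operators `∂_{ξ_i} + q_i ∂_τ`. -/
def dX (i : Fin n) : Derivation K (DivPow K (CVar n)) (DivPow K (CVar n)) :=
  pd (Sum.inl (Sum.inr i)) + (var (Sum.inl (Sum.inl i)) : DivPow K (CVar n)) • pd (Sum.inr ())

theorem dX_apply (i : Fin n) (f : DivPow K (CVar n)) :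
    dX i f = pd (Sum.inl (Sum.inr i)) f + var (Sum.inl (Sum.inl i)) * pd (Sum.inr ()) f := by
  simp [dX]

/-- The shearing vector `(N, 1, …, 1)` on the indeterminates `q, ξ`. -/
def shearLe (N : Fin n → ℕ∞) : Fin n ⊕ Fin n → ℕ∞ := Sum.elim N fun _ => 1

/-- The shearing vector `Ñ = (N, 1, …, 1, 1)` on the indeterminates `q, ξ, τ`. -/
def shearPo (N : Fin n → ℕ∞) : CVar n → ℕ∞ := Sum.elim (shearLe N) fun _ => 1

theorem isFrame_po [CharP K 2] :
    IsFrame (K := K) (A := DivPow K (CVar n)) dTau dQ dX where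
  two := two_eq_zero
  TQ i a := pd_comm _ _ _
  TX i a := by
    simp only [dX_apply, dTau, map_add, Derivation.leibniz, smul_eq_mul]
    rw [pd_var_ne (by simp), pd_comm (Sum.inr ()) (Sum.inl (Sum.inr i))]
    ring
  QQ i j a := pd_comm _ _ _
  XX i j a := by
    simp only [dX_apply, map_add, Derivation.leibniz, smul_eq_mul]
    rw [pd_var_ne (by simp), pd_var_ne (by simp), pd_var_ne (by simp), pd_var_ne (by simp),
      pd_comm (Sum.inl (Sum.inr i)) (Sum.inl (Sum.inr j)),
      pd_comm (Sum.inr ()) (Sum.inl (Sum.inr j)), pd_comm (Sum.inr ()) (Sum.inl (Sum.inr i))]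
    ring
  QX i j a := by
    simp only [dX_apply, dQ, dTau, map_add, Derivation.leibniz, smul_eq_mul]
    rw [pd_comm (Sum.inl (Sum.inl i)) (Sum.inl (Sum.inr j)),
      pd_comm (Sum.inl (Sum.inl i)) (Sum.inr ())]
    by_cases h : i = j
    · subst h
      rw [pd_var_same, if_pos rfl]; ring
    · rw [pd_var_ne (by simpa using h), if_neg h]; ring

theorem dX_dX [CharP K 2] {N : Fin n → ℕ∞} {f : DivPow K (CVar n)} (hf : f ∈ trunc (shearPo N))
    (i : Fin n) : dX i (dX i f) = 0 := by
  simp only [dX_apply, map_add, Derivation.leibniz, smul_eq_mul]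
  rw [pd_var_ne (by simp), pd_var_ne (by simp), pd_pd_eq_zero (N := shearPo N) (by rfl) hf,
    pd_comm (Sum.inr ()) (Sum.inl (Sum.inr i))]
  have h := two_eq_zero (var (Sum.inl (Sum.inl i)) *
    (pd (Sum.inl (Sum.inr i)) (pd (Sum.inr ()) f)) : DivPow K (CVar n))
  have h' := var_mul_var (K := K) (Sum.inl (Sum.inl i) : CVar n)
  linear_combination h + pd (Sum.inr ()) (pd (Sum.inr ()) f) * h'

theorem dQ_mul_dX_mem [CharP K 2] {N : Fin n → ℕ∞} {f g : DivPow K (CVar n)}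
    (hf : f ∈ trunc (shearPo N)) (hg : g ∈ trunc (shearPo N)) (i : Fin n) :
    dQ i f * dX i g ∈ trunc (shearPo N) := by
  by_cases hi : shearPo N (Sum.inl (Sum.inl i)) = 0
  · rw [dQ, pd_eq_zero hi hf, zero_mul]; exact Submodule.zero_mem _
  · refine mul_mem_trunc (pd_mem_trunc _ hf) ?_
    rw [dX_apply]
    exact Submodule.add_mem _ (pd_mem_trunc _ hg)
      (mul_mem_trunc (var_mem_trunc' hi) (pd_mem_trunc _ hg))

/-- The contact vector field `M_f` with generating function `f`. -/
def contactField (f : DivPow K (CVar n)) : Derivation K (DivPow K (CVar n)) (DivPow K (CVar n)) :=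
  genField dTau dQ dX f

/-- The operator `Δ^𝔪 = ∑ (∂_{ξ_i} + q_i ∂_τ) ∂_{q_i}`. -/
def deltaM (f : DivPow K (CVar n)) : DivPow K (CVar n) := ∑ i, dX i (dQ i f)

/-- The Lie algebra `po_{a,b}(2n; Ñ)` of the contact vector fields `M_f` with
`f ∈ 𝒪(q, ξ, τ; Ñ)` and `b ∂_τ(f) + a Δ^𝔪(f) = 0`. -/
def poAlg [CharP K 2] (a b : K) (N : Fin n → ℕ∞) :
    LieSubalgebra K (Derivation K (DivPow K (CVar n)) (DivPow K (CVar n))) where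
  carrier := {D | ∃ f ∈ trunc (shearPo N), b • dTau f + a • deltaM f = 0 ∧ D = contactField f}
  add_mem' := by
    rintro _ _ ⟨f, hf, hf', rfl⟩ ⟨g, hg, hg', rfl⟩
    refine ⟨f + g, Submodule.add_mem _ hf hg, ?_, (genField_add f g).symm⟩
    have h : deltaM (f + g) = deltaM f + deltaM g := by
      simp only [deltaM, map_add, Finset.sum_add_distrib]
    rw [h, map_add, smul_add, smul_add, add_add_add_comm, hf', hg', add_zero]
  zero_mem' := by
    refine ⟨0, Submodule.zero_mem _, ?_, ?_⟩
    · simp [deltaM]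
    · have h := genField_smul (T := dTau) (Q := dQ) (X := dX) (0 : K) (0 : DivPow K (CVar n))
      rw [zero_smul, zero_smul] at h
      exact h.symm
  smul_mem' := by
    rintro c _ ⟨f, hf, hf', rfl⟩
    refine ⟨c • f, Submodule.smul_mem _ _ hf, ?_, (genField_smul c f).symm⟩
    have h : deltaM (c • f) = c • deltaM f := by
      simp only [deltaM, Derivation.map_smul, Finset.smul_sum]
    rw [h, Derivation.map_smul, smul_comm b, smul_comm a, ← smul_add, hf', smul_zero]
  lie_mem' := by
    rintro _ _ ⟨f, hf, hf', rfl⟩ ⟨g, hg, hg', rfl⟩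
    refine ⟨genBracket dTau dQ dX f g, ?_, ?_, lie_genField isFrame_po f g⟩
    · refine Submodule.add_mem _ (Submodule.add_mem _ (mul_mem_trunc hf (pd_mem_trunc _ hg))
        (mul_mem_trunc hg (pd_mem_trunc _ hf))) (Submodule.sum_mem _ fun i _ => ?_)
      refine Submodule.add_mem _ (dQ_mul_dX_mem hf hg i) ?_
      rw [mul_comm]; exact dQ_mul_dX_mem hg hf i
    · rw [T_genBracket isFrame_po, deltaM,
        div_genBracket isFrame_po (fun i => dX_dX hf i) (fun i => dX_dX hg i)]
      have e : ∀ f g : DivPow K (CVar n), b • dTau g + a • deltaM g = 0 →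
          b • genField dTau dQ dX f (dTau g) + a • genField dTau dQ dX f (∑ j, dX j (dQ j g)) = 0 := by
        intro f g h
        have h' := congrArg (genField dTau dQ dX f) h
        rw [map_add, Derivation.map_smul, Derivation.map_smul, map_zero] at h'
        exact h'
      rw [smul_add, smul_add, add_add_add_comm, e f g hg', e g f hf', add_zero]

end Po

section Le

variable {K : Type*} [Field K] {n : ℕ}

/-- The Hamiltonian vector field `Le_f = ∑ (∂_{q_i}(f) ∂_{ξ_i} + ∂_{ξ_i}(f) ∂_{q_i})`. -/
def hamField (f : DivPow K (Fin n ⊕ Fin n)) :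
    Derivation K (DivPow K (Fin n ⊕ Fin n)) (DivPow K (Fin n ⊕ Fin n)) :=
  genField 0 (fun i => pd (Sum.inl i)) (fun i => pd (Sum.inr i)) f

theorem isFrame_le [CharP K 2] :
    IsFrame (K := K) (A := DivPow K (Fin n ⊕ Fin n)) 0 (fun i => pd (Sum.inl i))
      (fun i => pd (Sum.inr i)) where
  two := two_eq_zero
  TQ i a := by simp
  TX i a := by simp
  QQ i j a := pd_comm _ _ _
  XX i j a := pd_comm _ _ _
  QX i j a := by simp [pd_comm]

/-- The desuperization of `le(n; N)`: the Lie algebra of the vector fields `Le_f` with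
`f ∈ 𝒪(q, ξ; (N, 1, …, 1))`. -/
def leAlg [CharP K 2] (N : Fin n → ℕ∞) :
    LieSubalgebra K (Derivation K (DivPow K (Fin n ⊕ Fin n)) (DivPow K (Fin n ⊕ Fin n))) where
  carrier := {D | ∃ f ∈ trunc (shearLe N), D = hamField f}
  add_mem' := by
    rintro _ _ ⟨f, hf, rfl⟩ ⟨g, hg, rfl⟩
    exact ⟨f + g, Submodule.add_mem _ hf hg, (genField_add f g).symm⟩
  zero_mem' := by
    refine ⟨0, Submodule.zero_mem _, ?_⟩
    have h := genField_smul (T := 0) (Q := fun i => pd (Sum.inl i)) (X := fun i => pd (Sum.inr i))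
      (0 : K) (0 : DivPow K (Fin n ⊕ Fin n))
    rw [zero_smul, zero_smul] at h
    exact h.symm
  smul_mem' := by
    rintro c _ ⟨f, hf, rfl⟩
    exact ⟨c • f, Submodule.smul_mem _ _ hf, (genField_smul c f).symm⟩
  lie_mem' := by
    rintro _ _ ⟨f, hf, rfl⟩ ⟨g, hg, rfl⟩
    refine ⟨_, ?_, lie_genField isFrame_le f g⟩
    refine Submodule.add_mem _ ?_ (Submodule.sum_mem _ fun i _ => ?_)
    · simp
    · exact Submodule.add_mem _ (mul_mem_trunc (pd_mem_trunc _ hf) (pd_mem_trunc _ hg))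
        (mul_mem_trunc (pd_mem_trunc _ hf) (pd_mem_trunc _ hg))

/-- The inclusion of the functions in `q, ξ` into the functions in `q, ξ, τ`. -/
def inclTau : DivPow K (Fin n ⊕ Fin n) →ₗ[K] DivPow K (CVar n) :=
  lift fun r => mon (r.mapDomain Sum.inl)

end Le

/-! ### The algebras `s̃b_μ(2 ^ n - 1; N)` -/

section SvectTilde

variable {K : Type*} [Field K] {n : ℕ}

/-- The divergence of `∑ f_i ∂_i`. -/
def divergence (f : Fin n → DivPow K (Fin n)) : DivPow K (Fin n) := ∑ i, pd i (f i)

/-- The Lie derivative along `∑ f_i ∂_i` on volume forms: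
`h vol ↦ (∑ f_i ∂_i(h) + h div) vol`. -/
def densityAct (f : Fin n → DivPow K (Fin n)) : DivPow K (Fin n) →ₗ[K] DivPow K (Fin n) :=
  (field f : DivPow K (Fin n) →ₗ[K] DivPow K (Fin n)) + LinearMap.mulRight K (divergence f)

theorem densityAct_apply (f : Fin n → DivPow K (Fin n)) (h : DivPow K (Fin n)) :
    densityAct f h = field f h + h * divergence f := rfl

theorem divergence_lie (f g : Fin n → DivPow K (Fin n)) :
    divergence (fun i => field f (g i) - field g (f i)) =
      field f (divergence g) - field g (divergence f) := by
  have e : ∀ f g : Fin n → DivPow K (Fin n), ∑ i, pd i (field f (g i)) =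
      field f (divergence g) + ∑ i, ∑ j, pd j (g i) * pd i (f j) := by
    intro f g
    rw [divergence, map_sum, ← Finset.sum_add_distrib]
    refine Finset.sum_congr rfl fun i _ => ?_
    rw [field_apply, field_apply, map_sum, ← Finset.sum_add_distrib]
    refine Finset.sum_congr rfl fun j _ => ?_
    rw [Derivation.leibniz, smul_eq_mul, smul_eq_mul, pd_comm i j]
  have e' : ∑ i, ∑ j, pd j (g i) * pd i (f j) = ∑ i, ∑ j, pd j (f i) * pd i (g j) := by
    rw [Finset.sum_comm]
    exact Finset.sum_congr rfl fun i _ => Finset.sum_congr rfl fun j _ => mul_comm _ _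
  rw [divergence]
  simp only [map_sub, Finset.sum_sub_distrib]
  rw [e f g, e g f, e']
  ring

theorem densityAct_lie (f g : Fin n → DivPow K (Fin n)) (h : DivPow K (Fin n)) :
    densityAct (fun i => field f (g i) - field g (f i)) h =
      densityAct f (densityAct g h) - densityAct g (densityAct f h) := by
  simp only [densityAct_apply, divergence_lie, ← lie_field, Derivation.commutator_apply, map_add,
    Derivation.leibniz, smul_eq_mul]
  ring

/-- The monomial `ξ_S = ∏_{i ∈ S} ξ_i`. -/
def xiMon (S : Finset (Fin n)) : DivPow K (Fin n) := ∏ i ∈ S, var i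

/-- The coefficient `1 + μ ξ_1 ⋯ ξ_n` of the deformed volume form. -/
def volTilde (n : ℕ) (μ : K) : DivPow K (Fin n) := 1 + μ • xiMon Finset.univ

/-- The indices of the basis `ξ_S vol`, `S ≠ ∅`, of the quotient of the space of volume forms by
`K (1 + μ ξ_1 ⋯ ξ_n) vol`; they number the `2 ^ n - 1` indeterminates of `s̃b_μ`. -/
abbrev NonemptySubset (n : ℕ) := {S : Finset (Fin n) // S.Nonempty}

/-- The matrix `A` describes the action of `∑ f_i ∂_i` on the volume forms modulo
`K (1 + μ ξ_1 ⋯ ξ_n) vol`: `ξ_S vol ↦ ∑_T A_{ST} ξ_T vol`. -/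
def Represents (μ : K) (f : Fin n → DivPow K (Fin n))
    (A : Matrix (NonemptySubset n) (NonemptySubset n) K) : Prop :=
  ∀ S, densityAct f (xiMon S.1) - ∑ T, A S T • xiMon T.1 ∈ Submodule.span K {volTilde n μ}

/-- The vector fields from `svect(n; (1, …, 1))~_μ`: those with coefficients in
`𝒪(n; (1, …, 1))` which preserve the volume form `(1 + μ ξ_1 ⋯ ξ_n) vol`. -/
def PreservesVolTilde (μ : K) (f : Fin n → DivPow K (Fin n)) : Prop :=
  (∀ i, f i ∈ trunc fun _ => 1) ∧ densityAct f (volTilde n μ) = 0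

theorem densityAct_add (f g : Fin n → DivPow K (Fin n)) (h : DivPow K (Fin n)) :
    densityAct (f + g) h = densityAct f h + densityAct g h := by
  simp only [densityAct_apply, field_add, Derivation.add_apply, divergence, Pi.add_apply, map_add,
    Finset.sum_add_distrib]
  ring

theorem densityAct_smul (c : K) (f : Fin n → DivPow K (Fin n)) (h : DivPow K (Fin n)) :
    densityAct (c • f) h = c • densityAct f h := by
  simp only [densityAct_apply, field_smul, Derivation.smul_apply, divergence, Pi.smul_apply,
    Derivation.map_smul, ← Finset.smul_sum, mul_smul_comm, smul_add]

theorem densityAct_span {μ : K} {f : Fin n → DivPow K (Fin n)} (hf : PreservesVolTilde μ f)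
    {h : DivPow K (Fin n)} (hh : h ∈ Submodule.span K {volTilde n μ}) : densityAct f h = 0 := by
  obtain ⟨c, rfl⟩ := Submodule.mem_span_singleton.1 hh
  rw [map_smul, hf.2, smul_zero]

theorem represents_comp {μ : K} {f g : Fin n → DivPow K (Fin n)}
    {A B : Matrix (NonemptySubset n) (NonemptySubset n) K} (hf : PreservesVolTilde μ f)
    (hA : Represents μ f A) (hB : Represents μ g B) (S : NonemptySubset n) :
    densityAct f (densityAct g (xiMon S.1)) - ∑ T, (B * A) S T • xiMon T.1 ∈
      Submodule.span K {volTilde n μ} := by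
  have h1 := densityAct_span hf (hB S)
  rw [map_sub, sub_eq_zero, map_sum] at h1
  rw [h1]
  have h2 : ∑ T, (B * A) S T • (xiMon T.1 : DivPow K (Fin n)) =
      ∑ T, B S T • ∑ U, A T U • xiMon U.1 := by
    simp only [Matrix.mul_apply, Finset.sum_smul, Finset.smul_sum, smul_smul]
    exact Finset.sum_comm
  rw [h2, ← Finset.sum_sub_distrib]
  refine Submodule.sum_mem _ fun T _ => ?_
  rw [map_smul, ← smul_sub]
  exact Submodule.smul_mem _ _ (hA T)

/-- The Lie algebra `svect(n; (1, …, 1))~_μ` represented in the quotient of the space of volume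
forms by `K (1 + μ ξ_1 ⋯ ξ_n) vol`, as matrices in the basis `ξ_S vol`, `S ≠ ∅`. -/
def svectTilde [CharP K 2] (n : ℕ) (μ : K) :
    LieSubalgebra K (Matrix (NonemptySubset n) (NonemptySubset n) K) where
  carrier := {A | ∃ f, PreservesVolTilde μ f ∧ Represents μ f A}
  add_mem' := by
    rintro A B ⟨f, hf, hA⟩ ⟨g, hg, hB⟩
    refine ⟨f + g, ⟨fun i => Submodule.add_mem _ (hf.1 i) (hg.1 i), ?_⟩, fun S => ?_⟩
    · rw [densityAct_add, hf.2, hg.2, add_zero]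
    · simp only [densityAct_add, Matrix.add_apply, add_smul, Finset.sum_add_distrib]
      rw [add_sub_add_comm]
      exact Submodule.add_mem _ (hA S) (hB S)
  zero_mem' := by
    have h : ∀ h : DivPow K (Fin n), densityAct 0 h = 0 := fun h => by
      rw [densityAct_apply, field_zero]; simp [divergence]
    refine ⟨0, ⟨fun i => Submodule.zero_mem _, h _⟩, fun S => ?_⟩
    rw [h]; simp
  smul_mem' := by
    rintro c A ⟨f, hf, hA⟩
    refine ⟨c • f, ⟨fun i => Submodule.smul_mem _ _ (hf.1 i), ?_⟩, fun S => ?_⟩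
    · rw [densityAct_smul, hf.2, smul_zero]
    · simp only [densityAct_smul, Matrix.smul_apply, smul_assoc, ← Finset.smul_sum]
      rw [← smul_sub]
      exact Submodule.smul_mem _ _ (hA S)
  lie_mem' := by
    rintro A B ⟨f, hf, hA⟩ ⟨g, hg, hB⟩
    refine ⟨fun i => field g (f i) - field f (g i),
      ⟨fun i => Submodule.sub_mem _ (field_mem_trunc hg.1 (hf.1 i))
        (field_mem_trunc hf.1 (hg.1 i)), ?_⟩, fun S => ?_⟩
    · rw [densityAct_lie, hf.2, hg.2, map_zero, map_zero, sub_zero]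
    · have h := Submodule.sub_mem _ (represents_comp hg hB hA S) (represents_comp hf hA hB S)
      rw [densityAct_lie, Ring.lie_def]
      simp only [Matrix.sub_apply, sub_smul, Finset.sum_sub_distrib]
      rw [sub_sub_sub_comm]
      exact h

/-- The Lie algebra `s̃b_μ(2 ^ n - 1; N)`: the complete Cartan prolong of `svect~_μ` acting on the
quotient of the space of volume forms by `K (1 + μ ξ_1 ⋯ ξ_n) vol`. -/
def sbTilde [CharP K 2] (n : ℕ) (μ : K) (N : NonemptySubset n → ℕ∞) :
    LieSubalgebra K (Derivation K (DivPow K (NonemptySubset n)) (DivPow K (NonemptySubset n))) :=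
  prolong (svectTilde n μ) N

end SvectTilde

end Algebras

end

/-! Every algebra is replaced by a space of generating functions on which the Lie bracket is an
explicit bilinear operation (`IsModel`). Simplicity of a derived algebra becomes a statement on
subspaces I stable under that operation (`IsSimpleModel`). Such a W is automatically perfect, so it
lies in every term of the derived series (`IsSimpleModel.le_derivedSeries`); only the inclusion from
above is computed (`IsModel.derived_succ`).

The calculus is that of Δ = ∑ ∂_{ξ_i}∂_{q_i}. It satisfies Δ² = 0, its failure to be a derivation is
the Buttin bracket { , }, and it is a derivation of that bracket. The operator E = ∑ q_i∂_{q_i} is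
the q-degree modulo 2, hence a projector, and Δ exchanges its eigenspaces. The coefficient of the
highest monomial is an integral: it kills derivatives, brackets and the image of Δ, which gives the
codimension one statements.

All ideal arguments follow one pattern. A nonzero element of I is differentiated down to a constant
(for `le`, to an affine function). From it the indeterminates are recovered, so derivatives of all
available functions lie in I. This reaches every monomial that can be raised; the few monomials next
to the highest one are eigenvectors of weight elements such as q_iξ_i or q_iξ_i + q_jξ_j, with
nonzero eigenvalue.

For `poAlg` write f = f_0 + τf_1. If a ≠ 0, then with c = b/a the defining equation reads Δf_0 = (c
+ E)f_1, Δf_1 = 0. If a = 0, then f_1 = 0 and only the Buttin bracket remains, whence the sequence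
ending in `leAlg`. If c ≠ 0, 1, then c + E is invertible because E² = E, so f_0 is a free parameter
(`mem_poV_generic`, `generic_ideal`). If c = 0 or 1, then c + E is a projector and the solutions are
(f + z, Δf + w) with f, z, w of prescribed parity and z, w closed (`mem_poV_special`). One bracket
makes z and w exact, a second one kills a highest coefficient, and the result is simple
(`spW_zero_le`, `spW_one_le`). For infinite shearing the Poincaré lemma `exists_lap_add` shows that
closed means exact up to multiples of ξ_1⋯ξ_n, which is the complement of codimension one.

For `sbTilde` a field ∑ F_S ∂_S is encoded as P = ∑ F_S(x) e_S(ξ), with e_S representatives of the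
basis of volume forms. The prolong condition becomes ∂P/∂x_T = {ξ_T, P} for all T, together with ΔP
= 0, where q_i = x_{i} (`jacobian_mem_iff`). This is an evolution in the x_T with |T| ≥ 2: P is
determined by its restriction H to x_T = 0 (`eq_zero_of_rho_eq_zero`) and every closed H without
terms divisible by ξ_1⋯ξ_n extends (`exists_extension`). Since {ξ_T, {ξ_T, P}} = 0 for |T| ≥ 2
(`pbX_pbX`), the first power of x_T suffices, which settles the critical coordinates. On the
functions H the bracket is Δ(fg(1 + μξ_1⋯ξ_n)) and the derived algebra is the image of Δ. Because μ
≠ 0, the constant 1 generates the ξ_i and from them the rest; only for n = 2 and N_{1} = N_{2} = 1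
is there no room to obtain the weight element. -/

noncomputable section

attribute [local instance 100] LieRing.ofAssociativeRing

set_option linter.unusedSectionVars false

section

namespace DivPow

/-! ### Coefficients and degrees of divided powers -/

section Coeff

variable {K ι : Type*} [Field K]

/-- The coefficient of the divided monomial `u^(r)`. -/
def coeff (r : ι →₀ ℕ) : DivPow K ι →ₗ[K] K := Finsupp.lapply r

theorem coeff_mon_self (r : ι →₀ ℕ) : coeff r (mon r : DivPow K ι) = 1 :=
  Finsupp.single_eq_same

theorem coeff_mon_ne {r s : ι →₀ ℕ} (h : s ≠ r) : coeff r (mon s : DivPow K ι) = 0 :=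
  Finsupp.single_eq_of_ne h.symm

theorem ext_coeff {f g : DivPow K ι} (h : ∀ r, coeff r f = coeff r g) : f = g :=
  Finsupp.ext h

theorem linearMap_ext {M : Type*} [AddCommGroup M] [Module K M] {φ ψ : DivPow K ι →ₗ[K] M}
    (h : ∀ r, φ (mon r) = ψ (mon r)) : φ = ψ := by
  refine LinearMap.ext fun f => ?_
  refine induct (p := fun f => φ f = ψ f) f (by simp) ?_ ?_ h
  · intro a b ha hb; rw [map_add, map_add, ha, hb]
  · intro c a ha; rw [map_smul, map_smul, ha]

/-- Since an element is the finite sum of its terms, this reduces membership questions below to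
monomials. -/
theorem mem_of_mon_mem (P : Submodule K (DivPow K ι)) {f : DivPow K ι}
    (h : ∀ r, coeff r f ≠ 0 → mon r ∈ P) : f ∈ P := by
  have e : Finsupp.sum (f : (ι →₀ ℕ) →₀ K) (fun r c => (Finsupp.single r c : (ι →₀ ℕ) →₀ K)) = f :=
    Finsupp.sum_single (f : (ι →₀ ℕ) →₀ K)
  refine e ▸ Submodule.sum_mem P fun r hr => ?_
  have : (Finsupp.single r (coeff r f) : (ι →₀ ℕ) →₀ K) =
      coeff r f • (mon r : DivPow K ι) := by
    change _ = coeff r f • (Finsupp.single r (1 : K) : (ι →₀ ℕ) →₀ K)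
    rw [Finsupp.smul_single, smul_eq_mul, mul_one]
  refine (congrArg (· ∈ P) this).mpr ?_
  exact P.smul_mem _ (h r (Finsupp.mem_support_iff.1 hr))

theorem mon_ne_zero (r : ι →₀ ℕ) : (mon r : DivPow K ι) ≠ 0 := fun h => by
  have := coeff_mon_self (K := K) r
  rw [h, map_zero] at this
  exact zero_ne_one this

theorem mem_trunc_iff [Fintype ι] {N : ι → ℕ∞} {f : DivPow K ι} :
    f ∈ trunc N ↔ ∀ r, coeff r f ≠ 0 → Admissible N r := by
  constructor
  · intro h
    refine Submodule.span_induction (p := fun f _ => ∀ r, coeff r f ≠ 0 → Admissible N r)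
      ?_ ?_ ?_ ?_ h
    · rintro _ ⟨s, hs, rfl⟩ r hr
      by_cases e : s = r
      · exact e ▸ hs
      · exact absurd (coeff_mon_ne e) hr
    · intro r hr; simp at hr
    · intro a b _ _ ha hb r hr
      rw [map_add] at hr
      by_cases h0 : coeff r a = 0
      · exact hb r (by rw [h0, zero_add] at hr; exact hr)
      · exact ha r h0
    · intro c a _ ha r hr
      rw [map_smul] at hr
      exact ha r (right_ne_zero_of_mul hr)
  · intro h
    exact mem_of_mon_mem _ fun r hr => mon_mem_trunc (h r hr)

variable [Fintype ι]

theorem one_def : (1 : DivPow K ι) = mon 0 := rfl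

theorem coeff_mon_self' {r s : ι →₀ ℕ} (h : s = r) : coeff r (mon s : DivPow K ι) = 1 := by
  rw [h, coeff_mon_self]

/-- Divided powers differentiate without numerical factors, so ∂_i is a mere shift of coefficients.
This is why any monomial is the derivative of the next higher one, even in characteristic 2. -/
theorem coeff_pd (r : ι →₀ ℕ) (i : ι) (f : DivPow K ι) :
    coeff r (pd i f) = coeff (r + unitExp i) f := by
  have : (coeff r).comp (lower (K := K) i) = coeff (r + unitExp i) := by
    refine linearMap_ext fun s => ?_
    rw [LinearMap.comp_apply]
    by_cases h : s i = 0
    · rw [lower_mon_zero h, map_zero, coeff_mon_ne]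
      rintro rfl
      simp [unitExp_same] at h
    · obtain ⟨s, rfl⟩ := exists_add h
      rw [lower_mon_add]
      by_cases e : s = r
      · subst e; rw [coeff_mon_self, coeff_mon_self]
      · rw [coeff_mon_ne e, coeff_mon_ne]
        exact fun h => e (add_right_cancel h)
  exact LinearMap.congr_fun this f

theorem pd_mon_add (i : ι) (r : ι →₀ ℕ) : pd i (mon (r + unitExp i) : DivPow K ι) = mon r :=
  lower_mon_add i r

theorem pd_mon_zero {i : ι} {r : ι →₀ ℕ} (h : r i = 0) : pd i (mon r : DivPow K ι) = 0 :=
  lower_mon_zero h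

theorem var_mul_mon (i : ι) (r : ι →₀ ℕ) :
    (var i * mon r : DivPow K ι) = ((r i + 1 : ℕ) : K) • mon (r + unitExp i) := by
  rw [var, mon_mul_mon, add_comm]
  congr 2
  unfold binom
  rw [Finset.prod_eq_single i]
  · rw [unitExp_same, add_comm, Nat.choose_one_right]
  · intro j _ hj; rw [unitExp_ne hj]; simp
  · simp

theorem var_mul_pd_mon (i : ι) (r : ι →₀ ℕ) :
    (var i * pd i (mon r) : DivPow K ι) = (r i : K) • mon r := by
  by_cases h : r i = 0
  · rw [pd_mon_zero h, h, mul_zero, Nat.cast_zero, zero_smul]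
  · obtain ⟨s, rfl⟩ := exists_add h
    rw [pd_mon_add, var_mul_mon]
    simp [unitExp_same]

theorem coeff_zero_one : coeff 0 (1 : DivPow K ι) = 1 := coeff_mon_self 0

/-- Elements annihilated by all derivatives are constants. -/
theorem eq_smul_one_of_pd_eq_zero {f : DivPow K ι} (h : ∀ i, pd i f = 0) :
    f = coeff 0 f • (1 : DivPow K ι) := by
  refine ext_coeff fun r => ?_
  rw [map_smul, smul_eq_mul]
  by_cases hr : r = 0
  · rw [hr, coeff_zero_one, mul_one]
  · rw [one_def, coeff_mon_ne (Ne.symm hr), mul_zero]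
    obtain ⟨i, hi⟩ := Finsupp.ne_iff.1 hr
    obtain ⟨s, rfl⟩ := exists_add hi
    rw [← coeff_pd, h, map_zero]

/-- A bound for the total degree. -/
def DegLT (f : DivPow K ι) (d : ℕ) : Prop := ∀ r, coeff r f ≠ 0 → ∑ i, r i < d

theorem exists_degLT (f : DivPow K ι) : ∃ d, DegLT f d := by
  refine induct (p := fun f => ∃ d, DegLT f d) f ⟨0, fun r hr => by simp at hr⟩ ?_ ?_ ?_
  · rintro a b ⟨d, hd⟩ ⟨e, he⟩
    refine ⟨max d e, fun r hr => ?_⟩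
    by_cases h0 : coeff r a = 0
    · exact lt_max_of_lt_right (he r (by rwa [map_add, h0, zero_add] at hr))
    · exact lt_max_of_lt_left (hd r h0)
  · rintro c a ⟨d, hd⟩
    exact ⟨d, fun r hr => hd r (right_ne_zero_of_mul (by rwa [map_smul] at hr))⟩
  · intro s
    refine ⟨∑ i, s i + 1, fun r hr => ?_⟩
    by_cases e : s = r
    · rw [e]; omega
    · exact absurd (coeff_mon_ne e) hr

theorem DegLT.pd {f : DivPow K ι} {d : ℕ} (h : DegLT f (d + 1)) (i : ι) : DegLT (pd i f) d := by
  intro r hr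
  rw [coeff_pd] at hr
  have := h _ hr
  simp only [Finsupp.add_apply, Finset.sum_add_distrib] at this
  have h1 : ∑ j, (unitExp i : ι →₀ ℕ) j = 1 := by
    classical
    rw [Finset.sum_eq_single i (fun j _ hj => unitExp_ne hj) (by simp), unitExp_same]
  omega

/-- A set of elements with property `p` that is stable under some of the derivatives as long as
these have the property `q` contains an element whose derivatives do not have this property. -/
theorem exists_last {J : Set ι} {p q : DivPow K ι → Prop} (hq : ¬ q 0)
    (hp : ∀ f, p f → ∀ i ∈ J, p (pd i f)) (h : ∃ f, p f ∧ q f) :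
    ∃ f, p f ∧ q f ∧ ∀ i ∈ J, ¬ q (pd i f) := by
  obtain ⟨f, hf, hqf⟩ := h
  obtain ⟨d, hd⟩ := exists_degLT f
  -- Each derivative lowers the degree bound, so the descent through elements with property `q` must
  -- stop; the bound 0 would force f = 0, which `hq` excludes.
  induction d generalizing f with
  | zero =>
    have : f = 0 := ext_coeff fun r => by
      by_contra h
      exact absurd (hd r (by simpa using h)) (by omega)
    exact absurd hqf (this ▸ hq)
  | succ d ih =>
    by_cases h : ∀ i ∈ J, ¬ q (pd i f)
    · exact ⟨f, hf, hqf, h⟩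
    · push Not at h
      obtain ⟨i, hi, hqi⟩ := h
      exact ih _ (hp f hf i hi) hqi (hd.pd i)

theorem one_mem_trunc {N : ι → ℕ∞} : (1 : DivPow K ι) ∈ trunc N :=
  mon_mem_trunc fun i k _ => by simp

theorem admissible_of_add {N : ι → ℕ∞} {r s : ι →₀ ℕ} (h : Admissible N (r + s)) :
    Admissible N r := fun i k hk => lt_of_le_of_lt (by simp) (h i k hk)

theorem prod_var_mem_trunc [CharP K 2] {N : ι → ℕ∞} {κ : Type*} (s : Finset κ) {φ : κ → ι}
    (h : ∀ j ∈ s, N (φ j) ≠ 0) : (∏ j ∈ s, var (φ j) : DivPow K ι) ∈ trunc N := by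
  classical
  induction s using Finset.induction_on with
  | empty => rw [Finset.prod_empty]; exact one_mem_trunc
  | insert j s hj ih =>
    rw [Finset.prod_insert hj]
    exact mul_mem_trunc (var_mem_trunc' (h j (by simp))) (ih fun k hk => h k (by simp [hk]))

end Coeff

/-! ### Renaming indeterminates and setting indeterminates to zero -/

section Maps

variable {K ι κ : Type*} [Field K] [Fintype ι] [Fintype κ]

/-- The homomorphism `u^(r) ↦ u^(r)` that renames the indeterminates. -/
def incl (φ : ι ↪ κ) : DivPow K ι →ₐ[K] DivPow K κ :=
  AlgHom.ofLinearMap (lift fun r => mon (r.mapDomain φ))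
    (by rw [one_def, lift_mon, Finsupp.mapDomain_zero]; rfl) (by
    -- Indeterminates outside the image have exponent 0 in both monomials and contribute a factor 1
    -- to the binomial coefficient.
    have hb : ∀ r s : ι →₀ ℕ, binom (r.mapDomain φ) (s.mapDomain φ) = binom r s := by
      intro r s
      classical
      unfold binom
      rw [← Finset.prod_subset (Finset.subset_univ (Finset.univ.map φ)), Finset.prod_map]
      · simp only [Finsupp.mapDomain_apply φ.injective]
      · intro x _ hx
        rw [Finsupp.mapDomain_of_notMem_range, Finsupp.mapDomain_of_notMem_range]
        · simp
        all_goals simpa using hx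
    intro f g
    refine induct (p := fun f => lift _ (f * g) = lift _ f * lift _ g) f ?_ ?_ ?_ fun r => ?_
    · simp
    · intro a b ha hb; rw [add_mul, map_add, ha, hb, map_add, add_mul]
    · intro c a ha; rw [smul_mul', map_smul, ha, map_smul, smul_mul']
    refine induct (p := fun g => lift _ (mon r * g) = lift _ (mon r) * lift _ g) g ?_ ?_ ?_
      fun s => ?_
    · simp
    · intro a b ha hb; rw [mul_add, map_add, ha, hb, map_add, mul_add]
    · intro c a ha; rw [mul_smul', map_smul, ha, map_smul, mul_smul']
    rw [mon_mul_mon, map_smul, lift_mon, lift_mon, lift_mon, mon_mul_mon, hb,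
      Finsupp.mapDomain_add])

theorem incl_mon (φ : ι ↪ κ) (r : ι →₀ ℕ) :
    incl φ (mon r : DivPow K ι) = mon (r.mapDomain φ) := lift_mon _ _

theorem mapDomain_unitExp (φ : ι ↪ κ) (i : ι) :
    (unitExp i : ι →₀ ℕ).mapDomain φ = unitExp (φ i) := Finsupp.mapDomain_single

theorem incl_var (φ : ι ↪ κ) (i : ι) : incl φ (var i : DivPow K ι) = var (φ i) := by
  rw [var, incl_mon, mapDomain_unitExp]; rfl

theorem pd_incl (φ : ι ↪ κ) (i : ι) (f : DivPow K ι) :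
    pd (φ i) (incl φ f) = incl φ (pd i f) := by
  have : (lower (φ i) : DivPow K κ →ₗ[K] DivPow K κ).comp (incl φ).toLinearMap =
      (incl φ).toLinearMap.comp (lower i : DivPow K ι →ₗ[K] DivPow K ι) := by
    refine linearMap_ext fun r => ?_
    change pd (φ i) (incl φ (mon r)) = incl φ (pd i (mon r))
    by_cases h : r i = 0
    · rw [pd_mon_zero h, map_zero, incl_mon, pd_mon_zero]
      rw [Finsupp.mapDomain_apply φ.injective, h]
    · obtain ⟨s, rfl⟩ := exists_add h
      rw [pd_mon_add, incl_mon, incl_mon, Finsupp.mapDomain_add, mapDomain_unitExp, pd_mon_add]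
  exact LinearMap.congr_fun this f

theorem pd_incl_of_notMem (φ : ι ↪ κ) {k : κ} (hk : k ∉ Set.range φ) (f : DivPow K ι) :
    pd k (incl φ f) = 0 := by
  have : (lower k : DivPow K κ →ₗ[K] DivPow K κ).comp (incl φ).toLinearMap = 0 := by
    refine linearMap_ext fun r => ?_
    change pd k (incl φ (mon r)) = 0
    rw [incl_mon, pd_mon_zero]
    exact Finsupp.mapDomain_of_notMem_range _ _ hk
  exact LinearMap.congr_fun this f

theorem incl_mem_trunc (φ : ι ↪ κ) {N : κ → ℕ∞} {f : DivPow K ι} (hf : f ∈ trunc (N ∘ φ)) :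
    incl φ f ∈ trunc N := by
  refine Submodule.span_induction (p := fun f _ => incl φ f ∈ trunc N) ?_ ?_ ?_ ?_ hf
  · rintro _ ⟨r, hr, rfl⟩
    rw [incl_mon]
    refine mon_mem_trunc fun j k hk => ?_
    by_cases hj : j ∈ Set.range φ
    · obtain ⟨i, rfl⟩ := hj
      rw [Finsupp.mapDomain_apply φ.injective]
      exact hr i k hk
    · rw [Finsupp.mapDomain_of_notMem_range _ _ hj]; positivity
  · rw [map_zero]; exact Submodule.zero_mem _
  · intro a b _ _ ha hb; rw [map_add]; exact Submodule.add_mem _ ha hb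
  · intro c a _ ha; rw [map_smul]; exact Submodule.smul_mem _ _ ha

/-- The map that takes `u^(r)` to `u^(r)` if `r` involves only the indeterminates from `ι`, and
to `0` otherwise. -/
def projLin (φ : ι ↪ κ) : DivPow K κ →ₗ[K] DivPow K ι :=
  open Classical in
  lift fun r => if ∀ k ∉ Set.range φ, r k = 0 then mon (r.comapDomain φ φ.injective.injOn) else 0

theorem projLin_mon_zero (φ : ι ↪ κ) {r : κ →₀ ℕ} {k : κ} (hk : k ∉ Set.range φ) (h : r k ≠ 0) :
    projLin φ (mon r : DivPow K κ) = 0 := by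
  classical
  rw [projLin, lift_mon, if_neg]
  exact fun h' => h (h' k hk)

theorem projLin_mon (φ : ι ↪ κ) {r : κ →₀ ℕ} (h : ∀ k ∉ Set.range φ, r k = 0) :
    projLin φ (mon r : DivPow K κ) = mon (r.comapDomain φ φ.injective.injOn) := by
  classical
  rw [projLin, lift_mon, if_pos h]

theorem comapDomain_add' (φ : ι ↪ κ) (r s : κ →₀ ℕ) :
    (r + s).comapDomain φ φ.injective.injOn =
      r.comapDomain φ φ.injective.injOn + s.comapDomain φ φ.injective.injOn := by
  ext i; simp [Finsupp.comapDomain_apply]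

/-- Exponents only add under multiplication, so the monomials involving an indeterminate outside the
image span an ideal; the projection is the quotient by it. -/
theorem projLin_mul (φ : ι ↪ κ) (f g : DivPow K κ) :
    projLin φ (f * g) = projLin φ f * projLin φ g := by
  refine induct (p := fun f => projLin φ (f * g) = projLin φ f * projLin φ g) f ?_ ?_ ?_
    fun r => ?_
  · simp
  · intro a b ha hb; rw [add_mul, map_add, ha, hb, map_add, add_mul]
  · intro c a ha; rw [smul_mul', map_smul, ha, map_smul, smul_mul']
  refine induct (p := fun g => projLin φ (mon r * g) = projLin φ (mon r) * projLin φ g) g ?_ ?_ ?_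
    fun s => ?_
  · simp
  · intro a b ha hb; rw [mul_add, map_add, ha, hb, map_add, mul_add]
  · intro c a ha; rw [mul_smul', map_smul, ha, map_smul, mul_smul']
  rw [mon_mul_mon, map_smul]
  by_cases hr : ∀ k ∉ Set.range φ, r k = 0
  · by_cases hs : ∀ k ∉ Set.range φ, s k = 0
    · rw [projLin_mon φ hr, projLin_mon φ hs, projLin_mon, mon_mul_mon, comapDomain_add']
      · congr 2
        unfold binom
        classical
        rw [← Finset.prod_subset (Finset.subset_univ (Finset.univ.map φ)), Finset.prod_map]
        · simp [Finsupp.comapDomain_apply]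
        · intro x _ hx
          rw [hr x (by simpa using hx), hs x (by simpa using hx)]
          simp
      · intro k hk; rw [Finsupp.add_apply, hr k hk, hs k hk]
    · push Not at hs
      obtain ⟨k, hk, hs⟩ := hs
      rw [projLin_mon_zero φ hk hs, projLin_mon_zero φ hk, smul_zero, mul_zero]
      rw [Finsupp.add_apply]; omega
  · push Not at hr
    obtain ⟨k, hk, hr⟩ := hr
    rw [projLin_mon_zero φ hk hr, projLin_mon_zero φ hk, smul_zero, zero_mul]
    rw [Finsupp.add_apply]; omega

/-- The homomorphism of `projLin`. -/
def proj (φ : ι ↪ κ) : DivPow K κ →ₐ[K] DivPow K ι :=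
  AlgHom.ofLinearMap (projLin φ) (by
    rw [one_def, projLin_mon φ (by simp), one_def]
    congr 1; ext i; simp) (projLin_mul φ)

theorem proj_mon_zero (φ : ι ↪ κ) {r : κ →₀ ℕ} {k : κ} (hk : k ∉ Set.range φ) (h : r k ≠ 0) :
    proj φ (mon r : DivPow K κ) = 0 := projLin_mon_zero φ hk h

theorem proj_mon (φ : ι ↪ κ) {r : κ →₀ ℕ} (h : ∀ k ∉ Set.range φ, r k = 0) :
    proj φ (mon r : DivPow K κ) = mon (r.comapDomain φ φ.injective.injOn) := projLin_mon φ h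

theorem proj_incl (φ : ι ↪ κ) (f : DivPow K ι) : proj φ (incl φ f) = f := by
  have : (proj φ : DivPow K κ →ₐ[K] _).toLinearMap.comp (incl φ).toLinearMap = LinearMap.id := by
    refine linearMap_ext fun r => ?_
    change proj φ (incl φ (mon r)) = mon r
    rw [incl_mon, proj_mon]
    · congr 1
      ext i
      rw [Finsupp.comapDomain_apply, Finsupp.mapDomain_apply φ.injective]
    · intro k hk; exact Finsupp.mapDomain_of_notMem_range _ _ hk
  exact LinearMap.congr_fun this f

theorem proj_var_zero (φ : ι ↪ κ) {k : κ} (hk : k ∉ Set.range φ) :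
    proj φ (var k : DivPow K κ) = 0 := proj_mon_zero φ hk (by simp [unitExp_same])

theorem coeff_proj (φ : ι ↪ κ) (r : ι →₀ ℕ) (f : DivPow K κ) :
    coeff r (proj φ f) = coeff (r.mapDomain φ) f := by
  have : (coeff r).comp (proj φ : DivPow K κ →ₐ[K] _).toLinearMap = coeff (r.mapDomain φ) := by
    refine linearMap_ext fun s => ?_
    change coeff r (proj φ (mon s)) = _
    by_cases h : ∀ k ∉ Set.range φ, s k = 0
    · rw [proj_mon φ h]
      by_cases e : s = r.mapDomain φ
      · rw [e, coeff_mon_self, coeff_mon_self']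
        ext i
        rw [Finsupp.comapDomain_apply, Finsupp.mapDomain_apply φ.injective]
      · rw [coeff_mon_ne e, coeff_mon_ne]
        rintro rfl
        apply e
        ext k
        by_cases hk : k ∈ Set.range φ
        · obtain ⟨i, rfl⟩ := hk
          rw [Finsupp.mapDomain_apply φ.injective, Finsupp.comapDomain_apply]
        · rw [h k hk, Finsupp.mapDomain_of_notMem_range _ _ hk]
    · push Not at h
      obtain ⟨k, hk, hs⟩ := h
      rw [proj_mon_zero φ hk hs, map_zero, coeff_mon_ne]
      rintro rfl
      exact hs (Finsupp.mapDomain_of_notMem_range _ _ hk)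
  exact LinearMap.congr_fun this f

theorem pd_proj (φ : ι ↪ κ) (i : ι) (f : DivPow K κ) :
    pd i (proj φ f) = proj φ (pd (φ i) f) := by
  refine ext_coeff fun r => ?_
  rw [coeff_pd, coeff_proj, coeff_proj, coeff_pd, Finsupp.mapDomain_add, mapDomain_unitExp]

theorem proj_mem_trunc (φ : ι ↪ κ) {N : κ → ℕ∞} {f : DivPow K κ} (hf : f ∈ trunc N) :
    proj φ f ∈ trunc (N ∘ φ) := by
  rw [mem_trunc_iff] at hf ⊢
  intro r hr i k hk
  rw [coeff_proj] at hr
  have := hf _ hr (φ i) k hk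
  rwa [Finsupp.mapDomain_apply φ.injective] at this

end Maps

end DivPow

end

section

/-! ### Simplicity of derived algebras through generating functions -/

section Model

variable {K L E : Type*} [Field K] [LieRing L] [LieAlgebra K L] [AddCommGroup E] [Module K E]

/-- A model of a Lie algebra `L`: a surjection `M` onto `L` from a space `V` of "generating
functions" that intertwines the operation `B` and the Lie bracket. -/
structure IsModel (V : Submodule K E) (M : V →ₗ[K] L) (B : E → E → E) : Prop where
  surj : Function.Surjective M
  lie : ∀ u v : V, ∃ h : B u v ∈ V, ⁅M u, M v⁆ = M ⟨B u v, h⟩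

/-- The subspace `W` of generating functions is simple modulo the kernel of `M`. -/
structure IsSimpleModel (V : Submodule K E) (M : V →ₗ[K] L) (B : E → E → E) (W : Submodule K E) :
    Prop where
  le : W ≤ V
  ker : ∀ u : V, M u = 0 → (u : E) ∈ W
  bracket : ∀ u ∈ W, ∀ v ∈ W, B u v ∈ W
  nonabelian : ∃ u : V, ∃ v : V, (u : E) ∈ W ∧ (v : E) ∈ W ∧ ⁅M u, M v⁆ ≠ 0
  ideal : ∀ I : Submodule K E, I ≤ W → (∀ u : V, M u = 0 → (u : E) ∈ I) →
    (∃ u : V, (u : E) ∈ I ∧ M u ≠ 0) → (∀ w ∈ W, ∀ u ∈ I, B w u ∈ I) → W ≤ I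

variable {V : Submodule K E} {M : V →ₗ[K] L} {B : E → E → E} {W W' : Submodule K E}

theorem IsModel.derived_zero (D : L) (h : IsModel V M B) : ∃ u : V, (u : E) ∈ V ∧ M u = D := by
  obtain ⟨u, hu⟩ := h.surj D
  exact ⟨u, u.2, hu⟩

/-- Derived algebras are spanned by brackets and brackets are computed by `B`, so a bound for one
term of the derived series yields a bound for the next. -/
theorem IsModel.derived_succ (h : IsModel V M B) {k : ℕ}
    (hk : ∀ D ∈ LieAlgebra.derivedSeries K L k, ∃ u : V, (u : E) ∈ W ∧ M u = D)
    (hB : ∀ u ∈ W, ∀ v ∈ W, B u v ∈ W') :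
    ∀ D ∈ LieAlgebra.derivedSeries K L (k + 1), ∃ u : V, (u : E) ∈ W' ∧ M u = D := by
  intro D hD
  have hD' : D ∈ (⁅LieAlgebra.derivedSeries K L k, LieAlgebra.derivedSeries K L k⁆ : LieIdeal K L) := by
    rwa [LieAlgebra.derivedSeries_def, LieAlgebra.derivedSeriesOfIdeal_succ] at hD
  rw [← LieSubmodule.mem_toSubmodule, LieSubmodule.lieIdeal_oper_eq_linear_span'] at hD'
  suffices h2 : D ∈ (W'.comap V.subtype).map M by
    obtain ⟨u, hu, rfl⟩ := h2
    exact ⟨u, hu, rfl⟩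
  refine Submodule.span_le.2 ?_ hD'
  rintro _ ⟨x, hx, y, hy, rfl⟩
  obtain ⟨u, hu, rfl⟩ := hk x hx
  obtain ⟨v, hv, rfl⟩ := hk y hy
  obtain ⟨hm, e⟩ := h.lie u v
  exact ⟨_, hB u hu v hv, e.symm⟩

/-- The preimage of `J` under `M` is stable under `B w` for `w` in `W`, contains the kernel, and
stays inside `W` because the kernel does; so the ideal condition of the model applies to it. Working
with subspaces of `L` lets the same lemma serve ideals of `L` and ideals of its derived algebras. -/
theorem IsSimpleModel.eq_of_invariant (hs : IsSimpleModel V M B W) (h : IsModel V M B)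
    {J : Submodule K L} (hJ : J ≤ (W.comap V.subtype).map M) (h0 : J ≠ ⊥)
    (hinv : ∀ x ∈ (W.comap V.subtype).map M, ∀ y ∈ J, ⁅x, y⁆ ∈ J) :
    (W.comap V.subtype).map M ≤ J := by
  have hI : ∀ u : V, (u : E) ∈ (J.comap M).map V.subtype ↔ M u ∈ J := by
    intro u
    constructor
    · rintro ⟨v, hv, e⟩
      have : v = u := Subtype.ext e
      exact this ▸ hv
    · intro hu; exact ⟨u, hu, rfl⟩
  have key : W ≤ (J.comap M).map V.subtype := by
    refine hs.ideal _ ?_ ?_ ?_ ?_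
    · rintro _ ⟨u, hu, rfl⟩
      obtain ⟨v, hv, e⟩ := hJ hu
      have h1 := hs.ker (u - v) (by rw [map_sub, e, sub_self])
      have h2 : (u : E) = ((u - v : V) : E) + v := by simp
      change (u : E) ∈ W
      rw [h2]
      exact W.add_mem h1 hv
    · intro u hu
      rw [hI, hu]; exact J.zero_mem
    · obtain ⟨x, hx, hx0⟩ := (Submodule.ne_bot_iff _).1 h0
      obtain ⟨u, rfl⟩ := h.surj x
      exact ⟨u, (hI u).2 hx, hx0⟩
    · rintro w hw _ ⟨u, hu, rfl⟩
      obtain ⟨hm, e⟩ := h.lie ⟨w, hs.le hw⟩ u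
      refine (hI ⟨_, hm⟩).2 ?_
      rw [← e]
      exact hinv _ ⟨⟨w, hs.le hw⟩, hw, rfl⟩ _ hu
  rintro _ ⟨u, hu, rfl⟩
  exact (hI u).1 (key hu)

/-- The span of all brackets of M(W) is a nonzero invariant subspace of M(W), hence equal to it. So
M(W) is perfect, and a perfect subspace survives in every term of the derived series. -/
theorem IsSimpleModel.le_derivedSeries (hs : IsSimpleModel V M B W) (h : IsModel V M B) (k : ℕ) :
    (W.comap V.subtype).map M ≤ (LieAlgebra.derivedSeries K L k).toSubmodule := by
  have key : (W.comap V.subtype).map M ≤ Submodule.span K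
      {z | ∃ x ∈ (W.comap V.subtype).map M, ∃ y ∈ (W.comap V.subtype).map M, ⁅x, y⁆ = z} := by
    have hle : Submodule.span K {z | ∃ x ∈ (W.comap V.subtype).map M,
        ∃ y ∈ (W.comap V.subtype).map M, ⁅x, y⁆ = z} ≤ (W.comap V.subtype).map M := by
      refine Submodule.span_le.2 ?_
      rintro _ ⟨_, ⟨u, hu, rfl⟩, _, ⟨v, hv, rfl⟩, rfl⟩
      obtain ⟨hm, e⟩ := h.lie u v
      exact ⟨_, hs.bracket u hu v hv, e.symm⟩
    refine hs.eq_of_invariant h hle ?_ fun x hx y hy => Submodule.subset_span ⟨x, hx, y, hle hy, rfl⟩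
    obtain ⟨u, v, hu, hv, h0⟩ := hs.nonabelian
    exact (Submodule.ne_bot_iff _).2 ⟨_, Submodule.subset_span
      ⟨_, ⟨u, hu, rfl⟩, _, ⟨v, hv, rfl⟩, rfl⟩, h0⟩
  induction k with
  | zero => exact fun x _ => by simp
  | succ k ih =>
    refine key.trans (Submodule.span_le.2 ?_)
    rintro _ ⟨x, hx, y, hy, rfl⟩
    rw [LieAlgebra.derivedSeries_def, LieAlgebra.derivedSeriesOfIdeal_succ]
    exact LieSubmodule.lie_mem_lie (ih hx) (ih hy)

theorem IsSimpleModel.derivedSeries_eq (hs : IsSimpleModel V M B W) (h : IsModel V M B) {k : ℕ}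
    (hk : ∀ D ∈ LieAlgebra.derivedSeries K L k, ∃ u : V, (u : E) ∈ W ∧ M u = D) :
    (LieAlgebra.derivedSeries K L k).toSubmodule = (W.comap V.subtype).map M :=
  le_antisymm (fun D hD => hk D hD) (hs.le_derivedSeries h k)

theorem IsSimpleModel.mem_derivedSeries_iff (hs : IsSimpleModel V M B W) (h : IsModel V M B)
    {k : ℕ} (hk : ∀ D ∈ LieAlgebra.derivedSeries K L k, ∃ u : V, (u : E) ∈ W ∧ M u = D) (u : V) :
    M u ∈ LieAlgebra.derivedSeries K L k ↔ (u : E) ∈ W := by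
  rw [← LieSubmodule.mem_toSubmodule, hs.derivedSeries_eq h hk]
  constructor
  · rintro ⟨v, hv, e⟩
    have h1 := hs.ker (u - v) (by rw [map_sub, e, sub_self])
    have h2 : (u : E) = ((u - v : V) : E) + v := by simp
    rw [h2]
    exact W.add_mem h1 hv
  · intro hu; exact ⟨u, hu, rfl⟩

theorem IsSimpleModel.isSimple (hs : IsSimpleModel V M B W) (h : IsModel V M B) {k : ℕ}
    (hk : ∀ D ∈ LieAlgebra.derivedSeries K L k, ∃ u : V, (u : E) ∈ W ∧ M u = D) :
    LieAlgebra.IsSimple K (LieAlgebra.derivedSeries K L k) := by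
  have e := hs.derivedSeries_eq h hk
  refine { eq_bot_or_eq_top := fun J => ?_, non_abelian := fun hab => ?_ }
  · by_cases h0 : J = ⊥
    · exact Or.inl h0
    · right
      have key := hs.eq_of_invariant h
        (J := J.toSubmodule.map (LieAlgebra.derivedSeries K L k).toSubmodule.subtype) ?_ ?_ ?_
      · rw [← e] at key
        refine eq_top_iff.2 fun x _ => ?_
        obtain ⟨y, hy, hxy⟩ := key x.2
        have : y = x := Subtype.ext hxy
        exact this ▸ hy
      · rw [← e]
        rintro _ ⟨x, -, rfl⟩
        exact x.2
      · intro hb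
        apply h0
        rw [LieSubmodule.eq_bot_iff]
        intro x hx
        have : (x : L) ∈ J.toSubmodule.map (LieAlgebra.derivedSeries K L k).toSubmodule.subtype :=
          ⟨x, hx, rfl⟩
        rw [hb] at this
        exact Subtype.ext this
      · rw [← e]
        rintro x hx _ ⟨y, hy, rfl⟩
        exact ⟨⁅(⟨x, hx⟩ : LieAlgebra.derivedSeries K L k), y⁆, J.lie_mem hy, rfl⟩
  · obtain ⟨u, v, hu, hv, hne⟩ := hs.nonabelian
    have hx := (hs.mem_derivedSeries_iff h hk u).2 hu
    have hy := (hs.mem_derivedSeries_iff h hk v).2 hv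
    have := hab.trivial (⟨_, hx⟩ : LieAlgebra.derivedSeries K L k) ⟨_, hy⟩
    exact hne (congrArg Subtype.val this)

theorem IsSimpleModel.isSimple_self (hs : IsSimpleModel V M B V) (h : IsModel V M B) :
    LieAlgebra.IsSimple K L := by
  have htop : ∀ x : L, x ∈ (V.comap V.subtype).map M := fun x => by
    obtain ⟨u, rfl⟩ := h.surj x
    exact ⟨u, u.2, rfl⟩
  refine { eq_bot_or_eq_top := fun J => ?_, non_abelian := fun hab => ?_ }
  · by_cases h0 : J = ⊥
    · exact Or.inl h0
    · right
      have key := hs.eq_of_invariant h (J := J.toSubmodule) (fun x _ => htop x)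
        (fun hb => h0 (by simpa using hb)) fun x _ y hy => J.lie_mem hy
      exact eq_top_iff.2 fun x _ => key (htop x)
  · obtain ⟨u, v, -, -, hne⟩ := hs.nonabelian
    exact hne (hab.trivial _ _)

/-- A derived algebra that is given by one linear condition has codimension one. -/
theorem IsSimpleModel.finrank_quotient (hs : IsSimpleModel V M B W) (h : IsModel V M B) {k : ℕ}
    (hk : ∀ D ∈ LieAlgebra.derivedSeries K L k, ∃ u : V, (u : E) ∈ W ∧ M u = D)
    (t : E →ₗ[K] K) (ht : ∀ u ∈ V, u ∈ W ↔ t u = 0) (h1 : ∃ u ∈ V, t u = 1) :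
    Module.finrank K (L ⧸ (LieAlgebra.derivedSeries K L k).toSubmodule) = 1 := by
  obtain ⟨u, hu, hu1⟩ := h1
  refine finrank_eq_one (Submodule.Quotient.mk (M ⟨u, hu⟩)) ?_ ?_
  · intro h0
    rw [Submodule.Quotient.mk_eq_zero, LieSubmodule.mem_toSubmodule,
      hs.mem_derivedSeries_iff h hk, ht u hu, hu1] at h0
    exact one_ne_zero h0
  · intro x
    obtain ⟨x, rfl⟩ := Submodule.Quotient.mk_surjective _ x
    obtain ⟨v, rfl⟩ := h.surj x
    refine ⟨t v, ?_⟩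
    rw [← Submodule.Quotient.mk_smul, Submodule.Quotient.eq, ← map_smul, ← map_sub,
      LieSubmodule.mem_toSubmodule, hs.mem_derivedSeries_iff h hk, ht _ (Subtype.prop _)]
    simp [hu1]

end Model

section BV

/-! The operator `∑ X_i Q_i` and the Buttin bracket for commuting derivations of a commutative
algebra of characteristic two. -/

variable {K A κ : Type*} [Field K] [CommRing A] [Algebra K A] [Fintype κ]

/-- The second order operator `∑ X_i Q_i`. -/
def delta (Q X : κ → Derivation K A A) : A →ₗ[K] A :=
  ∑ i, (X i : A →ₗ[K] A) ∘ₗ (Q i : A →ₗ[K] A)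

/-- The Buttin bracket as a derivation in its second argument. -/
def buttin (Q X : κ → Derivation K A A) (f : A) : Derivation K A A := genField 0 Q X f

variable {Q X : κ → Derivation K A A}

theorem delta_apply (f : A) : delta Q X f = ∑ i, X i (Q i f) := by
  simp [delta]

theorem buttin_apply (f g : A) : buttin Q X f g = ∑ i, (Q i f * X i g + X i f * Q i g) := by
  rw [buttin, genField_apply]; simp

theorem genBracket_zero (f g : A) : genBracket 0 Q X f g = buttin Q X f g := by
  rw [buttin_apply, genBracket]; simp

theorem buttin_symm (f g : A) : buttin Q X f g = buttin Q X g f := by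
  rw [buttin_apply, buttin_apply]
  exact Finset.sum_congr rfl fun i _ => by ring

theorem buttin_add_left (f f' g : A) :
    buttin Q X (f + f') g = buttin Q X f g + buttin Q X f' g := by
  rw [buttin_symm, map_add, buttin_symm, buttin_symm g]

theorem buttin_mul_left (f f' g : A) :
    buttin Q X (f * f') g = f * buttin Q X f' g + f' * buttin Q X f g := by
  rw [buttin_symm, Derivation.leibniz, buttin_symm g, buttin_symm g]; rfl

theorem buttin_zero_left (g : A) : buttin Q X 0 g = 0 := by
  rw [buttin_symm, map_zero]

theorem buttin_one_left (g : A) : buttin Q X 1 g = 0 := by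
  rw [buttin_symm, Derivation.map_one_eq_zero]

variable [DecidableEq κ]

theorem frame_comm (H : IsFrame 0 Q X) (i j : κ) (a : A) : Q i (X j a) = X j (Q i a) := by
  have := H.QX i j a
  simpa using this

/-- A second order operator fails the Leibniz rule by its mixed first order terms, and these form
the Buttin bracket. -/
theorem delta_mul (f g : A) :
    delta Q X (f * g) = f * delta Q X g + g * delta Q X f + buttin Q X f g := by
  simp only [delta_apply, buttin_apply, Finset.mul_sum, ← Finset.sum_add_distrib]
  refine Finset.sum_congr rfl fun i _ => ?_
  simp only [Derivation.leibniz, smul_eq_mul, map_add]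
  ring

/-- The double sum is symmetric in its two indices, so off-diagonal terms cancel in pairs in
characteristic 2, while the diagonal ones contain X_i²f = 0. -/
theorem delta_delta (H : IsFrame 0 Q X) {f : A} (hf : ∀ i, X i (X i f) = 0) :
    delta Q X (delta Q X f) = 0 := by
  simp only [delta_apply, map_sum]
  refine sum_symm_eq_zero H.two (fun j i => X i (Q i (X j (Q j f)))) (fun i j => ?_) fun i => ?_
  · rw [frame_comm H, frame_comm H, H.XX, H.QQ]
  · rw [← frame_comm H i i f, ← frame_comm H i i (Q i (X i f)), ← frame_comm H i i (X i f), hf]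
    simp

/-- This is the case T = 0 of the divergence formula `div_genBracket` for contact brackets. -/
theorem delta_buttin (H : IsFrame 0 Q X) {f g : A} (hf : ∀ i, X i (X i f) = 0)
    (hg : ∀ i, X i (X i g) = 0) :
    delta Q X (buttin Q X f g) = buttin Q X (delta Q X f) g + buttin Q X f (delta Q X g) := by
  have := div_genBracket H hf hg
  rw [genBracket_zero, ← delta_apply, ← delta_apply, ← delta_apply] at this
  rw [this, buttin_symm (delta Q X f), add_comm]; rfl

end BV

end

section

open DivPow

/-! ### The operators Δ and E and the Buttin bracket on functions of q, ξ -/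

section QXi

variable {K : Type*} [Field K] {n : ℕ}

/-- The algebra of functions in `q_1, …, q_n, ξ_1, …, ξ_n`. -/
abbrev QXi (K : Type*) [Field K] (n : ℕ) := DivPow K (Fin n ⊕ Fin n)

/-- The derivatives `∂_{q_i}`. -/
abbrev dq (i : Fin n) : Derivation K (QXi K n) (QXi K n) := pd (Sum.inl i)

/-- The derivatives `∂_{ξ_i}`. -/
abbrev dxi (i : Fin n) : Derivation K (QXi K n) (QXi K n) := pd (Sum.inr i)

/-- The indeterminate `q_i`. -/
abbrev qv (i : Fin n) : QXi K n := var (Sum.inl i)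

/-- The indeterminate `ξ_i`. -/
abbrev xv (i : Fin n) : QXi K n := var (Sum.inr i)

/-- The operator `Δ = ∑ ∂_{ξ_i} ∂_{q_i}`. -/
abbrev lap : QXi K n →ₗ[K] QXi K n := delta (fun i => dq i) (fun i => dxi i)

/-- The Buttin bracket on the functions in `q, ξ`. -/
abbrev pb (f : QXi K n) : Derivation K (QXi K n) (QXi K n) :=
  buttin (fun i => dq i) (fun i => dxi i) f

/-- The derivation `∑ q_i ∂_{q_i}`. -/
def euler : Derivation K (QXi K n) (QXi K n) :=
  ∑ i, (qv i : QXi K n) • dq i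

/-- The degree in `q`. -/
def qdeg (s : Fin n ⊕ Fin n →₀ ℕ) : ℕ := ∑ i, s (Sum.inl i)

theorem qdeg_add (s t : Fin n ⊕ Fin n →₀ ℕ) : qdeg (s + t) = qdeg s + qdeg t := by
  simp [qdeg, Finset.sum_add_distrib]

theorem qdeg_unitExp_inl (i : Fin n) : qdeg (unitExp (Sum.inl i)) = 1 := by
  rw [qdeg, Finset.sum_eq_single i, unitExp_same]
  · intro j _ hj; exact unitExp_ne (by simpa using hj)
  · simp

theorem qdeg_unitExp_inr (i : Fin n) : qdeg (unitExp (Sum.inr i)) = 0 :=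
  Finset.sum_eq_zero fun j _ => unitExp_ne (by simp)

theorem euler_apply (f : QXi K n) : euler f = ∑ i, qv i * dq i f := sum_smul_apply _ _ _ _

theorem euler_mon (s : Fin n ⊕ Fin n →₀ ℕ) :
    euler (mon s : QXi K n) = (qdeg s : K) • mon s := by
  rw [euler_apply]
  simp only [var_mul_pd_mon]
  rw [← Finset.sum_smul, qdeg, Nat.cast_sum]

theorem pb_qv (i : Fin n) (g : QXi K n) : pb (qv i) g = dxi i g := by
  rw [buttin_apply, Finset.sum_eq_single i]
  · rw [pd_var_same, pd_var_ne (by simp)]; ring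
  · intro j _ hj
    rw [pd_var_ne (by simpa using hj), pd_var_ne (by simp)]; ring
  · simp

theorem pb_xv (i : Fin n) (g : QXi K n) : pb (xv i) g = dq i g := by
  rw [buttin_apply, Finset.sum_eq_single i]
  · rw [pd_var_same, pd_var_ne (by simp)]; ring
  · intro j _ hj
    rw [pd_var_ne (by simp), pd_var_ne (by simpa using hj)]; ring
  · simp

theorem lap_qv (i : Fin n) : lap (qv i : QXi K n) = 0 := by
  rw [delta_apply]
  refine Finset.sum_eq_zero fun j _ => ?_
  by_cases h : j = i
  · subst h; rw [pd_var_same, Derivation.map_one_eq_zero]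
  · rw [pd_var_ne (by simpa using h), map_zero]

theorem lap_xv (i : Fin n) : lap (xv i : QXi K n) = 0 := by
  rw [delta_apply]
  exact Finset.sum_eq_zero fun j _ => by rw [pd_var_ne (by simp), map_zero]

theorem lap_one : lap (1 : QXi K n) = 0 := by
  rw [delta_apply]
  exact Finset.sum_eq_zero fun j _ => by rw [Derivation.map_one_eq_zero, map_zero]

theorem euler_qv (i : Fin n) : euler (qv i : QXi K n) = qv i := by
  rw [qv, var, euler_mon, qdeg_unitExp_inl]; simp

theorem euler_xv (i : Fin n) : euler (xv i : QXi K n) = 0 := by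
  rw [xv, var, euler_mon, qdeg_unitExp_inr]; simp

theorem lap_qv_mul_xv_same (i : Fin n) : lap (qv i * xv i : QXi K n) = 1 := by
  rw [delta_mul, lap_qv, lap_xv, pb_qv, pd_var_same]; ring

theorem lap_qv_mul (i : Fin n) (f : QXi K n) : lap (qv i * f) = qv i * lap f + dxi i f := by
  rw [delta_mul, lap_qv, pb_qv]; ring

theorem lap_xv_mul (i : Fin n) (f : QXi K n) : lap (xv i * f) = xv i * lap f + dq i f := by
  rw [delta_mul, lap_xv, pb_xv]; ring

variable [CharP K 2]

theorem isFrame_qxi :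
    IsFrame (K := K) (A := QXi K n) 0 (fun i => dq i) (fun i => dxi i) := isFrame_le

theorem natCast_eq_of_mod {a b : ℕ} (h : a % 2 = b % 2) : (a : K) = (b : K) := by
  have : a ≡ b [MOD 2] := h
  exact (CharP.natCast_eq_natCast K 2).2 this

theorem natCast_even {a : ℕ} (h : a % 2 = 0) : (a : K) = 0 := by
  rw [natCast_eq_of_mod (K := K) (b := 0) (by omega), Nat.cast_zero]

theorem natCast_odd {a : ℕ} (h : a % 2 = 1) : (a : K) = 1 := by
  rw [natCast_eq_of_mod (K := K) (b := 1) (by omega), Nat.cast_one]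

/-- The q-degree matters only modulo 2, and 0 and 1 are idempotent: E projects onto odd q-degree.
This makes c + E invertible for c ≠ 0, 1 and a projector for c = 0, 1. -/
theorem euler_euler (f : QXi K n) : euler (euler f) = euler f := by
  refine induct (p := fun f => euler (euler f) = euler f) f (by simp) ?_ ?_ fun s => ?_
  · intro a b ha hb; simp only [map_add, ha, hb]
  · intro c a ha; simp only [Derivation.map_smul, ha]
  · rw [euler_mon, Derivation.map_smul, euler_mon, smul_smul]
    rcases Nat.mod_two_eq_zero_or_one (qdeg s) with h | h
    · rw [natCast_even h, mul_zero]
    · rw [natCast_odd h, mul_one]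

theorem euler_dq (i : Fin n) (f : QXi K n) : euler (dq i f) = dq i (euler f) + dq i f := by
  have h : dq i (euler f) = dq i f + euler (dq i f) := by
    rw [euler_apply, euler_apply, map_sum]
    have : ∀ j, dq i (qv j * dq j f) = (if i = j then dq i f else 0) + qv j * dq j (dq i f) := by
      intro j
      rw [Derivation.leibniz, smul_eq_mul, smul_eq_mul, pd_comm]
      by_cases h : i = j
      · subst h; rw [pd_var_same, if_pos rfl]; ring
      · rw [pd_var_ne (by simpa using h), if_neg h]; ring
    simp only [this, Finset.sum_add_distrib]
    simp
  rw [h]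
  linear_combination - two_eq_zero (dq i f)

theorem euler_dxi (i : Fin n) (f : QXi K n) : euler (dxi i f) = dxi i (euler f) := by
  rw [euler_apply, euler_apply, map_sum]
  refine Finset.sum_congr rfl fun j _ => ?_
  rw [Derivation.leibniz, smul_eq_mul, smul_eq_mul, pd_comm, pd_var_ne (by simp)]; ring

/-- Since Δ removes one q, it exchanges the even and the odd eigenspace of E. -/
theorem euler_lap (f : QXi K n) : euler (lap f) = lap (euler f) + lap f := by
  simp only [delta_apply, map_sum, euler_dxi, euler_dq, map_add, Finset.sum_add_distrib]

theorem euler_pb (f g : QXi K n) :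
    euler (pb f g) = pb (euler f) g + pb f (euler g) + pb f g := by
  simp only [buttin_apply, map_sum, ← Finset.sum_add_distrib]
  refine Finset.sum_congr rfl fun i _ => ?_
  simp only [map_add, Derivation.leibniz, smul_eq_mul, euler_dq, euler_dxi]
  ring

/-- The element q_iξ_i acts diagonally on monomials. Its eigenvalues modulo 2 are the tool for
monomials that cannot be obtained as derivatives. -/
theorem pb_weight (i : Fin n) (s : Fin n ⊕ Fin n →₀ ℕ) :
    pb (qv i * xv i) (mon s : QXi K n) = ((s (Sum.inl i) + s (Sum.inr i) : ℕ) : K) • mon s := by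
  rw [buttin_mul_left, pb_xv, pb_qv, var_mul_pd_mon, var_mul_pd_mon, ← add_smul, Nat.cast_add]

/-! ### Admissible exponents and the highest coefficient as an integral -/

section Trunc

variable {N : Fin n → ℕ∞}

theorem shear_ne_zero (hN : ∀ i, N i ≠ 0) (z : Fin n ⊕ Fin n) : shearLe N z ≠ 0 := by
  rcases z with i | i
  · exact hN i
  · simp [shearLe]

theorem dxi_dxi {f : QXi K n} (hf : f ∈ trunc (shearLe N)) (i : Fin n) : dxi i (dxi i f) = 0 :=
  pd_pd_eq_zero (N := shearLe N) rfl hf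

theorem lap_mem {f : QXi K n} (hf : f ∈ trunc (shearLe N)) : lap f ∈ trunc (shearLe N) := by
  rw [delta_apply]
  exact Submodule.sum_mem _ fun i _ => pd_mem_trunc _ (pd_mem_trunc _ hf)

theorem pb_mem {f g : QXi K n} (hf : f ∈ trunc (shearLe N)) (hg : g ∈ trunc (shearLe N)) :
    pb f g ∈ trunc (shearLe N) := by
  rw [buttin_apply]
  exact Submodule.sum_mem _ fun i _ => Submodule.add_mem _
    (mul_mem_trunc (pd_mem_trunc _ hf) (pd_mem_trunc _ hg))
    (mul_mem_trunc (pd_mem_trunc _ hf) (pd_mem_trunc _ hg))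

theorem euler_mem {f : QXi K n} (hf : f ∈ trunc (shearLe N)) : euler f ∈ trunc (shearLe N) := by
  refine Submodule.span_induction (p := fun f _ => euler f ∈ trunc (shearLe N)) ?_ ?_ ?_ ?_ hf
  · rintro _ ⟨r, hr, rfl⟩
    rw [euler_mon]; exact Submodule.smul_mem _ _ (mon_mem_trunc hr)
  · rw [map_zero]; exact Submodule.zero_mem _
  · intro a b _ _ ha hb; rw [map_add]; exact Submodule.add_mem _ ha hb
  · intro c a _ ha; rw [Derivation.map_smul]; exact Submodule.smul_mem _ _ ha

theorem lap_lap {f : QXi K n} (hf : f ∈ trunc (shearLe N)) : lap (lap f) = 0 :=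
  delta_delta isFrame_qxi (dxi_dxi hf)

theorem lap_pb {f g : QXi K n} (hf : f ∈ trunc (shearLe N)) (hg : g ∈ trunc (shearLe N)) :
    lap (pb f g) = pb (lap f) g + pb f (lap g) :=
  delta_buttin isFrame_qxi (dxi_dxi hf) (dxi_dxi hg)

theorem qv_mem (hN : ∀ i, N i ≠ 0) (i : Fin n) : (qv i : QXi K n) ∈ trunc (shearLe N) :=
  var_mem_trunc (shear_ne_zero hN) _

theorem xv_mem (i : Fin n) : (xv i : QXi K n) ∈ trunc (shearLe N) :=
  var_mem_trunc' (by simp [shearLe])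

omit [CharP K 2] in
-- An exponent can be raised unless it has the maximal value 2^k - 1, and this value is odd since k
-- ≥ 1. The parity is recorded because the weight arguments at the boundary rely on it.
theorem admissible_add_or {r : Fin n ⊕ Fin n →₀ ℕ} (hr : Admissible (shearLe N) r)
    (hN : ∀ i, N i ≠ 0) (z : Fin n ⊕ Fin n) : Admissible (shearLe N) (r + unitExp z) ∨
      ∃ k : ℕ, shearLe N z = k ∧ r z + 1 = 2 ^ k ∧ r z % 2 = 1 := by
  by_cases h : ∃ k : ℕ, shearLe N z = k ∧ r z + 1 = 2 ^ k
  · obtain ⟨k, hk, e⟩ := h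
    refine Or.inr ⟨k, hk, e, ?_⟩
    have hk0 : k ≠ 0 := by
      rintro rfl
      exact shear_ne_zero hN z (by simpa using hk)
    have : 2 ∣ 2 ^ k := dvd_pow_self 2 hk0
    omega
  · left
    intro y k hk
    have h1 := hr y k hk
    rw [Finsupp.add_apply]
    by_cases hy : y = z
    · subst hy
      rw [unitExp_same]
      push Not at h
      have := h k hk
      omega
    · rw [unitExp_ne hy]; exact h1

omit [CharP K 2] in
theorem apply_inr_le {r : Fin n ⊕ Fin n →₀ ℕ} (hr : Admissible (shearLe N) r) (i : Fin n) :
    r (Sum.inr i) ≤ 1 := by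
  have := hr (Sum.inr i) 1 rfl
  omega

/-- The exponent of the highest monomial (if all the coordinates of `N` are finite). -/
def topExp (N : Fin n → ℕ∞) : Fin n ⊕ Fin n →₀ ℕ :=
  Finsupp.equivFunOnFinite.symm fun z => 2 ^ (shearLe N z).toNat - 1

/-- The monomial with exponent `r` is the highest one. -/
def IsTopExp (N : Fin n → ℕ∞) (r : Fin n ⊕ Fin n →₀ ℕ) : Prop := (∀ i, N i ≠ ⊤) ∧ r = topExp N

omit [CharP K 2] in
theorem isTop_of_not_admissible {r : Fin n ⊕ Fin n →₀ ℕ} (hr : Admissible (shearLe N) r)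
    (hN : ∀ i, N i ≠ 0) (h : ∀ z, ¬ Admissible (shearLe N) (r + unitExp z)) : IsTopExp N r := by
  have key : ∀ z, ∃ k : ℕ, shearLe N z = k ∧ r z + 1 = 2 ^ k := fun z => by
    obtain ⟨k, h1, h2, -⟩ := (admissible_add_or hr hN z).resolve_left (h z)
    exact ⟨k, h1, h2⟩
  refine ⟨fun i hi => ?_, ?_⟩
  · obtain ⟨k, hk, -⟩ := key (Sum.inl i)
    have : N i = k := hk
    rw [hi] at this
    exact ENat.natCast_ne_top k this.symm
  · ext z
    obtain ⟨k, hk, e⟩ := key z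
    change r z = 2 ^ (shearLe N z).toNat - 1
    rw [hk]
    simp only [ENat.toNat_natCast]
    omega

omit [CharP K 2] in
theorem shear_eq_toNat (h : ∀ i, N i ≠ ⊤) (z : Fin n ⊕ Fin n) :
    shearLe N z = ((shearLe N z).toNat : ℕ∞) := by
  refine (ENat.natCast_toNat ?_).symm
  rcases z with i | i
  · exact h i
  · simp [shearLe]

omit [CharP K 2] in
theorem topExp_add_one (z : Fin n ⊕ Fin n) : topExp N z + 1 = 2 ^ (shearLe N z).toNat := by
  change 2 ^ (shearLe N z).toNat - 1 + 1 = _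
  have : 0 < 2 ^ (shearLe N z).toNat := by positivity
  omega

omit [CharP K 2] in
theorem topExp_mod (h : ∀ i, N i ≠ ⊤) (hN : ∀ i, N i ≠ 0) (z : Fin n ⊕ Fin n) :
    topExp N z % 2 = 1 := by
  have h1 := topExp_add_one (N := N) z
  have hk0 : (shearLe N z).toNat ≠ 0 := by
    intro h0
    have := shear_eq_toNat h z
    rw [h0] at this
    exact shear_ne_zero hN z (by simpa using this)
  have : 2 ∣ 2 ^ (shearLe N z).toNat := dvd_pow_self 2 hk0
  omega

omit [CharP K 2] in
theorem topExp_inr (i : Fin n) : topExp N (Sum.inr i) = 1 := by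
  have := topExp_add_one (N := N) (Sum.inr i)
  simp [shearLe] at this
  exact this

omit [CharP K 2] in
theorem admissible_topExp : Admissible (shearLe N) (topExp N) := by
  intro z k hk
  have := topExp_add_one (N := N) z
  rw [hk] at this
  simp only [ENat.toNat_natCast] at this
  omega

omit [CharP K 2] in
theorem not_admissible_topExp_add (h : ∀ i, N i ≠ ⊤) (z : Fin n ⊕ Fin n) :
    ¬ Admissible (shearLe N) (topExp N + unitExp z) := by
  intro hA
  have h1 := hA z _ (shear_eq_toNat h z)
  rw [Finsupp.add_apply, unitExp_same, topExp_add_one] at h1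
  omega

omit [CharP K 2] in
theorem not_isTop_of_admissible {r : Fin n ⊕ Fin n →₀ ℕ} {z : Fin n ⊕ Fin n}
    (h : Admissible (shearLe N) (r + unitExp z)) : ¬ IsTopExp N r := by
  rintro ⟨hf, rfl⟩
  exact not_admissible_topExp_add hf z h

/-- Each of the n exponents 2^k - 1 of the q_i is odd. -/
theorem qdeg_topExp (h : ∀ i, N i ≠ ⊤) (hN : ∀ i, N i ≠ 0) : (qdeg (topExp N) : K) = (n : K) := by
  rw [qdeg, Nat.cast_sum]
  simp [natCast_odd (K := K) (topExp_mod h hN _)]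

open Classical in
/-- The coefficient of the highest monomial; `0` if there is no highest monomial. -/
def topCoeff (N : Fin n → ℕ∞) : QXi K n →ₗ[K] K :=
  if ∀ i, N i ≠ ⊤ then coeff (topExp N) else 0

omit [CharP K 2] in
theorem topCoeff_mon_of_not {r : Fin n ⊕ Fin n →₀ ℕ} (h : ¬ IsTopExp N r) :
    topCoeff N (mon r : QXi K n) = 0 := by
  rw [topCoeff]
  split_ifs with hf
  · exact coeff_mon_ne fun e => h ⟨hf, e⟩
  · rfl

omit [CharP K 2] in
theorem topCoeff_mon_top {r : Fin n ⊕ Fin n →₀ ℕ} (h : IsTopExp N r) :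
    topCoeff N (mon r : QXi K n) = 1 := by
  rw [topCoeff, if_pos h.1, h.2, coeff_mon_self]

omit [CharP K 2] in
/-- Membership in a subspace can be tested on monomials if the highest coefficient vanishes. -/
theorem mem_of_mon_mem_of_topCoeff {P : Submodule K (QXi K n)} {f : QXi K n}
    (hf : f ∈ trunc (shearLe N)) (ht : topCoeff N f = 0)
    (h : ∀ r, Admissible (shearLe N) r → ¬ IsTopExp N r → coeff r f ≠ 0 → mon r ∈ P) : f ∈ P := by
  refine mem_of_mon_mem P fun r hr => h r (mem_trunc_iff.1 hf r hr) (fun hT => hr ?_) hr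
  rw [topCoeff, if_pos hT.1] at ht
  rw [hT.2, ht]

omit [CharP K 2] in
-- The monomial one step above the highest is not admissible, so no derivative contains the highest
-- one. The highest coefficient thus behaves as an integral, and this is integration by parts.
theorem topCoeff_pd {f : QXi K n} (hf : f ∈ trunc (shearLe N)) (z : Fin n ⊕ Fin n) :
    topCoeff N (pd z f) = 0 := by
  rw [topCoeff]
  split_ifs with h
  · rw [coeff_pd]
    by_contra h0
    exact not_admissible_topExp_add h z (mem_trunc_iff.1 hf _ h0)
  · rfl

omit [CharP K 2] in
theorem topCoeff_lap {f : QXi K n} (hf : f ∈ trunc (shearLe N)) : topCoeff N (lap f) = 0 := by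
  rw [delta_apply, map_sum]
  exact Finset.sum_eq_zero fun i _ => topCoeff_pd (pd_mem_trunc _ hf) _

/-- The bracket is a total divergence, {f, g} = ∑ ∂_{q_i}(f ∂_{ξ_i}g) + ∂_{ξ_i}(f ∂_{q_i}g), since
the mixed second derivatives of g cancel in characteristic 2. -/
theorem topCoeff_pb {f g : QXi K n} (hf : f ∈ trunc (shearLe N)) (hg : g ∈ trunc (shearLe N)) :
    topCoeff N (pb f g) = 0 := by
  have : pb f g = ∑ i, (dq i (f * dxi i g) + dxi i (f * dq i g)) := by
    rw [buttin_apply]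
    refine Finset.sum_congr rfl fun i _ => ?_
    simp only [Derivation.leibniz, smul_eq_mul]
    rw [pd_comm (Sum.inr i) (Sum.inl i)]
    linear_combination - two_eq_zero (f * dq i (dxi i g))
  rw [this, map_sum]
  refine Finset.sum_eq_zero fun i _ => ?_
  rw [map_add, topCoeff_pd (mul_mem_trunc hf (pd_mem_trunc _ hg)),
    topCoeff_pd (mul_mem_trunc hf (pd_mem_trunc _ hg)), add_zero]

theorem topCoeff_euler (hN : ∀ i, N i ≠ 0) (f : QXi K n) :
    topCoeff N (euler f) = (n : K) * topCoeff N f := by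
  refine induct (p := fun f => topCoeff N (euler f) = (n : K) * topCoeff N f) f (by simp) ?_ ?_
    fun r => ?_
  · intro a b ha hb; rw [map_add, map_add, map_add, ha, hb, mul_add]
  · intro c a ha
    rw [Derivation.map_smul, map_smul, map_smul, ha, smul_eq_mul, smul_eq_mul]; ring
  · rw [euler_mon, map_smul, smul_eq_mul]
    by_cases h : IsTopExp N r
    · rw [h.2, qdeg_topExp h.1 hN]
    · rw [topCoeff_mon_of_not h, mul_zero, mul_zero]

/-- Integrating the product rule `delta_mul` kills Δ(fg) and {f, g}; what remains says that Δ is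
self-adjoint for the pairing by the highest coefficient. -/
theorem topCoeff_mul_lap {f g : QXi K n} (hf : f ∈ trunc (shearLe N))
    (hg : g ∈ trunc (shearLe N)) : topCoeff N (f * lap g) = topCoeff N (g * lap f) := by
  have h := topCoeff_lap (mul_mem_trunc hf hg)
  rw [delta_mul, map_add, map_add, topCoeff_pb hf hg, add_zero] at h
  rw [CharTwo.add_eq_zero] at h
  exact h

end Trunc

end QXi

end

section

open DivPow

/-! ### Simplicity of le(n; N) and of its derived algebra -/

section Le

variable {K : Type*} [Field K] {n : ℕ} {N : Fin n → ℕ∞}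

theorem topCoeff_of_pd_eq_zero (hN : ∀ i, N i ≠ 0) {f : QXi K n} (z : Fin n ⊕ Fin n)
    (h : pd z f = 0) : topCoeff N f = 0 := by
  rw [topCoeff]
  split_ifs with hf
  · have : topExp N z ≠ 0 := fun h0 => by
      have := topExp_mod hf hN z
      omega
    obtain ⟨r, hr⟩ := exists_add this
    rw [hr, ← coeff_pd, h, map_zero]
  · rfl

variable [CharP K 2]

/-- The functions without the highest monomial. -/
def truncTop (K : Type*) [Field K] [CharP K 2] (N : Fin n → ℕ∞) : Submodule K (QXi K n) :=
  trunc (shearLe N) ⊓ LinearMap.ker (topCoeff N)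

theorem truncTop_eq_of_infinite (h : ∃ i, N i = ⊤) : truncTop K N = trunc (shearLe N) := by
  refine le_antisymm inf_le_left fun f hf => ⟨hf, ?_⟩
  have : topCoeff (K := K) N = 0 := if_neg fun h' => h.elim h'
  rw [this]; simp

theorem mon_mem_truncTop {r : Fin n ⊕ Fin n →₀ ℕ} (h : Admissible (shearLe N) r)
    (h' : ¬ IsTopExp N r) : (mon r : QXi K n) ∈ truncTop K N :=
  ⟨mon_mem_trunc h, topCoeff_mon_of_not h'⟩

theorem mem_truncTop_of_pd (hN : ∀ i, N i ≠ 0) {f : QXi K n} (hf : f ∈ trunc (shearLe N))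
    (z : Fin n ⊕ Fin n) (h : pd z f = 0) : f ∈ truncTop K N :=
  ⟨hf, topCoeff_of_pd_eq_zero hN z h⟩

theorem var_mem_shear (hN : ∀ i, N i ≠ 0) (z : Fin n ⊕ Fin n) :
    (var z : QXi K n) ∈ trunc (shearLe N) := var_mem_trunc (shear_ne_zero hN) z

theorem swap_ne (z : Fin n ⊕ Fin n) : z.swap ≠ z := by rcases z with i | i <;> simp

theorem pb_var (z : Fin n ⊕ Fin n) (g : QXi K n) : pb (var z) g = pd z.swap g := by
  rcases z with i | i
  · exact pb_qv i g
  · exact pb_xv i g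

theorem pb_var_mul_var (y z : Fin n ⊕ Fin n) (g : QXi K n) :
    pb (var y * var z) g = var y * pd z.swap g + var z * pd y.swap g := by
  rw [buttin_mul_left, pb_var, pb_var]

theorem pd_var_mul_var_self {y z : Fin n ⊕ Fin n} (h : y ≠ z) :
    pd y (var y * var z : QXi K n) = var z := by
  rw [Derivation.leibniz, pd_var_same, pd_var_ne h]; simp

theorem pd_pair_eq_zero {x y z : Fin n ⊕ Fin n} (hy : x ≠ y) (hz : x ≠ z) :
    pd x (var y * var z : QXi K n) = 0 := by
  rw [Derivation.leibniz, pd_var_ne hy, pd_var_ne hz]; simp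

theorem exists_ne_pair (hn : 2 ≤ n) (y z : Fin n ⊕ Fin n) : ∃ x, x ≠ y ∧ x ≠ z := by
  by_contra h
  push Not at h
  have h1 : (Finset.univ : Finset (Fin n ⊕ Fin n)) ⊆ {y, z} := fun x _ => by
    by_cases hx : x = y
    · simp [hx]
    · simp [h x hx]
  have h2 := Finset.card_le_card h1
  have h3 := Finset.card_le_two (a := y) (b := z)
  rw [Finset.card_univ, Fintype.card_sum, Fintype.card_fin] at h2
  omega

theorem exists_ne_fin (hn : 2 ≤ n) (i : Fin n) : ∃ j : Fin n, j ≠ i := by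
  have : Nontrivial (Fin n) := Fin.nontrivial_iff_two_le.2 hn
  exact exists_ne i

theorem var_mul_var_mem_truncTop (hn : 2 ≤ n) (hN : ∀ i, N i ≠ 0) (y z : Fin n ⊕ Fin n) :
    (var y * var z : QXi K n) ∈ truncTop K N := by
  obtain ⟨x, hx, hx'⟩ := exists_ne_pair hn y z
  exact mem_truncTop_of_pd hN (mul_mem_trunc (var_mem_shear hN y) (var_mem_shear hN z)) x
    (pd_pair_eq_zero hx hx')

theorem isModel_le (N : Fin n → ℕ∞) :
    ∃ M : (trunc (shearLe N) : Submodule K (QXi K n)) →ₗ[K] leAlg (K := K) N,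
      IsModel (trunc (shearLe N)) M (fun f g => pb f g) ∧ ∀ u, (M u).1 = hamField (u : QXi K n) := by
  refine ⟨{ toFun := fun u => ⟨hamField (u : QXi K n), u, u.2, rfl⟩
            map_add' := fun u v => Subtype.ext (genField_add _ _)
            map_smul' := fun c u => Subtype.ext (genField_smul c _) }, ⟨?_, ?_⟩, fun u => rfl⟩
  · rintro ⟨_, f, hf, rfl⟩
    exact ⟨⟨f, hf⟩, rfl⟩
  · intro u v
    refine ⟨pb_mem u.2 v.2, Subtype.ext ?_⟩
    change ⁅hamField (u : QXi K n), hamField (v : QXi K n)⁆ = _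
    exact (lie_genField isFrame_le _ _).trans (by rw [genBracket_zero]; rfl)

/-- Bracketing with an indeterminate is differentiation by its conjugate, so the field detects all
first derivatives and loses only constants. -/
theorem hamField_eq_zero_iff (f : QXi K n) : hamField f = 0 ↔ ∀ z, pd z f = 0 := by
  have e : ∀ g, hamField f g = pb f g := fun g => rfl
  constructor
  · intro h z
    rw [← Sum.swap_swap z, ← pb_var, buttin_symm, ← e, h]; rfl
  · intro h
    ext g
    rw [e, buttin_apply]
    exact Finset.sum_eq_zero fun i _ => by rw [h, h]; simp

/-- Differentiation leads to an affine function, quadratic functions move it to every indeterminate,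
and then I contains all first derivatives of the functions without highest term. Only monomials one
step below the highest one need an additional weight argument. -/
theorem le_ideal (hn : 2 ≤ n) (hN : ∀ i, N i ≠ 0) (I : Submodule K (QXi K n))
    (hnc : ∃ f ∈ I, ∃ z, pd z f ≠ 0)
    (hI : ∀ w ∈ truncTop K N, ∀ u ∈ I, pb w u ∈ I) : truncTop K N ≤ I := by
  have hvar : ∀ z, (var z : QXi K n) ∈ truncTop K N := fun z => by
    obtain ⟨x, hx, -⟩ := exists_ne_pair hn z z
    exact mem_truncTop_of_pd hN (var_mem_shear hN z) x (pd_var_ne hx)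
  have hpair := var_mul_var_mem_truncTop (K := K) hn hN
  -- a non-constant element all of whose derivatives are constant
  obtain ⟨g, hg, ⟨z, hz⟩, hlast⟩ := exists_last (J := Set.univ) (p := fun f => f ∈ I)
    (q := fun f => ∃ z, pd z f ≠ 0) (by simp)
    (fun f hf z _ => by
      have := hI _ (hvar z.swap) f hf
      rwa [pb_var, Sum.swap_swap] at this) hnc
  have hconst : ∀ y, pd y g = coeff 0 (pd y g) • (1 : QXi K n) := fun y => by
    refine eq_smul_one_of_pd_eq_zero fun x => ?_
    have := hlast y trivial
    push Not at this
    exact this x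
  -- some indeterminate belongs to `I`
  have hsome : ∃ v, (var v : QXi K n) ∈ I := by
    obtain ⟨v, hv, hv'⟩ := exists_ne_pair hn z z.swap
    refine ⟨v, ?_⟩
    -- Here g is a constant plus a linear form whose z-derivative is nonzero. Writing z' and v' for
    -- the conjugates of z and v, the bracket with z'v sends g to (∂_{v'} g) z' + (∂_z g) v, and a
    -- further bracket with zv leaves (∂_{v'} g) v. One of the two yields v, according to whether
    -- ∂_{v'} g vanishes.
    have a1 := hI _ (hpair z.swap v) g hg
    rw [pb_var_mul_var, Sum.swap_swap, hconst v.swap, hconst z, mul_smul_comm, mul_smul_comm,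
      mul_one, mul_one] at a1
    have a2 := hI _ (hpair z v) _ a1
    have hvs : v.swap ≠ z.swap := fun h => hv (Sum.swap_leftInverse.injective h)
    rw [pb_var_mul_var, map_add, map_add, Derivation.map_smul, Derivation.map_smul,
      Derivation.map_smul, Derivation.map_smul, pd_var_ne hvs, pd_var_ne (swap_ne v),
      pd_var_same, pd_var_ne (Ne.symm hv'), smul_zero, smul_zero, add_zero, mul_zero, zero_add,
      add_zero, mul_smul_comm, mul_one] at a2
    by_cases h0 : coeff 0 (pd v.swap g) = 0
    · rw [h0, zero_smul, zero_add] at a1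
      refine (I.smul_mem_iff (s := coeff 0 (pd z g)) fun h => hz ?_).1 a1
      rw [hconst z, h, zero_smul]
    · exact (I.smul_mem_iff h0).1 a2
  obtain ⟨v, hv⟩ := hsome
  have step : ∀ v w, (var v : QXi K n) ∈ I → w ≠ v.swap → (var w : QXi K n) ∈ I := by
    intro v w hv hw
    have := hI _ (hpair v.swap w) _ hv
    rwa [buttin_symm, pb_var, pd_var_mul_var_self hw.symm] at this
  have hall : ∀ w, (var w : QXi K n) ∈ I := by
    intro w
    by_cases hw : w = v.swap
    · obtain ⟨x, hx, hx'⟩ := exists_ne_pair hn v v.swap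
      refine step x w (step v x hv hx') ?_
      rw [hw]
      exact fun h => hx (Sum.swap_leftInverse.injective h).symm
    · exact step v w hv hw
  have hpd : ∀ z, ∀ f ∈ truncTop K N, pd z f ∈ I := by
    intro z f hf
    have := hI f hf _ (hall z.swap)
    rwa [buttin_symm, pb_var, Sum.swap_swap] at this
  intro f hf
  refine mem_of_mon_mem_of_topCoeff hf.1 hf.2 fun r hr hT _ => ?_
  by_cases hex : ∃ z, Admissible (shearLe N) (r + unitExp z) ∧ ¬ IsTopExp N (r + unitExp z)
  · obtain ⟨z, hz, hz'⟩ := hex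
    rw [← pd_mon_add z r]
    exact hpd z _ (mon_mem_truncTop hz hz')
  · push Not at hex
    have : ∃ z, Admissible (shearLe N) (r + unitExp z) := by
      by_contra h
      push Not at h
      exact hT (isTop_of_not_admissible hr hN h)
    obtain ⟨z, hz⟩ := this
    obtain ⟨hfin, htop⟩ := hex z hz
    -- The exponent r is the highest one lowered by 1 at z. In the highest exponent each pair (q_i,
    -- ξ_i) has even total, so the pair containing z now has odd weight.
    obtain ⟨i, hi⟩ : ∃ i, (r (Sum.inl i) + r (Sum.inr i)) % 2 = 1 := by
      have e : ∀ y, r y + unitExp z y = topExp N y := fun y => by rw [← htop]; rfl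
      rcases z with i | i
      · refine ⟨i, ?_⟩
        have e1 := e (Sum.inl i)
        have e2 := e (Sum.inr i)
        rw [unitExp_same] at e1
        rw [unitExp_ne (by simp)] at e2
        have := topExp_mod hfin hN (Sum.inl i)
        have := topExp_mod hfin hN (Sum.inr i)
        omega
      · refine ⟨i, ?_⟩
        have e1 := e (Sum.inl i)
        have e2 := e (Sum.inr i)
        rw [unitExp_same] at e2
        rw [unitExp_ne (by simp)] at e1
        have := topExp_mod hfin hN (Sum.inl i)
        have := topExp_mod hfin hN (Sum.inr i)
        omega
    have hw := pb_weight (K := K) i r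
    rw [natCast_odd hi, one_smul] at hw
    rw [← hw, buttin_symm]
    refine hI _ (mon_mem_truncTop hr hT) _ ?_
    obtain ⟨j, hj⟩ := exists_ne_fin hn i
    -- The weight element q_iξ_i belongs to I as the ξ_j-derivative of this cubic; the cubic is free
    -- of q_j, hence has no highest term.
    have h3 : (xv j * (qv i * xv i) : QXi K n) ∈ truncTop K N := by
      refine mem_truncTop_of_pd hN (mul_mem_trunc (var_mem_shear hN _)
        (mul_mem_trunc (var_mem_shear hN _) (var_mem_shear hN _))) (Sum.inl j) ?_
      rw [Derivation.leibniz, pd_pair_eq_zero (by simpa using hj) (by simp), pd_var_ne (by simp)]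
      simp
    have h4 := hpd (Sum.inr j) _ h3
    rwa [Derivation.leibniz, pd_var_same, pd_pair_eq_zero (by simp) (by simpa using hj), smul_zero,
      zero_add, smul_eq_mul, mul_one] at h4

theorem isSimpleModel_le (hn : 2 ≤ n) (hN : ∀ i, N i ≠ 0)
    {M : (trunc (shearLe N) : Submodule K (QXi K n)) →ₗ[K] leAlg (K := K) N}
    (hm : IsModel (trunc (shearLe N)) M (fun f g => pb f g))
    (hM : ∀ u, (M u).1 = hamField (u : QXi K n)) :
    IsSimpleModel (trunc (shearLe N)) M (fun f g => pb f g) (truncTop K N) := by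
  have hM0 : ∀ u, M u = 0 ↔ ∀ z, pd z (u : QXi K n) = 0 := by
    intro u
    rw [← hamField_eq_zero_iff, ← hM]
    exact ⟨fun h => by rw [h]; rfl, fun h => Subtype.ext h⟩
  let i : Fin n := ⟨0, by omega⟩
  refine ⟨inf_le_left, fun u hu => ?_, fun u hu v hv => ⟨pb_mem hu.1 hv.1, topCoeff_pb hu.1 hv.1⟩,
    ?_, fun I _ _ hnz hI => ?_⟩
  · exact mem_truncTop_of_pd hN u.2 (Sum.inl i) ((hM0 u).1 hu _)
  · have h2 := var_mul_var_mem_truncTop (K := K) hn hN (Sum.inl i) (Sum.inr i)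
    have h1 : (qv i : QXi K n) ∈ truncTop K N :=
      mem_truncTop_of_pd hN (qv_mem hN i) (Sum.inr i) (pd_var_ne (by simp))
    refine ⟨⟨_, h2.1⟩, ⟨_, h1.1⟩, h2, h1, ?_⟩
    obtain ⟨hm', e⟩ := hm.lie ⟨_, h2.1⟩ ⟨_, h1.1⟩
    rw [e]
    intro h0
    have := (hM0 _).1 h0 (Sum.inl i)
    simp only [pb_var_mul_var, Sum.swap_inl, Sum.swap_inr] at this
    rw [pd_var_same, pd_var_ne (by simp), mul_one, mul_zero, add_zero, pd_var_same, one_def] at this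
    exact mon_ne_zero _ this
  · refine le_ideal hn hN I ?_ hI
    obtain ⟨u, hu, h0⟩ := hnz
    refine ⟨u, hu, ?_⟩
    by_contra h
    push Not at h
    exact h0 ((hM0 u).2 h)

theorem leAlg_derived {M : (trunc (shearLe N) : Submodule K (QXi K n)) →ₗ[K] leAlg (K := K) N}
    (hm : IsModel (trunc (shearLe N)) M (fun f g => pb f g)) :
    ∀ D ∈ LieAlgebra.derivedSeries K (leAlg (K := K) N) 1,
      ∃ u : (trunc (shearLe N) : Submodule K (QXi K n)), (u : QXi K n) ∈ truncTop K N ∧ M u = D :=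
  hm.derived_succ (k := 0) (fun D _ => hm.derived_zero D)
    fun _ hu _ hv => ⟨pb_mem hu hv, topCoeff_pb hu hv⟩

theorem leAlg_isSimple_of_infinite (hn : 2 ≤ n) (hN : ∀ i, N i ≠ 0) (h : ∃ i, N i = ⊤) :
    LieAlgebra.IsSimple K (leAlg (K := K) N) := by
  obtain ⟨M, hm, hM⟩ := isModel_le (K := K) N
  have hs := isSimpleModel_le hn hN hm hM
  rw [truncTop_eq_of_infinite h] at hs
  exact hs.isSimple_self hm

theorem leAlg_finite (hn : 2 ≤ n) (hN : ∀ i, N i ≠ 0) (h : ∀ i, N i ≠ ⊤) :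
    LieAlgebra.IsSimple K (LieAlgebra.derivedSeries K (leAlg (K := K) N) 1) ∧
      Module.finrank K
        (leAlg (K := K) N ⧸ (LieAlgebra.derivedSeries K (leAlg (K := K) N) 1).toSubmodule) = 1 := by
  obtain ⟨M, hm, hM⟩ := isModel_le (K := K) N
  have hs := isSimpleModel_le hn hN hm hM
  refine ⟨hs.isSimple hm (leAlg_derived hm), hs.finrank_quotient hm (leAlg_derived hm) (topCoeff N)
    (fun u hu => ⟨fun h => h.2, fun h => ⟨hu, h⟩⟩) ⟨mon (topExp N),
      mon_mem_trunc admissible_topExp, topCoeff_mon_top ⟨h, rfl⟩⟩⟩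

end Le

end

section

open DivPow

/-! ### Contact generating functions f_0 + τf_1 and the equations defining po -/

section PoModel

variable {K : Type*} [Field K] {n : ℕ} {N : Fin n → ℕ∞}

/-- The embedding of the indices of `q, ξ` into those of `q, ξ, τ`. -/
def embTau (n : ℕ) : Fin n ⊕ Fin n ↪ CVar n := ⟨Sum.inl, Sum.inl_injective⟩

/-- The inclusion of the functions in `q, ξ` into the functions in `q, ξ, τ`. -/
abbrev inc : QXi K n →ₐ[K] DivPow K (CVar n) := incl (embTau n)

/-- The restriction of functions in `q, ξ, τ` to `τ = 0`. -/
abbrev res : DivPow K (CVar n) →ₐ[K] QXi K n := proj (embTau n)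

/-- The indeterminate `τ`. -/
abbrev tau : DivPow K (CVar n) := var (Sum.inr ())

theorem tau_notMem : (Sum.inr () : CVar n) ∉ Set.range (embTau n) := by
  rintro ⟨x, hx⟩
  exact Sum.inl_ne_inr hx

theorem dTau_inc (f : QXi K n) : dTau (inc f) = 0 := pd_incl_of_notMem _ tau_notMem _

theorem dTau_tau : dTau (tau : DivPow K (CVar n)) = 1 := pd_var_same _

theorem pd_inc (z : Fin n ⊕ Fin n) (f : QXi K n) : pd (Sum.inl z) (inc f) = inc (pd z f) :=
  pd_incl (embTau n) z f

theorem res_inc (f : QXi K n) : res (inc f) = f := proj_incl _ _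

theorem res_tau : res (tau : DivPow K (CVar n)) = 0 := proj_var_zero _ tau_notMem

theorem inc_qv (i : Fin n) : inc (qv i : QXi K n) = var (Sum.inl (Sum.inl i)) := incl_var _ _

/-- The function `f_0 + τ f_1`. -/
def pairFun : QXi K n × QXi K n →ₗ[K] DivPow K (CVar n) :=
  inc.toLinearMap ∘ₗ LinearMap.fst K _ _ +
    LinearMap.mulLeft K tau ∘ₗ inc.toLinearMap ∘ₗ LinearMap.snd K _ _

theorem pairFun_apply (u : QXi K n × QXi K n) : pairFun u = inc u.1 + tau * inc u.2 := rfl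

theorem dTau_pairFun (u : QXi K n × QXi K n) : dTau (pairFun u) = inc u.2 := by
  rw [pairFun_apply, map_add, Derivation.leibniz, dTau_inc, dTau_inc, dTau_tau]
  simp

theorem res_pairFun (u : QXi K n × QXi K n) : res (pairFun u) = u.1 := by
  rw [pairFun_apply, map_add, map_mul, res_inc, res_tau, zero_mul, add_zero]

theorem pairFun_injective : Function.Injective (pairFun (K := K) (n := n)) := by
  intro u v h
  have h1 := congrArg res h
  have h2 := congrArg (fun f => res (dTau f)) h
  simp only [dTau_pairFun, res_inc] at h2
  rw [res_pairFun, res_pairFun] at h1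
  exact Prod.ext h1 h2

theorem pd_pairFun (z : Fin n ⊕ Fin n) (u : QXi K n × QXi K n) :
    pd (Sum.inl z) (pairFun u) = pairFun (pd z u.1, pd z u.2) := by
  rw [pairFun_apply, map_add, Derivation.leibniz, pd_inc, pd_inc, pd_var_ne (by simp)]
  simp [pairFun_apply]

theorem dQ_pairFun (i : Fin n) (u : QXi K n × QXi K n) :
    dQ i (pairFun u) = pairFun (dq i u.1, dq i u.2) := pd_pairFun _ _

theorem dX_pairFun (i : Fin n) (u : QXi K n × QXi K n) :
    dX i (pairFun u) = pairFun (dxi i u.1 + qv i * u.2, dxi i u.2) := by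
  rw [dX_apply, pd_pairFun, ← inc_qv]
  change _ + inc (qv i) * dTau (pairFun u) = _
  rw [dTau_pairFun, pairFun_apply, pairFun_apply, map_add, map_mul]
  ring

theorem mem_shearPo_iff {u : QXi K n × QXi K n} [CharP K 2] :
    pairFun u ∈ trunc (shearPo N) ↔ u.1 ∈ trunc (shearLe N) ∧ u.2 ∈ trunc (shearLe N) := by
  constructor
  · intro h
    have h1 := proj_mem_trunc (embTau n) h
    have h2 := proj_mem_trunc (embTau n) (pd_mem_trunc (Sum.inr ()) h)
    have e : shearPo N ∘ embTau n = shearLe N := rfl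
    rw [e] at h1 h2
    change res (dTau _) ∈ _ at h2
    change res _ ∈ _ at h1
    rw [dTau_pairFun, res_inc] at h2
    rw [res_pairFun] at h1
    exact ⟨h1, h2⟩
  · rintro ⟨h1, h2⟩
    exact Submodule.add_mem _ (incl_mem_trunc (embTau n) h1)
      (mul_mem_trunc (var_mem_trunc' (by simp [shearPo])) (incl_mem_trunc (embTau n) h2))

theorem exists_pairFun {f : DivPow K (CVar n)} (hf : f ∈ trunc (shearPo N)) :
    ∃ u, f = pairFun u := by
  refine Submodule.span_induction (p := fun f _ => ∃ u, f = pairFun u) ?_ ?_ ?_ ?_ hf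
  · rintro _ ⟨s, hs, rfl⟩
    have hinc : ∀ s : CVar n →₀ ℕ, s (Sum.inr ()) = 0 →
        (mon s : DivPow K (CVar n)) = inc (res (mon s)) := by
      intro s hs
      have hr : ∀ k ∉ Set.range (embTau n), s k = 0 := by
        rintro (k | k) hk
        · exact absurd ⟨k, rfl⟩ hk
        · exact hs
      rw [proj_mon _ hr, incl_mon, Finsupp.mapDomain_comapDomain _ (embTau n).injective]
      rintro (k | k) hk
      · exact ⟨k, rfl⟩
      · exact absurd hs (by simpa using hk)
    by_cases h0 : s (Sum.inr ()) = 0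
    · exact ⟨(res (mon s), 0), by rw [pairFun_apply, ← hinc s h0]; simp⟩
    · obtain ⟨s, rfl⟩ := exists_add h0
      have h1 := hs (Sum.inr ()) 1 rfl
      rw [Finsupp.add_apply, unitExp_same] at h1
      have h0' : s (Sum.inr ()) = 0 := by omega
      refine ⟨(0, res (mon s)), ?_⟩
      rw [pairFun_apply, ← hinc s h0', var_mul_mon, h0']
      simp
  · exact ⟨0, by simp⟩
  · rintro a b _ _ ⟨u, rfl⟩ ⟨v, rfl⟩; exact ⟨u + v, (map_add _ _ _).symm⟩
  · rintro c a _ ⟨u, rfl⟩; exact ⟨c • u, (map_smul _ _ _).symm⟩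

/-- The generating function is recovered from values on coordinates: M_f(ξ_i) = ∂_{q_i}f and M_f(τ)
= f + ∑ q_i ∂_{q_i}f. -/
theorem contactField_injective {f g : DivPow K (CVar n)} (h : contactField f = contactField g) :
    f = g := by
  -- Characteristic 2 is not assumed here; the correction by twice the sum makes the identity valid
  -- over any field.
  have e : ∀ f : DivPow K (CVar n), f = contactField f tau +
      ∑ i, var (Sum.inl (Sum.inl i)) * contactField f (var (Sum.inl (Sum.inr i))) -
        2 * ∑ i, var (Sum.inl (Sum.inl i)) * dQ i f := by
    intro f
    have hX : ∀ i, dX i (tau : DivPow K (CVar n)) = var (Sum.inl (Sum.inl i)) := fun i => by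
      rw [dX_apply, pd_var_ne (by simp), pd_var_same]; ring
    have hQ : ∀ i, dQ i (tau : DivPow K (CVar n)) = 0 := fun i => pd_var_ne (by simp)
    have hX' : ∀ i j, dX i (var (Sum.inl (Sum.inr j)) : DivPow K (CVar n)) =
        if i = j then 1 else 0 := fun i j => by
      rw [dX_apply, pd_var_ne (i := Sum.inr ()) (by simp)]
      by_cases h : i = j
      · subst h; rw [pd_var_same, if_pos rfl]; ring
      · rw [pd_var_ne (by simpa using h), if_neg h]; ring
    have hQ' : ∀ i j, dQ i (var (Sum.inl (Sum.inr j)) : DivPow K (CVar n)) = 0 :=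
      fun i j => pd_var_ne (by simp)
    have hT' : ∀ j, dTau (var (Sum.inl (Sum.inr j)) : DivPow K (CVar n)) = 0 :=
      fun j => pd_var_ne (by simp)
    simp only [contactField, genField_apply, dTau_tau, hX, hQ, hX', hQ', hT']
    simp only [mul_one, mul_zero, add_zero, zero_add, mul_ite, Finset.sum_ite_eq',
      Finset.mem_univ, if_true]
    simp only [mul_comm (dQ _ f)]
    ring
  have hd : ∀ i, dQ i f = dQ i g := by
    intro i
    have h1 : ∀ f : DivPow K (CVar n), contactField f (var (Sum.inl (Sum.inr i))) = dQ i f := by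
      intro f
      have hX' : ∀ j, dX j (var (Sum.inl (Sum.inr i)) : DivPow K (CVar n)) =
          if j = i then 1 else 0 := fun j => by
        rw [dX_apply, pd_var_ne (i := Sum.inr ()) (by simp)]
        by_cases h : j = i
        · subst h; rw [pd_var_same, if_pos rfl]; ring
        · rw [pd_var_ne (by simpa using h), if_neg h]; ring
      have hQ' : ∀ j, dQ j (var (Sum.inl (Sum.inr i)) : DivPow K (CVar n)) = 0 :=
        fun j => pd_var_ne (by simp)
      have hT' : dTau (var (Sum.inl (Sum.inr i)) : DivPow K (CVar n)) = 0 := pd_var_ne (by simp)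
      rw [contactField, genField_apply, hT']
      simp [hX', hQ']
    rw [← h1, h, h1]
  rw [e f, e g, h]
  simp only [hd]

/-- The bracket of the generating functions `f_0 + τ f_1`. -/
def poBr (u v : QXi K n × QXi K n) : QXi K n × QXi K n :=
  (pb u.1 v.1 + (u.1 + euler u.1) * v.2 + u.2 * (v.1 + euler v.1),
    pb u.1 v.2 + pb u.2 v.1 + euler (u.2 * v.2))

/-- The summands q_i∂_τ of the frame, applied to τf_1, contribute E(f_1) to the part without τ. This
is how E enters the defining equation. -/
theorem deltaM_pairFun (u : QXi K n × QXi K n) :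
    deltaM (pairFun u) = pairFun (lap u.1 + euler u.2, lap u.2) := by
  simp only [deltaM, dQ_pairFun, dX_pairFun]
  rw [← map_sum]
  congr 1
  refine Prod.ext ?_ ?_
  · rw [Prod.fst_sum, euler_apply, delta_apply, ← Finset.sum_add_distrib]
  · rw [Prod.snd_sum]; exact (delta_apply _).symm

variable [CharP K 2]

theorem pairFun_mul (u v : QXi K n × QXi K n) :
    pairFun u * pairFun v = pairFun (u.1 * v.1, u.1 * v.2 + u.2 * v.1) := by
  have ht : (tau * tau : DivPow K (CVar n)) = 0 := var_mul_var _
  simp only [pairFun_apply, map_add, map_mul]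
  linear_combination (inc u.2 * inc v.2) * ht

/-- The contact bracket is expanded using τ² = 0; the summands q_i∂_τ of the frame collect into E.
-/
theorem genBracket_pairFun (u v : QXi K n × QXi K n) :
    genBracket dTau dQ dX (pairFun u) (pairFun v) = pairFun (poBr u v) := by
  have hT : ∀ u : QXi K n × QXi K n, dTau (pairFun u) = pairFun (u.2, 0) := fun u => by
    rw [dTau_pairFun, pairFun_apply]; simp
  simp only [genBracket, hT, dQ_pairFun, dX_pairFun, pairFun_mul, ← map_add, ← map_sum]
  congr 1
  refine Prod.ext ?_ ?_
  · simp only [Prod.fst_add, Prod.fst_sum, poBr, euler_apply, buttin_apply]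
    have : ∑ i, (dq i u.1 * (dxi i v.1 + qv i * v.2) + (dxi i u.1 + qv i * u.2) * dq i v.1) =
        ∑ i, (dq i u.1 * dxi i v.1 + dxi i u.1 * dq i v.1) + (∑ i, qv i * dq i u.1) * v.2 +
          u.2 * ∑ i, qv i * dq i v.1 := by
      rw [Finset.sum_mul, Finset.mul_sum, ← Finset.sum_add_distrib, ← Finset.sum_add_distrib]
      exact Finset.sum_congr rfl fun i _ => by ring
    rw [this]; ring
  · simp only [Prod.snd_add, Prod.snd_sum, poBr, Derivation.leibniz, smul_eq_mul, euler_apply,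
      buttin_apply, Finset.mul_sum, ← Finset.sum_add_distrib, mul_zero, zero_add]
    have h0 : u.2 * v.2 + v.2 * u.2 = 0 := by rw [mul_comm v.2]; exact two_eq_zero _
    rw [h0, zero_add]
    exact Finset.sum_congr rfl fun i _ => by ring

/-- The generating functions of `po_{a,b}`. -/
def poV (a b : K) (N : Fin n → ℕ∞) : Submodule K (QXi K n × QXi K n) where
  carrier := {u | u.1 ∈ trunc (shearLe N) ∧ u.2 ∈ trunc (shearLe N) ∧
    b • u.2 + a • (lap u.1 + euler u.2) = 0 ∧ a • lap u.2 = 0}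
  add_mem' := by
    rintro u v ⟨h1, h2, h3, h4⟩ ⟨k1, k2, k3, k4⟩
    refine ⟨Submodule.add_mem _ h1 k1, Submodule.add_mem _ h2 k2, ?_, ?_⟩
    · rw [Prod.snd_add, Prod.fst_add, map_add, map_add]
      calc _ = (b • u.2 + a • (lap u.1 + euler u.2)) + (b • v.2 + a • (lap v.1 + euler v.2)) := by
            module
        _ = 0 := by rw [h3, k3, add_zero]
    · rw [Prod.snd_add, map_add, smul_add, h4, k4, add_zero]
  zero_mem' := by
    refine ⟨Submodule.zero_mem _, Submodule.zero_mem _, ?_, ?_⟩ <;> simp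
  smul_mem' := by
    rintro c u ⟨h1, h2, h3, h4⟩
    refine ⟨Submodule.smul_mem _ _ h1, Submodule.smul_mem _ _ h2, ?_, ?_⟩
    · rw [Prod.smul_snd, Prod.smul_fst, map_smul, Derivation.map_smul]
      calc _ = c • (b • u.2 + a • (lap u.1 + euler u.2)) := by module
        _ = 0 := by rw [h3, smul_zero]
    · rw [Prod.smul_snd, map_smul, smul_comm, h4, smul_zero]

theorem mem_poV {a b : K} {u : QXi K n × QXi K n} : u ∈ poV a b N ↔ u.1 ∈ trunc (shearLe N) ∧
    u.2 ∈ trunc (shearLe N) ∧ b • u.2 + a • (lap u.1 + euler u.2) = 0 ∧ a • lap u.2 = 0 := Iff.rfl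

theorem poV_iff {a b : K} {u : QXi K n × QXi K n} : u ∈ poV a b N ↔
    pairFun u ∈ trunc (shearPo N) ∧ b • dTau (pairFun u) + a • deltaM (pairFun u) = 0 := by
  have hT : dTau (pairFun u) = pairFun (u.2, 0) := by
    rw [dTau_pairFun, pairFun_apply]; simp
  rw [mem_poV, mem_shearPo_iff, hT, deltaM_pairFun, ← map_smul pairFun, ← map_smul pairFun,
    ← map_add, map_eq_zero_iff _ pairFun_injective, and_assoc]
  refine and_congr_right fun _ => and_congr_right fun _ => ?_
  rw [Prod.ext_iff]
  simp

theorem contactField_mem {a b : K} {u : QXi K n × QXi K n} (hu : u ∈ poV a b N) :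
    contactField (pairFun u) ∈ poAlg a b N :=
  ⟨_, (poV_iff.1 hu).1, (poV_iff.1 hu).2, rfl⟩

/-- The parametrization of `po_{a,b}` by generating functions. -/
def poMap (a b : K) (N : Fin n → ℕ∞) : poV a b N →ₗ[K] poAlg a b N where
  toFun u := ⟨contactField (pairFun u.1), contactField_mem u.2⟩
  map_add' u v := Subtype.ext (by
    change contactField (pairFun (u.1 + v.1)) = _
    rw [map_add]; exact genField_add _ _)
  map_smul' c u := Subtype.ext (by
    change contactField (pairFun (c • u.1)) = _
    rw [map_smul]; exact genField_smul c _)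

theorem poMap_injective {a b : K} {u v : poV a b N} (h : poMap a b N u = poMap a b N v) : u = v :=
  Subtype.ext (pairFun_injective (contactField_injective (congrArg Subtype.val h)))

theorem isModel_po (a b : K) (N : Fin n → ℕ∞) : IsModel (poV a b N) (poMap a b N) poBr := by
  have hs : Function.Surjective (poMap a b N) := by
    rintro ⟨_, f, hf, hf', rfl⟩
    obtain ⟨u, rfl⟩ := exists_pairFun hf
    exact ⟨⟨u, poV_iff.2 ⟨hf, hf'⟩⟩, rfl⟩
  refine ⟨hs, fun u v => ?_⟩
  have e : (⁅poMap a b N u, poMap a b N v⁆ : poAlg a b N).1 =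
      contactField (pairFun (poBr u.1 v.1)) := by
    rw [← genBracket_pairFun]
    exact lie_genField isFrame_po _ _
  -- That `poBr` preserves the equations is not computed: the bracket lies in `poAlg`, so it has
  -- some generating function satisfying them, and generating functions are unique.
  obtain ⟨w, hw⟩ := hs ⁅poMap a b N u, poMap a b N v⁆
  have hw' : poBr u.1 v.1 = w.1 := by
    refine (pairFun_injective (contactField_injective ?_)).symm
    rw [← e, ← hw]; rfl
  exact ⟨hw' ▸ w.2, Subtype.ext e⟩

end PoModel

end

section

open DivPow

/-! ### The case a = 0 and the exact sequence over le(n; N) -/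

section PoZero

variable {K : Type*} [Field K] {n : ℕ} {N : Fin n → ℕ∞} [CharP K 2]

theorem mem_poV_zero {b : K} (hb : b ≠ 0) {u : QXi K n × QXi K n} :
    u ∈ poV 0 b N ↔ u.1 ∈ trunc (shearLe N) ∧ u.2 = 0 := by
  rw [mem_poV]
  simp only [zero_smul, add_zero, smul_eq_zero, hb, false_or, and_true]
  refine and_congr_right fun _ => ⟨fun h => h.2, fun h => ⟨?_, h⟩⟩
  rw [h]; exact Submodule.zero_mem _

/-- Dividing by a leaves the single parameter c = b/a and the equation Δf_0 = (c + E)f_1, on which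
all cases with a ≠ 0 are based. -/
theorem mem_poV_of_ne {a b : K} (ha : a ≠ 0) {u : QXi K n × QXi K n} :
    u ∈ poV a b N ↔ u.1 ∈ trunc (shearLe N) ∧ u.2 ∈ trunc (shearLe N) ∧
      lap u.1 = (b / a) • u.2 + euler u.2 ∧ lap u.2 = 0 := by
  rw [mem_poV]
  refine and_congr_right fun _ => and_congr_right fun _ => ?_
  refine and_congr ⟨fun h => ?_, fun h => ?_⟩ (by simp [ha])
  · have h1 : (b / a) • u.2 + (lap u.1 + euler u.2) = 0 := by
      have := congrArg (a⁻¹ • ·) h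
      simpa [smul_add, smul_smul, ha, div_eq_inv_mul] using this
    linear_combination h1 - two_eq_zero ((b / a) • u.2 + euler u.2)
  · have h1 : b • u.2 = a • ((b / a) • u.2) := by rw [smul_smul, mul_div_cancel₀ b ha]
    rw [h, h1, ← smul_add]
    have : (b / a) • u.2 + ((b / a) • u.2 + euler u.2 + euler u.2) = 0 := by
      linear_combination two_eq_zero ((b / a) • u.2) + two_eq_zero (euler u.2)
    rw [this, smul_zero]

/-- For a = 0 the equation forces f_1 = 0, so the contact bracket reduces to the Buttin bracket of
f_0; passing to Le_f loses exactly the constants. -/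
theorem poAlg_zero_exact {b : K} (hb : b ≠ 0) :
    ∃ π : poAlg 0 b N →ₗ⁅K⁆ leAlg (K := K) N, Function.Surjective π ∧
      (∀ D : poAlg 0 b N, π D = 0 ↔
        (D : Derivation K (DivPow K (CVar n)) (DivPow K (CVar n))) ∈
          Submodule.span K {contactField 1}) ∧
      ∀ f ∈ DivPow.trunc (shearLe N), ∃ h : contactField (inclTau f) ∈ poAlg 0 b N,
        ((π ⟨_, h⟩).1 : Derivation K (DivPow K (Fin n ⊕ Fin n)) (DivPow K (Fin n ⊕ Fin n))) =
          hamField f := by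
  obtain ⟨M, hm, hM⟩ := isModel_le (K := K) N
  have hp := isModel_po (0 : K) b N
  let e : poV 0 b N ≃ₗ[K] poAlg 0 b N :=
    LinearEquiv.ofBijective (poMap 0 b N) ⟨fun _ _ => poMap_injective, hp.surj⟩
  let r : poV 0 b N →ₗ[K] (trunc (shearLe N) : Submodule K (QXi K n)) :=
    ((LinearMap.fst K _ _).comp (poV 0 b N).subtype).codRestrict _ fun u => ((mem_poV_zero hb).1 u.2).1
  let π₀ : poAlg 0 b N →ₗ[K] leAlg (K := K) N := M ∘ₗ r ∘ₗ e.symm.toLinearMap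
  have hπ : ∀ u, π₀ (poMap 0 b N u) = M (r u) := fun u => by
    change M (r (e.symm (e u))) = _
    rw [e.symm_apply_apply]
  have hlie : ∀ x y, π₀ ⁅x, y⁆ = ⁅π₀ x, π₀ y⁆ := by
    intro x y
    obtain ⟨u, rfl⟩ := hp.surj x
    obtain ⟨v, rfl⟩ := hp.surj y
    obtain ⟨h1, e1⟩ := hp.lie u v
    obtain ⟨h2, e2⟩ := hm.lie (r u) (r v)
    rw [e1, hπ, hπ, hπ, e2]
    refine congrArg M (Subtype.ext ?_)
    change (poBr u.1 v.1).1 = pb u.1.1 v.1.1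
    rw [poBr, ((mem_poV_zero hb).1 u.2).2, ((mem_poV_zero hb).1 v.2).2]
    simp
  have hmem : ∀ f ∈ (trunc (shearLe N) : Submodule K (QXi K n)), (f, 0) ∈ poV 0 b N :=
    fun f hf => (mem_poV_zero hb).2 ⟨hf, rfl⟩
  have hfun : ∀ f : QXi K n, pairFun (f, 0) = inc f := fun f => by rw [pairFun_apply]; simp
  refine ⟨{ π₀ with map_lie' := hlie _ _ }, ?_, ?_, ?_⟩
  · intro y
    obtain ⟨f, rfl⟩ := hm.surj y
    exact ⟨poMap 0 b N ⟨_, hmem f f.2⟩, hπ _⟩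
  · intro D
    obtain ⟨u, rfl⟩ := hp.surj D
    change π₀ (poMap 0 b N u) = 0 ↔ _
    rw [hπ]
    have h2 : u.1.2 = 0 := ((mem_poV_zero hb).1 u.2).2
    have hu : pairFun u.1 = inc u.1.1 := by
      rw [pairFun_apply, h2, map_zero, mul_zero, add_zero]
    have h3 : M (r u) = 0 ↔ ∀ z, pd z u.1.1 = 0 := by
      rw [← hamField_eq_zero_iff]
      exact ⟨fun h => (hM (r u)).symm.trans (by rw [h]; rfl), fun h => Subtype.ext ((hM (r u)).trans h)⟩
    rw [h3, Submodule.mem_span_singleton]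
    constructor
    · intro h
      refine ⟨coeff 0 u.1.1, ?_⟩
      change _ = contactField (pairFun u.1)
      have h4 : inc u.1.1 = coeff 0 u.1.1 • (1 : DivPow K (CVar n)) := by
        conv_lhs => rw [eq_smul_one_of_pd_eq_zero h, map_smul, map_one]
      rw [hu, h4]
      exact (genField_smul _ _).symm
    · rintro ⟨c, hc⟩ z
      have h4 : inc u.1.1 = c • (1 : DivPow K (CVar n)) := by
        refine contactField_injective ?_
        rw [← hu]
        exact hc.symm.trans (genField_smul c (1 : DivPow K (CVar n))).symm
      have h5 : u.1.1 = c • (1 : QXi K n) := by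
        have := congrArg res h4
        rwa [res_inc, map_smul, map_one] at this
      rw [h5, Derivation.map_smul, Derivation.map_one_eq_zero, smul_zero]
  · intro f hf
    have h := contactField_mem (hmem f hf)
    rw [hfun] at h
    refine ⟨h, ?_⟩
    have : (⟨contactField (inclTau f), h⟩ : poAlg 0 b N) = poMap 0 b N ⟨_, hmem f hf⟩ := by
      refine Subtype.ext ?_
      change contactField (inc f) = contactField (pairFun (f, 0))
      rw [hfun]
    rw [this]
    change (π₀ (poMap 0 b N ⟨_, hmem f hf⟩)).1 = _
    rw [hπ, hM]
    rfl

end PoZero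

end

section

open DivPow

/-! ### Generic a/b: the algebra of all functions of q, ξ with a deformed bracket -/

section PoGeneric

variable {K : Type*} [Field K] {n : ℕ} {N : Fin n → ℕ∞}

/-- The operator `(c + E)⁻¹ Δ` for `c ≠ 0, 1`. -/
def genT (c : K) : QXi K n →ₗ[K] QXi K n :=
  (c * (c + 1))⁻¹ • ((c + 1) • lap + (euler (K := K) (n := n) : QXi K n →ₗ[K] QXi K n) ∘ₗ lap)

theorem genT_apply (c : K) (f : QXi K n) :
    genT c f = (c * (c + 1))⁻¹ • ((c + 1) • lap f + euler (lap f)) := rfl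

theorem genT_of_lap_eq_zero (c : K) {f : QXi K n} (h : lap f = 0) : genT c f = 0 := by
  rw [genT_apply, h]; simp

variable [CharP K 2]

theorem add_one_ne_zero_of_ne {c : K} (h1 : c ≠ 1) : c + 1 ≠ 0 :=
  fun h => h1 (CharTwo.add_eq_zero.1 h)

/-- From E² = E in characteristic 2 one gets (c + E)(c + 1 + E) = c(c + 1), so `genT` solves (c +
E)T = Δ. -/
theorem euler_genT {c : K} (h0 : c ≠ 0) (h1 : c ≠ 1) (f : QXi K n) :
    euler (genT c f) = lap f + c • genT c f := by
  have hk : c * (c + 1) ≠ 0 := mul_ne_zero h0 (add_one_ne_zero_of_ne h1)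
  rw [genT_apply, Derivation.map_smul, map_add, Derivation.map_smul, euler_euler, smul_comm c,
    ← smul_right_injective _ hk |>.eq_iff]
  simp only [smul_add, smul_smul, mul_inv_cancel_left₀ hk, mul_inv_cancel₀ hk, one_smul]
  linear_combination (norm := module) two_eq_zero (euler (lap f)) - two_eq_zero ((c * (c + 1)) • lap f)

/-- As c + E is invertible, f_1 is determined by f_0. The remaining condition Δf_1 = 0 is automatic,
because Δ² = 0 and Δ commutes with E up to Δ. -/
theorem mem_poV_generic {a b : K} (ha : a ≠ 0) (hb : b ≠ 0) (hab : a ≠ b)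
    {u : QXi K n × QXi K n} :
    u ∈ poV a b N ↔ u.1 ∈ trunc (shearLe N) ∧ u.2 = genT (b / a) u.1 := by
  have h0 : b / a ≠ 0 := div_ne_zero hb ha
  have h1 : b / a ≠ 1 := fun h => hab ((div_eq_one_iff_eq ha).1 h).symm
  set c := b / a with hc
  have hk : c * (c + 1) ≠ 0 := mul_ne_zero h0 (add_one_ne_zero_of_ne h1)
  rw [mem_poV_of_ne ha, ← hc]
  refine and_congr_right fun hu => ⟨fun ⟨_, h3, _⟩ => ?_, fun h => ?_⟩
  · rw [genT_apply, h3, ← smul_right_injective _ hk |>.eq_iff, smul_smul, mul_inv_cancel₀ hk,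
      one_smul, map_add, Derivation.map_smul, euler_euler, smul_add, smul_smul, mul_comm]
    have e : (c + 1) • euler u.2 + (c • euler u.2 + euler u.2) = 0 := by
      linear_combination (norm := module) two_eq_zero ((c + 1) • euler u.2)
    linear_combination (norm := module) - e
  · rw [h, euler_genT h0 h1]
    refine ⟨?_, ?_, ?_⟩
    · rw [genT_apply]
      exact Submodule.smul_mem _ _ (Submodule.add_mem _ (Submodule.smul_mem _ _ (lap_mem hu))
        (euler_mem (lap_mem hu)))
    · linear_combination (norm := module) - two_eq_zero (c • genT c u.1)
    · have h2 := lap_lap hu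
      have h3 := euler_lap (lap u.1)
      rw [h2, map_zero, add_zero] at h3
      rw [genT_apply, map_smul, map_add, map_smul, h2, ← h3, smul_zero, add_zero, smul_zero]

/-- The bracket of generating functions for generic `a / b`. -/
def brG (c : K) (f g : QXi K n) : QXi K n :=
  pb f g + (f + euler f) * genT c g + genT c f * (g + euler g)

theorem isModel_generic {a b : K} (ha : a ≠ 0) (hb : b ≠ 0) (hab : a ≠ b) :
    ∃ M : (trunc (shearLe N) : Submodule K (QXi K n)) →ₗ[K] poAlg a b N,
      IsModel (trunc (shearLe N)) M (brG (b / a)) ∧ Function.Injective M := by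
  have hp := isModel_po a b N
  have hmem : ∀ f : (trunc (shearLe N) : Submodule K (QXi K n)),
      ((LinearMap.id.prod (genT (b / a))).comp (trunc (shearLe N)).subtype) f ∈ poV a b N :=
    fun f => (mem_poV_generic ha hb hab).2 ⟨f.2, rfl⟩
  let r := ((LinearMap.id.prod (genT (b / a))).comp (trunc (shearLe N)).subtype).codRestrict _ hmem
  have hr : ∀ u : poV a b N, ∃ f, r f = u := fun u =>
    ⟨⟨u.1.1, ((mem_poV_generic ha hb hab).1 u.2).1⟩,
      Subtype.ext (Prod.ext rfl ((mem_poV_generic ha hb hab).1 u.2).2.symm)⟩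
  refine ⟨(poMap a b N).comp r, ⟨?_, ?_⟩, ?_⟩
  · intro D
    obtain ⟨u, rfl⟩ := hp.surj D
    obtain ⟨f, rfl⟩ := hr u
    exact ⟨f, rfl⟩
  · intro f g
    obtain ⟨h, e⟩ := hp.lie (r f) (r g)
    have h' := (mem_poV_generic ha hb hab).1 h
    refine ⟨h'.1, e.trans (congrArg (poMap a b N) (Subtype.ext (Prod.ext rfl h'.2)))⟩
  · intro f g h
    exact Subtype.ext (congrArg (fun u : poV a b N => u.1.1) (poMap_injective h))

open Classical in
/-- The generating functions of the derived algebra for generic `a / b`. -/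
def genW (K : Type*) [Field K] [CharP K 2] (N : Fin n → ℕ∞) : Submodule K (QXi K n) :=
  if Odd n then truncTop K N else trunc (shearLe N)

theorem genW_odd (h : Odd n) : genW K N = truncTop K N := if_pos h

theorem genW_even (h : ¬ Odd n) : genW K N = trunc (shearLe N) := if_neg h

theorem truncTop_le_genW : truncTop K N ≤ genW K N := by
  rw [genW]
  split_ifs
  · exact le_rfl
  · exact inf_le_left

theorem genW_le : genW K N ≤ trunc (shearLe N) := by
  rw [genW]
  split_ifs
  · exact inf_le_left
  · exact le_rfl

/-- With the highest coefficient as integral, both Δ and T are self-adjoint for odd n. After E is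
moved across and ET = Δ + cT is substituted, the terms symmetric in f and g cancel. -/
theorem topCoeff_brG {c : K} (h0 : c ≠ 0) (h1 : c ≠ 1) (hN : ∀ i, N i ≠ 0) (hodd : Odd n)
    {f g : QXi K n} (hf : f ∈ trunc (shearLe N)) (hg : g ∈ trunc (shearLe N)) :
    topCoeff N (brG c f g) = 0 := by
  have hn1 : (n : K) = 1 := natCast_odd (Nat.odd_iff.1 hodd)
  have two : (2 : K) = 0 := CharTwo.two_eq_zero
  -- For n odd the highest monomial has odd q-degree, so E preserves the highest coefficient; the
  -- Leibniz rule for E then gives the formula.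
  have hE : ∀ x y : QXi K n, topCoeff N (euler x * y) = topCoeff N (x * y) +
      topCoeff N (x * euler y) := by
    intro x y
    have := topCoeff_euler hN (x * y)
    rw [Derivation.leibniz, smul_eq_mul, smul_eq_mul, map_add, hn1, one_mul, mul_comm y] at this
    linear_combination this - topCoeff N (x * euler y) * two
  -- Self-adjointness of T, obtained from that of Δ and the rule `hE`.
  have hX : topCoeff N (f * genT c g) + topCoeff N (g * genT c f) = 0 := by
    simp only [genT_apply, mul_smul_comm, map_smul, mul_add, map_add, smul_eq_mul]
    have e1 := topCoeff_mul_lap hf hg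
    have e2 := topCoeff_mul_lap hf (euler_mem hg)
    have e3 := hE g (lap f)
    have e4 : topCoeff N (f * euler (lap g)) = topCoeff N (f * lap (euler g)) +
        topCoeff N (f * lap g) := by rw [euler_lap, mul_add, map_add]
    linear_combination (c * (c + 1))⁻¹ * ((c + 1) * e1 + e4 + e2 + e3 + e1 +
      ((c + 1) * topCoeff N (g * lap f) + topCoeff N (g * euler (lap f)) +
        topCoeff N (g * lap f)) * two)
  rw [brG, map_add, map_add, topCoeff_pb hf hg, add_mul, mul_add, map_add, map_add,
    mul_comm _ (euler g), hE, hE, mul_comm _ g, euler_genT h0 h1, euler_genT h0 h1, mul_add, mul_add,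
    mul_smul_comm, mul_smul_comm, map_add, map_add, map_smul, map_smul, smul_eq_mul, smul_eq_mul]
  have e1 := topCoeff_mul_lap hf hg
  linear_combination c * hX + e1 + (topCoeff N (f * genT c g) + topCoeff N (g * genT c f) +
    topCoeff N (g * lap f)) * two

theorem brG_one (c : K) (g : QXi K n) : brG c 1 g = genT c g := by
  rw [brG, genT_of_lap_eq_zero c lap_one, buttin_one_left, Derivation.map_one_eq_zero]; ring

theorem brG_qv (c : K) (i : Fin n) (g : QXi K n) : brG c (qv i) g = dxi i g := by
  rw [brG, genT_of_lap_eq_zero c (lap_qv i), pb_qv, euler_qv, two_eq_zero]; ring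

theorem brG_xv (c : K) (i : Fin n) (g : QXi K n) : brG c (xv i) g = dq i g + xv i * genT c g := by
  rw [brG, genT_of_lap_eq_zero c (lap_xv i), pb_xv, euler_xv]; ring

theorem genT_weight {c : K} (h1 : c ≠ 1) (i : Fin n) :
    genT c (qv i * xv i : QXi K n) = c⁻¹ • (1 : QXi K n) := by
  rw [genT_apply, lap_qv_mul_xv_same, Derivation.map_one_eq_zero, add_zero, smul_smul, mul_inv,
    mul_assoc, inv_mul_cancel₀ (add_one_ne_zero_of_ne h1), mul_one]

theorem euler_weight (i : Fin n) : euler (qv i * xv i : QXi K n) = qv i * xv i := by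
  rw [Derivation.leibniz, euler_qv, euler_xv, smul_zero, zero_add, smul_eq_mul, mul_comm]

/-- The Buttin eigenvalue of q_iξ_i acquires the term c⁻¹(1 + q-degree), because T(q_iξ_i) = c⁻¹
while q_iξ_i is fixed by E. -/
theorem brG_weight {c : K} (h1 : c ≠ 1) (i : Fin n) (r : Fin n ⊕ Fin n →₀ ℕ) :
    brG c (qv i * xv i) (mon r : QXi K n) =
      (((r (Sum.inl i) + r (Sum.inr i) : ℕ) : K) + c⁻¹ * (1 + (qdeg r : K))) • mon r := by
  rw [brG, pb_weight, euler_weight, two_eq_zero, zero_mul, add_zero, genT_weight h1, euler_mon,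
    smul_mul_assoc, one_mul]
  module

theorem brG_comm (c : K) (f g : QXi K n) : brG c f g = brG c g f := by
  rw [brG, brG, buttin_symm]; ring

theorem euler_lap_mon (r : Fin n ⊕ Fin n →₀ ℕ) :
    euler (lap (mon r : QXi K n)) = ((qdeg r : K) + 1) • lap (mon r) := by
  rw [euler_lap, euler_mon, map_smul, add_smul, one_smul]

theorem genT_mon (c : K) (r : Fin n ⊕ Fin n →₀ ℕ) :
    genT c (mon r : QXi K n) = ((c * (c + 1))⁻¹ * (c + qdeg r)) • lap (mon r) := by
  rw [genT_apply, euler_lap_mon, ← add_smul, smul_smul]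
  congr 2
  linear_combination (1 : K) * (CharTwo.two_eq_zero : (2 : K) = 0)

theorem qdeg_cases (r : Fin n ⊕ Fin n →₀ ℕ) : (qdeg r : K) = 0 ∨ (qdeg r : K) = 1 := by
  rcases Nat.mod_two_eq_zero_or_one (qdeg r) with h | h
  · exact Or.inl (natCast_even h)
  · exact Or.inr (natCast_odd h)

theorem xv_mul_mon {i : Fin n} {r : Fin n ⊕ Fin n →₀ ℕ} (h : r (Sum.inr i) = 1) :
    (xv i * mon r : QXi K n) = 0 := by
  rw [xv, var_mul_mon, h, natCast_even (by norm_num), zero_smul]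

/-- Apply Δ to the relation ξ_i u^(r) = 0, which holds because ξ_i² = 0. -/
theorem xv_mul_lap_mon {i : Fin n} {r : Fin n ⊕ Fin n →₀ ℕ} (h : r (Sum.inr i) = 1) :
    (xv i * lap (mon r) : QXi K n) = dq i (mon r) := by
  have := lap_xv_mul i (mon r : QXi K n)
  rw [xv_mul_mon h, map_zero] at this
  linear_combination - this - two_eq_zero (dq i (mon r) : QXi K n)

omit [CharP K 2] in
theorem admissible_add_inr {r : Fin n ⊕ Fin n →₀ ℕ} (hr : Admissible (shearLe N) r)
    (hN : ∀ i, N i ≠ 0) {i : Fin n} (h : r (Sum.inr i) = 0) :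
    Admissible (shearLe N) (r + unitExp (Sum.inr i)) :=
  (admissible_add_or hr hN (Sum.inr i)).resolve_right fun ⟨_, _, _, h'⟩ => by omega

omit [CharP K 2] in
theorem exists_admissible_add_inl {r : Fin n ⊕ Fin n →₀ ℕ} (hr : Admissible (shearLe N) r)
    (hN : ∀ i, N i ≠ 0) (h : ∀ i, r (Sum.inr i) = 1) (hT : ¬ IsTopExp N r) :
    ∃ i, Admissible (shearLe N) (r + unitExp (Sum.inl i)) := by
  by_contra hc
  push Not at hc
  refine hT (isTop_of_not_admissible hr hN fun z => ?_)
  rcases z with i | i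
  · exact hc i
  · intro hA
    have := apply_inr_le hA i
    rw [Finsupp.add_apply, unitExp_same, h i] at this
    omega

theorem triple_mem_truncTop (hN : ∀ i, N i ≠ 0) {i j : Fin n} (hij : j ≠ i)
    (z : Fin n ⊕ Fin n) (hz : z = Sum.inl i ∨ z = Sum.inr i) :
    (var z * (qv j * xv j) : QXi K n) ∈ truncTop K N := by
  refine mem_truncTop_of_pd hN (mul_mem_trunc (var_mem_shear hN _)
    (mul_mem_trunc (var_mem_shear hN _) (var_mem_shear hN _))) z.swap ?_
  have e1 : pd z.swap (qv j * xv j : QXi K n) = 0 := by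
    refine pd_pair_eq_zero ?_ ?_ <;> rcases hz with rfl | rfl <;> simp [hij.symm]
  rw [Derivation.leibniz, e1, pd_var_ne (swap_ne z)]
  simp

/-- Descent to 1, then T(cubics) gives the indeterminates and ξ-derivatives of cubics give the
weight elements. Each monomial is obtained by raising ξ_i and differentiating, or by raising q_i and
applying ∂_{q_i} + ξ_iT. The weights handle the highest monomial, for even n, and the exponents
whose raising would reach it, for odd n. -/
theorem generic_ideal {c : K} (h0 : c ≠ 0) (h1 : c ≠ 1) (hn : 2 ≤ n) (hN : ∀ i, N i ≠ 0)
    (I : Submodule K (QXi K n)) (hne : ∃ f ∈ I, f ≠ 0)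
    (hI : ∀ w ∈ genW K N, ∀ u ∈ I, brG c w u ∈ I) : genW K N ≤ I := by
  have hc1 := add_one_ne_zero_of_ne h1
  have hk : c * (c + 1) ≠ 0 := mul_ne_zero h0 hc1
  have hvar : ∀ z, (var z : QXi K n) ∈ genW K N := fun z => by
    obtain ⟨x, hx, -⟩ := exists_ne_pair hn z z
    exact truncTop_le_genW (mem_truncTop_of_pd hN (var_mem_shear hN z) x (pd_var_ne hx))
  have hpair : ∀ y z, (var y * var z : QXi K n) ∈ genW K N := fun y z =>
    truncTop_le_genW (var_mul_var_mem_truncTop hn hN y z)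
  -- the constants belong to `I`
  have hone : (1 : QXi K n) ∈ I := by
    obtain ⟨f, hf, hf0, hfx⟩ := exists_last (J := Set.range Sum.inr) (p := fun f => f ∈ I)
      (q := fun f => f ≠ 0) (by simp) (by
        rintro f hf _ ⟨i, rfl⟩
        rw [← brG_qv c]
        exact hI _ (hvar _) f hf) hne
    have hfx' : ∀ i, dxi i f = 0 := fun i => not_not.1 (hfx _ ⟨i, rfl⟩)
    -- The ξ-derivatives are exhausted first: on functions free of ξ the operator T vanishes, so
    -- only there does the bracket with ξ_i act as ∂_{q_i}.
    obtain ⟨g, ⟨hg, hgx⟩, hg0, hgq⟩ := exists_last (J := Set.range Sum.inl)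
      (p := fun f => f ∈ I ∧ ∀ i, dxi i f = 0) (q := fun f => f ≠ 0) (by simp) (by
        rintro f ⟨hf, hfx⟩ _ ⟨i, rfl⟩
        refine ⟨?_, fun j => by rw [pd_comm, hfx, map_zero]⟩
        have := hI _ (hvar (Sum.inr i)) f hf
        rwa [brG_xv, genT_of_lap_eq_zero c, mul_zero, add_zero] at this
        rw [delta_apply]
        exact Finset.sum_eq_zero fun j _ => by rw [pd_comm, hfx, map_zero]) ⟨f, ⟨hf, hfx'⟩, hf0⟩
    have e := eq_smul_one_of_pd_eq_zero (f := g) fun z => by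
      rcases z with i | i
      · exact not_not.1 (hgq _ ⟨i, rfl⟩)
      · exact hgx i
    rw [e] at hg
    refine (I.smul_mem_iff fun h => hg0 ?_).1 hg
    rw [e, h, zero_smul]
  have hT : ∀ g ∈ genW K N, genT c g ∈ I := fun g hg => by
    rw [← brG_one, brG_comm]; exact hI g hg _ hone
  have hq : ∀ i, (qv i : QXi K n) ∈ I := fun i => by
    obtain ⟨j, hj⟩ := exists_ne_fin hn i
    have := hT _ (truncTop_le_genW (triple_mem_truncTop hN hj (Sum.inl i) (Or.inl rfl)))
    rw [genT_apply, lap_qv_mul, lap_qv_mul_xv_same, pd_pair_eq_zero (by simp) (by simpa using hj.symm),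
      mul_one, add_zero, euler_qv] at this
    -- The factor c survives here and c + 1 in the analogous computation for ξ_i; both are nonzero
    -- for generic c.
    have e : (c + 1) • qv i + qv i = c • (qv i : QXi K n) := by
      linear_combination (norm := module) two_eq_zero (qv i : QXi K n)
    rw [e, smul_smul] at this
    exact (I.smul_mem_iff (mul_ne_zero (inv_ne_zero hk) h0)).1 this
  have hx : ∀ i, (xv i : QXi K n) ∈ I := fun i => by
    obtain ⟨j, hj⟩ := exists_ne_fin hn i
    have := hT _ (truncTop_le_genW (triple_mem_truncTop hN hj (Sum.inr i) (Or.inr rfl)))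
    rw [genT_apply, lap_xv_mul, lap_qv_mul_xv_same, pd_pair_eq_zero (by simpa using hj.symm) (by simp),
      mul_one, add_zero, euler_xv, add_zero, smul_smul] at this
    exact (I.smul_mem_iff (mul_ne_zero (inv_ne_zero hk) hc1)).1 this
  have hdx : ∀ i, ∀ g ∈ genW K N, dxi i g ∈ I := fun i g hg => by
    rw [← brG_qv c, brG_comm]; exact hI g hg _ (hq i)
  have hdq : ∀ i, ∀ g ∈ genW K N, dq i g + xv i * genT c g ∈ I := fun i g hg => by
    rw [← brG_xv c, brG_comm]; exact hI g hg _ (hx i)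
  have hwt : ∀ i : Fin n, (qv i * xv i : QXi K n) ∈ I := fun i => by
    obtain ⟨j, hj⟩ := exists_ne_fin hn i
    have h4 := hdx j _ (truncTop_le_genW (triple_mem_truncTop hN hj.symm (Sum.inr j) (Or.inr rfl)))
    rwa [Derivation.leibniz, pd_var_same, pd_pair_eq_zero (by simp) (by simpa using hj), smul_zero,
      zero_add, smul_eq_mul, mul_one] at h4
  have hwt' : ∀ (i : Fin n) (r : Fin n ⊕ Fin n →₀ ℕ), mon r ∈ genW K N →
      ((r (Sum.inl i) + r (Sum.inr i) : ℕ) : K) + c⁻¹ * (1 + (qdeg r : K)) ≠ 0 →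
      (mon r : QXi K n) ∈ I := fun i r hr h => by
    have := hI _ hr _ (hwt i)
    rw [brG_comm, brG_weight h1] at this
    exact (I.smul_mem_iff h).1 this
  have hmon : ∀ r, Admissible (shearLe N) r → (Odd n → ¬ IsTopExp N r) →
      (mon r : QXi K n) ∈ genW K N := by
    intro r hr h
    by_cases hodd : Odd n
    · exact truncTop_le_genW (mon_mem_truncTop hr (h hodd))
    · rw [genW_even hodd]; exact mon_mem_trunc hr
  have main : ∀ r, Admissible (shearLe N) r → (Odd n → ¬ IsTopExp N r) →
      (mon r : QXi K n) ∈ I := by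
    intro r hr hrT
    by_cases hex : ∃ i, r (Sum.inr i) = 0
    · obtain ⟨i, hi⟩ := hex
      have hA := admissible_add_inr hr hN hi
      by_cases hs : Odd n → ¬ IsTopExp N (r + unitExp (Sum.inr i))
      · rw [← pd_mon_add (Sum.inr i) r]
        exact hdx i _ (hmon _ hA hs)
      · push Not at hs
        obtain ⟨hodd, hfin, htop⟩ := hs
        -- Raising ξ_i would reach the forbidden highest monomial. Then q_i has odd exponent, ξ_i is
        -- absent and the q-degree is odd, so the weight of q_iξ_i equals 1.
        refine hwt' i r (hmon r hr hrT) ?_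
        have e1 := congrArg (fun s : Fin n ⊕ Fin n →₀ ℕ => s (Sum.inl i)) htop
        simp only [Finsupp.add_apply] at e1
        rw [unitExp_ne (by simp)] at e1
        have := topExp_mod hfin hN (Sum.inl i)
        have e2 := qdeg_topExp (K := K) hfin hN
        rw [← htop, qdeg_add, qdeg_unitExp_inr, add_zero, natCast_odd (Nat.odd_iff.1 hodd)] at e2
        rw [natCast_odd (by omega), e2, CharTwo.add_self_eq_zero, mul_zero, add_zero]
        exact one_ne_zero
    · have hall : ∀ i, r (Sum.inr i) = 1 := fun i => by
        have := apply_inr_le hr i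
        have : r (Sum.inr i) ≠ 0 := fun h => hex ⟨i, h⟩
        omega
      let i₀ : Fin n := ⟨0, by omega⟩
      by_cases hT : IsTopExp N r
      · have heven : n % 2 = 0 := by
          have : ¬ Odd n := fun h => hrT h hT
          exact Nat.even_iff.1 (Nat.not_odd_iff_even.1 this)
        -- The highest monomial, present for even n: the Buttin weight and the q-degree are even, so
        -- the eigenvalue is c⁻¹.
        refine hwt' i₀ r (hmon r hr hrT) ?_
        have := topExp_mod hT.1 hN (Sum.inl i₀)
        rw [← hT.2] at this
        have e2 := qdeg_topExp (K := K) hT.1 hN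
        rw [← hT.2, natCast_even heven] at e2
        rw [hall, natCast_even (by omega), e2, zero_add, add_zero, mul_one]
        exact inv_ne_zero h0
      · obtain ⟨i, hA⟩ := exists_admissible_add_inl hr hN hall hT
        by_cases hs : Odd n → ¬ IsTopExp N (r + unitExp (Sum.inl i))
        · have h2 := hdq i _ (hmon _ hA hs)
          have h3 : (r + unitExp (Sum.inl i) : Fin n ⊕ Fin n →₀ ℕ) (Sum.inr i) = 1 := by
            rw [Finsupp.add_apply, unitExp_ne (by simp), hall]
          rw [genT_mon, mul_smul_comm, xv_mul_lap_mon h3, pd_mon_add] at h2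
          nth_rewrite 1 [← one_smul K (mon r : QXi K n)] at h2
          rw [← add_smul] at h2
          refine (I.smul_mem_iff ?_).1 h2
          -- The coefficient of u^(r) is (c² + d)/(c(c + 1)) with d the q-degree modulo 2; it
          -- vanishes only for c = 0 (d = 0) or c = 1 (d = 1).
          have e : 1 + (c * (c + 1))⁻¹ * (c + (qdeg (r + unitExp (Sum.inl i)) : K)) =
              (c * (c + 1))⁻¹ * (c * c + (qdeg (r + unitExp (Sum.inl i)) : K)) := by
            field_simp
            linear_combination c * (CharTwo.two_eq_zero : (2 : K) = 0)
          rw [e]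
          refine mul_ne_zero (inv_ne_zero hk) ?_
          rcases qdeg_cases (K := K) (r + unitExp (Sum.inl i)) with h | h
          · rw [h, add_zero]; exact mul_ne_zero h0 h0
          · rw [h]
            have : c * c + 1 = (c + 1) * (c + 1) := by
              linear_combination - c * (CharTwo.two_eq_zero : (2 : K) = 0)
            rw [this]; exact mul_ne_zero hc1 hc1
        · push Not at hs
          obtain ⟨hodd, hfin, htop⟩ := hs
          -- One q_i below the highest monomial with n odd: the Buttin weight is odd and the
          -- q-degree even, so the eigenvalue is 1 + c⁻¹.
          refine hwt' i r (hmon r hr hrT) ?_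
          have e1 := congrArg (fun s : Fin n ⊕ Fin n →₀ ℕ => s (Sum.inl i)) htop
          simp only [Finsupp.add_apply] at e1
          rw [unitExp_same] at e1
          have := topExp_mod hfin hN (Sum.inl i)
          have e2 := qdeg_topExp (K := K) hfin hN
          rw [← htop, qdeg_add, qdeg_unitExp_inl, Nat.cast_add, Nat.cast_one,
            natCast_odd (Nat.odd_iff.1 hodd)] at e2
          rw [hall, natCast_odd (by omega), add_comm (1 : K) (qdeg r : K), e2, mul_one]
          intro h
          apply hc1
          have := congrArg (c * ·) h
          simpa [mul_add, h0] using this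
  intro f hf
  refine mem_of_mon_mem I fun r hr => main r (mem_trunc_iff.1 (genW_le hf) r hr) fun hodd hT => hr ?_
  rw [genW_odd hodd] at hf
  have : topCoeff N f = 0 := hf.2
  rw [topCoeff, if_pos hT.1] at this
  rw [hT.2, this]

theorem brG_mem {c : K} {f g : QXi K n} (hf : f ∈ trunc (shearLe N))
    (hg : g ∈ trunc (shearLe N)) : brG c f g ∈ trunc (shearLe N) := by
  have hT : ∀ {f : QXi K n}, f ∈ trunc (shearLe N) → genT c f ∈ trunc (shearLe N) := fun hu => by
    rw [genT_apply]
    exact Submodule.smul_mem _ _ (Submodule.add_mem _ (Submodule.smul_mem _ _ (lap_mem hu))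
      (euler_mem (lap_mem hu)))
  exact Submodule.add_mem _ (Submodule.add_mem _ (pb_mem hf hg)
    (mul_mem_trunc (Submodule.add_mem _ hf (euler_mem hf)) (hT hg)))
    (mul_mem_trunc (hT hf) (Submodule.add_mem _ hg (euler_mem hg)))

theorem brG_mem_genW {c : K} (h0 : c ≠ 0) (h1 : c ≠ 1) (hN : ∀ i, N i ≠ 0) {f g : QXi K n}
    (hf : f ∈ trunc (shearLe N)) (hg : g ∈ trunc (shearLe N)) : brG c f g ∈ genW K N := by
  by_cases hodd : Odd n
  · rw [genW_odd hodd]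
    exact ⟨brG_mem hf hg, topCoeff_brG h0 h1 hN hodd hf hg⟩
  · rw [genW_even hodd]; exact brG_mem hf hg

theorem poAlg_generic (hn : 2 ≤ n) {a b : K} (hN : ∀ i, N i ≠ 0) (ha : a ≠ 0) (hb : b ≠ 0)
    (hab : a ≠ b) : LieAlgebra.IsSimple K (LieAlgebra.derivedSeries K (poAlg a b N) 1) ∧
      ((Even n ∨ ∃ i, N i = ⊤) → LieAlgebra.IsSimple K (poAlg a b N)) ∧
      (Odd n → (∀ i, N i ≠ ⊤) → Module.finrank K
        (poAlg a b N ⧸ (LieAlgebra.derivedSeries K (poAlg a b N) 1).toSubmodule) = 1) := by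
  have h0 : b / a ≠ 0 := div_ne_zero hb ha
  have h1 : b / a ≠ 1 := fun h => hab ((div_eq_one_iff_eq ha).1 h).symm
  obtain ⟨M, hm, hinj⟩ := isModel_generic (N := N) ha hb hab
  let i : Fin n := ⟨0, by omega⟩
  have hs : IsSimpleModel (trunc (shearLe N)) M (brG (b / a)) (genW K N) := by
    refine ⟨genW_le, fun u hu => ?_, fun u hu v hv => brG_mem_genW h0 h1 hN (genW_le hu) (genW_le hv),
      ?_, fun I _ _ hnz hI => ?_⟩
    · rw [(map_eq_zero_iff M hinj).1 hu]; exact Submodule.zero_mem _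
    · have h2 : (qv i : QXi K n) ∈ truncTop K N :=
        mem_truncTop_of_pd hN (qv_mem hN i) (Sum.inr i) (pd_var_ne (by simp))
      have h3 : (xv i : QXi K n) ∈ truncTop K N :=
        mem_truncTop_of_pd hN (xv_mem i) (Sum.inl i) (pd_var_ne (by simp))
      refine ⟨⟨_, h2.1⟩, ⟨_, h3.1⟩, truncTop_le_genW h2, truncTop_le_genW h3, ?_⟩
      obtain ⟨hm', e⟩ := hm.lie ⟨_, h2.1⟩ ⟨_, h3.1⟩
      rw [e, Ne, map_eq_zero_iff M hinj]
      intro hz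
      have := congrArg Subtype.val hz
      simp only [brG_qv, pd_var_same] at this
      exact mon_ne_zero _ this
    · obtain ⟨u, hu, hu0⟩ := hnz
      refine generic_ideal h0 h1 hn hN I ⟨u, hu, fun h => hu0 ?_⟩ hI
      rw [map_eq_zero_iff M hinj]
      exact Subtype.ext h
  have hd : ∀ D ∈ LieAlgebra.derivedSeries K (poAlg a b N) 1,
      ∃ u : (trunc (shearLe N) : Submodule K (QXi K n)), (u : QXi K n) ∈ genW K N ∧ M u = D :=
    hm.derived_succ (k := 0) (fun D _ => hm.derived_zero D)
      fun _ hu _ hv => brG_mem_genW h0 h1 hN hu hv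
  refine ⟨hs.isSimple hm hd, fun h => ?_, fun hodd hfin => ?_⟩
  · have hW : genW K N = trunc (shearLe N) := by
      by_cases hodd : Odd n
      · rw [genW_odd hodd]
        exact truncTop_eq_of_infinite (h.resolve_left (Nat.not_even_iff_odd.2 hodd))
      · exact genW_even hodd
    rw [hW] at hs
    exact hs.isSimple_self hm
  · exact hs.finrank_quotient hm hd (topCoeff N)
      (fun u hu => by rw [genW_odd hodd]; exact ⟨fun h => h.2, fun h => ⟨hu, h⟩⟩)
      ⟨mon (topExp N), mon_mem_trunc admissible_topExp, topCoeff_mon_top ⟨hfin, rfl⟩⟩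

end PoGeneric

end

section

open DivPow

/-! ### The cases a/b = 1 and a/b = ∞: closed and exact parts -/

section PoSpecial

variable {K : Type*} [Field K] {n : ℕ} {N : Fin n → ℕ∞}

theorem poBr_one (g : QXi K n × QXi K n) : poBr (1, 0) g = (g.2, 0) := by
  simp only [poBr, buttin_one_left, buttin_zero_left, Derivation.map_one_eq_zero, zero_mul, map_zero]
  refine Prod.ext ?_ ?_ <;> simp

variable [CharP K 2]

theorem poBr_comm (u v : QXi K n × QXi K n) : poBr u v = poBr v u := by
  refine Prod.ext ?_ ?_
  · simp only [poBr, buttin_symm u.1]; ring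
  · simp only [poBr, buttin_symm u.1, buttin_symm u.2, mul_comm u.2]; ring

theorem poBr_qv (i : Fin n) (g : QXi K n × QXi K n) :
    poBr (qv i, 0) g = (dxi i g.1, dxi i g.2) := by
  simp only [poBr, pb_qv, euler_qv, two_eq_zero, buttin_zero_left, zero_mul, map_zero, add_zero]

theorem poBr_xv (i : Fin n) (g : QXi K n × QXi K n) :
    poBr (xv i, 0) g = (dq i g.1 + xv i * g.2, dq i g.2) := by
  simp only [poBr, pb_xv, euler_xv, buttin_zero_left, zero_mul, map_zero, add_zero]

/-- The triples of functions that parametrize the first derived algebra in the cases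
`b / a = c`, `c = 0, 1`. -/
def spDom (c : K) (N : Fin n → ℕ∞) : Submodule K (QXi K n × QXi K n × QXi K n) where
  carrier := {p | (p.1 ∈ trunc (shearLe N) ∧ p.2.1 ∈ trunc (shearLe N) ∧
    p.2.2 ∈ trunc (shearLe N)) ∧
    euler p.1 = c • p.1 ∧ euler p.2.1 = c • p.2.1 ∧ euler p.2.2 = (1 + c) • p.2.2}
  add_mem' := by
    rintro p p' ⟨⟨h1, h2, h3⟩, h4, h5, h6⟩ ⟨⟨k1, k2, k3⟩, k4, k5, k6⟩
    refine ⟨⟨add_mem h1 k1, add_mem h2 k2, add_mem h3 k3⟩, ?_, ?_, ?_⟩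
    · rw [Prod.fst_add, map_add, h4, k4, smul_add]
    · rw [Prod.snd_add, Prod.fst_add, map_add, h5, k5, smul_add]
    · rw [Prod.snd_add, Prod.snd_add, map_add, h6, k6, smul_add]
  zero_mem' := by simp
  smul_mem' := by
    rintro s p ⟨⟨h1, h2, h3⟩, h4, h5, h6⟩
    refine ⟨⟨Submodule.smul_mem _ s h1, Submodule.smul_mem _ s h2, Submodule.smul_mem _ s h3⟩,
      ?_, ?_, ?_⟩
    · rw [Prod.smul_fst, Derivation.map_smul, h4, smul_comm]
    · rw [Prod.smul_snd, Prod.smul_fst, Derivation.map_smul, h5, smul_comm]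
    · rw [Prod.smul_snd, Prod.smul_snd, Derivation.map_smul, h6, smul_comm]

/-- The generating function that corresponds to a triple of functions. -/
def spMap : QXi K n × QXi K n × QXi K n →ₗ[K] QXi K n × QXi K n where
  toFun p := (p.1 + lap p.2.1, lap p.1 + lap p.2.2)
  map_add' p p' := by
    refine Prod.ext ?_ ?_ <;> simp only [Prod.fst_add, Prod.snd_add, map_add] <;> abel
  map_smul' s p := by
    refine Prod.ext ?_ ?_ <;> simp [smul_add]

theorem spMap_apply (f x y : QXi K n) : spMap (f, x, y) = (f + lap x, lap f + lap y) := rfl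

/-- The condition on the highest coefficient in the second derived algebra. -/
def spTop (c : K) (N : Fin n → ℕ∞) : Submodule K (QXi K n × QXi K n × QXi K n) :=
  LinearMap.ker (c • (topCoeff N ∘ₗ LinearMap.fst K _ _)) ⊓
    LinearMap.ker ((1 + c) • (topCoeff N ∘ₗ LinearMap.snd K _ _ ∘ₗ LinearMap.snd K _ _))

theorem mem_spTop {c : K} {p : QXi K n × QXi K n × QXi K n} :
    p ∈ spTop c N ↔ c * topCoeff N p.1 = 0 ∧ (1 + c) * topCoeff N p.2.2 = 0 := Iff.rfl

/-- The generating functions of the first derived algebra. -/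
def spW₁ (c : K) (N : Fin n → ℕ∞) : Submodule K (QXi K n × QXi K n) := (spDom c N).map spMap

/-- The generating functions of the second derived algebra. -/
def spW (c : K) (N : Fin n → ℕ∞) : Submodule K (QXi K n × QXi K n) :=
  (spDom c N ⊓ spTop c N).map spMap

theorem spW_le (c : K) : spW c N ≤ spW₁ c N := Submodule.map_mono inf_le_left

theorem euler_lap_of {c : K} {f : QXi K n} (h : euler f = c • f) :
    euler (lap f) = (1 + c) • lap f := by
  rw [euler_lap, h, map_smul, add_smul, one_smul, add_comm]

/-- For c = 0, 1 the operator c + E projects onto one parity of the q-degree, so the equation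
determines only half of f_1. It is Δf, where f is the component of f_0 of parity c; the other
components z of f_0 and w of f_1 are merely closed. -/
theorem mem_poV_special {c a b : K} (ha : a ≠ 0) (hc : b / a = c) (h01 : c = 0 ∨ c = 1)
    {u : QXi K n × QXi K n} : u ∈ poV a b N ↔ ∃ f z w : QXi K n,
      (f ∈ trunc (shearLe N) ∧ z ∈ trunc (shearLe N) ∧ w ∈ trunc (shearLe N)) ∧
      (euler f = c • f ∧ euler z = (1 + c) • z ∧ euler w = c • w) ∧
      (lap z = 0 ∧ lap w = 0) ∧ u = (f + z, lap f + w) := by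
  have hcc : c * c = c := by rcases h01 with rfl | rfl <;> simp
  rw [mem_poV_of_ne ha, hc]
  constructor
  · rintro ⟨h1, h2, h3, h4⟩
    have e1 := euler_lap u.1
    have e2 := euler_lap u.2
    rw [h3, map_add, Derivation.map_smul, euler_euler] at e1
    rw [h4, map_zero, add_zero] at e2
    -- The operators 1 + c + E and c + E are the complementary projectors onto the two parities.
    refine ⟨(1 + c) • u.1 + euler u.1, c • u.1 + euler u.1, (1 + c) • u.2 + euler u.2,
      ⟨add_mem (Submodule.smul_mem _ _ h1) (euler_mem h1),
        add_mem (Submodule.smul_mem _ _ h1) (euler_mem h1),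
        add_mem (Submodule.smul_mem _ _ h2) (euler_mem h2)⟩, ⟨?_, ?_, ?_⟩, ⟨?_, ?_⟩, ?_⟩
    · rw [map_add, Derivation.map_smul, euler_euler, smul_add, smul_smul, mul_add, hcc]
      linear_combination (norm := module) two_eq_zero (euler u.1) - two_eq_zero (c • u.1)
    · rw [map_add, Derivation.map_smul, euler_euler, smul_add, smul_smul, add_mul, hcc]
      linear_combination (norm := module) - two_eq_zero (c • u.1)
    · rw [map_add, Derivation.map_smul, euler_euler, smul_add, smul_smul, mul_add, hcc]
      linear_combination (norm := module) two_eq_zero (euler u.2) - two_eq_zero (c • u.2)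
    · rw [map_add, map_smul, h3, smul_add, smul_smul, hcc]
      linear_combination (norm := module) - e1 + two_eq_zero (c • euler u.2)
    · rw [map_add, map_smul, h4, ← e2]; simp
    · refine Prod.ext ?_ ?_
      · change u.1 = (1 + c) • u.1 + euler u.1 + (c • u.1 + euler u.1)
        linear_combination (norm := module) - two_eq_zero (c • u.1) - two_eq_zero (euler u.1)
      · change u.2 = lap ((1 + c) • u.1 + euler u.1) + ((1 + c) • u.2 + euler u.2)
        rw [map_add, map_smul, h3, smul_add, smul_smul, add_mul, hcc]
        linear_combination (norm := module) e1 - two_eq_zero (c • euler u.2) -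
          two_eq_zero (euler u.2) - two_eq_zero (c • u.2)
  · rintro ⟨f, z, w, ⟨h1, h2, h3⟩, ⟨h4, -, h6⟩, ⟨h7, h8⟩, rfl⟩
    refine ⟨add_mem h1 h2, add_mem (lap_mem h1) h3, ?_, ?_⟩
    · change lap (f + z) = c • (lap f + w) + euler (lap f + w)
      rw [map_add, h7, map_add, euler_lap_of h4, h6]
      linear_combination (norm := module) - two_eq_zero (c • lap f) - two_eq_zero (c • w)
    · change lap (lap f + w) = 0
      rw [map_add, lap_lap h1, h8, add_zero]

/-- The bracket of two elements in the case `c = 1`. -/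
theorem poBr_special_one {f z w f' z' w' : QXi K n} (hf : f ∈ trunc (shearLe N))
    (hf' : f' ∈ trunc (shearLe N)) (hz : lap z = 0) (hw : lap w = 0) (hz' : lap z' = 0)
    (hw' : lap w' = 0)
    (e1 : euler f = f) (e2 : euler z = 0) (e3 : euler w = w) (e1' : euler f' = f')
    (e2' : euler z' = 0) (e3' : euler w' = w') (hzt : z ∈ trunc (shearLe N))
    (hzt' : z' ∈ trunc (shearLe N)) :
    poBr (f + z, lap f + w) (f' + z', lap f' + w') =
      spMap (pb f f' + pb z z' + z * w' + z' * w, f * z' + f' * z,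
        f * w' + f' * w + z * lap f' + z' * lap f) := by
  have e4 : euler (lap f) = 0 := by
    rw [euler_lap, e1, two_eq_zero]
  have e4' : euler (lap f') = 0 := by
    rw [euler_lap, e1', two_eq_zero]
  rw [spMap_apply]
  refine Prod.ext ?_ ?_
  · simp only [poBr, map_add, e1, e2, e1', e2', buttin_add_left, delta_mul, hz, hz', mul_zero,
      buttin_symm f' z]
    linear_combination two_eq_zero (f * lap f' + f * w' + lap f * f' + w * f')
  · simp only [poBr, map_add, e3, e4, e3', e4', buttin_add_left, delta_mul, hz, hz', hw, hw',
      Derivation.leibniz, smul_eq_mul, mul_zero, lap_pb hf hf', lap_pb hzt hzt', lap_lap hf, lap_lap hf',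
      buttin_symm (lap f) z', buttin_symm f' w, buttin_symm w z', map_zero, buttin_zero_left]
    linear_combination two_eq_zero (w * w')

/-- The bracket of two elements in the case `c = 0`. -/
theorem poBr_special_zero {f z w f' z' w' : QXi K n} (hf : f ∈ trunc (shearLe N))
    (hf' : f' ∈ trunc (shearLe N)) (hz : lap z = 0) (hw : lap w = 0) (hz' : lap z' = 0)
    (hw' : lap w' = 0)
    (e1 : euler f = 0) (e2 : euler z = z) (e3 : euler w = 0) (e1' : euler f' = 0)
    (e2' : euler z' = z') (e3' : euler w' = 0) (hzt : z ∈ trunc (shearLe N))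
    (hzt' : z' ∈ trunc (shearLe N)) :
    poBr (f + z, lap f + w) (f' + z', lap f' + w') =
      spMap (pb f z' + pb z f' + f * w' + f' * w, f * f' + z * z',
        pb f f' + z * w' + z' * w) := by
  have e4 : euler (lap f) = lap f := by
    rw [euler_lap, e1, map_zero, zero_add]
  have e4' : euler (lap f') = lap f' := by
    rw [euler_lap, e1', map_zero, zero_add]
  rw [spMap_apply]
  refine Prod.ext ?_ ?_
  · simp only [poBr, map_add, e1, e2, e1', e2', buttin_add_left, delta_mul, hz, hz', mul_zero]
    linear_combination two_eq_zero (z * lap f' + z * w' + lap f * z' + w * z')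
  · simp only [poBr, map_add, e3, e4, e3', e4', buttin_add_left, delta_mul, hz, hz', hw, hw',
      Derivation.leibniz, smul_eq_mul, mul_zero, lap_pb hf hf', lap_pb hf hzt', lap_pb hzt hf',
      buttin_symm f' w, buttin_symm w z', map_zero, buttin_zero_left]
    linear_combination two_eq_zero (lap f * lap f')

/-- Self-adjointness moves Δ onto the closed factor. -/
theorem topCoeff_lap_mul {x w : QXi K n} (hx : x ∈ trunc (shearLe N))
    (hw : w ∈ trunc (shearLe N)) (h : lap w = 0) : topCoeff N (lap x * w) = 0 := by
  rw [mul_comm, topCoeff_mul_lap hw hx, h, mul_zero, map_zero]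

/-- A bracket of elements with closed z, w is again of the same shape, but with the closed parts
replaced by Δ of products of the data. The highest coefficient to be controlled involves, apart from
Buttin brackets, only the products zw' and z'w. -/
theorem poBr_mem_spDom {c : K} (h01 : c = 0 ∨ c = 1) {f z w f' z' w' : QXi K n}
    (hf : f ∈ trunc (shearLe N)) (hzt : z ∈ trunc (shearLe N)) (hwt : w ∈ trunc (shearLe N))
    (hf' : f' ∈ trunc (shearLe N)) (hzt' : z' ∈ trunc (shearLe N)) (hwt' : w' ∈ trunc (shearLe N))
    (hz : lap z = 0) (hw : lap w = 0) (hz' : lap z' = 0) (hw' : lap w' = 0)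
    (e1 : euler f = c • f) (e2 : euler z = (1 + c) • z) (e3 : euler w = c • w)
    (e1' : euler f' = c • f') (e2' : euler z' = (1 + c) • z') (e3' : euler w' = c • w') :
    ∃ p ∈ spDom c N, spMap p = poBr (f + z, lap f + w) (f' + z', lap f' + w') ∧
      (topCoeff N (z * w') = 0 → topCoeff N (z' * w) = 0 → p ∈ spTop c N) := by
  have hl := lap_mem hf
  have hl' := lap_mem hf'
  rcases h01 with rfl | rfl
  · simp only [zero_smul, add_zero, one_smul] at e1 e2 e3 e1' e2' e3'
    refine ⟨_, ⟨⟨?_, ?_, ?_⟩, ?_, ?_, ?_⟩,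
      (poBr_special_zero hf hf' hz hw hz' hw' e1 e2 e3 e1' e2' e3' hzt hzt').symm, ?_⟩
    · exact add_mem (add_mem (add_mem (pb_mem hf hzt') (pb_mem hzt hf')) (mul_mem_trunc hf hwt'))
        (mul_mem_trunc hf' hwt)
    · exact add_mem (mul_mem_trunc hf hf') (mul_mem_trunc hzt hzt')
    · exact add_mem (add_mem (pb_mem hf hf') (mul_mem_trunc hzt hwt')) (mul_mem_trunc hzt' hwt)
    · simp only [map_add, euler_pb, Derivation.leibniz, e1, e2, e3, e1', e2', e3', smul_eq_mul,
        buttin_zero_left, map_zero, mul_zero, zero_smul]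
      linear_combination two_eq_zero (pb f z') + two_eq_zero (pb z f')
    · simp only [map_add, Derivation.leibniz, e1, e2, e1', e2', smul_eq_mul, mul_zero, zero_smul]
      linear_combination two_eq_zero (z * z')
    · simp only [map_add, euler_pb, Derivation.leibniz, e1, e2, e3, e1', e2', e3', smul_eq_mul,
        buttin_zero_left, map_zero, mul_zero, add_zero, one_smul]
      ring
    · intro h1 h2
      refine mem_spTop.2 ⟨zero_mul _, ?_⟩
      simp only [map_add, topCoeff_pb hf hf', h1, h2]; simp
  · have h11 : (1 + 1 : K) = 0 := CharTwo.add_self_eq_zero 1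
    simp only [h11, zero_smul, one_smul] at e1 e2 e3 e1' e2' e3'
    refine ⟨_, ⟨⟨?_, ?_, ?_⟩, ?_, ?_, ?_⟩,
      (poBr_special_one hf hf' hz hw hz' hw' e1 e2 e3 e1' e2' e3' hzt hzt').symm, ?_⟩
    · exact add_mem (add_mem (add_mem (pb_mem hf hf') (pb_mem hzt hzt')) (mul_mem_trunc hzt hwt'))
        (mul_mem_trunc hzt' hwt)
    · exact add_mem (mul_mem_trunc hf hzt') (mul_mem_trunc hf' hzt)
    · exact add_mem (add_mem (add_mem (mul_mem_trunc hf hwt') (mul_mem_trunc hf' hwt))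
        (mul_mem_trunc hzt hl')) (mul_mem_trunc hzt' hl)
    · simp only [map_add, euler_pb, Derivation.leibniz, e1, e2, e3, e1', e2', e3', smul_eq_mul,
        buttin_zero_left, map_zero, mul_zero, one_smul]
      linear_combination two_eq_zero (pb f f')
    · simp only [map_add, Derivation.leibniz, e1, e2, e1', e2', smul_eq_mul, mul_zero, one_smul]
      ring
    · simp only [map_add, euler_lap, Derivation.leibniz, e1, e2, e3, e1', e2', e3', smul_eq_mul,
        mul_zero, h11, zero_smul]
      linear_combination two_eq_zero (f * w') + two_eq_zero (f' * w) + two_eq_zero (z * lap f') +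
        two_eq_zero (z' * lap f)
    · intro h1 h2
      refine mem_spTop.2 ⟨?_, by rw [h11, zero_mul]⟩
      simp only [map_add, topCoeff_pb hf hf', topCoeff_pb hzt hzt', h1, h2]; simp

theorem poBr_mem_spW₁ {c a b : K} (ha : a ≠ 0) (hc : b / a = c) (h01 : c = 0 ∨ c = 1)
    {u v : QXi K n × QXi K n} (hu : u ∈ poV a b N) (hv : v ∈ poV a b N) : poBr u v ∈ spW₁ c N := by
  obtain ⟨f, z, w, ⟨h1, h2, h3⟩, ⟨e1, e2, e3⟩, ⟨hz, hw⟩, rfl⟩ := (mem_poV_special ha hc h01).1 hu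
  obtain ⟨f', z', w', ⟨h1', h2', h3'⟩, ⟨e1', e2', e3'⟩, ⟨hz', hw'⟩, rfl⟩ :=
    (mem_poV_special ha hc h01).1 hv
  obtain ⟨p, hp, e, -⟩ := poBr_mem_spDom h01 h1 h2 h3 h1' h2' h3' hz hw hz' hw' e1 e2 e3 e1' e2' e3'
  exact ⟨p, hp, e⟩

theorem add_add_self (c : K) : 1 + (1 + c) = c := by
  rw [← add_assoc, CharTwo.add_self_eq_zero, zero_add]

/-- In the first derived algebra z = Δx is exact and w' is closed, so the highest coefficient of zw'
vanishes by integration by parts. -/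
theorem poBr_mem_spW {c : K} (h01 : c = 0 ∨ c = 1)
    {u v : QXi K n × QXi K n} (hu : u ∈ spW₁ c N) (hv : v ∈ spW₁ c N) : poBr u v ∈ spW c N := by
  obtain ⟨⟨f, x, y⟩, ⟨⟨h1, h2, h3⟩, e1, e2, e3⟩, rfl⟩ := hu
  obtain ⟨⟨f', x', y'⟩, ⟨⟨h1', h2', h3'⟩, e1', e2', e3'⟩, rfl⟩ := hv
  simp only at h1 h2 h3 e1 e2 e3 h1' h2' h3' e1' e2' e3'
  obtain ⟨p, hp, e, ht⟩ := poBr_mem_spDom h01 h1 (lap_mem h2) (lap_mem h3) h1' (lap_mem h2')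
    (lap_mem h3') (lap_lap h2) (lap_lap h3) (lap_lap h2') (lap_lap h3') e1 (euler_lap_of e2)
    (by rw [euler_lap_of e3, add_add_self]) e1' (euler_lap_of e2')
    (by rw [euler_lap_of e3', add_add_self])
  exact ⟨p, ⟨hp, ht (topCoeff_lap_mul h2 (lap_mem h3') (lap_lap h3'))
    (topCoeff_lap_mul h2' (lap_mem h3) (lap_lap h3))⟩, e⟩

theorem spW₁_le_poV {c a b : K} (ha : a ≠ 0) (hc : b / a = c) (h01 : c = 0 ∨ c = 1) :
    spW₁ c N ≤ poV a b N := by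
  rintro _ ⟨⟨f, x, y⟩, ⟨⟨h1, h2, h3⟩, e1, e2, e3⟩, rfl⟩
  exact (mem_poV_special ha hc h01).2 ⟨f, lap x, lap y, ⟨h1, lap_mem h2, lap_mem h3⟩,
    ⟨e1, euler_lap_of e2, by rw [euler_lap_of e3, add_add_self]⟩, ⟨lap_lap h2, lap_lap h3⟩, rfl⟩

end PoSpecial

end

section

open DivPow

/-! ### The cases a/b = 1 and a/b = ∞: simplicity of the second derived algebra -/

section PoSpecialIdeal

variable {K : Type*} [Field K] [CharP K 2] {n : ℕ} {N : Fin n → ℕ∞}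

theorem coeff_euler (r : Fin n ⊕ Fin n →₀ ℕ) (f : QXi K n) :
    coeff r (euler f) = (qdeg r : K) * coeff r f := by
  refine induct (p := fun f => coeff r (euler f) = (qdeg r : K) * coeff r f) f (by simp) ?_ ?_
    fun s => ?_
  · intro a b ha hb; rw [map_add, map_add, map_add, ha, hb, mul_add]
  · intro c a ha
    rw [Derivation.map_smul, map_smul, map_smul, ha, smul_eq_mul, smul_eq_mul]; ring
  · rw [euler_mon, map_smul, smul_eq_mul]
    by_cases h : s = r
    · rw [h]
    · rw [coeff_mon_ne h, mul_zero, mul_zero]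

theorem qdeg_of_euler {c : K} {f : QXi K n} (h : euler f = c • f) {r : Fin n ⊕ Fin n →₀ ℕ}
    (hr : coeff r f ≠ 0) : (qdeg r : K) = c := by
  have := coeff_euler r f
  rw [h, map_smul, smul_eq_mul] at this
  exact (mul_right_cancel₀ hr this).symm

/-- If the τ-part is nonzero, the bracket with 1 turns it into an element without τ. On such
elements the brackets with q_i and ξ_i are plain derivatives, which lead down to a constant. -/
theorem poBr_invariant_one_mem {I : Submodule K (QXi K n × QXi K n)} (hne : ∃ u ∈ I, u ≠ 0)
    (h1 : ∀ u ∈ I, (u.2, 0) ∈ I) (hx : ∀ u ∈ I, ∀ i, (dxi i u.1, dxi i u.2) ∈ I)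
    (hq : ∀ u ∈ I, ∀ i, (dq i u.1 + xv i * u.2, dq i u.2) ∈ I) : ((1 : QXi K n), (0 : QXi K n)) ∈ I := by
  have h0 : ∃ f : QXi K n, (f, (0 : QXi K n)) ∈ I ∧ f ≠ 0 := by
    obtain ⟨⟨f, g⟩, hu, hu0⟩ := hne
    by_cases hg : g = 0
    · subst hg
      exact ⟨f, hu, fun h => hu0 (by rw [h]; rfl)⟩
    · exact ⟨g, h1 _ hu, hg⟩
  obtain ⟨g, hg, hg0, hgz⟩ := exists_last (J := Set.univ)
    (p := fun f : QXi K n => (f, (0 : QXi K n)) ∈ I) (q := fun f => f ≠ 0) (by simp) (by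
      rintro f hf z -
      rcases z with i | i
      · simpa using hq _ hf i
      · simpa using hx _ hf i) h0
  have e := eq_smul_one_of_pd_eq_zero (f := g) fun z => not_not.1 (hgz z trivial)
  rw [e] at hg
  refine (I.smul_mem_iff (s := coeff 0 g) fun h => hg0 ?_).1 ?_
  · rw [e, h, zero_smul]
  · simpa using hg

theorem fst_mem_spW {c : K} {f : QXi K n} (hf : f ∈ trunc (shearLe N)) (he : euler f = c • f)
    (ht : c * topCoeff N f = 0) : (f, lap f) ∈ spW c N :=
  ⟨(f, 0, 0), ⟨⟨⟨hf, zero_mem _, zero_mem _⟩, he, by simp, by simp⟩,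
    mem_spTop.2 ⟨ht, by simp⟩⟩, by rw [spMap_apply]; simp⟩

theorem mid_mem_spW {c : K} {f : QXi K n} (hf : f ∈ trunc (shearLe N)) (he : euler f = c • f) :
    (lap f, 0) ∈ spW c N :=
  ⟨(0, f, 0), ⟨⟨⟨zero_mem _, hf, zero_mem _⟩, by simp, he, by simp⟩,
    mem_spTop.2 ⟨by simp, by simp⟩⟩, by rw [spMap_apply]; simp⟩

theorem snd_mem_spW {c : K} {f : QXi K n} (hf : f ∈ trunc (shearLe N))
    (he : euler f = (1 + c) • f) (ht : (1 + c) * topCoeff N f = 0) : (0, lap f) ∈ spW c N :=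
  ⟨(0, 0, f), ⟨⟨⟨zero_mem _, zero_mem _, hf⟩, by simp, by simp, he⟩,
    mem_spTop.2 ⟨by simp, ht⟩⟩, by rw [spMap_apply]; simp⟩

theorem lap_var (z : Fin n ⊕ Fin n) : lap (var z : QXi K n) = 0 := by
  rcases z with i | i
  · exact lap_qv i
  · exact lap_xv i

/-- `Δ (z q_j ξ_j) = z` for an indeterminate `z` different from `q_j`, `ξ_j`. -/
theorem lap_triple {i j : Fin n} (hij : j ≠ i) {z : Fin n ⊕ Fin n}
    (hz : z = Sum.inl i ∨ z = Sum.inr i) :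
    lap (var z * (qv j * xv j) : QXi K n) = var z := by
  have e1 : pd z.swap (qv j * xv j : QXi K n) = 0 := by
    refine pd_pair_eq_zero ?_ ?_ <;> rcases hz with rfl | rfl <;> simp [hij.symm]
  rw [delta_mul, lap_var, lap_qv_mul_xv_same, pb_var, e1]; ring

theorem euler_triple_inl (i j : Fin n) : euler (qv i * (qv j * xv j) : QXi K n) = 0 := by
  rw [Derivation.leibniz, euler_weight, euler_qv, smul_eq_mul, smul_eq_mul]
  linear_combination two_eq_zero (qv i * (qv j * xv j) : QXi K n)

theorem euler_triple_inr (i j : Fin n) :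
    euler (xv i * (qv j * xv j) : QXi K n) = xv i * (qv j * xv j) := by
  rw [Derivation.leibniz, euler_weight, euler_xv, smul_zero, add_zero, smul_eq_mul]

theorem one_mem_spW {c : K} (h01 : c = 0 ∨ c = 1) (hn : 2 ≤ n) (hN : ∀ i, N i ≠ 0) :
    ((1 : QXi K n), (0 : QXi K n)) ∈ spW c N := by
  rcases h01 with rfl | rfl
  · have := fst_mem_spW (N := N) (c := 0) (f := (1 : QXi K n)) one_mem_trunc (by simp) (by simp)
    rwa [lap_one] at this
  · have := mid_mem_spW (K := K) (N := N) (c := 1) (f := qv ⟨0, by omega⟩ * xv ⟨0, by omega⟩)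
      (mul_mem_trunc (qv_mem hN _) (xv_mem _)) (by rw [euler_weight, one_smul])
    rwa [lap_qv_mul_xv_same] at this

theorem triple_mem {hN : ∀ i, N i ≠ 0} (z : Fin n ⊕ Fin n) (j : Fin n) :
    (var z * (qv j * xv j) : QXi K n) ∈ trunc (shearLe N) :=
  mul_mem_trunc (var_mem_shear hN _) (mul_mem_trunc (qv_mem hN _) (xv_mem _))

theorem qv_mem_spW {c : K} (h01 : c = 0 ∨ c = 1) (hn : 2 ≤ n) (hN : ∀ i, N i ≠ 0) (i : Fin n) :
    ((qv i : QXi K n), (0 : QXi K n)) ∈ spW c N := by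
  obtain ⟨j, hj⟩ := exists_ne_fin hn i
  rcases h01 with rfl | rfl
  · have := mid_mem_spW (K := K) (N := N) (c := 0) (triple_mem (hN := hN) (Sum.inl i) j)
      (by rw [euler_triple_inl, zero_smul])
    rwa [lap_triple hj (Or.inl rfl)] at this
  · have := fst_mem_spW (N := N) (c := (1 : K)) (qv_mem hN i) (by rw [euler_qv, one_smul]) (by
      rw [topCoeff_of_pd_eq_zero hN (Sum.inr i) (pd_var_ne (by simp)), mul_zero])
    rwa [lap_qv] at this

theorem xv_mem_spW {c : K} (h01 : c = 0 ∨ c = 1) (hn : 2 ≤ n) (hN : ∀ i, N i ≠ 0) (i : Fin n) :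
    ((xv i : QXi K n), (0 : QXi K n)) ∈ spW c N := by
  obtain ⟨j, hj⟩ := exists_ne_fin hn i
  rcases h01 with rfl | rfl
  · have := fst_mem_spW (K := K) (N := N) (c := 0) (xv_mem i) (by rw [euler_xv, zero_smul])
      (zero_mul _)
    rwa [lap_xv] at this
  · have := mid_mem_spW (K := K) (N := N) (c := 1) (triple_mem (hN := hN) (Sum.inr i) j)
      (by rw [euler_triple_inr, one_smul])
    rwa [lap_triple hj (Or.inr rfl)] at this

/-- The elements of an invariant subspace that are obtained from `1`, `q_i`, `ξ_i`. -/
theorem spW_ideal_low {c : K} (h01 : c = 0 ∨ c = 1) (hn : 2 ≤ n) (hN : ∀ i, N i ≠ 0)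
    {I : Submodule K (QXi K n × QXi K n)} (hne : ∃ u ∈ I, u ≠ 0)
    (hI : ∀ w ∈ spW c N, ∀ u ∈ I, poBr w u ∈ I) :
    (∀ u ∈ spW c N, (u.2, 0) ∈ I) ∧ (∀ u ∈ spW c N, ∀ i, (dxi i u.1, dxi i u.2) ∈ I) ∧
      ∀ u ∈ spW c N, ∀ i, (dq i u.1 + xv i * u.2, dq i u.2) ∈ I := by
  have hone := poBr_invariant_one_mem hne
    (fun u hu => by rw [← poBr_one]; exact hI _ (one_mem_spW h01 hn hN) u hu)
    (fun u hu i => by rw [← poBr_qv]; exact hI _ (qv_mem_spW h01 hn hN i) u hu)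
    (fun u hu i => by rw [← poBr_xv]; exact hI _ (xv_mem_spW h01 hn hN i) u hu)
  have h1 : ∀ u ∈ spW c N, (u.2, 0) ∈ I := fun u hu => by
    rw [← poBr_one, poBr_comm]; exact hI u hu _ hone
  -- The indeterminate is Δ(z q_jξ_j), and the bracket with 1 extracts second components. The parity
  -- of the cubic and the value of c decide whether it occurs as (f, Δf) or as (0, Δf).
  have hvar : ∀ (i : Fin n) (z : Fin n ⊕ Fin n), z = Sum.inl i ∨ z = Sum.inr i →
      ((var z : QXi K n), (0 : QXi K n)) ∈ I := by
    intro i z hz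
    obtain ⟨j, hj⟩ := exists_ne_fin hn i
    have ht : topCoeff N (var z * (qv j * xv j) : QXi K n) = 0 := (triple_mem_truncTop hN hj z hz).2
    rw [← lap_triple (K := K) hj hz]
    have h11 : (1 + 1 : K) = 0 := CharTwo.add_self_eq_zero 1
    rcases hz with rfl | rfl <;> rcases h01 with rfl | rfl
    · exact h1 _ (fst_mem_spW (triple_mem (hN := hN) _ j) (by rw [euler_triple_inl, zero_smul])
        (zero_mul _))
    · exact h1 _ (snd_mem_spW (triple_mem (hN := hN) _ j)
        (by rw [euler_triple_inl, h11, zero_smul]) (by rw [ht, mul_zero]))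
    · exact h1 _ (snd_mem_spW (triple_mem (hN := hN) _ j)
        (by rw [euler_triple_inr, add_zero, one_smul]) (by rw [ht, mul_zero]))
    · exact h1 _ (fst_mem_spW (triple_mem (hN := hN) _ j) (by rw [euler_triple_inr, one_smul])
        (by rw [ht, mul_zero]))
  refine ⟨h1, fun u hu i => ?_, fun u hu i => ?_⟩
  · rw [← poBr_qv, poBr_comm]; exact hI u hu _ (hvar i _ (Or.inl rfl))
  · rw [← poBr_xv, poBr_comm]; exact hI u hu _ (hvar i _ (Or.inr rfl))

/-- Δ is a derivation of the bracket and Δ(q_iξ_i) = 1 brackets to zero, so Δ commutes with the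
weight operator. -/
theorem pb_weight_lap {i : Fin n} (hN : ∀ i, N i ≠ 0) {r : Fin n ⊕ Fin n →₀ ℕ}
    (hr : Admissible (shearLe N) r) : pb (qv i * xv i) (lap (mon r) : QXi K n) =
      ((r (Sum.inl i) + r (Sum.inr i) : ℕ) : K) • lap (mon r) := by
  have := lap_pb (K := K) (mul_mem_trunc (qv_mem hN i) (xv_mem i)) (mon_mem_trunc hr)
  rw [lap_qv_mul_xv_same, buttin_one_left, pb_weight, map_smul] at this
  simpa using this.symm

theorem pd_lap (z : Fin n ⊕ Fin n) (f : QXi K n) : pd z (lap f) = lap (pd z f) := by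
  simp only [delta_apply, map_sum]
  exact Finset.sum_congr rfl fun i _ => by rw [pd_comm z, pd_comm z]

/-- The space is spanned by three families: A = (u, Δu) with u of odd q-degree and not highest, B =
(Δu, 0) with u odd, C = (0, Δu) with u even. B comes from A by bracketing with 1, C from A and B by
raising q_i, A from A by raising ξ_i and from C by raising q_i. The weight elements settle the
boundary cases. -/
theorem spW_one_le (hn : 2 ≤ n) (hN : ∀ i, N i ≠ 0) {I : Submodule K (QXi K n × QXi K n)}
    (hne : ∃ u ∈ I, u ≠ 0) (hI : ∀ w ∈ spW (1 : K) N, ∀ u ∈ I, poBr w u ∈ I) :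
    spW (1 : K) N ≤ I := by
  have h01 : (1 : K) = 0 ∨ (1 : K) = 1 := Or.inr rfl
  have h11 : (1 + 1 : K) = 0 := CharTwo.add_self_eq_zero 1
  obtain ⟨h1, hx, hq⟩ := spW_ideal_low h01 hn hN hne hI
  have hA : ∀ r, Admissible (shearLe N) r → ¬ IsTopExp N r → (qdeg r : K) = 1 →
      ((mon r : QXi K n), lap (mon r)) ∈ spW (1 : K) N := fun r hr hT h =>
    fst_mem_spW (mon_mem_trunc hr) (by rw [euler_mon, h]) (by rw [topCoeff_mon_of_not hT, mul_zero])
  have hC : ∀ r, Admissible (shearLe N) r → (qdeg r : K) = 0 →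
      (0, lap (mon r : QXi K n)) ∈ spW (1 : K) N := fun r hr h =>
    snd_mem_spW (mon_mem_trunc hr) (by rw [euler_mon, h, h11]) (by rw [h11, zero_mul])
  -- the weight elements
  have hw : ∀ i, ((qv i * xv i : QXi K n), (1 : QXi K n)) ∈ I := by
    intro i
    obtain ⟨j, hj⟩ := exists_ne_fin hn i
    have e1 : dxi j (qv i * xv i : QXi K n) = 0 := pd_pair_eq_zero (by simp) (by simpa using hj)
    have e0 : dq j (qv i * xv i : QXi K n) = 0 := pd_pair_eq_zero (by simpa using hj) (by simp)
    have := hx _ (fst_mem_spW (triple_mem (K := K) (hN := hN) (Sum.inr j) i)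
      (by rw [euler_triple_inr, one_smul])
      (by rw [(triple_mem_truncTop hN hj.symm _ (Or.inr rfl)).2, mul_zero])) j
    rw [lap_triple hj.symm (Or.inr rfl), Derivation.leibniz, e1, pd_var_same, smul_zero, zero_add,
      smul_eq_mul, mul_one] at this
    exact this
  -- The extra 1 in the weight element adds 1 + E to the first component and E to the second. So its
  -- eigenvalue is the Buttin weight on A, and the Buttin weight plus 1 on B and on C.
  have hwt : ∀ i f g, poBr ((qv i * xv i : QXi K n), 1) (f, g) =
      (pb (qv i * xv i) f + (f + euler f), pb (qv i * xv i) g + euler g) := by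
    intro i f g
    simp only [poBr, euler_weight, two_eq_zero, zero_mul, one_mul, add_zero, buttin_one_left]
  have hwI : ∀ i, ∀ u ∈ spW (1 : K) N, poBr ((qv i * xv i : QXi K n), 1) u ∈ I := fun i u hu => by
    rw [poBr_comm]; exact hI u hu _ (hw i)
  have hwA : ∀ i r, Admissible (shearLe N) r → ¬ IsTopExp N r → (qdeg r : K) = 1 →
      (r (Sum.inl i) + r (Sum.inr i)) % 2 = 1 → ((mon r : QXi K n), lap (mon r)) ∈ I := by
    intro i r hr hT h hodd
    have := hwI i _ (hA r hr hT h)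
    rw [hwt, pb_weight, pb_weight_lap hN hr, natCast_odd hodd, euler_lap_mon, h, h11, euler_mon, h,
      one_smul, one_smul, two_eq_zero, zero_smul, add_zero, add_zero] at this
    exact this
  have hwC : ∀ i r, Admissible (shearLe N) r → (qdeg r : K) = 0 →
      (r (Sum.inl i) + r (Sum.inr i)) % 2 = 0 → ((0 : QXi K n), lap (mon r : QXi K n)) ∈ I := by
    intro i r hr h heven
    have := hwI i _ (hC r hr h)
    rw [hwt, pb_weight_lap hN hr, natCast_even heven, euler_lap_mon, h] at this
    simpa using this
  have hB : ∀ r, Admissible (shearLe N) r → (qdeg r : K) = 1 →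
      (lap (mon r : QXi K n), (0 : QXi K n)) ∈ I := by
    intro r hr h
    by_cases hT : IsTopExp N r
    -- The highest monomial gives no element of family A; but its Buttin weight is even, so the
    -- weight element acts on (Δu, 0) with eigenvalue 1.
    · have i : Fin n := ⟨0, by omega⟩
      have := hwI i _ (mid_mem_spW (mon_mem_trunc hr) (by rw [euler_mon, h]))
      have e : (r (Sum.inl i) + r (Sum.inr i)) % 2 = 0 := by
        rw [hT.2, topExp_inr]
        have := topExp_mod hT.1 hN (Sum.inl i)
        omega
      rw [hwt, pb_weight_lap hN hr, natCast_even e, euler_lap_mon, h, h11] at this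
      simpa using this
    · exact h1 _ (hA r hr hT h)
  have hCI : ∀ r, Admissible (shearLe N) r → (qdeg r : K) = 0 →
      ((0 : QXi K n), lap (mon r : QXi K n)) ∈ I := by
    intro r hr h
    by_cases hev : ∃ i, (r (Sum.inl i) + r (Sum.inr i)) % 2 = 0
    · obtain ⟨i, hi⟩ := hev
      exact hwC i r hr h hi
    push Not at hev
    by_cases hs : ∃ i, Admissible (shearLe N) (r + unitExp (Sum.inl i)) ∧
        ¬ IsTopExp N (r + unitExp (Sum.inl i))
    · obtain ⟨i, hA', hT'⟩ := hs
      have hd : (qdeg (r + unitExp (Sum.inl i)) : K) = 1 := by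
        rw [qdeg_add, qdeg_unitExp_inl, Nat.cast_add, h]; simp
      have h2 := hq _ (hA _ hA' hT' hd) i
      -- The first component of `h2` is Δ(ξ_i u^(r + e)), with e the unit exponent of q_i. It is
      -- zero or in family B, so subtracting it leaves (0, Δu^(r)).
      have h3 : (lap (xv i * mon (r + unitExp (Sum.inl i)) : QXi K n), (0 : QXi K n)) ∈ I := by
        rw [xv, var_mul_mon, map_smul]
        by_cases h0 : r (Sum.inr i) = 0
        · have : (r + unitExp (Sum.inl i) : Fin n ⊕ Fin n →₀ ℕ) (Sum.inr i) + 1 = 1 := by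
            rw [Finsupp.add_apply, h0, unitExp_ne (by simp)]
          rw [this, Nat.cast_one, one_smul]
          refine hB _ (admissible_add_inr hA' hN ?_) ?_
          · omega
          · rw [qdeg_add, qdeg_unitExp_inr, add_zero, hd]
        · have h0' := apply_inr_le hr i
          have : (r + unitExp (Sum.inl i) : Fin n ⊕ Fin n →₀ ℕ) (Sum.inr i) + 1 = 2 := by
            rw [Finsupp.add_apply, unitExp_ne (by simp)]; omega
          rw [this, natCast_even (by norm_num), zero_smul]
          exact zero_mem I
      have h4 := sub_mem h2 h3
      rw [lap_xv_mul, Prod.mk_sub_mk, sub_zero, add_comm (xv i * _), sub_self, pd_lap,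
        pd_mon_add] at h4
      exact h4
    · push Not at hs
      -- Were the raised exponent the highest one, any other pair (q_j, ξ_j) would have even weight,
      -- against `hev`.
      have hall : ∀ i, ¬ Admissible (shearLe N) (r + unitExp (Sum.inl i)) := by
        intro i hi
        obtain ⟨hT, e⟩ := hs i hi
        obtain ⟨j, hj⟩ := exists_ne_fin hn i
        have e1 := congrArg (fun s => s (Sum.inl j)) e
        have e2 := congrArg (fun s => s (Sum.inr j)) e
        simp only [Finsupp.add_apply] at e1 e2
        rw [unitExp_ne (by simpa using hj)] at e1
        rw [unitExp_ne (by simp), topExp_inr] at e2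
        have := topExp_mod hT hN (Sum.inl j)
        have := hev j
        omega
      -- All q-exponents are maximal, hence odd, so odd weights force every ξ-exponent to be 0 and Δ
      -- kills the monomial.
      have hz : lap (mon r : QXi K n) = 0 := by
        rw [delta_apply]
        refine Finset.sum_eq_zero fun i _ => ?_
        rw [← frame_comm isFrame_qxi, pd_mon_zero, map_zero]
        obtain ⟨k, -, -, h2⟩ := (admissible_add_or hr hN (Sum.inl i)).resolve_left (hall i)
        have := hev i
        have := apply_inr_le hr i
        omega
      rw [hz]
      exact zero_mem I
  have hAI : ∀ r, Admissible (shearLe N) r → ¬ IsTopExp N r → (qdeg r : K) = 1 →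
      ((mon r : QXi K n), lap (mon r)) ∈ I := by
    intro r hr hT h
    by_cases h0 : ∃ i, r (Sum.inr i) = 0
    · obtain ⟨i, hi⟩ := h0
      have hs := admissible_add_inr hr hN hi
      by_cases hT' : IsTopExp N (r + unitExp (Sum.inr i))
      · refine hwA i r hr hT h ?_
        have e1 := congrArg (fun s => s (Sum.inl i)) hT'.2
        simp only [Finsupp.add_apply] at e1
        rw [unitExp_ne (by simp)] at e1
        have := topExp_mod hT'.1 hN (Sum.inl i)
        omega
      · have := hx _ (hA _ hs hT' (by rw [qdeg_add, qdeg_unitExp_inr, add_zero, h])) i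
        rw [pd_lap, pd_mon_add] at this
        exact this
    · push Not at h0
      have h0' : ∀ i, r (Sum.inr i) = 1 := fun i => by
        have := apply_inr_le hr i
        have := h0 i
        omega
      obtain ⟨i, hi⟩ := exists_admissible_add_inl hr hN h0' hT
      -- Since ξ_i already divides the monomial, ξ_iΔ acts on it as ∂_{q_i}; an element of family C
      -- is thus sent to (u^(r), Δu^(r)).
      have h2 := hq _ (hC _ hi (by
        rw [qdeg_add, qdeg_unitExp_inl, Nat.cast_add, h, Nat.cast_one, h11])) i
      rw [map_zero, zero_add, xv_mul_lap_mon, pd_lap, pd_mon_add] at h2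
      · exact h2
      · rw [Finsupp.add_apply, h0', unitExp_ne (by simp)]
  rintro _ ⟨⟨f, x, y⟩, ⟨⟨⟨k1, k2, k3⟩, e1, e2, e3⟩, ht⟩, rfl⟩
  simp only at k1 k2 k3 e1 e2 e3
  obtain ⟨t1, -⟩ := mem_spTop.1 ht
  rw [one_mul] at t1
  rw [h11] at e3
  have m1 : f ∈ I.comap (LinearMap.id.prod lap) :=
    mem_of_mon_mem_of_topCoeff k1 t1 fun r hr hT h0 => hAI r hr hT (qdeg_of_euler e1 h0)
  have m2 : x ∈ I.comap (LinearMap.inl K _ _ ∘ₗ lap) :=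
    mem_of_mon_mem _ fun r h0 => hB r (mem_trunc_iff.1 k2 r h0) (qdeg_of_euler e2 h0)
  have m3 : y ∈ I.comap (LinearMap.inr K _ _ ∘ₗ lap) :=
    mem_of_mon_mem _ fun r h0 => hCI r (mem_trunc_iff.1 k3 r h0) (qdeg_of_euler e3 h0)
  have := add_mem (add_mem (Submodule.mem_comap.1 m1) (Submodule.mem_comap.1 m2))
    (Submodule.mem_comap.1 m3)
  rw [spMap_apply]
  simpa using this

/-- The same three families with the parities interchanged: A and B come from even q-degree, C from
odd. The highest monomial is now allowed in A and excluded in C. Weight elements without τ-part are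
sums q_iξ_i + q_jξ_j = Δ(q_iξ_i q_jξ_j). -/
theorem spW_zero_le (hn : 2 ≤ n) (hN : ∀ i, N i ≠ 0) {I : Submodule K (QXi K n × QXi K n)}
    (hne : ∃ u ∈ I, u ≠ 0) (hI : ∀ w ∈ spW (0 : K) N, ∀ u ∈ I, poBr w u ∈ I) :
    spW (0 : K) N ≤ I := by
  have h01 : (0 : K) = 0 ∨ (0 : K) = 1 := Or.inl rfl
  have h11 : (1 + 1 : K) = 0 := CharTwo.add_self_eq_zero 1
  obtain ⟨h1, hx, hq⟩ := spW_ideal_low h01 hn hN hne hI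
  have hA : ∀ r, Admissible (shearLe N) r → (qdeg r : K) = 0 →
      ((mon r : QXi K n), lap (mon r)) ∈ spW (0 : K) N := fun r hr h =>
    fst_mem_spW (mon_mem_trunc hr) (by rw [euler_mon, h]) (zero_mul _)
  have hC : ∀ r, Admissible (shearLe N) r → ¬ IsTopExp N r → (qdeg r : K) = 1 →
      (0, lap (mon r : QXi K n)) ∈ spW (0 : K) N := fun r hr hT h =>
    snd_mem_spW (mon_mem_trunc hr) (by rw [euler_mon, h, add_zero])
      (by rw [topCoeff_mon_of_not hT, mul_zero])
  have hB : ∀ f : QXi K n, f ∈ trunc (shearLe N) → euler f = (0 : K) • f → (lap f, (0 : QXi K n)) ∈ I :=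
    fun f hf he => h1 _ (fst_mem_spW hf he (zero_mul _))
  -- the weight elements
  have hw : ∀ i j, j ≠ i → ((qv i * xv i + qv j * xv j : QXi K n), (0 : QXi K n)) ∈ I := by
    intro i j hj
    have e1 : pb (qv i * xv i : QXi K n) (qv j * xv j) = 0 := by
      rw [buttin_mul_left, pb_xv, pb_qv, pd_pair_eq_zero (by simpa using hj.symm) (by simp),
        pd_pair_eq_zero (by simp) (by simpa using hj.symm)]; simp
    have := hB ((qv i * xv i) * (qv j * xv j)) (mul_mem_trunc (mul_mem_trunc (qv_mem hN _) (xv_mem _))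
      (mul_mem_trunc (qv_mem hN _) (xv_mem _))) (by
        rw [Derivation.leibniz, euler_weight, euler_weight, smul_eq_mul, smul_eq_mul, zero_smul,
          mul_comm, two_eq_zero])
    rw [delta_mul, lap_qv_mul_xv_same, lap_qv_mul_xv_same, mul_one, mul_one, e1, add_zero] at this
    exact this
  have hwt : ∀ i j f g, poBr ((qv i * xv i + qv j * xv j : QXi K n), 0) (f, g) =
      (pb (qv i * xv i) f + pb (qv j * xv j) f, pb (qv i * xv i) g + pb (qv j * xv j) g) := by
    intro i j f g
    simp only [poBr, map_add, euler_weight, two_eq_zero, zero_mul, add_zero, buttin_zero_left,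
      map_zero, buttin_add_left]
  have hwI : ∀ i j, j ≠ i → ∀ u ∈ spW (0 : K) N,
      poBr ((qv i * xv i + qv j * xv j : QXi K n), 0) u ∈ I := fun i j hj u hu => by
    rw [poBr_comm]; exact hI u hu _ (hw i j hj)
  have hCI : ∀ r, Admissible (shearLe N) r → ¬ IsTopExp N r → (qdeg r : K) = 1 →
      ((0 : QXi K n), lap (mon r : QXi K n)) ∈ I := by
    intro r hr hT h
    by_cases hs : ∃ i, Admissible (shearLe N) (r + unitExp (Sum.inl i))
    · obtain ⟨i, hA'⟩ := hs
      have hd : (qdeg (r + unitExp (Sum.inl i)) : K) = 0 := by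
        rw [qdeg_add, qdeg_unitExp_inl, Nat.cast_add, h, Nat.cast_one, h11]
      have h2 := hq _ (hA _ hA' hd) i
      -- This is the first component of `h2`, by the product rule for Δ(ξ_i · ); removing it
      -- isolates the element of family C.
      have h3 := hB (xv i * mon (r + unitExp (Sum.inl i)))
        (mul_mem_trunc (xv_mem i) (mon_mem_trunc hA')) (by
          rw [Derivation.leibniz, euler_xv, euler_mon, hd, zero_smul, zero_smul]; simp)
      have h4 := sub_mem h2 h3
      rw [lap_xv_mul, Prod.mk_sub_mk, sub_zero, add_comm (xv i * _), sub_self, pd_lap,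
        pd_mon_add] at h4
      exact h4
    · push Not at hs
      have hq' : ∀ i, r (Sum.inl i) % 2 = 1 := fun i =>
        ((admissible_add_or hr hN (Sum.inl i)).resolve_left (hs i)).choose_spec.2.2
      by_cases h0 : ∀ i, r (Sum.inr i) = 0
      · have hz : lap (mon r : QXi K n) = 0 := by
          rw [delta_apply]
          exact Finset.sum_eq_zero fun i _ => by
            rw [← frame_comm isFrame_qxi, pd_mon_zero (h0 i), map_zero]
        rw [hz]
        exact zero_mem I
      · push Not at h0
        obtain ⟨j, hj⟩ := h0
        -- Not every ξ can be present, since r is not the highest exponent although all q-exponents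
        -- are maximal. One present and one absent ξ give the sum of two weights odd parity.
        obtain ⟨i, hi⟩ : ∃ i, r (Sum.inr i) = 0 := by
          by_contra hc
          push Not at hc
          obtain ⟨i, hi⟩ := exists_admissible_add_inl hr hN (fun i => by
            have := apply_inr_le hr i
            have := hc i
            omega) hT
          exact hs i hi
        have hji : j ≠ i := by rintro rfl; exact hj hi
        have hj1 := apply_inr_le hr j
        have hqi := hq' i
        have hqj := hq' j
        have := hwI i j hji _ (hC r hr hT h)
        rw [hwt, pb_weight_lap hN hr, pb_weight_lap hN hr, natCast_odd (by omega),
          natCast_even (by omega)] at this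
        simpa using this
  have hAI : ∀ r, Admissible (shearLe N) r → (qdeg r : K) = 0 →
      ((mon r : QXi K n), lap (mon r)) ∈ I := by
    intro r hr h
    by_cases h0 : ∃ i, r (Sum.inr i) = 0
    · obtain ⟨i, hi⟩ := h0
      have := hx _ (hA _ (admissible_add_inr hr hN hi)
        (by rw [qdeg_add, qdeg_unitExp_inr, add_zero, h])) i
      rw [pd_lap, pd_mon_add] at this
      exact this
    push Not at h0
    have h0' : ∀ i, r (Sum.inr i) = 1 := fun i => by
      have := apply_inr_le hr i
      have := h0 i
      omega
    by_cases hT : IsTopExp N r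
    · have i : Fin n := ⟨0, by omega⟩
      obtain ⟨j, hj⟩ := exists_ne_fin hn i
      have htop : ∀ k, r (Sum.inl k) % 2 = 1 := fun k => by
        rw [hT.2]; exact topExp_mod hT.1 hN _
      obtain ⟨s, rfl⟩ := exists_add (i := Sum.inl j) (r := r) (by have := htop j; omega)
      have hs := admissible_of_add hr
      have hsd : (qdeg s : K) = 1 := by
        rw [qdeg_add, qdeg_unitExp_inl, Nat.cast_add, Nat.cast_one] at h
        exact CharTwo.add_eq_zero.1 h
      have hsT := not_isTop_of_admissible hr
      have hsi : s (Sum.inr i) = 1 := by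
        have := h0' i
        rwa [Finsupp.add_apply, unitExp_ne (by simp), add_zero] at this
      have hsq : s (Sum.inl i) % 2 = 1 := by
        have := htop i
        rwa [Finsupp.add_apply, unitExp_ne (by simpa using hj.symm), add_zero] at this
      have hsj : (s (Sum.inl j) + 1) % 2 = 1 := by
        have := htop j
        rwa [Finsupp.add_apply, unitExp_same] at this
      -- The highest monomial cannot be raised; it is the product of f = q_j q_iξ_i and Δu^(s),
      -- where s is its exponent with q_j lowered. The bracket of (f, Δf) with the element (0,
      -- Δu^(s)) of I is exactly (fΔu^(s), Δ(fΔu^(s))).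
      have hf : (qv j * (qv i * xv i) : QXi K n) ∈ trunc (shearLe N) := triple_mem (hN := hN) _ _
      have he := euler_triple_inl (K := K) j i
      have hw : (qv j * (qv i * xv i) : QXi K n) * lap (mon s) = mon (s + unitExp (Sum.inl j)) := by
        rw [mul_assoc, mul_assoc, xv_mul_lap_mon hsi, var_mul_pd_mon, natCast_odd hsq, one_smul, qv,
          var_mul_mon, natCast_odd hsj, one_smul]
      have h2 := hI _ (fst_mem_spW hf (by rw [he, zero_smul]) (zero_mul _)) _ (hCI s hs hsT hsd)
      have h3 := poBr_special_zero (w := 0) (z := 0) (f' := 0) (z' := 0) (w' := lap (mon s : QXi K n))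
        hf (zero_mem _) (map_zero _) (map_zero _) (map_zero _) (lap_lap (mon_mem_trunc hs))
        he (map_zero _) (map_zero _) (map_zero _) (map_zero _)
        (by rw [euler_lap_mon, hsd, h11, zero_smul]) (zero_mem _) (zero_mem _)
      simp only [map_zero, add_zero, zero_add, mul_zero, zero_mul] at h3
      rw [h3, spMap_apply, hw] at h2
      simpa using h2
    · obtain ⟨i, hi⟩ := exists_admissible_add_inl hr hN h0' hT
      have hd : (qdeg (r + unitExp (Sum.inl i)) : K) = 1 := by
        rw [qdeg_add, qdeg_unitExp_inl, Nat.cast_add, h]; simp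
      by_cases hT' : IsTopExp N (r + unitExp (Sum.inl i))
      -- One q_i below the highest monomial: the weight at i is odd and at any other j even, so
      -- q_iξ_i + q_jξ_j acts by 1.
      · obtain ⟨j, hj⟩ := exists_ne_fin hn i
        have e1 := congrArg (fun s => s (Sum.inl i)) hT'.2
        have e2 := congrArg (fun s => s (Sum.inl j)) hT'.2
        simp only [Finsupp.add_apply] at e1 e2
        rw [unitExp_same] at e1
        rw [unitExp_ne (by simpa using hj)] at e2
        have t1 := topExp_mod hT'.1 hN (Sum.inl i)
        have t2 := topExp_mod hT'.1 hN (Sum.inl j)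
        have x1 := h0' i
        have x2 := h0' j
        have := hwI i j hj _ (hA r hr h)
        rw [hwt, pb_weight_lap hN hr, pb_weight_lap hN hr, pb_weight, pb_weight,
          natCast_odd (by omega), natCast_even (by omega)] at this
        simpa using this
      · have h2 := hq _ (hC _ hi hT' hd) i
        rw [map_zero, zero_add, xv_mul_lap_mon, pd_lap, pd_mon_add] at h2
        · exact h2
        · rw [Finsupp.add_apply, h0', unitExp_ne (by simp)]
  rintro _ ⟨⟨f, x, y⟩, ⟨⟨⟨k1, k2, k3⟩, e1, e2, e3⟩, ht⟩, rfl⟩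
  simp only at k1 k2 k3 e1 e2 e3
  obtain ⟨-, t3⟩ := mem_spTop.1 ht
  rw [add_zero, one_mul] at t3
  rw [add_zero] at e3
  have m1 : f ∈ I.comap (LinearMap.id.prod lap) :=
    mem_of_mon_mem _ fun r h0 => hAI r (mem_trunc_iff.1 k1 r h0) (qdeg_of_euler e1 h0)
  have m3 : y ∈ I.comap (LinearMap.inr K _ _ ∘ₗ lap) :=
    mem_of_mon_mem_of_topCoeff k3 t3 fun r hr hT h0 => hCI r hr hT (qdeg_of_euler e3 h0)
  have := add_mem (add_mem (Submodule.mem_comap.1 m1) (hB x k2 e2)) (Submodule.mem_comap.1 m3)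
  rw [spMap_apply]
  simpa using this

theorem isSimpleModel_special {c a b : K} (ha : a ≠ 0) (hc : b / a = c) (h01 : c = 0 ∨ c = 1)
    (hn : 2 ≤ n) (hN : ∀ i, N i ≠ 0) :
    IsSimpleModel (poV a b N) (poMap a b N) poBr (spW c N) := by
  have hle := (spW_le c).trans (spW₁_le_poV (N := N) ha hc h01)
  have hM0 : ∀ u : poV a b N, poMap a b N u = 0 → u = 0 := fun u hu =>
    poMap_injective (hu.trans (map_zero _).symm)
  refine ⟨hle, fun u hu => by rw [hM0 u hu]; exact zero_mem _,
    fun u hu v hv => poBr_mem_spW h01 (spW_le c hu) (spW_le c hv), ?_, ?_⟩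
  · have i : Fin n := ⟨0, by omega⟩
    refine ⟨⟨_, hle (qv_mem_spW h01 hn hN i)⟩, ⟨_, hle (xv_mem_spW h01 hn hN i)⟩,
      qv_mem_spW h01 hn hN i, xv_mem_spW h01 hn hN i, fun h => ?_⟩
    obtain ⟨hm, e⟩ := (isModel_po a b N).lie ⟨_, hle (qv_mem_spW h01 hn hN i)⟩
      ⟨_, hle (xv_mem_spW h01 hn hN i)⟩
    rw [e] at h
    have := congrArg (fun u : poV a b N => u.1.1) (hM0 _ h)
    simp only [poBr_qv, pd_var_same] at this
    exact mon_ne_zero _ this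
  · rintro I - - ⟨u, hu, hu0⟩ hI
    have hne : ∃ u ∈ I, u ≠ 0 := ⟨u, hu, fun h => hu0 (by
      rw [show u = 0 from Subtype.ext h, map_zero])⟩
    rcases h01 with rfl | rfl
    · exact spW_zero_le hn hN hne hI
    · exact spW_one_le hn hN hne hI

theorem poAlg_derived_one {c a b : K} (ha : a ≠ 0) (hc : b / a = c) (h01 : c = 0 ∨ c = 1) :
    ∀ D ∈ LieAlgebra.derivedSeries K (poAlg a b N) 1,
      ∃ u : poV a b N, (u : QXi K n × QXi K n) ∈ spW₁ c N ∧ poMap a b N u = D :=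
  (isModel_po a b N).derived_succ (k := 0) (fun D _ => (isModel_po a b N).derived_zero D)
    fun _ hu _ hv => poBr_mem_spW₁ ha hc h01 hu hv

theorem poAlg_special_isSimple {c a b : K} (ha : a ≠ 0) (hc : b / a = c) (h01 : c = 0 ∨ c = 1)
    (hn : 2 ≤ n) (hN : ∀ i, N i ≠ 0) :
    LieAlgebra.IsSimple K (LieAlgebra.derivedSeries K (poAlg a b N) 2) :=
  (isSimpleModel_special ha hc h01 hn hN).isSimple (isModel_po a b N)
    ((isModel_po a b N).derived_succ (k := 1) (poAlg_derived_one ha hc h01)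
      fun _ hu _ hv => poBr_mem_spW h01 hu hv)

end PoSpecialIdeal

end

section

open DivPow

/-! ### Antiderivatives of divided powers and squarefree monomials -/

namespace DivPow

variable {K ι : Type*} [Field K] [Fintype ι]

/-- The linear map `u^(r) ↦ u^(r + e_i)`. -/
def raise (i : ι) : DivPow K ι →ₗ[K] DivPow K ι := lift fun r => mon (r + unitExp i)

theorem raise_mon (i : ι) (r : ι →₀ ℕ) : raise i (mon r : DivPow K ι) = mon (r + unitExp i) :=
  lift_mon _ _

theorem pd_raise_same (i : ι) (f : DivPow K ι) : pd i (raise i f) = f := by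
  refine induct (p := fun f => pd i (raise i f) = f) f (by simp) ?_ ?_ fun r => ?_
  · intro a b ha hb; rw [map_add, map_add, ha, hb]
  · intro c a ha; rw [map_smul, Derivation.map_smul, ha]
  · rw [raise_mon, pd_mon_add]

theorem pd_raise_ne {i j : ι} (h : j ≠ i) (f : DivPow K ι) :
    pd j (raise i f) = raise i (pd j f) := by
  refine induct (p := fun f => pd j (raise i f) = raise i (pd j f)) f (by simp) ?_ ?_ fun r => ?_
  · intro a b ha hb; simp only [map_add, ha, hb]
  · intro c a ha; simp only [map_smul, Derivation.map_smul, ha]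
  · rw [raise_mon]
    by_cases h0 : r j = 0
    · rw [pd_mon_zero h0, pd_mon_zero, map_zero]
      rw [Finsupp.add_apply, h0, unitExp_ne h]
    · obtain ⟨s, rfl⟩ := exists_add h0
      rw [pd_mon_add, raise_mon, add_right_comm, pd_mon_add]

theorem raise_mem_trunc {N : ι → ℕ∞} {i : ι} (h : N i = ⊤) {f : DivPow K ι} (hf : f ∈ trunc N) :
    raise i f ∈ trunc N := by
  refine Submodule.span_induction (p := fun f _ => raise i f ∈ trunc N) ?_ ?_ ?_ ?_ hf
  · rintro _ ⟨r, hr, rfl⟩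
    rw [raise_mon]
    refine mon_mem_trunc fun j k hk => ?_
    have hj : j ≠ i := by
      rintro rfl
      rw [h] at hk
      exact ENat.natCast_ne_top k hk.symm
    rw [Finsupp.add_apply, unitExp_ne hj]
    exact hr j k hk
  · rw [map_zero]; exact zero_mem _
  · intro a b _ _ ha hb; rw [map_add]; exact add_mem ha hb
  · intro c a _ ha; rw [map_smul]; exact Submodule.smul_mem _ _ ha

theorem prod_var_eq_mon {κ : Type*} (s : Finset κ) {φ : κ → ι} (hφ : Function.Injective φ) :
    (∏ j ∈ s, var (φ j) : DivPow K ι) = mon (∑ j ∈ s, unitExp (φ j)) := by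
  classical
  induction s using Finset.induction_on with
  | empty => simp [one_def]
  | insert j s hj ih =>
    rw [Finset.prod_insert hj, ih, var_mul_mon, Finset.sum_insert hj]
    have : (∑ k ∈ s, unitExp (φ k) : ι →₀ ℕ) (φ j) = 0 := by
      rw [Finsupp.finsetSum_apply]
      exact Finset.sum_eq_zero fun k hk => unitExp_ne fun e => hj (hφ e ▸ hk)
    rw [this, zero_add, Nat.cast_one, one_smul, add_comm]

theorem sum_unitExp_apply_mem {κ : Type*} {s : Finset κ} {φ : κ → ι} (hφ : Function.Injective φ)
    {j : κ} (hj : j ∈ s) : (∑ k ∈ s, unitExp (φ k) : ι →₀ ℕ) (φ j) = 1 := by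
  rw [Finsupp.finsetSum_apply, Finset.sum_eq_single_of_mem j hj, unitExp_same]
  exact fun k _ hk => unitExp_ne fun e => hk (hφ e).symm

theorem sum_unitExp_apply_of_forall_ne {κ : Type*} {s : Finset κ} {φ : κ → ι} {i : ι}
    (h : ∀ j ∈ s, i ≠ φ j) : (∑ k ∈ s, unitExp (φ k) : ι →₀ ℕ) i = 0 := by
  rw [Finsupp.finsetSum_apply]
  exact Finset.sum_eq_zero fun k hk => unitExp_ne (h k hk)

end DivPow

/-! ### The Poincaré lemma for Δ -/

section Poincare

variable {K : Type*} [Field K] {n : ℕ}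

/-- The product of all the `ξ_i`. -/
def xiTop (K : Type*) [Field K] (n : ℕ) : QXi K n := ∏ i, xv i

/-- The exponent of the product of all the `ξ_i`. -/
def xiExp (n : ℕ) : Fin n ⊕ Fin n →₀ ℕ := ∑ i, unitExp (Sum.inr i)

theorem xiTop_eq : xiTop K n = mon (xiExp n) := prod_var_eq_mon _ Sum.inr_injective

theorem xiExp_inl (i : Fin n) : xiExp n (Sum.inl i) = 0 :=
  sum_unitExp_apply_of_forall_ne fun _ _ => by simp

theorem xiExp_inr (i : Fin n) : xiExp n (Sum.inr i) = 1 :=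
  sum_unitExp_apply_mem Sum.inr_injective (Finset.mem_univ i)

theorem eq_xiExp {r : Fin n ⊕ Fin n →₀ ℕ} (h : ∀ i, r (Sum.inl i) = 0 ∧ r (Sum.inr i) = 1) :
    r = xiExp n := by
  ext z
  rcases z with i | i
  · rw [(h i).1, xiExp_inl]
  · rw [(h i).2, xiExp_inr]

theorem qdeg_xiExp : qdeg (xiExp n) = 0 := Finset.sum_eq_zero fun i _ => xiExp_inl i

variable [CharP K 2] {N : Fin n → ℕ∞}

theorem xiTop_mem : xiTop K n ∈ trunc (shearLe N) :=
  prod_var_mem_trunc _ fun i _ => by simp [shearLe]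

theorem euler_xiTop : euler (xiTop K n) = 0 := by
  rw [xiTop_eq, euler_mon, qdeg_xiExp, Nat.cast_zero, zero_smul]

theorem lap_xiTop : lap (xiTop K n) = 0 := by
  rw [xiTop_eq, delta_apply]
  exact Finset.sum_eq_zero fun i _ => by rw [pd_mon_zero (xiExp_inl i), map_zero]

/-- A term of f contributing to this coefficient of Δf would have to contain ξ_i². -/
theorem coeff_xiExp_lap {f : QXi K n} (hf : f ∈ trunc (shearLe N)) :
    coeff (xiExp n) (lap f) = 0 := by
  rw [delta_apply, map_sum]
  refine Finset.sum_eq_zero fun i _ => ?_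
  rw [coeff_pd, coeff_pd]
  by_contra h
  have := apply_inr_le (mem_trunc_iff.1 hf _ h) i
  rw [Finsupp.add_apply, Finsupp.add_apply, unitExp_same, xiExp_inr] at this
  omega

/-- The operator `raise` is a right inverse of ∂_{q_i} but not a left one: composed the other way it
drops the terms free of q_i. The correction is the ξ_i-derivative of just these terms. -/
theorem lap_raise (i : Fin n) (f : QXi K n) : lap (raise (Sum.inl i) f) =
    raise (Sum.inl i) (lap f) + dxi i (f + raise (Sum.inl i) (dq i f)) := by
  rw [delta_apply, delta_apply, map_sum, ← Finset.add_sum_erase _ _ (Finset.mem_univ i),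
    ← Finset.add_sum_erase _ (fun j => raise (Sum.inl i) (dxi j (dq j f))) (Finset.mem_univ i),
    pd_raise_same, map_add, pd_raise_ne (by simp)]
  have : ∑ j ∈ Finset.univ.erase i, dxi j (dq j (raise (Sum.inl i) f)) =
      ∑ j ∈ Finset.univ.erase i, raise (Sum.inl i) (dxi j (dq j f)) :=
    Finset.sum_congr rfl fun j hj => by
      rw [pd_raise_ne (by simpa using Finset.ne_of_mem_erase hj), pd_raise_ne (by simp)]
  rw [this]
  linear_combination - two_eq_zero (raise (Sum.inl i) (dxi i (dq i f)))

/-- The sum of f and its q_i-antidifferentiated q_i-derivative consists of the terms of f free of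
q_i, and ξ_i∂_{ξ_i} keeps those divisible by ξ_i. -/
theorem coeff_xv_mul_dxi (i : Fin n) {f : QXi K n} (hf : f ∈ trunc (shearLe N))
    {r : Fin n ⊕ Fin n →₀ ℕ} (h : coeff r (xv i * dxi i (f + raise (Sum.inl i) (dq i f))) ≠ 0) :
    r (Sum.inl i) = 0 ∧ r (Sum.inr i) = 1 ∧ coeff r f ≠ 0 := by
  have key : coeff r (xv i * dxi i (f + raise (Sum.inl i) (dq i f))) =
      if r (Sum.inl i) = 0 ∧ r (Sum.inr i) = 1 then coeff r f else 0 := by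
    refine Submodule.span_induction (p := fun f _ =>
      coeff r (xv i * dxi i (f + raise (Sum.inl i) (dq i f))) =
      if r (Sum.inl i) = 0 ∧ r (Sum.inr i) = 1 then coeff r f else 0) ?_ ?_ ?_ ?_ hf
    · rintro _ ⟨s, hs, rfl⟩
      have hs1 := apply_inr_le hs i
      by_cases h0 : s (Sum.inl i) = 0
      · rw [pd_mon_zero h0, map_zero, add_zero, var_mul_pd_mon, map_smul, smul_eq_mul]
        by_cases hrs : s = r
        · subst hrs
          rw [coeff_mon_self]
          by_cases h1 : s (Sum.inr i) = 1
          · rw [if_pos ⟨h0, h1⟩, h1]; simp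
          · rw [if_neg fun h => h1 h.2, show s (Sum.inr i) = 0 by omega]; simp
        · rw [coeff_mon_ne hrs]; simp
      · obtain ⟨t, rfl⟩ := exists_add h0
        rw [pd_mon_add, raise_mon, two_eq_zero, map_zero, mul_zero, map_zero]
        split_ifs with hr
        · rw [coeff_mon_ne]
          rintro rfl
          exact h0 hr.1
        · rfl
    · simp
    · intro a b _ _ ha hb
      have : xv i * dxi i (a + b + raise (Sum.inl i) (dq i (a + b))) =
        xv i * dxi i (a + raise (Sum.inl i) (dq i a)) +
          xv i * dxi i (b + raise (Sum.inl i) (dq i b)) := by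
        simp only [map_add]; ring
      rw [this, map_add, ha, hb]
      split_ifs <;> simp
    · intro c a _ ha
      have : xv i * dxi i (c • a + raise (Sum.inl i) (dq i (c • a))) =
        c • (xv i * dxi i (a + raise (Sum.inl i) (dq i a))) := by
        rw [Derivation.map_smul, map_smul, ← smul_add, Derivation.map_smul, mul_smul_comm]
      rw [this, map_smul, ha]
      split_ifs <;> simp
  rw [key] at h
  split_ifs at h with h'
  · exact ⟨h'.1, h'.2, h⟩
  · exact absurd rfl h

/-- The Poincaré lemma for the operator `Δ` and the shearing vector `(∞, …, ∞)`. -/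
theorem exists_lap_add {f : QXi K n} (hN : ∀ i, N i = ⊤) (hf : f ∈ trunc (shearLe N))
    (h : lap f = 0) : ∃ x ∈ trunc (shearLe N), ∃ κ : K, f = lap x + κ • xiTop K n := by
  classical
  have key : ∀ s : Finset (Fin n), ∃ x ∈ trunc (shearLe N), ∃ g ∈ trunc (shearLe N),
      f = lap x + g ∧ ∀ r, coeff r g ≠ 0 → ∀ i ∈ s, r (Sum.inl i) = 0 ∧ r (Sum.inr i) = 1 := by
    intro s
    induction s using Finset.induction_on with
    | empty => exact ⟨0, zero_mem _, f, hf, by simp, by simp⟩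
    | insert i s hi ih =>
      obtain ⟨x, hx, g, hg, e, hr⟩ := ih
      have hg0 : lap g = 0 := by
        rw [e, map_add, lap_lap hx, zero_add] at h
        exact h
      have hT : shearLe N (Sum.inl i) = ⊤ := hN i
      have hR := raise_mem_trunc hT hg
      -- The homotopy is ξ_i times the antiderivative in q_i: Δ of it returns the closed g up to the
      -- terms of g without q_i and with ξ_i. Doing this for every i leaves only a multiple of
      -- ξ_1⋯ξ_n.
      refine ⟨x + xv i * raise (Sum.inl i) g, add_mem hx (mul_mem_trunc (xv_mem i) hR),
        xv i * dxi i (g + raise (Sum.inl i) (dq i g)), mul_mem_trunc (xv_mem i)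
          (pd_mem_trunc _ (add_mem hg (raise_mem_trunc hT (pd_mem_trunc _ hg)))), ?_, ?_⟩
      · rw [map_add, lap_xv_mul, lap_raise, hg0, map_zero, zero_add, pd_raise_same]
        linear_combination e - two_eq_zero (xv i * dxi i (g + raise (Sum.inl i) (dq i g)))
      · intro r h0 j hj
        obtain ⟨h1, h2, h3⟩ := coeff_xv_mul_dxi i hg h0
        rcases Finset.mem_insert.1 hj with rfl | hj
        · exact ⟨h1, h2⟩
        · exact hr r h3 j hj
  obtain ⟨x, hx, g, hg, e, hr⟩ := key Finset.univ
  refine ⟨x, hx, coeff (xiExp n) g, ?_⟩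
  rw [e, xiTop_eq]
  congr 1
  refine ext_coeff fun r => ?_
  rw [map_smul, smul_eq_mul]
  by_cases h0 : r = xiExp n
  · rw [h0, coeff_mon_self, mul_one]
  · rw [coeff_mon_ne (Ne.symm h0), mul_zero]
    by_contra hc
    exact h0 (eq_xiExp fun i => hr r hc i (Finset.mem_univ i))

/-- Projecting the primitive to the parity opposite to that of f keeps the identity. The leftover
ξ_1⋯ξ_n has q-degree 0, so it can occur only for even f. -/
theorem exists_lap_add_of_euler {f : QXi K n} (hN : ∀ i, N i = ⊤) (hf : f ∈ trunc (shearLe N))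
    (h : lap f = 0) {d : K} (hd : d = 0 ∨ d = 1) (he : euler f = d • f) :
    ∃ x ∈ trunc (shearLe N), euler x = (1 + d) • x ∧
      ∃ κ : K, f = lap x + ((1 + d) * κ) • xiTop K n := by
  obtain ⟨x, hx, κ, e⟩ := exists_lap_add hN hf h
  refine ⟨d • x + euler x, add_mem (Submodule.smul_mem _ _ hx) (euler_mem hx), ?_, κ, ?_⟩
  · rw [map_add, Derivation.map_smul, euler_euler]
    rcases hd with rfl | rfl
    · simp
    · rw [one_smul, one_smul, two_eq_zero, CharTwo.add_self_eq_zero, zero_smul]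
  · have e2 := congrArg euler e
    rw [map_add, Derivation.map_smul, euler_xiTop, smul_zero, add_zero, euler_lap, he] at e2
    rw [map_add, map_smul]
    have e3 : lap (euler x) = d • f + lap x := by
      linear_combination (norm := module) - e2 - two_eq_zero (lap x)
    rw [e3, e]
    rcases hd with rfl | rfl
    · simp
    · rw [CharTwo.add_self_eq_zero, zero_mul, zero_smul, one_smul]
      linear_combination (norm := module) - two_eq_zero (lap x)

end Poincare

/-! ### The complements of codimension one for infinite shearing -/

section PoInfinite

variable {K : Type*} [Field K] [CharP K 2] {n : ℕ}

theorem topCoeff_of_top (hn : 2 ≤ n) : topCoeff (K := K) (fun _ : Fin n => ⊤) = 0 :=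
  if_neg fun h => h ⟨0, by omega⟩ rfl

theorem spW_top (hn : 2 ≤ n) (c : K) : spW c (fun _ : Fin n => ⊤) = spW₁ c fun _ => ⊤ := by
  have : spTop c (fun _ : Fin n => ⊤) = ⊤ := eq_top_iff.2 fun p _ => by
    rw [mem_spTop, topCoeff_of_top hn]; simp
  rw [spW, this, inf_top_eq, spW₁]

/-- By the Poincaré lemma, z and w are exact up to ξ_1⋯ξ_n. That monomial is even in q, so it is
compatible with the parity of z only for c = 1 and with that of w only for c = 0: a single class
survives. -/
theorem poAlg_infinite_aux {c a b : K} (ha : a ≠ 0) (hc : b / a = c) (h01 : c = 0 ∨ c = 1)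
    (hn : 2 ≤ n) (t : QXi K n × QXi K n) (ht : t = (c • xiTop K n, (1 + c) • xiTop K n)) :
    LieAlgebra.IsSimple K (LieAlgebra.derivedSeries K (poAlg a b fun _ : Fin n => ⊤) 1) ∧
      ∃ h : contactField (pairFun t) ∈ poAlg a b fun _ : Fin n => ⊤,
        ⟨_, h⟩ ∉ LieAlgebra.derivedSeries K (poAlg a b fun _ : Fin n => ⊤) 1 ∧
        (LieAlgebra.derivedSeries K (poAlg a b fun _ : Fin n => ⊤) 1).toSubmodule ⊔
          Submodule.span K {⟨_, h⟩} = ⊤ := by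
  have h11 : (1 + 1 : K) = 0 := CharTwo.add_self_eq_zero 1
  have hs := isSimpleModel_special (N := fun _ : Fin n => ⊤) ha hc h01 hn (by simp)
  have hm := isModel_po a b (fun _ : Fin n => ⊤)
  have hk := poAlg_derived_one (N := fun _ : Fin n => ⊤) ha hc h01
  rw [← spW_top hn] at hk
  have htV : t ∈ poV a b fun _ : Fin n => ⊤ :=
    (mem_poV_special ha hc h01).2 ⟨0, c • xiTop K n, (1 + c) • xiTop K n,
      ⟨zero_mem _, Submodule.smul_mem _ _ xiTop_mem, Submodule.smul_mem _ _ xiTop_mem⟩,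
      ⟨by simp, by
        rw [Derivation.map_smul, euler_xiTop, smul_zero]
        rcases h01 with rfl | rfl <;> simp [h11], by
        rw [Derivation.map_smul, euler_xiTop, smul_zero]
        rcases h01 with rfl | rfl <;> simp [h11]⟩,
      ⟨by rw [map_smul, lap_xiTop, smul_zero], by rw [map_smul, lap_xiTop, smul_zero]⟩, by simp [ht]⟩
  have hx : coeff (xiExp n) (xiTop K n) = 1 := by rw [xiTop_eq, coeff_mon_self]
  refine ⟨hs.isSimple hm hk, contactField_mem htV, ?_, ?_⟩
  · intro h
    obtain ⟨⟨f, x, y⟩, ⟨⟨⟨k1, k2, k3⟩, e1, e2, e3⟩, -⟩, e⟩ :=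
      (hs.mem_derivedSeries_iff hm hk ⟨t, htV⟩).1 h
    simp only at k1 k2 k3 e1 e2 e3
    replace e : (f + lap x, lap f + lap y) = t := e
    rw [ht] at e
    have e4 := congrArg (fun u => coeff (xiExp n) u.1) e
    have e5 := congrArg (fun u => coeff (xiExp n) u.2) e
    -- The image of Δ has no term ξ_1⋯ξ_n. For c = 0 this is already contradictory; for c = 1 the
    -- term would have to come from f, whose q-degree is odd.
    simp only [map_add, map_smul, coeff_xiExp_lap k1, coeff_xiExp_lap k2, coeff_xiExp_lap k3, hx,
      smul_eq_mul, mul_one, add_zero] at e4 e5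
    rcases h01 with rfl | rfl
    · simp at e5
    · have := qdeg_of_euler e1 (by rw [e4]; exact one_ne_zero)
      rw [qdeg_xiExp] at this
      simp at this
  · refine eq_top_iff.2 fun D _ => ?_
    obtain ⟨u, rfl⟩ := hm.surj D
    obtain ⟨f, z, w, ⟨h1, h2, h3⟩, ⟨e1, e2, e3⟩, ⟨hz, hw⟩, e⟩ := (mem_poV_special ha hc h01).1 u.2
    obtain ⟨x, hx, ex, κ, e4⟩ := exists_lap_add_of_euler (fun _ => rfl) h2 hz
      (d := 1 + c) (by rcases h01 with rfl | rfl <;> simp [h11]) e2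
    obtain ⟨y, hy, ey, κ', e5⟩ := exists_lap_add_of_euler (fun _ => rfl) h3 hw h01 e3
    rw [add_add_self] at ex e4
    have hW : spMap (f, x, y) ∈ spW c fun _ : Fin n => ⊤ := by
      rw [spW_top hn]
      exact ⟨_, ⟨⟨h1, hx, hy⟩, e1, ex, ey⟩, rfl⟩
    have hsum : u = ⟨_, hs.le hW⟩ + (c * κ + (1 + c) * κ') • (⟨t, htV⟩ : poV a b fun _ => ⊤) := by
      refine Subtype.ext (e.trans ?_)
      change _ = spMap (f, x, y) + (c * κ + (1 + c) * κ') • t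
      rw [spMap_apply, ht, e4, e5]
      rcases h01 with rfl | rfl
      · simp [add_assoc]
      · simp [add_assoc, h11]
    rw [hsum, map_add, map_smul]
    exact Submodule.add_mem_sup ((hs.mem_derivedSeries_iff hm hk ⟨_, hs.le hW⟩).2 hW)
      (Submodule.smul_mem _ _ (Submodule.mem_span_singleton_self _))

theorem inc_xiTop : inc (xiTop K n) = ∏ i, var (Sum.inl (Sum.inr i)) := by
  rw [xiTop, map_prod]
  exact Finset.prod_congr rfl fun i _ => incl_var _ _

theorem poAlg_one_infinite {a : K} (ha : a ≠ 0) (hn : 2 ≤ n) :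
    LieAlgebra.IsSimple K (LieAlgebra.derivedSeries K (poAlg a a fun _ : Fin n => ⊤) 1) ∧
      ∃ h : contactField (∏ i, DivPow.var (Sum.inl (Sum.inr i))) ∈ poAlg a a fun _ : Fin n => ⊤,
        ⟨_, h⟩ ∉ LieAlgebra.derivedSeries K (poAlg a a fun _ : Fin n => ⊤) 1 ∧
        (LieAlgebra.derivedSeries K (poAlg a a fun _ : Fin n => ⊤) 1).toSubmodule ⊔
          Submodule.span K {⟨_, h⟩} = ⊤ := by
  have := poAlg_infinite_aux ha (div_self ha) (Or.inr rfl) hn (xiTop K n, 0)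
    (by rw [CharTwo.add_self_eq_zero, one_smul, zero_smul])
  have e : pairFun (xiTop K n, 0) = ∏ i, DivPow.var (Sum.inl (Sum.inr i)) := by
    rw [pairFun_apply, map_zero, mul_zero, add_zero, inc_xiTop]
  rwa [e] at this

theorem poAlg_infty_infinite {a : K} (ha : a ≠ 0) (hn : 2 ≤ n) :
    LieAlgebra.IsSimple K (LieAlgebra.derivedSeries K (poAlg a 0 fun _ : Fin n => ⊤) 1) ∧
      ∃ h : contactField (DivPow.var (Sum.inr ()) * ∏ i, DivPow.var (Sum.inl (Sum.inr i))) ∈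
          poAlg a 0 fun _ : Fin n => ⊤,
        ⟨_, h⟩ ∉ LieAlgebra.derivedSeries K (poAlg a 0 fun _ : Fin n => ⊤) 1 ∧
        (LieAlgebra.derivedSeries K (poAlg a 0 fun _ : Fin n => ⊤) 1).toSubmodule ⊔
          Submodule.span K {⟨_, h⟩} = ⊤ := by
  have := poAlg_infinite_aux ha (zero_div a) (Or.inl rfl) hn (0, xiTop K n)
    (by rw [add_zero, one_smul, zero_smul])
  have e : pairFun (0, xiTop K n) =
      DivPow.var (Sum.inr ()) * ∏ i, DivPow.var (Sum.inl (Sum.inr i)) := by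
    rw [pairFun_apply, map_zero, zero_add, inc_xiTop]
  rwa [e] at this

end PoInfinite

end

section

open DivPow

namespace DivPow

/-! ### Coefficients with respect to some of the indeterminates -/

section Slice

variable {K ι κ : Type*} [Field K] [Fintype ι] [Fintype κ]

/-- The linear map `u^(s) ↦ u^(s - r)` (zero unless `r ≤ s`). -/
def lowerBy (r : ι →₀ ℕ) : DivPow K ι →ₗ[K] DivPow K ι :=
  open Classical in lift fun s => if r ≤ s then mon (s - r) else 0

theorem coeff_lowerBy (r t : ι →₀ ℕ) (f : DivPow K ι) :
    coeff t (lowerBy r f) = coeff (t + r) f := by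
  have : (coeff t).comp (lowerBy (K := K) r) = coeff (t + r) := by
    refine linearMap_ext fun s => ?_
    rw [LinearMap.comp_apply, lowerBy, lift_mon]
    split_ifs with h
    · by_cases e : s - r = t
      · rw [e, coeff_mon_self, coeff_mon_self']
        rw [← e, tsub_add_cancel_of_le h]
      · rw [coeff_mon_ne e, coeff_mon_ne]
        rintro rfl
        exact e (add_tsub_cancel_right _ _)
    · rw [map_zero, coeff_mon_ne]
      rintro rfl
      exact h le_add_self
  exact LinearMap.congr_fun this f

theorem lowerBy_add (r : ι →₀ ℕ) (i : ι) (f : DivPow K ι) :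
    lowerBy (r + unitExp i) f = lowerBy r (pd i f) :=
  ext_coeff fun t => by rw [coeff_lowerBy, coeff_lowerBy, coeff_pd, add_assoc]

theorem lowerBy_zero (f : DivPow K ι) : lowerBy 0 f = f :=
  ext_coeff fun t => by rw [coeff_lowerBy, add_zero]

/-- Extracting coefficients in the other indeterminates is iterated differentiation by them, for
which the included factor is a constant. -/
theorem lowerBy_incl_mul (φ : ι ↪ κ) (g : DivPow K ι) :
    ∀ (r : κ →₀ ℕ) (_ : ∀ i, r (φ i) = 0) (f : DivPow K κ),
      lowerBy r (incl φ g * f) = incl φ g * lowerBy r f := by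
  suffices h : ∀ (d : ℕ) (r : κ →₀ ℕ) (_ : r.degree = d) (_ : ∀ i, r (φ i) = 0) (f : DivPow K κ),
      lowerBy r (incl φ g * f) = incl φ g * lowerBy r f from fun r => h _ r rfl
  intro d
  induction d with
  | zero =>
    intro r hd _ f
    rw [Finsupp.degree_eq_zero_iff] at hd
    rw [hd, lowerBy_zero, lowerBy_zero]
  | succ d ih =>
    intro r hd hr f
    have h0 : r ≠ 0 := by
      rintro rfl
      simp at hd
    obtain ⟨k, hk⟩ := Finsupp.ne_iff.1 h0
    obtain ⟨s, rfl⟩ := exists_add (i := k) (r := r) hk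
    have hkr : k ∉ Set.range φ := by
      rintro ⟨i, rfl⟩
      exact hk (hr i)
    rw [lowerBy_add, Derivation.leibniz, pd_incl_of_notMem φ hkr, smul_zero, add_zero, smul_eq_mul,
      ih s ?_ ?_, lowerBy_add]
    · rw [map_add, unitExp, Finsupp.degree_single] at hd
      omega
    · intro i
      have := hr i
      rw [Finsupp.add_apply] at this
      omega

/-- The coefficient of `u^(r)`, as a function in the indeterminates from `ι`. -/
def slice (φ : ι ↪ κ) (r : κ →₀ ℕ) : DivPow K κ →ₗ[K] DivPow K ι :=
  (proj φ : DivPow K κ →ₐ[K] _).toLinearMap ∘ₗ lowerBy r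

theorem coeff_slice (φ : ι ↪ κ) (r : κ →₀ ℕ) (t : ι →₀ ℕ) (f : DivPow K κ) :
    coeff t (slice φ r f) = coeff (t.mapDomain φ + r) f := by
  rw [← coeff_lowerBy, ← coeff_proj]; rfl

theorem slice_incl_mul (φ : ι ↪ κ) {r : κ →₀ ℕ} (h : ∀ i, r (φ i) = 0) (g : DivPow K ι)
    (f : DivPow K κ) : slice φ r (incl φ g * f) = g * slice φ r f := by
  change proj φ (lowerBy r _) = g * proj φ (lowerBy r f)
  rw [lowerBy_incl_mul φ g r h, map_mul, proj_incl]

theorem slice_pd (φ : ι ↪ κ) (r : κ →₀ ℕ) (i : ι) (f : DivPow K κ) :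
    slice φ r (pd (φ i) f) = pd i (slice φ r f) :=
  ext_coeff fun t => by
    rw [coeff_pd, coeff_slice, coeff_slice, coeff_pd, Finsupp.mapDomain_add, mapDomain_unitExp,
      add_right_comm]

theorem coeff_incl_mapDomain (φ : ι ↪ κ) (r : ι →₀ ℕ) (f : DivPow K ι) :
    coeff (r.mapDomain φ) (incl φ f) = coeff r f := by
  rw [← coeff_proj, proj_incl]

theorem coeff_incl_of_ne (φ : ι ↪ κ) {s : κ →₀ ℕ} {k : κ} (hk : k ∉ Set.range φ) (hs : s k ≠ 0)
    (f : DivPow K ι) : coeff s (incl φ f) = 0 := by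
  obtain ⟨s, rfl⟩ := exists_add hs
  rw [← coeff_pd, pd_incl_of_notMem φ hk, map_zero]

/-- A function that does not depend on the other indeterminates. -/
theorem eq_incl_proj (φ : ι ↪ κ) {f : DivPow K κ} (h : ∀ k ∉ Set.range φ, pd k f = 0) :
    f = incl φ (proj φ f) := by
  have : f ∈ LinearMap.ker (LinearMap.id -
      (incl φ).toLinearMap ∘ₗ (proj φ : DivPow K κ →ₐ[K] _).toLinearMap) := by
    refine mem_of_mon_mem _ fun r hr => ?_
    have hr0 : ∀ k ∉ Set.range φ, r k = 0 := by
      intro k hk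
      by_contra h0
      obtain ⟨s, rfl⟩ := exists_add h0
      rw [← coeff_pd, h k hk, map_zero] at hr
      exact hr rfl
    change (mon r : DivPow K κ) - incl φ (proj φ (mon r)) = 0
    rw [proj_mon φ hr0, incl_mon, Finsupp.mapDomain_comapDomain _ φ.injective, sub_self]
    intro k hk
    by_contra h'
    exact (Finsupp.mem_support_iff.1 hk) (hr0 k h')
  exact sub_eq_zero.1 this

theorem coeff_var_mul_zero {i : ι} {r : ι →₀ ℕ} (h : r i = 0) (f : DivPow K ι) :
    coeff r (var i * f) = 0 := by
  have : (coeff r).comp (LinearMap.mulLeft K (var i : DivPow K ι)) = 0 := by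
    refine linearMap_ext fun s => ?_
    change coeff r (var i * mon s : DivPow K ι) = 0
    rw [var_mul_mon, map_smul, coeff_mon_ne, smul_zero]
    rintro rfl
    rw [Finsupp.add_apply, unitExp_same] at h
    omega
  exact LinearMap.congr_fun this f

theorem coeff_var_mul (i : ι) (r : ι →₀ ℕ) (f : DivPow K ι) :
    coeff (r + unitExp i) (var i * f) = ((r i + 1 : ℕ) : K) * coeff r f := by
  have : (coeff (r + unitExp i)).comp (LinearMap.mulLeft K (var i : DivPow K ι)) =
      ((r i + 1 : ℕ) : K) • coeff r := by
    refine linearMap_ext fun s => ?_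
    change coeff (r + unitExp i) (var i * mon s : DivPow K ι) = ((r i + 1 : ℕ) : K) • coeff r (mon s)
    rw [var_mul_mon, map_smul]
    by_cases h : s = r
    · rw [h, coeff_mon_self, coeff_mon_self]
    · rw [coeff_mon_ne h, coeff_mon_ne (fun e => h (add_right_cancel e)), smul_zero, smul_zero]
  exact LinearMap.congr_fun this f

/-- By the shift formula for coefficients, ∂_i²f = 0 excludes all exponents of u_i greater than 1.
-/
theorem mem_trunc_update [DecidableEq ι] {N : ι → ℕ∞} {i : ι} {f : DivPow K ι} (hf : f ∈ trunc N)
    (h : pd i (pd i f) = 0) : f ∈ trunc (Function.update N i 1) := by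
  rw [mem_trunc_iff] at hf ⊢
  intro r hr j k hk
  by_cases hj : j = i
  · subst hj
    rw [Function.update_self] at hk
    have hk1 : k = 1 := by exact_mod_cast hk.symm
    subst hk1
    by_contra hc
    obtain ⟨s, rfl⟩ := exists_add (i := j) (r := r) (by omega)
    rw [Finsupp.add_apply, unitExp_same] at hc
    obtain ⟨s, rfl⟩ := exists_add (i := j) (r := s) (by omega)
    rw [← coeff_pd, ← coeff_pd, h, map_zero] at hr
    exact hr rfl
  · rw [Function.update_of_ne hj] at hk
    exact hf r hr j k hk

theorem trunc_update_le [DecidableEq ι] {N : ι → ℕ∞} {i : ι} (h : N i ≠ 0) :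
    (trunc (Function.update N i 1) : Submodule K (DivPow K ι)) ≤ trunc N := by
  intro f hf
  rw [mem_trunc_iff] at hf ⊢
  intro r hr j k hk
  by_cases hj : j = i
  · subst hj
    have h1 := hf r hr j 1 (by rw [Function.update_self]; rfl)
    have hk0 : k ≠ 0 := by
      rintro rfl
      exact h (by simpa using hk)
    calc r j < 2 ^ 1 := h1
      _ ≤ 2 ^ k := Nat.pow_le_pow_right (by norm_num) (by omega)
  · exact hf r hr j k (by rw [Function.update_of_ne hj, hk])

/-- The module 𝒪 ⊗ g_0 is the direct sum of copies of g_0 indexed by monomials; this replaces the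
prolong condition by linear conditions on coefficient matrices. -/
theorem mem_matrixSpan_iff [DecidableEq ι] {g0 : LieSubalgebra K (Matrix ι ι K)}
    {J : Matrix ι ι (DivPow K ι)} : J ∈ matrixSpan g0 ↔ ∀ r, J.map (coeff r) ∈ g0 := by
  constructor
  · intro h
    suffices h' : ∀ φ : DivPow K ι →ₗ[K] K, J.map φ ∈ g0 from fun r => h' (coeff r)
    refine Submodule.span_induction (p := fun J _ => ∀ φ : DivPow K ι →ₗ[K] K, J.map φ ∈ g0)
      ?_ ?_ ?_ ?_ h
    · rintro _ ⟨A, hA, rfl⟩ φ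
      have : (A.map (algebraMap K (DivPow K ι))).map φ = φ 1 • A := by
        ext i j
        simp only [Matrix.map_apply, Matrix.smul_apply, smul_eq_mul, Algebra.algebraMap_eq_smul_one,
          map_smul]
        ring
      rw [this]
      exact g0.smul_mem _ hA
    · intro φ
      have : (0 : Matrix ι ι (DivPow K ι)).map φ = 0 := by ext; simp
      rw [this]; exact g0.zero_mem
    · intro x y _ _ hx hy φ
      have : (x + y).map φ = x.map φ + y.map φ := by ext; simp
      rw [this]; exact g0.add_mem (hx φ) (hy φ)
    · intro c x _ hx φ
      exact hx (φ ∘ₗ LinearMap.mulLeft K c)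
  · intro h
    classical
    let s : Finset (ι →₀ ℕ) := Finset.univ.biUnion fun p : ι × ι =>
      Finsupp.support (J p.1 p.2 : (ι →₀ ℕ) →₀ K)
    have e : J = ∑ r ∈ s, (mon r : DivPow K ι) • (J.map (coeff r)).map (algebraMap K (DivPow K ι)) := by
      ext i j
      rw [Matrix.sum_apply]
      refine ext_coeff fun t => ?_
      have : ∀ r, coeff t (((mon r : DivPow K ι) •
          (J.map (coeff r)).map (algebraMap K (DivPow K ι))) i j) =
          if r = t then coeff r (J i j) else 0 := by
        intro r
        rw [Matrix.smul_apply, Matrix.map_apply, Matrix.map_apply, smul_eq_mul,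
          Algebra.algebraMap_eq_smul_one, mul_smul_comm, mul_one, map_smul, smul_eq_mul]
        split_ifs with hr
        · rw [hr, coeff_mon_self, mul_one]
        · rw [coeff_mon_ne hr, mul_zero]
      rw [map_sum, Finset.sum_congr rfl fun r _ => this r, Finset.sum_ite_eq']
      split_ifs with ht
      · rfl
      · by_contra h0
        exact ht (Finset.mem_biUnion.2 ⟨(i, j), Finset.mem_univ _, Finsupp.mem_support_iff.2 h0⟩)
    rw [e]
    exact Submodule.sum_mem _ fun r _ => Submodule.smul_mem _ _
      (Submodule.subset_span ⟨_, h r, rfl⟩)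

end Slice

end DivPow

end

section

open DivPow

/-! ### Matrices of the fields preserving the deformed volume form -/

section SvectTilde

variable {K : Type*} [Field K] {n : ℕ}

/-- The set `{i}` as an index. -/
def sg (i : Fin n) : NonemptySubset n := ⟨{i}, Finset.singleton_nonempty i⟩

/-- The exponent of the monomial `ξ_S`. -/
def setExp (S : Finset (Fin n)) : Fin n →₀ ℕ := ∑ i ∈ S, unitExp i

theorem setExp_apply (S : Finset (Fin n)) (i : Fin n) : setExp S i = if i ∈ S then 1 else 0 := by
  split_ifs with h
  · exact sum_unitExp_apply_mem (φ := id) Function.injective_id h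
  · exact sum_unitExp_apply_of_forall_ne (φ := id) fun j hj e => h (by rw [e]; exact hj)

theorem setExp_injective : Function.Injective (setExp (n := n)) := by
  intro S T h
  ext i
  have := congrArg (fun r => r i) h
  simp only [setExp_apply] at this
  by_cases h1 : i ∈ S <;> by_cases h2 : i ∈ T <;> simp_all

theorem xiMon_eq (S : Finset (Fin n)) : (xiMon S : DivPow K (Fin n)) = mon (setExp S) :=
  prod_var_eq_mon S (φ := id) Function.injective_id

theorem coeff_xiMon (S T : Finset (Fin n)) :
    coeff (setExp S) (xiMon T : DivPow K (Fin n)) = if T = S then 1 else 0 := by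
  rw [xiMon_eq]
  split_ifs with h
  · rw [h, coeff_mon_self]
  · exact coeff_mon_ne fun e => h (setExp_injective e)

theorem xiMon_empty : (xiMon ∅ : DivPow K (Fin n)) = 1 := Finset.prod_empty

theorem xiMon_singleton (i : Fin n) : (xiMon {i} : DivPow K (Fin n)) = var i :=
  Finset.prod_singleton _ _

/-- The coefficient of `ξ_1 ⋯ ξ_n` in a volume form. -/
abbrev lastCoeff : DivPow K (Fin n) →ₗ[K] K := coeff (setExp Finset.univ)

theorem densityAct_eq_sum (f : Fin n → DivPow K (Fin n)) (h : DivPow K (Fin n)) :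
    densityAct f h = ∑ i, pd i (f i * h) := by
  rw [densityAct_apply, field_apply, divergence, Finset.mul_sum, ← Finset.sum_add_distrib]
  exact Finset.sum_congr rfl fun i _ => by rw [Derivation.leibniz, smul_eq_mul, smul_eq_mul]

theorem densityAct_mul (f : Fin n → DivPow K (Fin n)) (g h : DivPow K (Fin n)) :
    densityAct f (h * g) = h * field f g + g * densityAct f h := by
  rw [densityAct_apply, densityAct_apply, Derivation.leibniz, smul_eq_mul, smul_eq_mul]; ring

/-- The representatives of the basis of volume forms with vanishing highest coefficient. -/
def eVec (μ : K) (S : Finset (Fin n)) : DivPow K (Fin n) :=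
  if S = Finset.univ then μ⁻¹ • 1 else xiMon S

/-- The image of the basis vector `ξ_T vol` under a matrix. -/
def pRow (μ : K) (A : Matrix (NonemptySubset n) (NonemptySubset n) K) (T : NonemptySubset n) :
    DivPow K (Fin n) := ∑ S, A T S • eVec μ S.1

variable [CharP K 2]

theorem xiMon_mem (S : Finset (Fin n)) : (xiMon S : DivPow K (Fin n)) ∈ trunc fun _ => 1 :=
  prod_var_mem_trunc S (φ := id) fun _ _ => one_ne_zero

theorem volTilde_mem (μ : K) : volTilde n μ ∈ trunc fun _ => 1 :=
  add_mem one_mem_trunc (Submodule.smul_mem _ _ (xiMon_mem _))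

theorem xiMon_mul_self {S : Finset (Fin n)} (h : S.Nonempty) :
    (xiMon Finset.univ * xiMon S : DivPow K (Fin n)) = 0 := by
  obtain ⟨i, hi⟩ := h
  rw [xiMon, xiMon, ← Finset.mul_prod_erase _ _ (Finset.mem_univ i), ← Finset.mul_prod_erase _ _ hi,
    mul_mul_mul_comm, var_mul_var, zero_mul]

theorem volTilde_mul_xiMon (μ : K) {S : Finset (Fin n)} (h : S.Nonempty) :
    volTilde n μ * xiMon S = xiMon S := by
  rw [volTilde, add_mul, one_mul, smul_mul_assoc, xiMon_mul_self h, smul_zero, add_zero]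

/-- The square of ξ_1⋯ξ_n is 0 and the cross terms cancel in characteristic 2, so the density is its
own inverse; coefficients of a field are recovered from its matrix by multiplying with it. -/
theorem volTilde_mul_self (hn : 0 < n) (μ : K) : volTilde n μ * volTilde n μ = 1 := by
  have : (Finset.univ : Finset (Fin n)).Nonempty := ⟨⟨0, hn⟩, Finset.mem_univ _⟩
  conv_lhs => rw [show volTilde n μ * volTilde n μ =
    volTilde n μ * 1 + volTilde n μ * (μ • xiMon Finset.univ) by
      rw [← mul_add]; rfl]
  rw [mul_smul_comm, volTilde_mul_xiMon μ this, mul_one, volTilde]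
  linear_combination two_eq_zero (μ • xiMon Finset.univ : DivPow K (Fin n))

theorem lastCoeff_pd {g : DivPow K (Fin n)} (hg : g ∈ trunc fun _ => 1) (i : Fin n) :
    lastCoeff (pd i g) = 0 := by
  rw [coeff_pd]
  by_contra h
  have := mem_trunc_iff.1 hg _ h i 1 rfl
  rw [Finsupp.add_apply, unitExp_same, setExp_apply, if_pos (Finset.mem_univ i)] at this
  omega

theorem lastCoeff_one (hn : 0 < n) : lastCoeff (1 : DivPow K (Fin n)) = 0 := by
  rw [← xiMon_empty, coeff_xiMon, if_neg]
  exact fun h => Finset.notMem_empty ⟨0, hn⟩ (h ▸ Finset.mem_univ _)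

theorem eVec_eq {μ : K} (hμ : μ ≠ 0) (S : Finset (Fin n)) : eVec μ S =
    xiMon S + if S = Finset.univ then μ⁻¹ • volTilde n μ else 0 := by
  rw [eVec]
  split_ifs with h
  · rw [h, volTilde, smul_add, smul_smul, inv_mul_cancel₀ hμ, one_smul]
    linear_combination - two_eq_zero (xiMon Finset.univ : DivPow K (Fin n))
  · rw [add_zero]

theorem eVec_mem (μ : K) (S : Finset (Fin n)) : eVec μ S ∈ trunc fun _ => 1 := by
  rw [eVec]
  split_ifs
  · exact Submodule.smul_mem _ _ one_mem_trunc
  · exact xiMon_mem S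

/-- The index of the set of all the `ξ_i`. -/
def fullSet (hn : 0 < n) : NonemptySubset n := ⟨Finset.univ, ⟨⟨0, hn⟩, Finset.mem_univ _⟩⟩

theorem fullSet_val (hn : 0 < n) : (fullSet hn).1 = Finset.univ := rfl

theorem ne_univ {hn : 0 < n} {S : NonemptySubset n} (h : S ≠ fullSet hn) : S.1 ≠ Finset.univ :=
  fun e => h (Subtype.ext e)

theorem pRow_eq {μ : K} (hμ : μ ≠ 0) (hn : 0 < n)
    (A : Matrix (NonemptySubset n) (NonemptySubset n) K) (T : NonemptySubset n) :
    pRow μ A T = ∑ S, A T S • xiMon S.1 + (A T (fullSet hn) * μ⁻¹) • volTilde n μ := by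
  rw [pRow, ← sub_eq_iff_eq_add', ← Finset.sum_sub_distrib, Finset.sum_eq_single (fullSet hn)]
  · rw [fullSet_val, eVec_eq hμ, if_pos rfl, smul_add, add_sub_cancel_left, smul_smul]
  · intro S _ hS
    rw [eVec_eq hμ, if_neg (ne_univ hS), add_zero, sub_self]
  · simp

theorem lastCoeff_eVec (hn : 0 < n) (μ : K) (S : Finset (Fin n)) : lastCoeff (eVec μ S) = 0 := by
  rw [eVec]
  split_ifs with h
  · rw [map_smul, lastCoeff_one hn, smul_zero]
  · rw [coeff_xiMon, if_neg h]

/-- Let v = 1 + μξ_1⋯ξ_n. For T nonempty, vξ_T = ξ_T, so a field f preserving v sends ξ_T vol to v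
f(ξ_T) vol; in particular the rows at singletons are v f_i. The first condition says that f acts as
a derivation on ξ_T, the second that ∑ ∂_i(v f_i) = 0, i.e. that v is preserved. -/
theorem mem_svectTilde_iff {μ : K} (hμ : μ ≠ 0) (hn : 0 < n)
    {A : Matrix (NonemptySubset n) (NonemptySubset n) K} :
    A ∈ svectTilde n μ ↔ (∀ T, pRow μ A T = ∑ i, pd i (xiMon T.1) * pRow μ A (sg i)) ∧
      ∑ i, pd i (pRow μ A (sg i)) = 0 := by
  have hw := volTilde_mul_self hn μ
  constructor
  · rintro ⟨f, ⟨hf, hf0⟩, hA⟩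
    have h1 : ∀ T : NonemptySubset n, densityAct f (xiMon T.1) = volTilde n μ * field f (xiMon T.1) := by
      intro T
      conv_lhs => rw [← volTilde_mul_xiMon μ T.2, densityAct_mul, hf0, mul_zero, add_zero]
    have h2 : ∀ T, pRow μ A T = volTilde n μ * field f (xiMon T.1) := by
      intro T
      obtain ⟨κ, hκ⟩ := Submodule.mem_span_singleton.1 (hA T)
      -- A Lie derivative of a volume form is a total divergence, so it has no highest coefficient.
      -- This singles out `pRow` as its representative modulo v.
      have e0 : lastCoeff (densityAct f (xiMon T.1)) = 0 := by
        rw [densityAct_eq_sum, map_sum]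
        exact Finset.sum_eq_zero fun i _ => lastCoeff_pd (mul_mem_trunc (hf i) (xiMon_mem _)) i
      have e1 := congrArg lastCoeff hκ
      have e2 : lastCoeff (∑ S : NonemptySubset n, A T S • xiMon S.1) = A T (fullSet hn) := by
        rw [map_sum, Finset.sum_eq_single (fullSet hn)]
        · rw [map_smul, fullSet_val, coeff_xiMon, if_pos rfl, smul_eq_mul, mul_one]
        · intro S _ hS
          rw [map_smul, coeff_xiMon, if_neg (ne_univ hS), smul_zero]
        · simp
      rw [map_sub, e0, e2, volTilde, map_smul, map_add, map_smul, lastCoeff_one hn, coeff_xiMon,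
        if_pos rfl, smul_eq_mul, smul_eq_mul, mul_one, zero_add, zero_sub, CharTwo.neg_eq] at e1
      rw [← h1, pRow_eq hμ hn, ← e1, mul_assoc, mul_inv_cancel₀ hμ, mul_one, hκ]
      abel
    have h3 : ∀ i, pRow μ A (sg i) = volTilde n μ * f i := by
      intro i
      rw [h2, sg, xiMon_singleton, field_apply, Finset.sum_eq_single i]
      · rw [pd_var_same, mul_one]
      · intro j _ hj; rw [pd_var_ne hj, mul_zero]
      · simp
    refine ⟨fun T => ?_, ?_⟩
    · rw [h2, field_apply, Finset.mul_sum]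
      exact Finset.sum_congr rfl fun i _ => by rw [h3]; ring
    · rw [← hf0, densityAct_eq_sum]
      exact Finset.sum_congr rfl fun i _ => by rw [h3, mul_comm]
  · rintro ⟨h1, h2⟩
    have hf0 : densityAct (fun i => volTilde n μ * pRow μ A (sg i)) (volTilde n μ) = 0 := by
      rw [← h2, densityAct_eq_sum]
      exact Finset.sum_congr rfl fun i _ => by rw [mul_right_comm, hw, one_mul]
    refine ⟨fun i => volTilde n μ * pRow μ A (sg i), ⟨fun i => ?_, hf0⟩, fun T => ?_⟩
    · exact mul_mem_trunc (volTilde_mem μ)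
        (Submodule.sum_mem _ fun S _ => Submodule.smul_mem _ _ (eVec_mem μ S.1))
    · have e : densityAct (fun i => volTilde n μ * pRow μ A (sg i)) (xiMon T.1) = pRow μ A T := by
        conv_lhs => rw [← volTilde_mul_xiMon μ T.2, densityAct_mul, hf0, mul_zero, add_zero]
        rw [h1, field_apply, Finset.mul_sum]
        refine Finset.sum_congr rfl fun i _ => ?_
        linear_combination (pRow μ A (sg i) * pd i (xiMon T.1)) * hw
      rw [e, pRow_eq hμ hn, add_sub_cancel_left]
      exact Submodule.smul_mem _ _ (Submodule.mem_span_singleton_self _)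

end SvectTilde

end

section

open DivPow

/-! ### Generating functions in x and ξ of the fields of the prolong -/

section BigAlgebra

variable {K : Type*} [Field K] {n : ℕ}

/-- The indices of the indeterminates `x_S`, `ξ_i`. -/
abbrev XIndex (n : ℕ) := NonemptySubset n ⊕ Fin n

/-- The algebra of functions in `x_S` and `ξ_i`. -/
abbrev XXi (K : Type*) [Field K] (n : ℕ) := DivPow K (XIndex n)

/-- The embedding of the indices of the `x_S`. -/
def embX (n : ℕ) : NonemptySubset n ↪ XIndex n := ⟨Sum.inl, Sum.inl_injective⟩

/-- The embedding of the indices of the `ξ_i`. -/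
def embXi (n : ℕ) : Fin n ↪ XIndex n := ⟨Sum.inr, Sum.inr_injective⟩

/-- The functions in the `x_S`. -/
abbrev incX : DivPow K (NonemptySubset n) →ₐ[K] XXi K n := incl (embX n)

/-- The functions in the `ξ_i`. -/
abbrev incXi : DivPow K (Fin n) →ₐ[K] XXi K n := incl (embXi n)

/-- The derivatives with respect to `x_{ {i} }`. -/
abbrev dqX (i : Fin n) : Derivation K (XXi K n) (XXi K n) := pd (Sum.inl (sg i))

/-- The derivatives with respect to `ξ_i`. -/
abbrev dxiX (i : Fin n) : Derivation K (XXi K n) (XXi K n) := pd (Sum.inr i)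

/-- The operator `∑ ∂_{ξ_i} ∂_{x_{ {i} }}`. -/
abbrev lapX : XXi K n →ₗ[K] XXi K n := delta (fun i => dqX i) (fun i => dxiX i)

/-- The Buttin bracket on the functions in `x, ξ`. -/
abbrev pbX (f : XXi K n) : Derivation K (XXi K n) (XXi K n) :=
  buttin (fun i => dqX i) (fun i => dxiX i) f

theorem inl_notMem_embXi (S : NonemptySubset n) : Sum.inl S ∉ Set.range (embXi n) := by
  rintro ⟨x, hx⟩
  exact Sum.inr_ne_inl hx

theorem inr_notMem_embX (i : Fin n) : Sum.inr i ∉ Set.range (embX n) := by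
  rintro ⟨x, hx⟩
  exact Sum.inl_ne_inr hx

theorem pd_inl_incX (S : NonemptySubset n) (f : DivPow K (NonemptySubset n)) :
    pd (Sum.inl S) (incX f) = incX (pd S f) := pd_incl (embX n) S f

theorem pd_inr_incX (i : Fin n) (f : DivPow K (NonemptySubset n)) :
    pd (Sum.inr i) (incX f) = 0 := pd_incl_of_notMem _ (inr_notMem_embX i) f

theorem pd_inr_incXi (i : Fin n) (f : DivPow K (Fin n)) :
    pd (Sum.inr i) (incXi f) = incXi (pd i f) := pd_incl (embXi n) i f

theorem pd_inl_incXi (S : NonemptySubset n) (f : DivPow K (Fin n)) :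
    pd (Sum.inl S) (incXi f) = 0 := pd_incl_of_notMem _ (inl_notMem_embXi S) f

theorem pbX_incXi (g : DivPow K (Fin n)) (P : XXi K n) :
    pbX (incXi g) P = ∑ i, incXi (pd i g) * dqX i P := by
  rw [buttin_apply]
  refine Finset.sum_congr rfl fun i _ => ?_
  rw [pd_inl_incXi, pd_inr_incXi, zero_mul, zero_add]

theorem pd_inl_pbX (T : NonemptySubset n) (g : DivPow K (Fin n)) (P : XXi K n) :
    pd (Sum.inl T) (pbX (incXi g) P) = pbX (incXi g) (pd (Sum.inl T) P) := by
  rw [pbX_incXi, pbX_incXi, map_sum]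
  refine Finset.sum_congr rfl fun i _ => ?_
  rw [Derivation.leibniz, pd_inl_incXi, smul_zero, add_zero, smul_eq_mul, pd_comm]

/-- The coefficient of `x^(r)`. -/
def sliceXi (r : NonemptySubset n →₀ ℕ) : XXi K n →ₗ[K] DivPow K (Fin n) :=
  slice (embXi n) (r.mapDomain (embX n))

theorem mapDomain_embX_inr (r : NonemptySubset n →₀ ℕ) (i : Fin n) :
    r.mapDomain (embX n) (embXi n i) = 0 :=
  Finsupp.mapDomain_of_notMem_range _ _ (inr_notMem_embX i)

theorem sliceXi_incXi_mul (r : NonemptySubset n →₀ ℕ) (g : DivPow K (Fin n)) (f : XXi K n) :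
    sliceXi r (incXi g * f) = g * sliceXi r f :=
  slice_incl_mul _ (mapDomain_embX_inr r) g f

theorem sliceXi_pd (r : NonemptySubset n →₀ ℕ) (i : Fin n) (f : XXi K n) :
    sliceXi r (dxiX i f) = pd i (sliceXi r f) := slice_pd (embXi n) _ i f

theorem coeff_sliceXi (r : NonemptySubset n →₀ ℕ) (t : Fin n →₀ ℕ) (f : XXi K n) :
    coeff t (sliceXi r f) = coeff (t.mapDomain (embXi n) + r.mapDomain (embX n)) f :=
  coeff_slice _ _ _ _

theorem sliceXi_incX (r : NonemptySubset n →₀ ℕ) (f : DivPow K (NonemptySubset n)) :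
    sliceXi r (incX f) = coeff r f • 1 := by
  refine ext_coeff fun t => ?_
  rw [coeff_sliceXi, map_smul, smul_eq_mul]
  by_cases h : t = 0
  · subst h
    rw [Finsupp.mapDomain_zero, zero_add, coeff_incl_mapDomain, one_def, coeff_mon_self, mul_one]
  · obtain ⟨i, hi⟩ := Finsupp.ne_iff.1 h
    rw [coeff_incl_of_ne (embX n) (inr_notMem_embX i), one_def, coeff_mon_ne (Ne.symm h), mul_zero]
    rw [Finsupp.add_apply]
    have : t.mapDomain (embXi n) (Sum.inr i) = t i :=
      Finsupp.mapDomain_apply (embXi n).injective t i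
    rw [this]
    have : t i ≠ 0 := hi
    omega

theorem exp_split (s : XIndex n →₀ ℕ) :
    ∃ (t : Fin n →₀ ℕ) (r : NonemptySubset n →₀ ℕ),
      s = t.mapDomain (embXi n) + r.mapDomain (embX n) := by
  refine ⟨s.comapDomain (embXi n) (embXi n).injective.injOn,
    s.comapDomain (embX n) (embX n).injective.injOn, ?_⟩
  ext k
  rw [Finsupp.add_apply]
  rcases k with S | i
  · have e : Finsupp.mapDomain (embX n) (s.comapDomain (embX n) (embX n).injective.injOn)
        (embX n S) = s (embX n S) := by
      rw [Finsupp.mapDomain_apply (embX n).injective]; rfl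
    rw [Finsupp.mapDomain_of_notMem_range _ _ (inl_notMem_embXi S), zero_add]
    exact e.symm
  · have e : Finsupp.mapDomain (embXi n) (s.comapDomain (embXi n) (embXi n).injective.injOn)
        (embXi n i) = s (embXi n i) := by
      rw [Finsupp.mapDomain_apply (embXi n).injective]; rfl
    rw [Finsupp.mapDomain_of_notMem_range _ _ (inr_notMem_embX i), add_zero]
    exact e.symm

theorem ext_sliceXi {f g : XXi K n} (h : ∀ r, sliceXi r f = sliceXi r g) : f = g := by
  refine ext_coeff fun s => ?_
  obtain ⟨t, r, rfl⟩ := exp_split s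
  rw [← coeff_sliceXi, ← coeff_sliceXi, h]

/-- The generating function of the vector field `∑ F_S ∂_S`. -/
def genFun (μ : K) (F : NonemptySubset n → DivPow K (NonemptySubset n)) : XXi K n :=
  ∑ S, incX (F S) * incXi (eVec μ S.1)

theorem pd_genFun (μ : K) (F : NonemptySubset n → DivPow K (NonemptySubset n))
    (T : NonemptySubset n) : pd (Sum.inl T) (genFun μ F) = genFun μ fun S => pd T (F S) := by
  rw [genFun, map_sum, genFun]
  refine Finset.sum_congr rfl fun S _ => ?_
  rw [Derivation.leibniz, pd_inl_incXi, pd_inl_incX, smul_zero, zero_add, smul_eq_mul, mul_comm]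

theorem sliceXi_genFun (μ : K) (F : NonemptySubset n → DivPow K (NonemptySubset n))
    (r : NonemptySubset n →₀ ℕ) : sliceXi r (genFun μ F) = ∑ S, coeff r (F S) • eVec μ S.1 := by
  rw [genFun, map_sum]
  refine Finset.sum_congr rfl fun S _ => ?_
  rw [mul_comm, sliceXi_incXi_mul, sliceXi_incX, mul_smul_comm, mul_one]

variable [CharP K 2]

theorem isFrame_xxi :
    IsFrame (K := K) (A := XXi K n) 0 (fun i => dqX i) (fun i => dxiX i) where
  two := two_eq_zero
  TQ i a := by simp
  TX i a := by simp
  QQ i j a := pd_comm _ _ _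
  XX i j a := pd_comm _ _ _
  QX i j a := by simp [pd_comm]

/-- The vector fields of the prolong in terms of generating functions. -/
theorem jacobian_mem_iff {μ : K} (hμ : μ ≠ 0) (hn : 0 < n)
    (F : NonemptySubset n → DivPow K (NonemptySubset n)) :
    jacobian F ∈ matrixSpan (svectTilde n μ) ↔
      (∀ T : NonemptySubset n,
        pd (Sum.inl T) (genFun μ F) = pbX (incXi (xiMon T.1)) (genFun μ F)) ∧
      lapX (genFun μ F) = 0 := by
  -- The rows of the coefficient matrices of the Jacobian are the coefficients in x of ∂P/∂x_T, so
  -- the conditions on all matrices assemble into equations for P.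
  have h1 : ∀ r T, pRow μ ((jacobian F).map (coeff r)) T =
      sliceXi r (pd (Sum.inl T) (genFun μ F)) := by
    intro r T
    rw [pd_genFun, sliceXi_genFun]; rfl
  have h2 : ∀ r (T : NonemptySubset n), sliceXi r (pbX (incXi (xiMon T.1)) (genFun μ F)) =
      ∑ i, pd i (xiMon T.1) * sliceXi r (dqX i (genFun μ F)) := by
    intro r T
    rw [pbX_incXi, map_sum]
    exact Finset.sum_congr rfl fun i _ => sliceXi_incXi_mul _ _ _
  have h3 : ∀ r, sliceXi r (lapX (genFun μ F)) = ∑ i, pd i (sliceXi r (dqX i (genFun μ F))) := by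
    intro r
    rw [delta_apply, map_sum]
    exact Finset.sum_congr rfl fun i _ => sliceXi_pd _ _ _
  rw [mem_matrixSpan_iff]
  simp only [mem_svectTilde_iff hμ hn, h1, ← h2, ← h3]
  constructor
  · intro h
    exact ⟨fun T => ext_sliceXi fun r => (h r).1 T,
      ext_sliceXi fun r => by rw [(h r).2, map_zero]⟩
  · rintro ⟨h4, h5⟩ r
    exact ⟨fun T => by rw [h4], by rw [h5, map_zero]⟩

theorem coeff_eVec (μ : K) {U : Finset (Fin n)} (hU : U.Nonempty) (hU' : U ≠ Finset.univ)
    (S : Finset (Fin n)) : coeff (setExp U) (eVec μ S) = if S = U then 1 else 0 := by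
  rw [eVec]
  by_cases h : S = Finset.univ
  · rw [if_pos h, if_neg (by rw [h]; exact hU'.symm), map_smul, ← xiMon_empty, coeff_xiMon,
      if_neg hU.ne_empty.symm, smul_zero]
  · rw [if_neg h, coeff_xiMon]

theorem coeff_empty_eVec (μ : K) (S : NonemptySubset n) :
    coeff (setExp ∅) (eVec μ S.1) = if S.1 = Finset.univ then μ⁻¹ else 0 := by
  rw [eVec]
  by_cases h : S.1 = Finset.univ
  · rw [if_pos h, if_pos h, map_smul, ← xiMon_empty, coeff_xiMon, if_pos rfl, smul_eq_mul, mul_one]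
  · rw [if_neg h, if_neg h, coeff_xiMon, if_neg S.2.ne_empty]

/-- The coordinates with respect to the basis `eVec`. -/
def eCoord (μ : K) (S : NonemptySubset n) : DivPow K (Fin n) →ₗ[K] K :=
  if S.1 = Finset.univ then μ • coeff (setExp ∅) else coeff (setExp S.1)

theorem eCoord_eVec {μ : K} (hμ : μ ≠ 0) (S T : NonemptySubset n) :
    eCoord μ S (eVec μ T.1) = if T = S then 1 else 0 := by
  rw [eCoord]
  by_cases h : S.1 = Finset.univ
  · rw [if_pos h, LinearMap.smul_apply, coeff_empty_eVec]
    by_cases hT : T = S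
    · rw [if_pos hT, if_pos (by rw [hT, h]), smul_eq_mul, mul_inv_cancel₀ hμ]
    · rw [if_neg hT, if_neg (fun e => hT (Subtype.ext (e.trans h.symm))), smul_zero]
  · rw [if_neg h, coeff_eVec μ S.2 h]
    simp only [Subtype.ext_iff]

theorem exp_eq_setExp {t : Fin n →₀ ℕ} (h : ∀ i, t i < 2) : ∃ U, t = setExp U := by
  refine ⟨Finset.univ.filter fun i => t i = 1, ?_⟩
  ext i
  rw [setExp_apply]
  have := h i
  by_cases h1 : t i = 1
  · rw [if_pos (by simpa using h1), h1]
  · rw [if_neg (by simpa using h1)]; omega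

/-- Among functions of ξ without highest term, the nonconstant monomials are the e_S with S proper,
and the constants are spanned by e_S = μ⁻¹ for the full set S. -/
theorem eq_sum_eCoord {μ : K} (hμ : μ ≠ 0) (hn : 0 < n) {g : DivPow K (Fin n)}
    (hg : g ∈ trunc fun _ => 1) (h0 : lastCoeff g = 0) : g = ∑ S, eCoord μ S g • eVec μ S.1 := by
  refine ext_coeff fun t => ?_
  by_cases ht : ∀ i, t i < 2
  · obtain ⟨U, rfl⟩ := exp_eq_setExp ht
    rw [map_sum]
    simp only [map_smul, smul_eq_mul]
    by_cases hU : U = Finset.univ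
    · rw [hU, h0]
      exact (Finset.sum_eq_zero fun S _ => by rw [lastCoeff_eVec hn, mul_zero]).symm
    by_cases hU0 : U = ∅
    · subst hU0
      rw [Finset.sum_eq_single (fullSet hn)]
      · rw [coeff_empty_eVec, if_pos (fullSet_val hn), eCoord, if_pos (fullSet_val hn),
          LinearMap.smul_apply, smul_eq_mul, mul_right_comm, mul_inv_cancel₀ hμ, one_mul]
      · intro S _ hS
        rw [coeff_empty_eVec, if_neg (ne_univ hS), mul_zero]
      · simp
    · have hne := Finset.nonempty_iff_ne_empty.2 hU0
      rw [Finset.sum_eq_single ⟨U, hne⟩]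
      · rw [coeff_eVec μ hne hU, if_pos rfl, mul_one, eCoord, if_neg hU]
      · intro S _ hS
        rw [coeff_eVec μ hne hU, if_neg (fun e => hS (Subtype.ext e)), mul_zero]
      · simp
  · have hz : ∀ f ∈ (trunc fun _ => 1 : Submodule K (DivPow K (Fin n))), coeff t f = 0 := by
      intro f hf
      by_contra hc
      exact ht fun i => mem_trunc_iff.1 hf t hc i 1 rfl
    rw [hz _ hg, hz]
    exact Submodule.sum_mem _ fun S _ => Submodule.smul_mem _ _ (eVec_mem μ S.1)

theorem genFun_injective {μ : K} (hμ : μ ≠ 0) :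
    Function.Injective (genFun (n := n) μ) := by
  intro F F' h
  funext S
  refine ext_coeff fun r => ?_
  have := congrArg (fun P => eCoord μ S (sliceXi r P)) h
  simpa [sliceXi_genFun, eCoord_eVec hμ] using this

end BigAlgebra

end

section

open DivPow

namespace DivPow

theorem proj_incl_of_comp {K α ι κ : Type*} [Field K] [Fintype α] [Fintype ι] [Fintype κ]
    (φ : ι ↪ κ) (ψ : α ↪ κ) (χ : α ↪ ι) (h : ∀ a, ψ a = φ (χ a)) (g : DivPow K α) :
    proj φ (incl ψ g) = incl χ g := by
  have : incl ψ g = incl φ (incl χ g) := by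
    refine induct (p := fun g => incl ψ g = incl φ (incl χ g)) g (by simp) ?_ ?_ fun r => ?_
    · intro a b ha hb; simp only [map_add, ha, hb]
    · intro c a ha; simp only [map_smul, ha]
    · rw [incl_mon, incl_mon, incl_mon, ← Finsupp.mapDomain_comp]
      congr 2
      exact funext h
  rw [this, proj_incl]

end DivPow

/-! ### The evolution equations in x_T and extension from x_T = 0 -/

section Extension

variable {K : Type*} [Field K] {n : ℕ}

theorem sg_injective : Function.Injective (sg (n := n)) := fun i j h => by
  simpa [sg] using h

/-- The embedding of the indices of `q_i`, `ξ_i`, where `q_i = x_{ {i} }`. -/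
def embQ (n : ℕ) : Fin n ⊕ Fin n ↪ XIndex n :=
  ⟨Sum.map sg id, sg_injective.sumMap Function.injective_id⟩

/-- The embedding of the indices of `ξ_i` into the indices of `q_i`, `ξ_i`. -/
def embXiQ (n : ℕ) : Fin n ↪ Fin n ⊕ Fin n := ⟨Sum.inr, Sum.inr_injective⟩

/-- The restriction of functions to `x_T = 0` for `|T| > 1`. -/
abbrev rho : XXi K n →ₐ[K] QXi K n := proj (embQ n)

/-- The functions in `ξ` as functions in `q`, `ξ`. -/
abbrev incXiQ : DivPow K (Fin n) →ₐ[K] QXi K n := incl (embXiQ n)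

theorem rho_incXi (g : DivPow K (Fin n)) : rho (incXi g) = incXiQ g :=
  proj_incl_of_comp (embQ n) (embXi n) (embXiQ n) (fun _ => rfl) g

theorem rho_dqX (i : Fin n) (f : XXi K n) : rho (dqX i f) = dq i (rho f) :=
  (pd_proj (embQ n) (Sum.inl i) f).symm

theorem rho_dxiX (i : Fin n) (f : XXi K n) : rho (dxiX i f) = dxi i (rho f) :=
  (pd_proj (embQ n) (Sum.inr i) f).symm

theorem rho_pbX (f g : XXi K n) : rho (pbX f g) = pb (rho f) (rho g) := by
  simp only [buttin_apply, map_sum, map_add, map_mul, rho_dqX, rho_dxiX]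

theorem rho_lapX (f : XXi K n) : rho (lapX f) = lap (rho f) := by
  simp only [delta_apply, map_sum, rho_dqX, rho_dxiX]

theorem dq_incXiQ (i : Fin n) (g : DivPow K (Fin n)) : dq i (incXiQ g) = 0 := by
  refine pd_incl_of_notMem (embXiQ n) ?_ g
  rintro ⟨x, hx⟩
  exact Sum.inr_ne_inl hx

theorem card_eq_one_iff {T : NonemptySubset n} : T.1.card = 1 ↔ ∃ i, T = sg i := by
  rw [Finset.card_eq_one]
  exact exists_congr fun i => by rw [Subtype.ext_iff]; rfl

theorem inl_notMem_embQ {T : NonemptySubset n} (h : T.1.card ≠ 1) :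
    Sum.inl T ∉ Set.range (embQ n) := by
  rintro ⟨i | i, hi⟩
  · exact h (card_eq_one_iff.2 ⟨i, (Sum.inl_injective hi).symm⟩)
  · exact Sum.inr_ne_inl hi

theorem notMem_embQ {k : XIndex n} (h : k ∉ Set.range (embQ n)) :
    ∃ T : NonemptySubset n, T.1.card ≠ 1 ∧ k = Sum.inl T := by
  rcases k with T | i
  · refine ⟨T, fun h1 => h ?_, rfl⟩
    obtain ⟨i, rfl⟩ := card_eq_one_iff.1 h1
    exact ⟨Sum.inl i, rfl⟩
  · exact absurd ⟨Sum.inr i, rfl⟩ h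

theorem pbX_xiMon_singleton (i : Fin n) (P : XXi K n) :
    pbX (incXi (xiMon (sg i).1)) P = dqX i P := by
  rw [pbX_incXi, Finset.sum_eq_single i]
  · rw [sg, xiMon_singleton, pd_var_same, map_one, one_mul]
  · intro j _ hj
    rw [sg, xiMon_singleton, pd_var_ne hj, map_zero, zero_mul]
  · simp

/-- The derivatives of P by the x_T with |T| ≥ 2 satisfy the same equations with the same zero
restriction. A last nonzero one would not depend on these x_T, hence would coincide with its
restriction. -/
theorem eq_zero_of_rho_eq_zero {P : XXi K n}
    (h : ∀ T : NonemptySubset n, pd (Sum.inl T) P = pbX (incXi (xiMon T.1)) P) (h0 : rho P = 0) :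
    P = 0 := by
  by_contra hP
  obtain ⟨Q, ⟨hQ, hQ0⟩, hne, hJ⟩ := exists_last (J := (Set.range (embQ n))ᶜ)
    (p := fun P : XXi K n => (∀ T : NonemptySubset n,
      pd (Sum.inl T) P = pbX (incXi (xiMon T.1)) P) ∧ rho P = 0)
    (q := fun P => P ≠ 0) (by simp) (by
      rintro f ⟨hf, hf0⟩ k hk
      obtain ⟨T, -, rfl⟩ := notMem_embQ hk
      refine ⟨fun T' => ?_, ?_⟩
      · rw [pd_comm, hf, pd_inl_pbX]
      · rw [hf, rho_pbX, hf0, map_zero]) ⟨P, ⟨h, h0⟩, hP⟩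
  have := eq_incl_proj (embQ n) (f := Q) fun k hk => not_not.1 (hJ k hk)
  rw [show proj (embQ n) Q = 0 from hQ0, map_zero] at this
  exact hne this

variable [CharP K 2] {N : NonemptySubset n → ℕ∞}

/-- The shearing vector for `x_S`, `ξ_i`. -/
def shearX (N : NonemptySubset n → ℕ∞) : XIndex n → ℕ∞ := Sum.elim N fun _ => 1

theorem shearX_embQ : shearX N ∘ embQ n = shearLe (N ∘ sg) := by
  funext z
  rcases z with i | i <;> rfl

theorem incXi_mem {g : DivPow K (Fin n)} (hg : g ∈ trunc fun _ => 1) :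
    incXi g ∈ trunc (shearX N) := incl_mem_trunc (embXi n) hg

theorem incX_mem {f : DivPow K (NonemptySubset n)} (hf : f ∈ trunc N) :
    incX f ∈ trunc (shearX N) := incl_mem_trunc (embX n) hf

theorem rho_mem {f : XXi K n} (hf : f ∈ trunc (shearX N)) : rho f ∈ trunc (shearLe (N ∘ sg)) := by
  rw [← shearX_embQ]
  exact proj_mem_trunc (embQ n) hf

theorem dxiX_dxiX {f : XXi K n} (hf : f ∈ trunc (shearX N)) (i : Fin n) :
    dxiX i (dxiX i f) = 0 := pd_pd_eq_zero (N := shearX N) rfl hf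

/-- The functions without terms divisible by `ξ_1 ⋯ ξ_n`. -/
def xiFreeX (K : Type*) [Field K] (n : ℕ) : Submodule K (XXi K n) where
  carrier := {P | ∀ s : XIndex n →₀ ℕ, (∀ i, s (Sum.inr i) = 1) → coeff s P = 0}
  add_mem' := by
    intro a b ha hb s hs
    rw [map_add, ha s hs, hb s hs, add_zero]
  zero_mem' := by intro s _; rw [map_zero]
  smul_mem' := by
    intro c a ha s hs
    rw [map_smul, ha s hs, smul_zero]

theorem lapX_mem_xiFreeX {f : XXi K n} (hf : f ∈ trunc (shearX N)) : lapX f ∈ xiFreeX K n := by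
  intro s hs
  rw [delta_apply, map_sum]
  refine Finset.sum_eq_zero fun i _ => ?_
  rw [coeff_pd, coeff_pd]
  by_contra h
  have := mem_trunc_iff.1 hf _ h (Sum.inr i) 1 rfl
  rw [Finsupp.add_apply, Finsupp.add_apply, unitExp_same, hs i] at this
  omega

theorem var_mul_mem_xiFreeX (T : NonemptySubset n) {f : XXi K n} (hf : f ∈ xiFreeX K n) :
    var (Sum.inl T) * f ∈ xiFreeX K n := by
  intro s hs
  by_cases h : s (Sum.inl T) = 0
  · exact coeff_var_mul_zero h f
  · obtain ⟨t, rfl⟩ := exists_add h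
    rw [coeff_var_mul, hf t, mul_zero]
    intro i
    have := hs i
    rwa [Finsupp.add_apply, unitExp_ne (by simp), add_zero] at this

/-- Both factors are closed, so the bracket is exact by the product rule. Hence {ξ_T, P} is again
closed and free of terms divisible by ξ_1⋯ξ_n, as the extension requires. -/
theorem lapX_incXi_mul (g : DivPow K (Fin n)) {P : XXi K n} (h : lapX P = 0) :
    lapX (incXi g * P) = pbX (incXi g) P := by
  have : lapX (incXi g : XXi K n) = 0 := by
    rw [delta_apply]
    exact Finset.sum_eq_zero fun i _ => by rw [pd_inl_incXi, map_zero]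
  rw [delta_mul, h, this]; ring

/-- Bracketing with a function of ξ alone is a combination of the derivatives by x_{i} with
coefficients free of x. Such operators commute, so the evolution equations are compatible. -/
theorem pbX_comm (f g : DivPow K (Fin n)) (P : XXi K n) :
    pbX (incXi f) (pbX (incXi g) P) = pbX (incXi g) (pbX (incXi f) P) := by
  rw [pbX_incXi, pbX_incXi _ (pbX _ _)]
  simp only [pd_inl_pbX]
  simp only [pbX_incXi, Finset.mul_sum]
  rw [Finset.sum_comm]
  refine Finset.sum_congr rfl fun i _ => Finset.sum_congr rfl fun j _ => ?_
  rw [pd_comm]; ring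

/-- When |T| ≠ 1, the derivative of ξ_T either vanishes or retains a factor ξ_j, and ξ_j² = 0. -/
theorem pd_xiMon_mul_self {T : Finset (Fin n)} (hT : T.card ≠ 1) (i : Fin n) :
    (pd i (xiMon T) * pd i (xiMon T) : DivPow K (Fin n)) = 0 := by
  have e : ∀ S : Finset (Fin n), i ∉ S → pd i (xiMon S : DivPow K (Fin n)) = 0 := fun S hS => by
    rw [xiMon_eq, pd_mon_zero]
    rw [setExp_apply, if_neg hS]
  by_cases hi : i ∈ T
  · have h1 : (xiMon T : DivPow K (Fin n)) = var i * xiMon (T.erase i) :=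
      (Finset.mul_prod_erase T _ hi).symm
    rw [h1, Derivation.leibniz, e _ (Finset.notMem_erase i T), pd_var_same, smul_zero, zero_add,
      smul_eq_mul, mul_one]
    have hne : (T.erase i).Nonempty := by
      rw [← Finset.card_pos, Finset.card_erase_of_mem hi]
      have := Finset.card_pos.2 ⟨i, hi⟩
      omega
    obtain ⟨j, hj⟩ := hne
    rw [xiMon, ← Finset.mul_prod_erase _ _ hj, mul_mul_mul_comm, var_mul_var, zero_mul]
  · rw [e T hi, zero_mul]

/-- Off-diagonal terms cancel in pairs and diagonal ones carry (∂_iξ_T)² = 0. Consequently the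
evolution in x_T is linear in x_T, the source of the critical value 1. -/
theorem pbX_pbX {T : Finset (Fin n)} (hT : T.card ≠ 1) (P : XXi K n) :
    pbX (incXi (xiMon T)) (pbX (incXi (xiMon T)) P) = 0 := by
  rw [pbX_incXi]
  simp only [pd_inl_pbX]
  simp only [pbX_incXi, Finset.mul_sum]
  refine sum_symm_eq_zero two_eq_zero
    (fun i j => incXi (pd i (xiMon T)) * (incXi (pd j (xiMon T)) * dqX j (dqX i P))) ?_ ?_
  · intro i j
    rw [pd_comm]; ring
  · intro i
    rw [← mul_assoc, ← map_mul, pd_xiMon_mul_self hT, map_zero, zero_mul]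

/-- A function of `q`, `ξ` extends to a generating function of a vector field of the prolong. -/
theorem exists_extension (hN : ∀ T : NonemptySubset n, T.1.card ≠ 1 → N T ≠ 0) {H : QXi K n}
    (hH : H ∈ trunc (shearLe (N ∘ sg))) (h0 : lap H = 0)
    (hfree : ∀ s : Fin n ⊕ Fin n →₀ ℕ, (∀ i, s (Sum.inr i) = 1) → coeff s H = 0) :
    ∃ P : XXi K n, P ∈ trunc (shearX N) ∧ P ∈ xiFreeX K n ∧ lapX P = 0 ∧ rho P = H ∧
      ∀ T : NonemptySubset n, pd (Sum.inl T) P = pbX (incXi (xiMon T.1)) P := by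
  classical
  have key : ∀ s : Finset (NonemptySubset n), (∀ T ∈ s, T.1.card ≠ 1) →
      ∃ P : XXi K n, (P ∈ trunc (shearX N) ∧ P ∈ xiFreeX K n ∧ lapX P = 0 ∧ rho P = H) ∧
      (∀ T ∈ s, pd (Sum.inl T) P = pbX (incXi (xiMon T.1)) P) ∧
      ∀ T : NonemptySubset n, T.1.card ≠ 1 → T ∉ s → pd (Sum.inl T) P = 0 := by
    intro s
    induction s using Finset.induction_on with
    | empty =>
      intro _
      refine ⟨incl (embQ n) H, ⟨?_, ?_, ?_, proj_incl _ _⟩, by simp, fun T hT _ =>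
        pd_incl_of_notMem _ (inl_notMem_embQ hT) H⟩
      · refine incl_mem_trunc (embQ n) ?_
        rwa [shearX_embQ]
      · intro s hs
        by_cases hr : ∀ k ∉ Set.range (embQ n), s k = 0
        · have : s = (s.comapDomain (embQ n) (embQ n).injective.injOn).mapDomain (embQ n) := by
            rw [Finsupp.mapDomain_comapDomain _ (embQ n).injective]
            intro k hk
            by_contra h'
            exact (Finsupp.mem_support_iff.1 hk) (hr k h')
          rw [this, coeff_incl_mapDomain]
          exact hfree _ fun i => hs i
        · push Not at hr
          obtain ⟨k, hk, hk0⟩ := hr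
          exact coeff_incl_of_ne _ hk hk0 H
      · have e1 : ∀ i, dqX i (incl (embQ n) H) = incl (embQ n) (dq i H) := fun i =>
          pd_incl (embQ n) (Sum.inl i) H
        have e2 : ∀ i (f : QXi K n), dxiX i (incl (embQ n) f) = incl (embQ n) (dxi i f) := fun i f =>
          pd_incl (embQ n) (Sum.inr i) f
        rw [delta_apply] at h0 ⊢
        simp only [e1, e2, ← map_sum, h0, map_zero]
    | insert T s hT ih =>
      intro hs
      obtain ⟨P, ⟨hP, hPf, hP0, hPr⟩, h1, h2⟩ := ih fun S hS => hs S (Finset.mem_insert_of_mem hS)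
      have hTc := hs T (Finset.mem_insert_self _ _)
      have hmem : incXi (xiMon T.1) * P ∈ trunc (shearX N) := mul_mem_trunc (incXi_mem (xiMon_mem _)) hP
      have hD := lapX_incXi_mul (xiMon T.1) hP0
      have hlow : ∀ i, dqX i (var (Sum.inl T) : XXi K n) = 0 := fun i => pd_var_ne fun e =>
        hTc (card_eq_one_iff.2 ⟨i, (Sum.inl_injective e).symm⟩)
      have hpb : ∀ (S : NonemptySubset n) (Y : XXi K n),
          pbX (incXi (xiMon S.1)) (var (Sum.inl T) * Y) =
            var (Sum.inl T) * pbX (incXi (xiMon S.1)) Y := by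
        intro S Y
        have : pbX (incXi (xiMon S.1)) (var (Sum.inl T) : XXi K n) = 0 := by
          rw [pbX_incXi]
          exact Finset.sum_eq_zero fun i _ => by rw [hlow, mul_zero]
        rw [Derivation.leibniz, this, smul_zero, add_zero, smul_eq_mul]
      -- The solution of the equation for x_T; the exponential series stops after the linear term
      -- because {ξ_T, · } squares to zero.
      refine ⟨P + var (Sum.inl T) * pbX (incXi (xiMon T.1)) P, ⟨?_, ?_, ?_, ?_⟩, ?_, ?_⟩
      · refine add_mem hP (mul_mem_trunc (var_mem_trunc' (hN T hTc)) ?_)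
        rw [← hD, delta_apply]
        exact Submodule.sum_mem _ fun i _ => pd_mem_trunc _ (pd_mem_trunc _ hmem)
      · refine add_mem hPf (var_mul_mem_xiFreeX T ?_)
        rw [← hD]
        exact lapX_mem_xiFreeX hmem
      · rw [map_add, hP0, zero_add, delta_apply]
        have : lapX (pbX (incXi (xiMon T.1)) P) = 0 := by
          rw [← hD]
          exact delta_delta isFrame_xxi (dxiX_dxiX hmem)
        rw [delta_apply] at this
        rw [← mul_zero (var (Sum.inl T) : XXi K n), ← this, Finset.mul_sum]
        refine Finset.sum_congr rfl fun i _ => ?_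
        rw [Derivation.leibniz, hlow, smul_zero, add_zero, smul_eq_mul, Derivation.leibniz,
          pd_var_ne (by simp), smul_zero, add_zero, smul_eq_mul]
      · rw [map_add, map_mul, proj_var_zero _ (inl_notMem_embQ hTc), zero_mul, add_zero, hPr]
      · intro S hS
        rw [map_add, map_add, Derivation.leibniz, pd_inl_pbX, hpb]
        rcases Finset.mem_insert.1 hS with rfl | hS
        · rw [h2 S hTc hT, map_zero, pbX_pbX hTc, pd_var_same]
          simp
        · rw [h1 S hS, pd_var_ne (fun e => hT (by rwa [← Sum.inl_injective e])), pbX_comm]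
          simp
      · intro S hSc hS
        have hS' : S ∉ s := fun h => hS (Finset.mem_insert_of_mem h)
        rw [map_add, Derivation.leibniz, pd_inl_pbX, h2 S hSc hS', map_zero,
          pd_var_ne (fun e => hS (by rw [Sum.inl_injective e]; exact Finset.mem_insert_self _ _))]
        simp
  obtain ⟨P, ⟨hP, hPf, hP0, hPr⟩, h1, -⟩ := key (Finset.univ.filter fun T => T.1.card ≠ 1)
    fun T hT => (Finset.mem_filter.1 hT).2
  refine ⟨P, hP, hPf, hP0, hPr, fun T => ?_⟩
  by_cases hT : T.1.card = 1
  · obtain ⟨i, rfl⟩ := card_eq_one_iff.1 hT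
    rw [pbX_xiMon_singleton]
  · exact h1 T (Finset.mem_filter.2 ⟨Finset.mem_univ _, hT⟩)

/-- A function without terms divisible by `ξ_1 ⋯ ξ_n` comes from a vector field. -/
theorem exists_genFun {μ : K} (hμ : μ ≠ 0) (hn : 0 < n) {P : XXi K n} (hP : P ∈ trunc (shearX N))
    (hPf : P ∈ xiFreeX K n) : ∃ F, (∀ S, F S ∈ trunc N) ∧ genFun μ F = P := by
  let c : NonemptySubset n → K := fun S => if S.1 = Finset.univ then μ else 1
  let U : NonemptySubset n → Fin n →₀ ℕ := fun S => if S.1 = Finset.univ then setExp ∅ else setExp S.1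
  have hco : ∀ (a : Fin n →₀ ℕ) (r : NonemptySubset n →₀ ℕ),
      coeff r (slice (embX n) (a.mapDomain (embXi n)) P) = coeff a (sliceXi r P) := by
    intro a r
    rw [coeff_slice, coeff_sliceXi, add_comm]
  refine ⟨fun S => c S • slice (embX n) ((U S).mapDomain (embXi n)) P, fun S => ?_, ?_⟩
  · refine Submodule.smul_mem _ _ (mem_trunc_iff.2 fun r hr S' k hk => ?_)
    rw [coeff_slice] at hr
    have := mem_trunc_iff.1 hP _ hr (Sum.inl S') k hk
    rw [Finsupp.add_apply] at this
    have e : r.mapDomain (embX n) (Sum.inl S') = r S' :=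
      Finsupp.mapDomain_apply (embX n).injective r S'
    omega
  · refine ext_sliceXi fun r => ?_
    rw [sliceXi_genFun]
    have h1 : sliceXi r P ∈ trunc fun _ => 1 := mem_trunc_iff.2 fun t ht i k hk => by
      rw [coeff_sliceXi] at ht
      have := mem_trunc_iff.1 hP _ ht (Sum.inr i) k hk
      rw [Finsupp.add_apply] at this
      have e : t.mapDomain (embXi n) (Sum.inr i) = t i :=
        Finsupp.mapDomain_apply (embXi n).injective t i
      omega
    have h2 : lastCoeff (sliceXi r P) = 0 := by
      rw [coeff_sliceXi]
      refine hPf _ fun i => ?_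
      have e : (setExp Finset.univ).mapDomain (embXi n) (Sum.inr i) = setExp Finset.univ i :=
        Finsupp.mapDomain_apply (embXi n).injective _ i
      rw [Finsupp.add_apply, e, setExp_apply, if_pos (Finset.mem_univ i)]
      have := mapDomain_embX_inr r i
      change 1 + r.mapDomain (embX n) (embXi n i) = 1
      rw [this]
    conv_rhs => rw [eq_sum_eCoord hμ hn h1 h2]
    refine Finset.sum_congr rfl fun S _ => ?_
    rw [map_smul, hco, eCoord]
    congr 1
    by_cases h : S.1 = Finset.univ
    · simp [c, U, h]
    · simp [c, U, h]

end Extension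

end

section

open DivPow

/-! ### The model of s̃b_μ by closed functions of q, ξ and the critical coordinates -/

section SbModel

variable {K : Type*} [Field K] [CharP K 2] {n : ℕ}

/-- The coefficient `1 + μ ξ_1 ⋯ ξ_n` of the volume form as a function in `q`, `ξ`. -/
def volQ (n : ℕ) (μ : K) : QXi K n := 1 + μ • xiTop K n

theorem incXiQ_xiMon (S : Finset (Fin n)) : incXiQ (xiMon S : DivPow K (Fin n)) = ∏ i ∈ S, xv i := by
  rw [xiMon, map_prod]
  exact Finset.prod_congr rfl fun i _ => incl_var (embXiQ n) i

theorem incXiQ_volTilde (μ : K) : incXiQ (volTilde n μ) = volQ n μ := by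
  rw [volTilde, map_add, map_one, map_smul, incXiQ_xiMon]; rfl

/-- The generating functions of `s̃b_μ`. -/
def sbV (K : Type*) [Field K] (N : Fin n → ℕ∞) : Submodule K (QXi K n) where
  carrier := {H | H ∈ trunc (shearLe N) ∧ lap H = 0 ∧
    ∀ s : Fin n ⊕ Fin n →₀ ℕ, (∀ i, s (Sum.inr i) = 1) → coeff s H = 0}
  add_mem' := by
    rintro a b ⟨h1, h2, h3⟩ ⟨k1, k2, k3⟩
    exact ⟨add_mem h1 k1, by rw [map_add, h2, k2, add_zero],
      fun s hs => by rw [map_add, h3 s hs, k3 s hs, add_zero]⟩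
  zero_mem' := ⟨zero_mem _, map_zero _, fun _ _ => map_zero _⟩
  smul_mem' := by
    rintro c a ⟨h1, h2, h3⟩
    exact ⟨Submodule.smul_mem _ _ h1, by rw [map_smul, h2, smul_zero],
      fun s hs => by rw [map_smul, h3 s hs, smul_zero]⟩

/-- The bracket of generating functions of `s̃b_μ`. -/
def sbB (μ : K) (f g : QXi K n) : QXi K n := lap (f * g * volQ n μ)

theorem volQ_mem (μ : K) (N : Fin n → ℕ∞) : volQ n μ ∈ trunc (shearLe N) :=
  add_mem one_mem_trunc (Submodule.smul_mem _ _ xiTop_mem)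

theorem dq_volQ (μ : K) (i : Fin n) : dq i (volQ n μ) = 0 := by
  rw [← incXiQ_volTilde, dq_incXiQ]

theorem lap_volQ (μ : K) : lap (volQ n μ) = 0 := by
  rw [delta_apply]
  exact Finset.sum_eq_zero fun i _ => by rw [dq_volQ, map_zero]

theorem sbB_eq_sum {μ : K} {f g : QXi K n} (hf : lap f = 0) (hg : lap g = 0) :
    sbB μ f g = ∑ i, (dxi i (volQ n μ * f) * dq i g + dxi i (volQ n μ * g) * dq i f) := by
  rw [sbB, delta_mul, lap_volQ, delta_mul, hf, hg, mul_zero, mul_zero, mul_zero, add_zero, zero_add,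
    zero_add, buttin_apply, buttin_apply, Finset.mul_sum, ← Finset.sum_add_distrib]
  refine Finset.sum_congr rfl fun i _ => ?_
  simp only [Derivation.leibniz, smul_eq_mul, dq_volQ, mul_zero, add_zero]
  ring

theorem lap_coeff_xiFree {N : Fin n → ℕ∞} {f : QXi K n} (hf : f ∈ trunc (shearLe N))
    {s : Fin n ⊕ Fin n →₀ ℕ} (hs : ∀ i, s (Sum.inr i) = 1) : coeff s (lap f) = 0 := by
  rw [delta_apply, map_sum]
  refine Finset.sum_eq_zero fun i _ => ?_
  rw [coeff_pd, coeff_pd]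
  by_contra h
  have := apply_inr_le (mem_trunc_iff.1 hf _ h) i
  rw [Finsupp.add_apply, Finsupp.add_apply, unitExp_same, hs i] at this
  omega

theorem lap_mem_sbV {N : Fin n → ℕ∞} {f : QXi K n} (hf : f ∈ trunc (shearLe N)) :
    lap f ∈ sbV K N :=
  ⟨lap_mem hf, lap_lap hf, fun _ hs => lap_coeff_xiFree hf hs⟩

variable {μ : K} {N : NonemptySubset n → ℕ∞}

theorem field_var {ι : Type*} [Fintype ι] (f : ι → DivPow K ι) (i : ι) : field f (var i) = f i := by
  rw [field_apply, Finset.sum_eq_single i]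
  · rw [pd_var_same, mul_one]
  · intro j _ hj; rw [pd_var_ne hj, mul_zero]
  · simp

theorem mem_sbTilde_iff (hμ : μ ≠ 0) (hn : 0 < n)
    {D : Derivation K (DivPow K (NonemptySubset n)) (DivPow K (NonemptySubset n))} :
    D ∈ sbTilde n μ N ↔ ∃ F, (∀ S, F S ∈ trunc N) ∧ ((∀ T : NonemptySubset n,
      pd (Sum.inl T) (genFun μ F) = pbX (incXi (xiMon T.1)) (genFun μ F)) ∧
      lapX (genFun μ F) = 0) ∧ D = field F := by
  constructor
  · rintro ⟨F, h1, h2, h3⟩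
    exact ⟨F, h1, (jacobian_mem_iff hμ hn F).1 h2, h3⟩
  · rintro ⟨F, h1, h2, h3⟩
    exact ⟨F, h1, (jacobian_mem_iff hμ hn F).2 h2, h3⟩

theorem genFun_mem {F : NonemptySubset n → DivPow K (NonemptySubset n)} (hF : ∀ S, F S ∈ trunc N) :
    genFun μ F ∈ trunc (shearX N) :=
  Submodule.sum_mem _ fun S _ => mul_mem_trunc (incX_mem (hF S)) (incXi_mem (eVec_mem μ S.1))

theorem genFun_xiFree (hn : 0 < n) (F : NonemptySubset n → DivPow K (NonemptySubset n)) :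
    genFun μ F ∈ xiFreeX K n := by
  intro s hs
  obtain ⟨t, r, rfl⟩ := exp_split s
  have : t = setExp Finset.univ := by
    ext i
    have h := hs i
    have e : t.mapDomain (embXi n) (Sum.inr i) = t i :=
      Finsupp.mapDomain_apply (embXi n).injective t i
    have e' : r.mapDomain (embX n) (Sum.inr i) = 0 := mapDomain_embX_inr r i
    rw [Finsupp.add_apply, e, e'] at h
    rw [setExp_apply, if_pos (Finset.mem_univ i)]
    exact h
  rw [← coeff_sliceXi, sliceXi_genFun, this, map_sum]
  exact Finset.sum_eq_zero fun S _ => by rw [map_smul, lastCoeff_eVec hn, smul_zero]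

theorem rho_genFun_mem (hn : 0 < n) {F : NonemptySubset n → DivPow K (NonemptySubset n)}
    (hF : ∀ S, F S ∈ trunc N) (h0 : lapX (genFun μ F) = 0) :
    rho (genFun μ F) ∈ sbV K (N ∘ sg) := by
  refine ⟨rho_mem (genFun_mem hF), by rw [← rho_lapX, h0, map_zero], fun s hs => ?_⟩
  rw [coeff_proj]
  refine genFun_xiFree hn F _ fun i => ?_
  rw [← hs i]
  exact Finsupp.mapDomain_apply (embQ n).injective s (Sum.inr i)

theorem pd_volTilde_mul_eVec (hμ : μ ≠ 0) (hn : 0 < n) (i : Fin n) (S : NonemptySubset n) :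
    pd i (volTilde n μ * eVec μ S.1) = pd i (xiMon S.1) := by
  rw [eVec_eq hμ, mul_add, volTilde_mul_xiMon μ S.2]
  split_ifs
  · rw [mul_smul_comm, volTilde_mul_self hn, map_add, Derivation.map_smul,
      Derivation.map_one_eq_zero, smul_zero, add_zero]
  · rw [mul_zero, add_zero]

/-- The equation for the second function replaces its x_T-derivative by {ξ_T, · }. The resulting ∑
F_T ∂_iξ_T is the ξ_i-derivative of vP, where v = 1 + μξ_1⋯ξ_n, because v e_T differs from ξ_T by a
constant. -/
theorem genFun_field (hμ : μ ≠ 0) (hn : 0 < n)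
    {F F' : NonemptySubset n → DivPow K (NonemptySubset n)}
    (h' : ∀ T : NonemptySubset n,
      pd (Sum.inl T) (genFun μ F') = pbX (incXi (xiMon T.1)) (genFun μ F')) :
    genFun μ (fun S => field F (F' S)) =
      ∑ i, dxiX i (incXi (volTilde n μ) * genFun μ F) * dqX i (genFun μ F') := by
  have e1 : genFun μ (fun S => field F (F' S)) =
      ∑ T, incX (F T) * pd (Sum.inl T) (genFun μ F') := by
    have h1 : ∀ S, incX (field F (F' S)) * incXi (eVec μ S.1) =
        ∑ T, incX (F T) * (incX (pd T (F' S)) * incXi (eVec μ S.1)) := fun S => by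
      rw [field_apply, map_sum, Finset.sum_mul]
      exact Finset.sum_congr rfl fun T _ => by rw [map_mul, mul_assoc]
    have h2 : ∀ T, incX (F T) * pd (Sum.inl T) (genFun μ F') =
        ∑ S, incX (F T) * (incX (pd T (F' S)) * incXi (eVec μ S.1)) := fun T => by
      rw [pd_genFun, genFun, Finset.mul_sum]
    rw [genFun, Finset.sum_congr rfl fun S _ => h1 S, Finset.sum_comm]
    exact Finset.sum_congr rfl fun T _ => (h2 T).symm
  have e2 : ∀ i, dxiX i (incXi (volTilde n μ) * genFun μ F) =
      ∑ T, incX (F T) * incXi (pd i (xiMon T.1)) := by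
    intro i
    rw [genFun, Finset.mul_sum, map_sum]
    refine Finset.sum_congr rfl fun T _ => ?_
    rw [mul_left_comm, ← map_mul, Derivation.leibniz, pd_inr_incX, smul_zero, add_zero, smul_eq_mul,
      pd_inr_incXi, pd_volTilde_mul_eVec hμ hn]
  have e3 : ∀ i, dxiX i (incXi (volTilde n μ) * genFun μ F) * dqX i (genFun μ F') =
      ∑ T, incX (F T) * (incXi (pd i (xiMon T.1)) * dqX i (genFun μ F')) := fun i => by
    rw [e2, Finset.sum_mul]
    exact Finset.sum_congr rfl fun T _ => mul_assoc _ _ _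
  rw [e1, Finset.sum_congr rfl fun i _ => e3 i, Finset.sum_comm]
  refine Finset.sum_congr rfl fun T _ => ?_
  rw [h', pbX_incXi, Finset.mul_sum]

/-- The generating function in `q`, `ξ` of a vector field. -/
def genRho (μ : K) : Derivation K (DivPow K (NonemptySubset n)) (DivPow K (NonemptySubset n)) →ₗ[K]
    QXi K n where
  toFun D := rho (genFun μ fun S => D (var S))
  map_add' D D' := by
    simp only [genFun, Derivation.add_apply, map_add, add_mul, Finset.sum_add_distrib]
  map_smul' c D := by
    simp only [genFun, Derivation.smul_apply, map_smul, smul_mul_assoc, Finset.smul_sum, map_sum,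
      RingHom.id_apply]

theorem genRho_field (F : NonemptySubset n → DivPow K (NonemptySubset n)) :
    genRho μ (field F) = rho (genFun μ F) :=
  congrArg (fun G => rho (genFun μ G)) (funext fun S => field_var F S)

theorem genRho_lie (hμ : μ ≠ 0) (hn : 0 < n)
    {D D' : Derivation K (DivPow K (NonemptySubset n)) (DivPow K (NonemptySubset n))}
    (hD : D ∈ sbTilde n μ N) (hD' : D' ∈ sbTilde n μ N) :
    genRho μ ⁅D, D'⁆ = sbB μ (genRho μ D) (genRho μ D') := by
  obtain ⟨F, hF, ⟨h1, h2⟩, rfl⟩ := (mem_sbTilde_iff hμ hn).1 hD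
  obtain ⟨F', hF', ⟨h1', h2'⟩, rfl⟩ := (mem_sbTilde_iff hμ hn).1 hD'
  rw [lie_field, genRho_field, genRho_field, genRho_field,
    sbB_eq_sum (rho_genFun_mem hn hF h2).2.1 (rho_genFun_mem hn hF' h2').2.1]
  have e : genFun μ (fun S => field F (F' S) - field F' (F S)) =
      genFun μ (fun S => field F (F' S)) + genFun μ (fun S => field F' (F S)) := by
    have hneg : ∀ a : XXi K n, -a = a := fun a => by
      rw [neg_eq_iff_add_eq_zero, two_eq_zero]
    simp only [genFun, map_sub, sub_mul, Finset.sum_sub_distrib]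
    rw [sub_eq_add_neg, hneg]
  rw [e, genFun_field hμ hn h1', genFun_field hμ hn h1, map_add, map_sum, map_sum,
    ← Finset.sum_add_distrib]
  refine Finset.sum_congr rfl fun i _ => ?_
  rw [map_mul rho (dxiX i _), map_mul rho (dxiX i _), rho_dxiX, rho_dxiX, rho_dqX, rho_dqX,
    map_mul rho (incXi _), map_mul rho (incXi _), rho_incXi, incXiQ_volTilde]

theorem exists_mem_sbTilde (hμ : μ ≠ 0) (hn : 0 < n)
    (hN : ∀ T : NonemptySubset n, T.1.card ≠ 1 → N T ≠ 0) {H : QXi K n} (hH : H ∈ sbV K (N ∘ sg)) :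
    ∃ D ∈ sbTilde n μ N, genRho μ D = H := by
  obtain ⟨P, h1, h2, h3, h4, h5⟩ := exists_extension hN hH.1 hH.2.1 hH.2.2
  obtain ⟨F, hF, rfl⟩ := exists_genFun hμ hn h1 h2
  exact ⟨field F, (mem_sbTilde_iff hμ hn).2 ⟨F, hF, ⟨h5, h3⟩, rfl⟩, by rw [genRho_field, h4]⟩

theorem genRho_eq_zero (hμ : μ ≠ 0) (hn : 0 < n)
    {D : Derivation K (DivPow K (NonemptySubset n)) (DivPow K (NonemptySubset n))}
    (hD : D ∈ sbTilde n μ N) (h : genRho μ D = 0) : D = 0 := by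
  obtain ⟨F, hF, ⟨h1, h2⟩, rfl⟩ := (mem_sbTilde_iff hμ hn).1 hD
  rw [genRho_field] at h
  have h3 := eq_zero_of_rho_eq_zero h1 h
  have : F = 0 := genFun_injective hμ (by
    rw [h3]
    simp [genFun])
  rw [this, field_zero]

/-- Restriction to x_T = 0, |T| ≥ 2, is injective by uniqueness for the evolution equations and
surjective by the extension; the model map is its inverse. -/
theorem isModel_sb (hμ : μ ≠ 0) (hn : 0 < n) (hN : ∀ S, N S ≠ 0) :
    ∃ M : sbV K (N ∘ sg) →ₗ[K] sbTilde n μ N, IsModel (sbV K (N ∘ sg)) M (sbB μ) ∧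
      Function.Injective M := by
  have hmem : ∀ D : sbTilde n μ N,
      (genRho μ ∘ₗ (sbTilde n μ N).toSubmodule.subtype) D ∈ sbV K (N ∘ sg) := by
    rintro ⟨D, hD⟩
    obtain ⟨F, hF, ⟨h1, h2⟩, rfl⟩ := (mem_sbTilde_iff hμ hn).1 hD
    change genRho μ (field F) ∈ _
    rw [genRho_field]
    exact rho_genFun_mem hn hF h2
  let φ : sbTilde n μ N →ₗ[K] sbV K (N ∘ sg) :=
    (genRho μ ∘ₗ (sbTilde n μ N).toSubmodule.subtype).codRestrict _ hmem
  have hφ : Function.Bijective φ := by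
    constructor
    · rw [← LinearMap.ker_eq_bot, LinearMap.ker_eq_bot']
      intro D hD
      exact Subtype.ext (genRho_eq_zero hμ hn D.2 (congrArg Subtype.val hD))
    · rintro ⟨H, hH⟩
      obtain ⟨D, hD, e⟩ := exists_mem_sbTilde hμ hn (fun T _ => hN T) hH
      exact ⟨⟨D, hD⟩, Subtype.ext e⟩
  let e := LinearEquiv.ofBijective φ hφ
  refine ⟨e.symm.toLinearMap, ⟨e.symm.surjective, fun u v => ?_⟩, e.symm.injective⟩
  have h1 : (e ⁅e.symm u, e.symm v⁆ : QXi K n) = sbB μ u v := by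
    have h2 : ∀ D, (e D : QXi K n) = genRho μ D.1 := fun D => rfl
    rw [h2]
    refine (genRho_lie hμ hn (e.symm u).2 (e.symm v).2).trans ?_
    rw [← h2, ← h2, e.apply_symm_apply, e.apply_symm_apply]
  refine ⟨h1 ▸ (e ⁅e.symm u, e.symm v⁆).2, ?_⟩
  refine e.injective (Subtype.ext (h1.trans ?_))
  change sbB μ (u : QXi K n) v = (e (e.symm _) : QXi K n)
  rw [e.apply_symm_apply]

/-- Two derivatives along x_S act on the generating function as {ξ_S, {ξ_S, · }} = 0, so the
coefficients of the field are at most linear in x_S. -/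
theorem sbTilde_update (hμ : μ ≠ 0) (hn : 0 < n) {S : NonemptySubset n} (hS : S.1.card ≠ 1)
    (hN : N S ≠ 0) : sbTilde n μ N = sbTilde n μ (Function.update N S 1) := by
  ext D
  rw [mem_sbTilde_iff hμ hn, mem_sbTilde_iff hμ hn]
  constructor
  · rintro ⟨F, hF, ⟨h1, h2⟩, rfl⟩
    refine ⟨F, fun T => mem_trunc_update (hF T) ?_, ⟨h1, h2⟩, rfl⟩
    have e : pd (Sum.inl S) (pd (Sum.inl S) (genFun μ F)) = 0 := by
      rw [h1, pd_inl_pbX, h1, pbX_pbX hS]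
    rw [pd_genFun, pd_genFun] at e
    have := genFun_injective hμ (a₁ := fun T => pd S (pd S (F T))) (a₂ := 0) (by
      rw [e]; simp [genFun])
    exact congrFun this T
  · rintro ⟨F, hF, h, rfl⟩
    exact ⟨F, fun T => trunc_update_le hN (hF T), h, rfl⟩

theorem isCritical_iff (hμ : μ ≠ 0) (hn : 0 < n) (S : NonemptySubset n) :
    IsCritical (svectTilde n μ) S ↔ S.1.card ≠ 1 := by
  constructor
  · rintro ⟨B, hB⟩ hS
    obtain ⟨i, rfl⟩ := card_eq_one_iff.1 hS
    have e : sbTilde n μ (fun _ => ⊤) = sbTilde n μ (Function.update (fun _ => ⊤) (sg i) B) :=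
      hB (fun _ => ⊤) le_top
    -- The monomial q_i^(2^B) is closed, being free of ξ; it occurs for infinite N_i but is just
    -- beyond the truncation N_i = B.
    let r : Fin n ⊕ Fin n →₀ ℕ := Finsupp.single (Sum.inl i) (2 ^ B)
    have hr : ∀ j, r (Sum.inr j) = 0 := fun j => by simp [r]
    have hH : (mon r : QXi K n) ∈ sbV K ((fun _ : NonemptySubset n => (⊤ : ℕ∞)) ∘ sg) := by
      refine ⟨mon_mem_trunc ?_, ?_, fun s hs => coeff_mon_ne ?_⟩
      · intro z k hk
        rcases z with j | j
        · exact absurd hk.symm (ENat.natCast_ne_top k)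
        · rw [hr]; positivity
      · rw [delta_apply]
        exact Finset.sum_eq_zero fun j _ => by
          rw [← frame_comm isFrame_qxi, pd_mon_zero (hr j), map_zero]
      · rintro rfl
        have := hs ⟨0, hn⟩
        rw [hr] at this
        omega
    obtain ⟨D, hD, hDH⟩ := exists_mem_sbTilde hμ hn (fun _ _ => by simp) hH
    rw [e] at hD
    obtain ⟨F, hF, ⟨-, h2⟩, rfl⟩ := (mem_sbTilde_iff hμ hn).1 hD
    rw [genRho_field] at hDH
    have h3 := (rho_genFun_mem hn hF h2).1
    rw [hDH] at h3
    have hup : shearLe (Function.update (fun _ : NonemptySubset n => (⊤ : ℕ∞)) (sg i) B ∘ sg)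
        (Sum.inl i) = B := by
      change Function.update (fun _ : NonemptySubset n => (⊤ : ℕ∞)) (sg i) B (sg i) = B
      exact Function.update_self _ _ _
    have h4 := mem_trunc_iff.1 h3 r (by rw [coeff_mon_self]; exact one_ne_zero) (Sum.inl i) B
      hup
    have h5 : r (Sum.inl i) = 2 ^ B := Finsupp.single_eq_same
    omega
  · intro hS
    refine ⟨1, fun N hN => ?_⟩
    have hN0 : N S ≠ 0 := fun h => by
      rw [h] at hN
      simp at hN
    have := sbTilde_update (N := N) hμ hn hS hN0
    rw [Nat.cast_one]
    exact this

end SbModel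

end

section

open DivPow

/-! ### Simplicity of s̃b_μ: descent to the constant -/

section SbSimple

variable {K : Type*} [Field K] [CharP K 2] {n : ℕ} {μ : K} {N : Fin n → ℕ∞}

theorem xiTop_mul_xv (i : Fin n) : xiTop K n * xv i = 0 := by
  rw [xiTop, ← Finset.mul_prod_erase _ _ (Finset.mem_univ i), mul_right_comm, var_mul_var, zero_mul]

theorem sbB_comm (f g : QXi K n) : sbB μ f g = sbB μ g f := by rw [sbB, sbB, mul_comm f]

/-- Functions annihilated by ξ_1⋯ξ_n do not see the deformation of the volume form, so their
brackets are those for μ = 0. -/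
theorem sbB_of_xiTop_mul {f : QXi K n} (hf : xiTop K n * f = 0) (g : QXi K n) :
    sbB μ f g = lap (f * g) := by
  have : f * g * xiTop K n = xiTop K n * f * g := by ring
  rw [sbB, volQ, mul_add, mul_one, mul_smul_comm, this, hf, zero_mul, smul_zero, add_zero]

theorem sbB_eq_pb {f g : QXi K n} (hf : xiTop K n * f = 0) (h1 : lap f = 0) (h2 : lap g = 0) :
    sbB μ f g = pb f g := by
  rw [sbB_of_xiTop_mul hf, delta_mul, h1, h2, mul_zero, mul_zero, zero_add, zero_add]

theorem sbB_xv (i : Fin n) {H : QXi K n} (h : lap H = 0) : sbB μ (xv i) H = dq i H := by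
  rw [sbB_eq_pb (xiTop_mul_xv i) (lap_xv i) h, pb_xv]

theorem sbB_qv (i : Fin n) {H : QXi K n} (h : lap H = 0) (hH : xiTop K n * H = 0) :
    sbB μ (qv i) H = dxi i H := by
  rw [sbB_comm, sbB_eq_pb hH h (lap_qv i), buttin_symm, pb_qv]

/-- The function `q_i ξ_i + q_j ξ_j`. -/
def weightFun (i j : Fin n) : QXi K n := qv i * xv i + qv j * xv j

theorem xiTop_mul_weightFun (i j : Fin n) : xiTop K n * weightFun i j = 0 := by
  rw [weightFun, mul_add, mul_left_comm, xiTop_mul_xv, mul_left_comm, xiTop_mul_xv, mul_zero,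
    mul_zero, add_zero]

theorem lap_weightFun (i j : Fin n) : lap (weightFun i j : QXi K n) = 0 := by
  rw [weightFun, map_add, lap_qv_mul_xv_same, lap_qv_mul_xv_same, two_eq_zero]

theorem lap_weight_mul {i j : Fin n} (h : i ≠ j) :
    lap (qv i * xv i * (qv j * xv j) : QXi K n) = weightFun i j := by
  rw [delta_mul, lap_qv_mul_xv_same, lap_qv_mul_xv_same, buttin_mul_left, pb_xv, pb_qv,
    pd_pair_eq_zero (by simpa using h) (by simp), pd_pair_eq_zero (by simp) (by simpa using h),
    weightFun]
  ring

theorem coeff_pb_weight (i : Fin n) (r : Fin n ⊕ Fin n →₀ ℕ) (f : QXi K n) :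
    coeff r (pb (qv i * xv i) f) = ((r (Sum.inl i) + r (Sum.inr i) : ℕ) : K) * coeff r f := by
  refine induct (p := fun f => coeff r (pb (qv i * xv i) f) =
    ((r (Sum.inl i) + r (Sum.inr i) : ℕ) : K) * coeff r f) f (by simp) ?_ ?_ fun s => ?_
  · intro a b ha hb; rw [map_add, map_add, map_add, ha, hb, mul_add]
  · intro c a ha
    rw [Derivation.map_smul, map_smul, map_smul, ha, smul_eq_mul, smul_eq_mul]; ring
  · rw [pb_weight, map_smul, smul_eq_mul]
    by_cases h : s = r
    · rw [h]
    · rw [coeff_mon_ne h, mul_zero, mul_zero]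

theorem pd_prod_xv {z : Fin n ⊕ Fin n} {S : Finset (Fin n)} (h : ∀ j ∈ S, z ≠ Sum.inr j) :
    pd z (∏ i ∈ S, xv i : QXi K n) = 0 := by
  rw [prod_var_eq_mon S Sum.inr_injective]
  exact pd_mon_zero (sum_unitExp_apply_of_forall_ne h)

theorem lap_prod_xv (S : Finset (Fin n)) : lap (∏ i ∈ S, xv i : QXi K n) = 0 := by
  rw [delta_apply]
  exact Finset.sum_eq_zero fun i _ => by rw [pd_prod_xv (by simp), map_zero]

theorem dxi_prod_insert {i : Fin n} {S : Finset (Fin n)} (h : i ∉ S) :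
    dxi i (∏ j ∈ insert i S, xv j : QXi K n) = ∏ j ∈ S, xv j := by
  have h0 : dxi i (∏ j ∈ S, xv j : QXi K n) = 0 :=
    pd_prod_xv fun j hj e => h (by rwa [Sum.inr_injective e])
  rw [Finset.prod_insert h, Derivation.leibniz, pd_var_same, h0]
  simp

/-- The generating functions of the derived algebra of `s̃b_μ`. -/
def sbW (K : Type*) [Field K] [CharP K 2] (N : Fin n → ℕ∞) : Submodule K (QXi K n) :=
  (trunc (shearLe N)).map lap

theorem lap_mem_sbW {f : QXi K n} (hf : f ∈ trunc (shearLe N)) : lap f ∈ sbW K N :=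
  Submodule.mem_map_of_mem hf

theorem sbW_le : sbW K N ≤ sbV K N := by
  rintro _ ⟨f, hf, rfl⟩
  exact lap_mem_sbV hf

theorem sbB_mem {f g : QXi K n} (hf : f ∈ sbV K N) (hg : g ∈ sbV K N) : sbB μ f g ∈ sbW K N :=
  lap_mem_sbW (mul_mem_trunc (mul_mem_trunc hf.1 hg.1) (volQ_mem μ N))

theorem var_mem_sbW (hn : 2 ≤ n) (hN : ∀ i, N i ≠ 0) (z : Fin n ⊕ Fin n) :
    (var z : QXi K n) ∈ sbW K N := by
  obtain ⟨i, hz⟩ : ∃ i, z = Sum.inl i ∨ z = Sum.inr i := by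
    rcases z with i | i
    · exact ⟨i, Or.inl rfl⟩
    · exact ⟨i, Or.inr rfl⟩
  obtain ⟨j, hj⟩ := exists_ne_fin hn i
  rw [← lap_triple hj hz]
  exact lap_mem_sbW (mul_mem_trunc (var_mem_shear hN z) (mul_mem_trunc (qv_mem hN j) (xv_mem j)))

theorem weight_mul_mem (hN : ∀ i, N i ≠ 0) (i j : Fin n) :
    (qv i * xv i * (qv j * xv j) : QXi K n) ∈ trunc (shearLe N) :=
  mul_mem_trunc (mul_mem_trunc (qv_mem hN i) (xv_mem i)) (mul_mem_trunc (qv_mem hN j) (xv_mem j))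

theorem weightFun_mem (hN : ∀ i, N i ≠ 0) {i j : Fin n} (h : i ≠ j) :
    (weightFun i j : QXi K n) ∈ sbW K N := by
  rw [← lap_weight_mul h]
  exact lap_mem_sbW (weight_mul_mem hN i j)

variable {I : Submodule K (QXi K n)}

/-- On terms free of q the weights of q_iξ_i + q_jξ_j compare ξ-exponents, so all of these are equal
in each term; the case of all exponents 1 is excluded in `sbV`. -/
theorem eq_smul_one_of_weights {h : QXi K n} (hV : h ∈ sbV K N) (hq : ∀ i, dq i h = 0)
    (hE : ∀ i j, i ≠ j → pb (weightFun i j) h = 0) : h = coeff 0 h • (1 : QXi K n) := by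
  have key : ∀ r, coeff r h ≠ 0 → r = 0 := by
    intro r hr
    have hl : ∀ i, r (Sum.inl i) = 0 := by
      intro i
      by_contra h0
      obtain ⟨s, rfl⟩ := exists_add h0
      rw [← coeff_pd, hq, map_zero] at hr
      exact hr rfl
    have hx : ∀ i, r (Sum.inr i) ≤ 1 := fun i => apply_inr_le (mem_trunc_iff.1 hV.1 r hr) i
    have hxx : ∀ i j, i ≠ j → r (Sum.inr i) = r (Sum.inr j) := by
      intro i j hij
      have h1 := congrArg (coeff r) (hE i j hij)
      rw [weightFun, buttin_add_left, map_add, coeff_pb_weight, coeff_pb_weight, ← add_mul,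
        ← Nat.cast_add, map_zero, hl, hl] at h1
      by_contra hne
      have := hx i
      have := hx j
      rw [natCast_odd (by omega), one_mul] at h1
      exact hr h1
    have h0 : ∀ i, r (Sum.inr i) = 0 := by
      intro i
      by_contra hi
      refine hr (hV.2.2 r fun j => ?_)
      have := hx i
      by_cases hij : i = j
      · subst hij; omega
      · rw [← hxx i j hij]; omega
    ext z
    rcases z with i | i
    · exact hl i
    · exact h0 i
  refine ext_coeff fun r => ?_
  rw [map_smul, smul_eq_mul]
  by_cases hr : r = 0
  · rw [hr, coeff_zero_one, mul_one]
  · rw [one_def, coeff_mon_ne (Ne.symm hr), mul_zero]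
    by_contra h'
    exact hr (key r h')

/-- The bracket with q_k is ∂_{ξ_k} only on functions killed by ξ_1⋯ξ_n. Passing first to the
bracket with a weight function leaves only terms containing some ξ and adds no new terms, so the
degree drops after differentiation. -/
theorem one_mem_of_qconst (hn : 2 ≤ n) (hN : ∀ i, N i ≠ 0) (hI : I ≤ sbV K N)
    (hinv : ∀ w ∈ sbW K N, ∀ u ∈ I, sbB μ w u ∈ I) (d : ℕ) :
    ∀ h ∈ I, h ≠ 0 → (∀ i, dq i h = 0) → DegLT h d → (1 : QXi K n) ∈ I := by
  induction d with
  | zero =>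
    intro h _ h0 _ hd
    refine absurd (ext_coeff fun r => ?_) h0
    by_contra h'
    exact absurd (hd r (by simpa using h')) (by omega)
  | succ d ih =>
    intro h hh h0 hq hd
    by_cases hE : ∀ i j, i ≠ j → pb (weightFun i j) h = 0
    · have e := eq_smul_one_of_weights (hI hh) hq hE
      have hc : coeff 0 h ≠ 0 := fun hc => h0 (by rw [e, hc, zero_smul])
      rw [e] at hh
      exact (Submodule.smul_mem_iff _ hc).1 hh
    · push Not at hE
      obtain ⟨i, j, hij, hne⟩ := hE
      have e1 : sbB μ (weightFun i j) h = pb (weightFun i j) h :=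
        sbB_eq_pb (xiTop_mul_weightFun i j) (lap_weightFun i j) (hI hh).2.1
      have hmem : pb (weightFun i j) h ∈ I := e1 ▸ hinv _ (weightFun_mem hN hij) _ hh
      have e2 : pb (weightFun i j) h = xv i * dxi i h + xv j * dxi j h := by
        rw [weightFun, buttin_add_left, buttin_mul_left, buttin_mul_left, pb_xv, pb_xv, pb_qv, pb_qv,
          hq, hq, mul_zero, mul_zero, zero_add, zero_add]
      have hcoeff : ∀ r, coeff r h = 0 → coeff r (pb (weightFun i j) h) = 0 := fun r hr => by
        rw [weightFun, buttin_add_left, map_add, coeff_pb_weight, coeff_pb_weight, hr, mul_zero,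
          mul_zero, add_zero]
      have hd' : DegLT (pb (weightFun i j) h) (d + 1) := fun r hr => hd r fun h' => hr (hcoeff r h')
      have hq' : ∀ k, dq k (pb (weightFun i j) h) = 0 := fun k => by
        refine ext_coeff fun r => ?_
        rw [coeff_pd, map_zero]
        refine hcoeff _ ?_
        rw [← coeff_pd, hq, map_zero]
      have hxi : xiTop K n * pb (weightFun i j) h = 0 := by
        rw [e2, mul_add, ← mul_assoc, xiTop_mul_xv, ← mul_assoc, xiTop_mul_xv, zero_mul, zero_mul,
          add_zero]
      obtain ⟨k, hk⟩ : ∃ k, dxi k (pb (weightFun i j) h) ≠ 0 := by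
        by_contra hk
        push Not at hk
        refine hne ?_
        rw [eq_smul_one_of_pd_eq_zero (f := pb (weightFun i j) h) fun z => ?_]
        · rw [weightFun, buttin_add_left, map_add, coeff_pb_weight, coeff_pb_weight]
          simp
        · rcases z with z | z
          · exact hq' z
          · exact hk z
      have e3 : sbB μ (qv k) (pb (weightFun i j) h) = dxi k (pb (weightFun i j) h) :=
        sbB_qv k (hI hmem).2.1 hxi
      refine ih _ (e3 ▸ hinv _ (var_mem_sbW hn hN _) _ hmem) hk (fun l => ?_) (hd'.pd _)
      rw [pd_comm, hq', map_zero]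

theorem one_mem_of_invariant (hn : 2 ≤ n) (hN : ∀ i, N i ≠ 0) (hI : I ≤ sbV K N)
    (hinv : ∀ w ∈ sbW K N, ∀ u ∈ I, sbB μ w u ∈ I) (hne : ∃ f, f ∈ I ∧ f ≠ 0) :
    (1 : QXi K n) ∈ I := by
  obtain ⟨f, hf, hf0, hq⟩ := exists_last (J := Set.range Sum.inl) (p := fun f => f ∈ I)
    (q := fun f => f ≠ 0) (by simp) (fun f hf _ ⟨i, hi⟩ => by
      rw [← hi]
      have : sbB μ (xv i) f = dq i f := sbB_xv i (hI hf).2.1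
      exact this ▸ hinv _ (var_mem_sbW hn hN _) _ hf) hne
  obtain ⟨d, hd⟩ := exists_degLT f
  exact one_mem_of_qconst hn hN hI hinv d f hf hf0
    (fun i => not_not.1 (hq (Sum.inl i) ⟨i, rfl⟩)) hd

/-! ### Simplicity of s̃b_μ: from the constant to the whole image of Δ -/

section Unit

variable (hn : 2 ≤ n) (hN : ∀ i, N i ≠ 0) (hμ : μ ≠ 0)
  (hinv : ∀ w ∈ sbW K N, ∀ u ∈ I, sbB μ w u ∈ I) (h1 : (1 : QXi K n) ∈ I)

include hn hN hμ hinv h1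

/-- The bracket of q_i with 1 is Δ(q_i(1 + μξ_1⋯ξ_n)) = μ∂_{ξ_i}(ξ_1⋯ξ_n): the deformation makes the
constant noncentral. -/
theorem dxi_xiTop_mem (i : Fin n) : dxi i (xiTop K n) ∈ I := by
  have h := hinv _ (var_mem_sbW hn hN (Sum.inl i)) _ h1
  rw [sbB, mul_one, volQ, mul_add, mul_one, map_add, mul_smul_comm, map_smul, lap_qv, lap_qv_mul,
    lap_xiTop, mul_zero, zero_add, zero_add] at h
  exact (Submodule.smul_mem_iff _ hμ).1 h

/-- The factors ξ_i are removed one at a time by brackets with q_i. Products with at least one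
factor are killed by ξ_1⋯ξ_n, so there these brackets are honest derivatives. -/
theorem prod_xv_mem (k : ℕ) : ∀ S : Finset (Fin n), S.Nonempty → Sᶜ.card = k + 1 →
    (∏ i ∈ S, xv i : QXi K n) ∈ I := by
  induction k with
  | zero =>
    intro S _ hS
    obtain ⟨i, hi⟩ := Finset.card_eq_one.1 hS
    have hiS : i ∉ S := Finset.mem_compl.1 (by rw [hi]; exact Finset.mem_singleton_self i)
    have : insert i S = Finset.univ := by
      rw [Finset.insert_eq, ← hi, Finset.union_comm, Finset.union_compl]
    rw [← dxi_prod_insert hiS, this]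
    exact dxi_xiTop_mem hn hN hμ hinv h1 i
  | succ k ih =>
    intro S hS hk
    obtain ⟨i, hi⟩ : Sᶜ.Nonempty := Finset.card_pos.1 (by omega)
    have hiS := Finset.mem_compl.1 hi
    have hm := ih (insert i S) (Finset.insert_nonempty i S) (by
      rw [Finset.compl_insert, Finset.card_erase_of_mem hi, hk]
      rfl)
    have e : sbB μ (qv i) (∏ j ∈ insert i S, xv j) = dxi i (∏ j ∈ insert i S, xv j) :=
      sbB_qv i (lap_prod_xv _) (by
        rw [Finset.prod_insert hiS, ← mul_assoc, xiTop_mul_xv, zero_mul])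
    rw [← dxi_prod_insert hiS, ← e]
    exact hinv _ (var_mem_sbW hn hN _) _ hm

theorem xv_mem_invariant (i : Fin n) : (xv i : QXi K n) ∈ I := by
  have h := prod_xv_mem hn hN hμ hinv h1 (n - 2) {i} (Finset.singleton_nonempty i) (by
    rw [Finset.card_compl, Finset.card_singleton, Fintype.card_fin]; omega)
  rwa [Finset.prod_singleton] at h

/-- Bracketing Δf with ξ_i, which is in I, gives ∂_{q_i}Δf, and Δ commutes with ∂_{q_i}. -/
theorem lap_dq_mem {f : QXi K n} (hf : f ∈ trunc (shearLe N)) (i : Fin n) : lap (dq i f) ∈ I := by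
  rw [← pd_lap, ← sbB_xv (μ := μ) i (lap_lap hf), sbB_comm]
  exact hinv _ (lap_mem_sbW hf) _ (xv_mem_invariant hn hN hμ hinv h1 i)

/-- If N_i ≠ 1 there is room for q_i^(2), so q_iξ_i q_jξ_j is a q_i-derivative and its Δ is the
weight function. -/
theorem weightFun_mem_of_ne_one {i j : Fin n} (hij : i ≠ j) (hi : N i ≠ 1) :
    (weightFun i j : QXi K n) ∈ I := by
  have ha : Admissible (shearLe N) (unitExp (Sum.inl i)) := by
    have := (admissible_add_or (N := N) (r := 0) (fun z k _ => by simp) hN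
      (Sum.inl i)).resolve_right (by simp)
    rwa [zero_add] at this
  have hb := (admissible_add_or ha hN (Sum.inl i)).resolve_right (by
    rintro ⟨k, hk, h2, -⟩
    rw [unitExp_same] at h2
    have : k = 1 := Nat.pow_right_injective le_rfl (by simpa using h2.symm)
    rw [this] at hk
    exact hi hk)
  have e : (qv i * xv i * (qv j * xv j) : QXi K n) =
      dq i (mon (unitExp (Sum.inl i) + unitExp (Sum.inl i)) * xv i * (qv j * xv j)) := by
    have h0 : dq i (qv j * xv j : QXi K n) = 0 := pd_pair_eq_zero (by simpa using hij) (by simp)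
    have h0' : dq i (xv i : QXi K n) = 0 := pd_var_ne (by simp)
    rw [Derivation.leibniz, h0, Derivation.leibniz, h0', pd_mon_add]
    have hv : (mon (unitExp (Sum.inl i)) : QXi K n) = qv i := rfl
    rw [hv]
    simp only [smul_eq_mul]
    ring
  rw [← lap_weight_mul hij, e]
  exact lap_dq_mem hn hN hμ hinv h1 (mul_mem_trunc (mul_mem_trunc (mon_mem_trunc hb) (xv_mem i))
    (mul_mem_trunc (qv_mem hN j) (xv_mem j))) i

/-- A third index k makes q_iξ_i q_jξ_j a q_k-derivative. For n = 2 there is none, and room must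
come from some N_i ≠ 1: this is where the excluded case enters. -/
theorem weightFun_mem_invariant (h2 : n = 2 → ∃ i, N i ≠ 1) {i j : Fin n} (hij : i ≠ j) :
    (weightFun i j : QXi K n) ∈ I := by
  by_cases hk : ∃ k, k ≠ i ∧ k ≠ j
  · obtain ⟨k, hki, hkj⟩ := hk
    have e : (qv i * xv i * (qv j * xv j) : QXi K n) =
        dq k (qv k * (qv i * xv i * (qv j * xv j))) := by
      have hi : dq k (qv i * xv i : QXi K n) = 0 := pd_pair_eq_zero (by simpa using hki) (by simp)
      have hj : dq k (qv j * xv j : QXi K n) = 0 := pd_pair_eq_zero (by simpa using hkj) (by simp)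
      rw [Derivation.leibniz, Derivation.leibniz, pd_var_same, hi, hj]
      simp
    rw [← lap_weight_mul hij, e]
    exact lap_dq_mem hn hN hμ hinv h1 (mul_mem_trunc (qv_mem hN k) (weight_mul_mem hN i j)) k
  · push Not at hk
    have hn2 : n = 2 := by
      have : (Finset.univ : Finset (Fin n)) ⊆ {i, j} := fun k _ => by
        by_cases h : k = i
        · simp [h]
        · simp [hk k h]
      have := (Finset.card_le_card this).trans Finset.card_le_two
      rw [Finset.card_univ, Fintype.card_fin] at this
      omega
    obtain ⟨l, hl⟩ := h2 hn2
    by_cases h : l = i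
    · exact weightFun_mem_of_ne_one hn hN hμ hinv h1 hij (h ▸ hl)
    · have := weightFun_mem_of_ne_one hn hN hμ hinv h1 hij.symm (hk l h ▸ hl)
      rwa [weightFun, add_comm] at this

/-- With both q-exponents odd and different ξ-exponents, the weight of q_iξ_i + q_jξ_j is odd. -/
theorem lap_mon_mem_of_ne (h2 : n = 2 → ∃ i, N i ≠ 1) {r : Fin n ⊕ Fin n →₀ ℕ}
    (hr : Admissible (shearLe N) r) (hodd : ∀ i, r (Sum.inl i) % 2 = 1) {i j : Fin n}
    (hij : r (Sum.inr i) ≠ r (Sum.inr j)) : lap (mon r : QXi K n) ∈ I := by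
  have hne : i ≠ j := fun h => hij (by rw [h])
  have h := hinv _ (lap_mem_sbW (mon_mem_trunc (K := K) hr)) _
    (weightFun_mem_invariant hn hN hμ hinv h1 h2 hne)
  have hi := apply_inr_le hr i
  have hj := apply_inr_le hr j
  have hi' := hodd i
  have hj' := hodd j
  rw [sbB_comm, sbB_eq_pb (xiTop_mul_weightFun i j) (lap_weightFun i j)
    (lap_lap (mon_mem_trunc hr)), weightFun, buttin_add_left, pb_weight_lap hN hr,
    pb_weight_lap hN hr, ← add_smul, ← Nat.cast_add, natCast_odd (by omega), one_smul] at h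
  exact h

theorem lap_mon_mem (h2 : n = 2 → ∃ i, N i ≠ 1) {r : Fin n ⊕ Fin n →₀ ℕ}
    (hr : Admissible (shearLe N) r) : lap (mon r : QXi K n) ∈ I := by
  -- Unless all q-exponents are maximal, the monomial is a q-derivative. In the remaining case they
  -- are all odd, and unequal ξ-exponents are settled by weights.
  by_cases ha : ∃ i, Admissible (shearLe N) (r + unitExp (Sum.inl i))
  · obtain ⟨i, hi⟩ := ha
    rw [← pd_mon_add (Sum.inl i) r]
    exact lap_dq_mem hn hN hμ hinv h1 (mon_mem_trunc hi) i
  push Not at ha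
  have hodd : ∀ i, r (Sum.inl i) % 2 = 1 := fun i => by
    obtain ⟨k, -, -, h⟩ := (admissible_add_or hr hN (Sum.inl i)).resolve_left (ha i)
    exact h
  by_cases hne : ∃ i j, r (Sum.inr i) ≠ r (Sum.inr j)
  · obtain ⟨i, j, hij⟩ := hne
    exact lap_mon_mem_of_ne hn hN hμ hinv h1 h2 hr hodd hij
  push Not at hne
  let i : Fin n := ⟨0, by omega⟩
  obtain ⟨j, hj⟩ := exists_ne_fin hn i
  by_cases h0 : r (Sum.inr i) = 0
  · have : lap (mon r : QXi K n) = 0 := by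
      rw [delta_apply]
      exact Finset.sum_eq_zero fun k _ => by
        rw [← frame_comm isFrame_qxi, pd_mon_zero ((hne k i).trans h0), map_zero]
    rw [this]
    exact zero_mem I
  have hr1 : ∀ k, r (Sum.inr k) = 1 := fun k => by
    have := apply_inr_le hr i
    rw [hne k i]
    omega
  obtain ⟨r', rfl⟩ := exists_add (i := Sum.inl i) (r := r) (by have := hodd i; omega)
  have hr1' : ∀ k, r' (Sum.inr k) = 1 := fun k => by
    have := hr1 k
    rwa [Finsupp.add_apply, unitExp_ne (by simp), add_zero] at this
  have hle : xiExp n ≤ r' := fun z => by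
    rcases z with z | z
    · rw [xiExp_inl]; exact Nat.zero_le _
    · rw [xiExp_inr, hr1']
  obtain ⟨s, rfl⟩ := exists_add_of_le hle
  have hs : ∀ k, s (Sum.inr k) = 0 := fun k => by
    have := hr1' k
    rw [Finsupp.add_apply, xiExp_inr] at this
    omega
  have hsodd : ∀ k, (s + unitExp (Sum.inl i) : Fin n ⊕ Fin n →₀ ℕ) (Sum.inl k) % 2 = 1 := fun k => by
    have := hodd k
    rwa [Finsupp.add_apply, Finsupp.add_apply, xiExp_inl, zero_add, ← Finsupp.add_apply] at this
  -- The remaining case has all ξ present: u^(r) is q_i u^(s) ξ_1⋯ξ_n, with s free of ξ. The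
  -- function u^(s) is Δ of a monomial containing ξ_i but not ξ_j, hence already in I.
  have hQ : lap (mon (s + unitExp (Sum.inl i) + unitExp (Sum.inr i)) : QXi K n) = mon s := by
    rw [delta_apply, Finset.sum_eq_single i]
    · rw [add_right_comm, pd_mon_add, pd_mon_add]
    · intro k _ hk
      rw [← frame_comm isFrame_qxi, pd_mon_zero, map_zero]
      rw [Finsupp.add_apply, Finsupp.add_apply, hs, unitExp_ne (by simp),
        unitExp_ne (by simpa using hk)]
    · simp
  have hta : Admissible (shearLe N) (s + unitExp (Sum.inl i) + unitExp (Sum.inr i)) := by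
    obtain ⟨x, hx⟩ := exists_add (i := Sum.inr i) (r := xiExp n) (by rw [xiExp_inr]; omega)
    refine admissible_of_add (s := x) ?_
    have : s + unitExp (Sum.inl i) + unitExp (Sum.inr i) + x =
        xiExp n + s + unitExp (Sum.inl i) := by rw [hx]; abel
    rw [this]
    exact hr
  have hmem : (mon s : QXi K n) ∈ I := by
    rw [← hQ]
    refine lap_mon_mem_of_ne hn hN hμ hinv h1 h2 hta (fun k => ?_) (i := i) (j := j) ?_
    · rw [Finsupp.add_apply, unitExp_ne (by simp), add_zero]
      exact hsodd k
    · simp only [Finsupp.add_apply, hs, unitExp_same]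
      rw [unitExp_ne (by simp), unitExp_ne (by simp), unitExp_ne (by simpa using hj)]
      omega
  have hq : (qv i * mon s : QXi K n) = mon (s + unitExp (Sum.inl i)) := by
    have := hsodd i
    rw [Finsupp.add_apply, unitExp_same] at this
    rw [var_mul_mon, natCast_odd this, one_smul]
  have hqx : (qv i * mon s * xiTop K n : QXi K n) = mon (xiExp n + s + unitExp (Sum.inl i)) := by
    have hb : binom (s + unitExp (Sum.inl i)) (xiExp n) = 1 := by
      refine Finset.prod_eq_one fun z _ => ?_
      rcases z with z | z
      · rw [xiExp_inl, add_zero, Nat.choose_self]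
      · rw [Finsupp.add_apply, hs, unitExp_ne (by simp), add_zero, Nat.choose_zero_right]
    rw [hq, xiTop_eq, mon_mul_mon, hb, Nat.cast_one, one_smul]
    congr 1
    abel
  have hdx : dxi i (mon s : QXi K n) = 0 := pd_mon_zero (hs i)
  have hl : lap (mon s : QXi K n) = 0 := by
    rw [← hQ]
    exact lap_lap (mon_mem_trunc hta)
  -- The bracket of q_i with u^(s) is Δ(q_i u^(s)) + μΔ(u^(r)), and its first summand vanishes, so μ
  -- ≠ 0 yields Δ(u^(r)).
  have h := hinv _ (var_mem_sbW hn hN (Sum.inl i)) _ hmem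
  rw [sbB, volQ, mul_add, mul_one, map_add, mul_smul_comm, map_smul, lap_qv_mul, hl, hdx, mul_zero,
    add_zero, zero_add, hqx] at h
  exact (Submodule.smul_mem_iff _ hμ).1 h

theorem sbW_le_of_one_mem (h2 : n = 2 → ∃ i, N i ≠ 1) : sbW K N ≤ I := by
  rintro _ ⟨f, hf, rfl⟩
  refine mem_of_mon_mem (I.comap lap) fun r hr => ?_
  exact lap_mon_mem hn hN hμ hinv h1 h2 (mem_trunc_iff.1 hf r hr)

end Unit

theorem isSimpleModel_sb {L : Type*} [LieRing L] [LieAlgebra K L] {M : sbV K N →ₗ[K] L}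
    (hn : 2 ≤ n) (hN : ∀ i, N i ≠ 0) (hμ : μ ≠ 0) (h2 : n = 2 → ∃ i, N i ≠ 1)
    (hm : IsModel (sbV K N) M (sbB μ)) (hM : Function.Injective M) :
    IsSimpleModel (sbV K N) M (sbB μ) (sbW K N) where
  le := sbW_le
  ker u hu := by
    rw [(map_eq_zero_iff M hM).1 hu]
    exact zero_mem _
  bracket u hu v hv := sbB_mem (sbW_le hu) (sbW_le hv)
  nonabelian := by
    let i : Fin n := ⟨0, by omega⟩
    have hx := var_mem_sbW (K := K) hn hN (Sum.inr i)
    have hq := var_mem_sbW (K := K) hn hN (Sum.inl i)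
    refine ⟨⟨_, sbW_le hx⟩, ⟨_, sbW_le hq⟩, hx, hq, fun h => ?_⟩
    obtain ⟨h', e⟩ := hm.lie ⟨_, sbW_le hx⟩ ⟨_, sbW_le hq⟩
    rw [e, map_eq_zero_iff M hM] at h
    have h3 : sbB μ (xv i) (qv i) = 0 := congrArg Subtype.val h
    rw [sbB_xv i (lap_qv i), pd_var_same] at h3
    exact mon_ne_zero 0 h3
  ideal I hI _ hne hinv := by
    obtain ⟨u, hu, hu0⟩ := hne
    refine sbW_le_of_one_mem hn hN hμ hinv (one_mem_of_invariant hn hN (hI.trans sbW_le) hinv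
      ⟨u, hu, fun h => hu0 ?_⟩) h2
    rw [Subtype.ext (a1 := u) (a2 := 0) h, map_zero]

/-- By the Poincaré lemma closed functions are exact up to a multiple of ξ_1⋯ξ_n, and this multiple
is zero because functions in `sbV` have no such term. -/
theorem sbW_eq_of_infinite (h : ∀ i, N i = ⊤) : sbW K N = sbV K N := by
  refine le_antisymm sbW_le fun f hf => ?_
  obtain ⟨x, hx, κ, e⟩ := exists_lap_add h hf.1 hf.2.1
  have h0 := hf.2.2 (xiExp n) xiExp_inr
  rw [e, map_add, coeff_xiExp_lap hx, zero_add, map_smul, xiTop_eq, coeff_mon_self, smul_eq_mul,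
    mul_one] at h0
  rw [e, h0, zero_smul, add_zero]
  exact lap_mem_sbW hx

theorem sbTilde_isSimple {N : NonemptySubset n → ℕ∞} (hn : 2 ≤ n) (hμ : μ ≠ 0)
    (hN : ∀ S, N S ≠ 0) (h2 : n = 2 → ∃ S : NonemptySubset n, S.1.card = 1 ∧ N S ≠ 1) :
    LieAlgebra.IsSimple K (LieAlgebra.derivedSeries K (sbTilde n μ N) 1) := by
  obtain ⟨M, hm, hM⟩ := isModel_sb hμ (by omega) hN
  have hs := isSimpleModel_sb (N := N ∘ sg) hn (fun i => hN (sg i)) hμ (fun h => by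
    obtain ⟨S, hS, hS1⟩ := h2 h
    obtain ⟨i, rfl⟩ := card_eq_one_iff.1 hS
    exact ⟨i, hS1⟩) hm hM
  exact hs.isSimple hm (hm.derived_succ (k := 0) (fun D _ => hm.derived_zero D)
    fun u hu v hv => sbB_mem hu hv)

theorem sbTilde_isSimple_of_infinite {N : NonemptySubset n → ℕ∞} (hn : 2 ≤ n) (hμ : μ ≠ 0)
    (hN : ∀ S, N S ≠ 0) (h : ∀ S : NonemptySubset n, S.1.card = 1 → N S = ⊤) :
    LieAlgebra.IsSimple K (sbTilde n μ N) := by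
  obtain ⟨M, hm, hM⟩ := isModel_sb hμ (by omega) hN
  have ht : ∀ i, (N ∘ sg) i = ⊤ := fun i => h _ (Finset.card_singleton i)
  have hs := isSimpleModel_sb (N := N ∘ sg) hn (fun i => hN (sg i)) hμ
    (fun _ => ⟨⟨0, by omega⟩, by rw [ht]; simp⟩) hm hM
  rw [sbW_eq_of_infinite ht] at hs
  exact hs.isSimple_self hm

end SbSimple

end

end

theorem mainTheorem4 {K : Type*} [Field K] [IsAlgClosed K] [CharP K 2] (n : ℕ) (hn : 2 ≤ n) :
    -- generic `a / b`
    (∀ (N : Fin n → ℕ∞) (a b : K), (∀ i, N i ≠ 0) → a ≠ 0 → b ≠ 0 → a ≠ b →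
      LieAlgebra.IsSimple K (LieAlgebra.derivedSeries K (poAlg a b N) 1) ∧
      ((Even n ∨ ∃ i, N i = ⊤) → LieAlgebra.IsSimple K (poAlg a b N)) ∧
      (Odd n → (∀ i, N i ≠ ⊤) → Module.finrank K
        (poAlg a b N ⧸ (LieAlgebra.derivedSeries K (poAlg a b N) 1).toSubmodule) = 1)) ∧
    -- `a / b = 0`: the sequence `0 → K M_1 → b(n; N) → le(n; N) → 0`
    (∀ (N : Fin n → ℕ∞) (b : K), (∀ i, N i ≠ 0) → b ≠ 0 →
      (∃ π : poAlg 0 b N →ₗ⁅K⁆ leAlg (K := K) N, Function.Surjective π ∧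
        (∀ D : poAlg 0 b N, π D = 0 ↔
          (D : Derivation K (DivPow K (CVar n)) (DivPow K (CVar n))) ∈
            Submodule.span K {contactField 1}) ∧
        ∀ f ∈ DivPow.trunc (shearLe N), ∃ h : contactField (inclTau f) ∈ poAlg 0 b N,
          ((π ⟨_, h⟩).1 : Derivation K (DivPow K (Fin n ⊕ Fin n)) (DivPow K (Fin n ⊕ Fin n))) =
            hamField f) ∧
      ((∃ i, N i = ⊤) → LieAlgebra.IsSimple K (leAlg (K := K) N)) ∧
      ((∀ i, N i ≠ ⊤) →
        LieAlgebra.IsSimple K (LieAlgebra.derivedSeries K (leAlg (K := K) N) 1) ∧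
        Module.finrank K
          (leAlg (K := K) N ⧸ (LieAlgebra.derivedSeries K (leAlg (K := K) N) 1).toSubmodule) = 1)) ∧
    -- `a / b = 1` and `a / b = ∞`: the simple relatives for every shearing vector
    (∀ (N : Fin n → ℕ∞) (a : K), (∀ i, N i ≠ 0) → a ≠ 0 →
      LieAlgebra.IsSimple K (LieAlgebra.derivedSeries K (poAlg a a N) 2) ∧
      LieAlgebra.IsSimple K (LieAlgebra.derivedSeries K (poAlg a 0 N) 2)) ∧
    -- `a / b = 1`: the sequence `0 → b_1^{(1)} → b_1 → K M_{ξ_1 ⋯ ξ_n} → 0`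
    (∀ a : K, a ≠ 0 →
      LieAlgebra.IsSimple K (LieAlgebra.derivedSeries K (poAlg a a fun _ : Fin n => ⊤) 1) ∧
      ∃ h : contactField (∏ i, DivPow.var (Sum.inl (Sum.inr i))) ∈ poAlg a a fun _ : Fin n => ⊤,
        ⟨_, h⟩ ∉ LieAlgebra.derivedSeries K (poAlg a a fun _ : Fin n => ⊤) 1 ∧
        (LieAlgebra.derivedSeries K (poAlg a a fun _ : Fin n => ⊤) 1).toSubmodule ⊔
          Submodule.span K {⟨_, h⟩} = ⊤) ∧
    -- `a / b = ∞`: the sequence `0 → b_∞^{(1)} → b_∞ → K M_{τ ξ_1 ⋯ ξ_n} → 0`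
    (∀ a : K, a ≠ 0 →
      LieAlgebra.IsSimple K (LieAlgebra.derivedSeries K (poAlg a 0 fun _ : Fin n => ⊤) 1) ∧
      ∃ h : contactField (DivPow.var (Sum.inr ()) * ∏ i, DivPow.var (Sum.inl (Sum.inr i))) ∈
          poAlg a 0 fun _ : Fin n => ⊤,
        ⟨_, h⟩ ∉ LieAlgebra.derivedSeries K (poAlg a 0 fun _ : Fin n => ⊤) 1 ∧
        (LieAlgebra.derivedSeries K (poAlg a 0 fun _ : Fin n => ⊤) 1).toSubmodule ⊔
          Submodule.span K {⟨_, h⟩} = ⊤) ∧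
    -- `s̃b_μ(2 ^ n - 1; N)`: simplicity
    (∀ (μ : K) (N : NonemptySubset n → ℕ∞), μ ≠ 0 → (∀ S, N S ≠ 0) →
      ((n = 2 → ∃ S : NonemptySubset n, S.1.card = 1 ∧ N S ≠ 1) →
        LieAlgebra.IsSimple K (LieAlgebra.derivedSeries K (sbTilde n μ N) 1)) ∧
      ((∀ S : NonemptySubset n, S.1.card = 1 → N S = ⊤) →
        LieAlgebra.IsSimple K (sbTilde n μ N))) ∧
    -- `s̃b_μ(2 ^ n - 1; N)`: the critical coordinates and their largest value
    (∀ (μ : K) (S : NonemptySubset n), μ ≠ 0 →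
      (DivPow.IsCritical (svectTilde n μ) S ↔ S.1.card ≠ 1) ∧
      (S.1.card ≠ 1 → ∀ N : NonemptySubset n → ℕ∞, N S ≠ 0 →
        sbTilde n μ N = sbTilde n μ (Function.update N S 1))) := by
  refine ⟨fun N a b hN ha hb hab => poAlg_generic hn hN ha hb hab,
    fun N b hN hb => ⟨poAlg_zero_exact hb, fun h => leAlg_isSimple_of_infinite hn hN h,
      fun h => leAlg_finite hn hN h⟩,
    fun N a hN ha => ⟨poAlg_special_isSimple ha (div_self ha) (Or.inr rfl) hn hN,
      poAlg_special_isSimple ha (zero_div a) (Or.inl rfl) hn hN⟩,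
    fun a ha => poAlg_one_infinite ha hn, fun a ha => poAlg_infty_infinite ha hn,
    fun μ N hμ hN => ⟨sbTilde_isSimple hn hμ hN, sbTilde_isSimple_of_infinite hn hμ hN⟩,
    fun μ S hμ => ⟨isCritical_iff hμ (by omega) S,
      fun hS N hN => sbTilde_update hμ (by omega) hS hN⟩⟩
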